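/- Let $N\in\{3,4,5\}$ and let $K=(K_{ij})$ be the $N\times N$ Cartan matrix of $SU(N+1)$ ($K_{ii}=2$, $K_{ij}=-1$ if $|i-j|=1$, $K_{ij}=0$ otherwise). Let $\Omega=\mathbb R^2/\Lambda$ be a flat torus ($\Lambda$ any lattice of rank two), let $n_1,\dots,n_N\ge 0$ be integers, not all zero, and let $p_{i1},\dots,p_{in_i}\in\Omega$ $(i=1,\dots,N)$ be arbitrary points, repeated with multiplicity. For $\lambda>0$ consider on $\Omega$, in the sense of distributions, the non-Abelian Chern–Simons–Higgs system $$\Delta u_i+\lambda\Big(\sum_{j=1}^N K_{ji}e^{u_j}-\sum_{j=1}^N\sum_{k=1}^N K_{kj}K_{ji}e^{u_j}e^{u_k}\Big)=4\pi\sum_{s=1}^{n_i}\delta_{p_{is}},\qquad i=1,\dots,N. \tag{1}$$ Put $A=(a_{jk})=K^{-1}$, $r_j=\sum_k a_{jk}$ (and $r_0=r_{N+1}=0$), $R=\mathrm{diag}(r_1,\dots,r_N)$, $M=RKR$, $b_j=4\pi\sum_k a_{jk}n_k$, $\mathbf b=(b_1,\dots,b_N)^\tau$. Let $u_i^0$ be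 the function with $\Delta u_i^0=4\pi\sum_s\delta_{p_{is}}-4\pi n_i/|\Omega|$ and $\int_\Omega u_i^0\,dx=0$. For $\mathbf v\in (W^{1,2}(\Omega))^N$ put $U_j=e^{u_j^0+v_j}$, $\mathbf U=(U_1,\dots,U_N)^\tau$, $\mathbf 1=(1,\dots,1)^\tau$, and $$I(\mathbf v)=\frac12\sum_{i=1}^2\int_\Omega\partial_i\mathbf v^\tau A\,\partial_i\mathbf v\,dx+\frac\lambda2\int_\Omega(\mathbf U-\mathbf 1)^\tau M(\mathbf U-\mathbf 1)\,dx+\frac1{|\Omega|}\int_\Omega\mathbf b^\tau\mathbf v\,dx .$$ Then there is $\lambda_1>0$ (depending on $N$, $\Omega$ and the points) such that for every $\lambda>\lambda_1$ the system (1) has at least two distinct doubly periodic solutions $\mathbf u\ne\mathbf u'$. They can be chosen of the form $u_i=\ln r_i+u_i^0+v_i$ and $u_i'=\ln r_i+u_i^0+v_i'$, with $\mathbf v,\mathbf v'\in(W^{1,2}(\Omega))^N$ critical points of $I$, such that: (i) $\mathbf v$ is a local minimum of $I$, and it minimises $I$ over the set of all $\mathbf v\in (W^{1,2}(\Omega))^N$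 that satisfy, for $j=1,\dots,N$, $$\Big(\int_\Omega U_j\Big)^2\ge\frac{8b_j}{\lambda}\int_\Omega U_j^2,\qquad 4r_j\int_\Omega U_j^2=Q_j+\sqrt{Q_j^2-\frac{8b_j}\lambda\int_\Omega U_j^2},\qquad Q_j=\int_\Omega U_j\,(1+r_{j-1}U_{j-1}+r_{j+1}U_{j+1}),$$ where the terms with index $0$ and $N+1$ are omitted (the Han–Yang minimiser); (ii) $\mathbf v'$ is of mountain-pass type: there is $\mathbf e\in(W^{1,2}(\Omega))^N$ with $I(\mathbf e)<I(\mathbf v)$ and $I(\mathbf v')=\inf_\Gamma\max_{t\in[0,1]}I(\Gamma(t))$, the infimum being over all continuous paths $\Gamma:[0,1]\to(W^{1,2}(\Omega))^N$ from $\mathbf v$ to $\mathbf e$. -/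

import Mathlib

open MeasureTheory
open scoped ContDiff

noncomputable section

namespace ChernSimonsHiggs

abbrev Plane : Type := EuclideanSpace ℝ (Fin 2)

/-! ### The doubly periodic domain

`B` is a basis of the plane generating the period lattice; the doubly periodic domain is the flat
torus, represented by the half-open fundamental cell of the lattice. -/

abbrev cell (B : Module.Basis (Fin 2) ℝ Plane) : Set Plane := ZSpan.fundamentalDomain B

/-- Lebesgue measure of the doubly periodic domain. -/
abbrev cellMeasure (B : Module.Basis (Fin 2) ℝ Plane) : Measure Plane := volume.restrict (cell B)

/-- The area of the doubly periodic domain. -/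
def area (B : Module.Basis (Fin 2) ℝ Plane) : ℝ := volume.real (cell B)

def IsDoublyPeriodic (B : Module.Basis (Fin 2) ℝ Plane) (f : Plane → ℝ) : Prop :=
  ∀ k, Function.Periodic f (B k)

/-- Test functions: smooth functions on the torus. -/
def IsTest (B : Module.Basis (Fin 2) ℝ Plane) (φ : Plane → ℝ) : Prop :=
  ContDiff ℝ ∞ φ ∧ IsDoublyPeriodic B φ

/-! ### The Sobolev space of the torus -/

/-- `g` is the distributional gradient of `f` on the torus. -/
def IsWeakGradient (B : Module.Basis (Fin 2) ℝ Plane) (f : Plane → ℝ) (g : Plane → Plane) : Prop :=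
  ∀ φ : Plane → ℝ, IsTest B φ → ∀ h : Plane,
    ∫ x, f x * fderiv ℝ φ x h ∂cellMeasure B = -∫ x, inner ℝ (g x) h * φ x ∂cellMeasure B

lemma integrable_mul_of_continuous {B : Module.Basis (Fin 2) ℝ Plane} {f ψ : Plane → ℝ}
    (hf : Integrable f (cellMeasure B)) (hψ : Continuous ψ) :
    Integrable (fun x => f x * ψ x) (cellMeasure B) := by
  have hb : Bornology.IsBounded (cell B) := ZSpan.fundamentalDomain_isBounded B
  obtain ⟨C, hC⟩ := (hb.isCompact_closure.image hψ).isBounded.exists_norm_le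
  refine hf.mul_bdd (c := C) hψ.aestronglyMeasurable ?_
  filter_upwards [ae_restrict_mem (ZSpan.fundamentalDomain_measurableSet B)] with x hx
  exact hC _ ⟨x, subset_closure hx, rfl⟩

instance isFiniteMeasure_cellMeasure (B : Module.Basis (Fin 2) ℝ Plane) :
    IsFiniteMeasure (cellMeasure B) :=
  isFiniteMeasure_restrict.2 (ZSpan.fundamentalDomain_isBounded B).measure_lt_top.ne

/-- The space `W^{1,2}` of the torus: the pairs `(f, ∇ f)` with `f` and its distributional
gradient in `L²`, with the norm `‖f‖² = ‖f‖₂² + ‖∇ f‖₂²`. -/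
def W12 (B : Module.Basis (Fin 2) ℝ Plane) :
    Submodule ℝ (WithLp 2 (Lp ℝ 2 (cellMeasure B) × Lp Plane 2 (cellMeasure B))) where
  carrier := {w | IsWeakGradient B w.fst w.snd}
  zero_mem' := by
    intro φ _ h
    have h1 : (fun x => (0 : Lp ℝ 2 (cellMeasure B)) x * fderiv ℝ φ x h)
        =ᵐ[cellMeasure B] fun _ => 0 := by
      filter_upwards [Lp.coeFn_zero ℝ 2 (cellMeasure B)] with x hx
      rw [hx]; simp
    have h2 : (fun x => inner ℝ ((0 : Lp Plane 2 (cellMeasure B)) x) h * φ x)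
        =ᵐ[cellMeasure B] fun _ => 0 := by
      filter_upwards [Lp.coeFn_zero Plane 2 (cellMeasure B)] with x hx
      rw [hx]; simp
    rw [WithLp.zero_fst, WithLp.zero_snd, integral_congr_ae h1, integral_congr_ae h2]
    simp
  add_mem' := by
    intro v w hv hw φ hφ h
    have hd : Continuous fun x => fderiv ℝ φ x h :=
      (hφ.1.continuous_fderiv (by simp)).clm_apply continuous_const
    have iv := (Lp.memLp v.fst).integrable (by norm_num)
    have iw := (Lp.memLp w.fst).integrable (by norm_num)
    have jv := ((Lp.memLp v.snd).integrable (by norm_num)).inner_const (𝕜 := ℝ) h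
    have jw := ((Lp.memLp w.snd).integrable (by norm_num)).inner_const (𝕜 := ℝ) h
    have h1 : (fun x => (v.fst + w.fst) x * fderiv ℝ φ x h) =ᵐ[cellMeasure B]
        fun x => v.fst x * fderiv ℝ φ x h + w.fst x * fderiv ℝ φ x h := by
      filter_upwards [Lp.coeFn_add v.fst w.fst] with x hx
      rw [hx, Pi.add_apply, add_mul]
    have h2 : (fun x => inner ℝ ((v.snd + w.snd) x) h * φ x) =ᵐ[cellMeasure B]
        fun x => inner ℝ (v.snd x) h * φ x + inner ℝ (w.snd x) h * φ x := by
      filter_upwards [Lp.coeFn_add v.snd w.snd] with x hx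
      rw [hx, Pi.add_apply, inner_add_left, add_mul]
    rw [WithLp.add_fst, WithLp.add_snd, integral_congr_ae h1, integral_congr_ae h2,
      integral_add (integrable_mul_of_continuous iv hd) (integrable_mul_of_continuous iw hd),
      integral_add (integrable_mul_of_continuous jv hφ.1.continuous)
        (integrable_mul_of_continuous jw hφ.1.continuous), hv φ hφ h, hw φ hφ h]
    ring
  smul_mem' := by
    intro c w hw φ hφ h
    have h1 : (fun x => (c • w.fst) x * fderiv ℝ φ x h) =ᵐ[cellMeasure B]
        fun x => c * (w.fst x * fderiv ℝ φ x h) := by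
      filter_upwards [Lp.coeFn_smul c w.fst] with x hx
      simp [hx, mul_assoc]
    have h2 : (fun x => inner ℝ ((c • w.snd) x) h * φ x) =ᵐ[cellMeasure B]
        fun x => c * (inner ℝ (w.snd x) h * φ x) := by
      filter_upwards [Lp.coeFn_smul c w.snd] with x hx
      simp [hx, inner_smul_left, mul_assoc]
    rw [WithLp.smul_fst, WithLp.smul_snd, integral_congr_ae h1, integral_congr_ae h2,
      integral_const_mul, integral_const_mul, hw φ hφ h]
    ring

/-- The Hilbert space `(W^{1,2})^N`. -/
abbrev W12N (B : Module.Basis (Fin 2) ℝ Plane) (N : ℕ) : Type := PiLp 2 fun _ : Fin N => W12 B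

variable {B : Module.Basis (Fin 2) ℝ Plane} {N : ℕ}

/-- The `j`-th component of `v`, as a function. -/
def W12N.val (v : W12N B N) (j : Fin N) : Plane → ℝ := (v j).1.fst

/-- The gradient of the `j`-th component of `v`. -/
def W12N.grad (v : W12N B N) (j : Fin N) : Plane → Plane := (v j).1.snd

/-! ### The system -/

/-- The Cartan matrix of `SU(N+1)`, with real entries. -/
def K (N : ℕ) : Matrix (Fin N) (Fin N) ℝ := (CartanMatrix.A N).map (Int.cast : ℤ → ℝ)

/-- `u` is a doubly periodic solution, in the sense of distributions, of
`Δ uᵢ + λ (∑ⱼ Kⱼᵢ exp uⱼ - ∑ⱼ ∑ₖ Kₖⱼ Kⱼᵢ exp uⱼ exp uₖ) = 4π ∑ₛ δ_{pᵢₛ}`,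
where `p i` lists the vortex points of the `i`-th component, with repetitions. -/
structure IsSolution (B : Module.Basis (Fin 2) ℝ Plane) (n : Fin N → ℕ)
    (p : (i : Fin N) → Fin (n i) → Plane) (lam : ℝ) (u : Fin N → Plane → ℝ) : Prop where
  periodic : ∀ i, IsDoublyPeriodic B (u i)
  integrable : ∀ i, Integrable (u i) (cellMeasure B)
  integrable_exp : ∀ i, Integrable (fun x => Real.exp (u i x)) (cellMeasure B)
  integrable_exp_mul_exp : ∀ i j,
    Integrable (fun x => Real.exp (u i x) * Real.exp (u j x)) (cellMeasure B)
  equation : ∀ i, ∀ φ : Plane → ℝ, IsTest B φ →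
    (∫ x, u i x * Laplacian.laplacian φ x ∂cellMeasure B) +
      lam * ∫ x, ((∑ j, K N j i * Real.exp (u j x)) -
        ∑ j, ∑ k, K N k j * K N j i * (Real.exp (u j x) * Real.exp (u k x))) * φ x ∂cellMeasure B
      = 4 * Real.pi * ∑ s, φ (p i s)

/-- The background function of a list of points:
`Δ u⁰ = 4π ∑ₛ δ_{pₛ} - 4π m / |Ω|` in the sense of distributions, and `∫ u⁰ = 0`. -/
structure IsBackground (B : Module.Basis (Fin 2) ℝ Plane) {m : ℕ} (p : Fin m → Plane)
    (u₀ : Plane → ℝ) : Prop where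
  periodic : IsDoublyPeriodic B u₀
  integrable : Integrable u₀ (cellMeasure B)
  mean_zero : ∫ x, u₀ x ∂cellMeasure B = 0
  equation : ∀ φ : Plane → ℝ, IsTest B φ →
    ∫ x, u₀ x * Laplacian.laplacian φ x ∂cellMeasure B =
      4 * Real.pi * ∑ s, φ (p s) - 4 * Real.pi * m / area B * ∫ x, φ x ∂cellMeasure B

/-! ### The action functional -/

/-- `A = K⁻¹`. -/
def A (N : ℕ) : Matrix (Fin N) (Fin N) ℝ := (K N)⁻¹

/-- `rⱼ = ∑ₖ aⱼₖ`. -/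
def r (N : ℕ) (j : Fin N) : ℝ := ∑ k, A N j k

/-- `M = R K R` with `R = diag (r₁, …, r_N)`. -/
def M (N : ℕ) : Matrix (Fin N) (Fin N) ℝ := Matrix.diagonal (r N) * K N * Matrix.diagonal (r N)

/-- `bⱼ = 4π ∑ₖ aⱼₖ nₖ`. -/
def b (n : Fin N → ℕ) (j : Fin N) : ℝ := 4 * Real.pi * ∑ k, A N j k * n k

/-- `Uⱼ = exp (u⁰ⱼ + vⱼ)`. -/
def U (u₀ : Fin N → Plane → ℝ) (v : W12N B N) (j : Fin N) (x : Plane) : ℝ :=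
  Real.exp (u₀ j x + v.val j x)

/-- The action functional
`I(v) = ½ ∑ᵢ ∫ ∂ᵢvᵀ A ∂ᵢv + λ/2 ∫ (U - 1)ᵀ M (U - 1) + |Ω|⁻¹ ∫ bᵀ v`. -/
def action (n : Fin N → ℕ) (u₀ : Fin N → Plane → ℝ) (lam : ℝ) (v : W12N B N) : ℝ :=
  1 / 2 * (∫ x, ∑ j, ∑ k, A N j k * inner ℝ (v.grad j x) (v.grad k x) ∂cellMeasure B) +
  lam / 2 * (∫ x, ∑ j, ∑ k, M N j k * ((U u₀ v j x - 1) * (U u₀ v k x - 1)) ∂cellMeasure B) +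
  1 / area B * ∫ x, ∑ j, b n j * v.val j x ∂cellMeasure B

/-! ### The two kinds of critical points -/

/-- `∫ Uⱼ (1 + r_{j-1} U_{j-1} + r_{j+1} U_{j+1})`, where `r₀ = r_{N+1} = 0`; off the diagonal
the entries `-Kⱼₖ` are `1` for neighbouring indices and `0` otherwise. -/
def Q (u₀ : Fin N → Plane → ℝ) (v : W12N B N) (j : Fin N) : ℝ :=
  ∫ x, U u₀ v j x * (1 - ∑ k ∈ Finset.univ.erase j, K N j k * (r N k * U u₀ v k x)) ∂cellMeasure B

/-- The set of all `v = w + c₊(w)`, where `w` runs through the admissible set, that is `w` has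
components of mean zero with
`(∫ exp (u⁰ⱼ + wⱼ))² ≥ (8 bⱼ / λ) ∫ exp (2 (u⁰ⱼ + wⱼ))`, and the constant vector `c = c₊(w)`
solves the integrated equations on the branch with the plus sign,
`4 rⱼ e^{cⱼ} ∫ exp (2 (u⁰ⱼ + wⱼ)) = Qⱼ + √(Qⱼ² - (8 bⱼ / λ) ∫ exp (2 (u⁰ⱼ + wⱼ)))`.
Both relations are written in terms of `v`, after multiplication by `e^{2cⱼ}` and `e^{cⱼ}`. -/
def plusConstraintSet (n : Fin N → ℕ) (u₀ : Fin N → Plane → ℝ) (lam : ℝ) : Set (W12N B N) :=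
  {v | ∀ j,
    8 * b n j / lam * (∫ x, U u₀ v j x ^ 2 ∂cellMeasure B) ≤
      (∫ x, U u₀ v j x ∂cellMeasure B) ^ 2 ∧
    4 * r N j * (∫ x, U u₀ v j x ^ 2 ∂cellMeasure B) =
      Q u₀ v j + √(Q u₀ v j ^ 2 - 8 * b n j / lam * ∫ x, U u₀ v j x ^ 2 ∂cellMeasure B)}

/-- `v` is a critical point of `I` whose critical value is the minimax level
`inf_Γ max_t I(Γ(t))` over the paths `Γ` from `v₀` to some point `e` with `I(e) < I(v₀)`. -/
def IsMountainPassPoint {H : Type*} [NormedAddCommGroup H] [NormedSpace ℝ H] (I : H → ℝ)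
    (v₀ v : H) : Prop :=
  HasFDerivAt I (0 : H →L[ℝ] ℝ) v ∧
    ∃ e : H, I e < I v₀ ∧
      IsGLB (Set.range fun Γ : Path v₀ e => ⨆ t : unitInterval, I (Γ t)) (I v)

end ChernSimonsHiggs

end

open ChernSimonsHiggs

open MeasureTheory
open scoped ContDiff Pointwise
noncomputable section
namespace ChernSimonsHiggs
variable {B : Module.Basis (Fin 2) ℝ Plane} {N : ℕ}

/-! ### Periodic functions on the cell -/

/-! Solutions of the form `u = ln r + u⁰ + v` correspond to critical points of `I`, because
multiplication by `A = K⁻¹` makes the system variational. The functional is a Dirichlet form plus a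
potential; with `yⱼ = rⱼ Uⱼ` the derivative of the potential has the density `λ yⱼ ((K y)ⱼ - 1) + bⱼ
/ |Ω|` (see `dens`). The first solution is a minimiser, the second a mountain pass over it.

The analysis on the torus rests on Fourier series. Parseval's identity gives the inequality of
Poincaré and the compactness of Rellich. Splitting at frequency `3 ^ m` gives exponential
integrability (`exists_trudinger`). The background functions are decreasing limits of Green
functions smoothed by the heat flow, and the monotonicity is the positivity of the heat kernel.
Since `u⁰` is bounded above, the potential is then `C¹` and weakly continuous together with its
derivative. Hence `I` is weakly lower semicontinuous, and weakly convergent almost critical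
sequences converge strongly (`isVariational_action`).

The minimiser. The equality that selects the plus branch leaves no room for an interior, so it is
relaxed to `Qⱼ ≤ 4 rⱼ ∫ Uⱼ²` (`looseSet`). On the relaxed set `∫ Uⱼ` is at least of order `1/λ`, and
`(∫ Uⱼ)² ≥ (8 bⱼ / λ) ∫ Uⱼ²` forbids concentration. With the Trudinger inequality this bounds minus
the mean of `vⱼ` by `C + C log λ` plus an arbitrarily small multiple of the Dirichlet energy
(`exists_neg_mean_le`). The linear term of `I` is thereby absorbed, and a minimiser exists.
Comparison with a fixed approximation of `-u⁰`, for which `U` is close to `1`, shows that for large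
`λ` the minimiser also has `U` close to `1` in `L²`, where all constraints are strict
(`exists_strict`). It is therefore an interior point, a local minimum and a critical point. At a
critical point the integrated equations turn the discriminant into the square of `4 rⱼ ∫ Uⱼ² - Qⱼ`,
and the relaxed inequality fixes the sign of the root. So the minimiser lies in the original
constraint set and minimises there as well.

The mountain pass. All `bⱼ` are positive, so subtracting large constants sends `I` to `-∞` and
provides the far end point. If the minimax level lies above the level of the minimiser, a
pseudo-gradient deformation yields almost critical points. If the two levels agree, a small sphere
around the minimiser contains another local minimum of the same value (`exists_mountainPass`).

Boundedness of Palais-Smale sequences (`exists_bound_of_palaisSmale`). Testing with constants bounds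
`∫ yⱼ²`. Testing with `K η`, where `ηᵢ = yᵢ / (1 + δ S)` and `S = ∑ yₖ`, removes `A`; the Dirichlet
term has a favourable sign, and positivity of `K` leaves a bound for `∫ S³ / (1 + δ S)`, uniform in
`δ` up to an error that vanishes with the derivative of `I` for fixed `δ`. If the sequence were
unbounded, the smallest of the means would tend to `-∞`, while the energy grows at most linearly in
it. Then the corresponding `yⱼ` would tend to zero in measure, and in `L²` by the cubic bound. This
contradicts `λ ∫ yⱼ ((K y)ⱼ - 1) → -bⱼ < 0`. -/

lemma measurableSet_cell (B : Module.Basis (Fin 2) ℝ Plane) : MeasurableSet (cell B) :=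
  ZSpan.fundamentalDomain_measurableSet B

lemma IsDoublyPeriodic.add_mem {f : Plane → ℝ} (hf : IsDoublyPeriodic B f) {l : Plane}
    (hl : l ∈ Submodule.span ℤ (Set.range B)) (x : Plane) : f (x + l) = f x := by
  induction hl using Submodule.span_induction generalizing x with
  | mem y hy => obtain ⟨k, rfl⟩ := hy; exact hf k x
  | zero => simp
  | add y z _ _ hy hz => rw [← add_assoc, hz, hy]
  | smul n y _ hy =>
    have : Function.Periodic f y := hy
    exact this.zsmul n x

lemma IsDoublyPeriodic.fract {f : Plane → ℝ} (hf : IsDoublyPeriodic B f) (x : Plane) :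
    f (ZSpan.fract B x) = f x := by
  rw [ZSpan.fract_apply, sub_eq_add_neg]
  exact hf.add_mem (neg_mem (ZSpan.floor B x).2) x

lemma isDoublyPeriodic_comp_fract (f : Plane → ℝ) :
    IsDoublyPeriodic B fun x => f (ZSpan.fract B x) := by
  intro k x
  simp only
  rw [ZSpan.fract_add_ZSpan _ _ (Submodule.subset_span ⟨k, rfl⟩)]

lemma exists_bound_cell {f : Plane → ℝ} (hf : Continuous f) (B : Module.Basis (Fin 2) ℝ Plane) :
    ∃ C, 0 ≤ C ∧ ∀ x ∈ cell B, |f x| ≤ C := by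
  have hb : Bornology.IsBounded (cell B) := ZSpan.fundamentalDomain_isBounded B
  obtain ⟨C, hC⟩ := (hb.isCompact_closure.image hf).isBounded.exists_norm_le
  exact ⟨max C 0, le_max_right _ _, fun x hx =>
    (hC _ ⟨x, subset_closure hx, rfl⟩).trans (le_max_left _ _)⟩

lemma IsDoublyPeriodic.exists_bound {f : Plane → ℝ} (hp : IsDoublyPeriodic B f)
    (hf : Continuous f) : ∃ C, 0 ≤ C ∧ ∀ x, |f x| ≤ C := by
  obtain ⟨C, h0, hC⟩ := exists_bound_cell hf B
  exact ⟨C, h0, fun x => hp.fract x ▸ hC _ (ZSpan.fract_mem_fundamentalDomain B x)⟩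

lemma memLp_of_continuous {f : Plane → ℝ} (hf : Continuous f) (p : ENNReal) :
    MemLp f p (cellMeasure B) := by
  obtain ⟨C, -, hC⟩ := exists_bound_cell hf B
  refine MemLp.of_bound hf.aestronglyMeasurable C ?_
  filter_upwards [ae_restrict_mem (measurableSet_cell B)] with x hx
  exact hC x hx

lemma integrable_of_continuous {f : Plane → ℝ} (hf : Continuous f) :
    Integrable f (cellMeasure B) :=
  (memLp_of_continuous hf 1).integrable le_rfl

/-- A translate of the cell is again a fundamental domain of the lattice, and the integral of a
periodic function does not depend on the choice of the domain. -/
lemma integral_cell_add {f : Plane → ℝ} (hf : IsDoublyPeriodic B f) (a : Plane) :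
    ∫ x, f (a + x) ∂cellMeasure B = ∫ x, f x ∂cellMeasure B := by
  have : VAddInvariantMeasure (Submodule.span ℤ (Set.range B)) Plane volume :=
    ⟨fun c s _ => by simp [Submodule.vadd_def]⟩
  have hD := ZSpan.isAddFundamentalDomain B (volume : Measure Plane)
  have hD' := hD.vadd_of_comm a
  have h := hD.setIntegral_eq hD' (f := f) (fun l x => by
    rw [Submodule.vadd_def, vadd_eq_add, add_comm]; exact hf.add_mem l.2 x)
  rw [h]
  have hm : MeasurePreserving (fun x : Plane => a + x) volume volume :=
    measurePreserving_add_left volume a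
  have := hm.setIntegral_preimage_emb (measurableEmbedding_addLeft a) f (a +ᵥ cell B)
  have hs : (fun x : Plane => a + x) ⁻¹' (a +ᵥ cell B) = cell B := by
    ext x
    rw [Set.mem_preimage, Set.mem_vadd_set_iff_neg_vadd_mem]
    simp
  rw [← this, hs]

lemma IsDoublyPeriodic.fderiv {f : Plane → ℝ} (hf : IsDoublyPeriodic B f) (h : Plane) :
    IsDoublyPeriodic B fun x => fderiv ℝ f x h := by
  intro k x
  simp only
  rw [← fderiv_comp_add_right (B k)]
  congr 2
  ext z
  exact hf k z

/-- By translation invariance the integral of `f (t h + x)` is constant in `t`; its derivative at `t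
= 0` is taken under the integral sign. This is the absence of boundary terms behind every
integration by parts below. -/
lemma integral_cell_fderiv {f : Plane → ℝ} (hp : IsDoublyPeriodic B f) (hf : ContDiff ℝ 1 f)
    (h : Plane) : ∫ x, fderiv ℝ f x h ∂cellMeasure B = 0 := by
  have hc : Continuous fun x => fderiv ℝ f x h :=
    (hf.continuous_fderiv (by simp)).clm_apply continuous_const
  obtain ⟨C, -, hC⟩ := (hp.fderiv h).exists_bound hc
  have key := hasDerivAt_integral_of_dominated_loc_of_deriv_le (μ := cellMeasure B)
    (F := fun (t : ℝ) x => f (t • h + x)) (F' := fun t x => fderiv ℝ f (t • h + x) h) (x₀ := 0)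
    (s := Set.univ) (bound := fun _ => C) Filter.univ_mem
    (Filter.Eventually.of_forall fun t =>
      (hf.continuous.comp (continuous_const.add continuous_id)).aestronglyMeasurable)
    (integrable_of_continuous (hf.continuous.comp (continuous_const.add continuous_id)))
    (hc.comp (continuous_const.add continuous_id)).aestronglyMeasurable
    (Filter.Eventually.of_forall fun x t _ => hC _) (integrable_const C)
    (Filter.Eventually.of_forall fun x t _ => by
      have h1 : HasDerivAt (fun t : ℝ => t • h + x) h t := by
        simpa using ((hasDerivAt_id t).smul_const h).add_const x
      exact ((hf.differentiable (by simp)) _).hasFDerivAt.comp_hasDerivAt t h1)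
  have h2 : (fun t : ℝ => ∫ x, f (t • h + x) ∂cellMeasure B) = fun _ => ∫ x, f x ∂cellMeasure B :=
    funext fun t => integral_cell_add hp _
  have := key.2.unique (h2 ▸ hasDerivAt_const (0 : ℝ) _)
  simpa using this

lemma IsDoublyPeriodic.mul {f g : Plane → ℝ} (hf : IsDoublyPeriodic B f)
    (hg : IsDoublyPeriodic B g) : IsDoublyPeriodic B fun x => f x * g x :=
  fun k x => by simp only [hf k x, hg k x]

lemma integral_mul_fderiv_cell {f g : Plane → ℝ} (hf : IsDoublyPeriodic B f)
    (hg : IsDoublyPeriodic B g) (cf : ContDiff ℝ 1 f) (cg : ContDiff ℝ 1 g) (h : Plane) :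
    ∫ x, f x * fderiv ℝ g x h ∂cellMeasure B = -∫ x, fderiv ℝ f x h * g x ∂cellMeasure B := by
  have h0 := integral_cell_fderiv (hf.mul hg) (cf.mul cg) h
  have c1 : Continuous fun x => f x * fderiv ℝ g x h :=
    cf.continuous.mul ((cg.continuous_fderiv (by simp)).clm_apply continuous_const)
  have c2 : Continuous fun x => fderiv ℝ f x h * g x :=
    ((cf.continuous_fderiv (by simp)).clm_apply continuous_const).mul cg.continuous
  have h1 : (fun x => fderiv ℝ (fun x => f x * g x) x h) =
      fun x => f x * fderiv ℝ g x h + fderiv ℝ f x h * g x := by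
    ext x
    rw [fderiv_fun_mul (cf.differentiable (by simp) x) (cg.differentiable (by simp) x)]
    simp [mul_comm]
  rw [h1, integral_add (integrable_of_continuous c1) (integrable_of_continuous c2)] at h0
  linarith

/-! ### The space `W12` -/

/-- The function underlying an element of `W12`. -/
def fn (w : W12 B) : Plane → ℝ := w.1.fst

/-- The weak gradient of an element of `W12`. -/
def gr (w : W12 B) : Plane → Plane := w.1.snd

lemma memLp_fn (w : W12 B) : MemLp (fn w) 2 (cellMeasure B) := Lp.memLp w.1.fst

lemma memLp_gr (w : W12 B) : MemLp (gr w) 2 (cellMeasure B) := Lp.memLp w.1.snd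

lemma integrable_fn (w : W12 B) : Integrable (fn w) (cellMeasure B) :=
  (memLp_fn w).integrable (by norm_num)

lemma integrable_gr (w : W12 B) : Integrable (gr w) (cellMeasure B) :=
  (memLp_gr w).integrable (by norm_num)

lemma weakGradient (w : W12 B) : IsWeakGradient B (fn w) (gr w) := w.2

lemma fn_add (v w : W12 B) : fn (v + w) =ᵐ[cellMeasure B] fun x => fn v x + fn w x :=
  Lp.coeFn_add v.1.fst w.1.fst

lemma fn_sub (v w : W12 B) : fn (v - w) =ᵐ[cellMeasure B] fun x => fn v x - fn w x :=
  Lp.coeFn_sub v.1.fst w.1.fst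

lemma fn_smul (c : ℝ) (w : W12 B) : fn (c • w) =ᵐ[cellMeasure B] fun x => c * fn w x :=
  Lp.coeFn_smul c w.1.fst

lemma gr_sub (v w : W12 B) : gr (v - w) =ᵐ[cellMeasure B] fun x => gr v x - gr w x :=
  Lp.coeFn_sub v.1.snd w.1.snd

lemma fn_zero : fn (0 : W12 B) =ᵐ[cellMeasure B] fun _ => 0 :=
  Lp.coeFn_zero ℝ 2 (cellMeasure B)

lemma inner_eq (v w : W12 B) : inner ℝ v w =
    ∫ x, fn v x * fn w x ∂cellMeasure B + ∫ x, inner ℝ (gr v x) (gr w x) ∂cellMeasure B := by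
  have h : inner ℝ v w = inner ℝ v.1.fst w.1.fst + inner ℝ v.1.snd w.1.snd :=
    WithLp.prod_inner_apply v.1 w.1
  rw [h, L2.inner_def, L2.inner_def]
  have h1 : ∀ x, inner ℝ (v.1.fst x) (w.1.fst x) = fn v x * fn w x := fun x => mul_comm _ _
  simp only [h1]
  rfl

lemma integrable_inner_gr (v w : W12 B) :
    Integrable (fun x => inner ℝ (gr v x) (gr w x)) (cellMeasure B) :=
  L2.integrable_inner (𝕜 := ℝ) v.1.snd w.1.snd

lemma norm_sq_eq (w : W12 B) : ‖w‖ ^ 2 =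
    ∫ x, fn w x ^ 2 ∂cellMeasure B + ∫ x, ‖gr w x‖ ^ 2 ∂cellMeasure B := by
  rw [← real_inner_self_eq_norm_sq, inner_eq]
  simp [sq]

lemma integrable_sq (w : W12 B) : Integrable (fun x => fn w x ^ 2) (cellMeasure B) :=
  (memLp_fn w).integrable_sq

/-- The element of `W12` with a given function and a given weak gradient. -/
def mkW12 (f : Plane → ℝ) (g : Plane → Plane) (hf : MemLp f 2 (cellMeasure B))
    (hg : MemLp g 2 (cellMeasure B)) (h : IsWeakGradient B f g) : W12 B :=
  ⟨WithLp.toLp 2 (hf.toLp f, hg.toLp g), by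
    intro φ hφ y
    have h1 := hf.coeFn_toLp
    have h2 := hg.coeFn_toLp
    have := h φ hφ y
    rw [integral_congr_ae (g := fun x => f x * fderiv ℝ φ x y), this]
    · congr 1
      refine integral_congr_ae ?_
      filter_upwards [h2] with x hx
      exact (congrArg (fun z => inner ℝ z y * φ x) hx).symm
    · filter_upwards [h1] with x hx
      exact congrArg (fun z => z * fderiv ℝ φ x y) hx⟩

lemma fn_mk {f : Plane → ℝ} {g : Plane → Plane} {hf : MemLp f 2 (cellMeasure B)}
    {hg : MemLp g 2 (cellMeasure B)} {h : IsWeakGradient B f g} :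
    fn (mkW12 f g hf hg h) =ᵐ[cellMeasure B] f := hf.coeFn_toLp

lemma gr_mk {f : Plane → ℝ} {g : Plane → Plane} {hf : MemLp f 2 (cellMeasure B)}
    {hg : MemLp g 2 (cellMeasure B)} {h : IsWeakGradient B f g} :
    gr (mkW12 f g hf hg h) =ᵐ[cellMeasure B] g := hg.coeFn_toLp

lemma continuous_gradient {f : Plane → ℝ} (hf : ContDiff ℝ 1 f) : Continuous (gradient f) :=
  (LinearIsometryEquiv.continuous _).comp (hf.continuous_fderiv (by simp))

lemma inner_gradient {f : Plane → ℝ} (x h : Plane) : inner ℝ (gradient f x) h = fderiv ℝ f x h := by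
  simp [gradient]

lemma memLp_gradient {f : Plane → ℝ} (hf : ContDiff ℝ 1 f) :
    MemLp (gradient f) 2 (cellMeasure B) := by
  have hc := continuous_gradient hf
  obtain ⟨C, -, hC⟩ := exists_bound_cell hc.norm B
  refine MemLp.of_bound hc.aestronglyMeasurable C ?_
  filter_upwards [ae_restrict_mem (measurableSet_cell B)] with x hx
  simpa using hC x hx

lemma isWeakGradient_gradient {f : Plane → ℝ} (hp : IsDoublyPeriodic B f) (hf : ContDiff ℝ 1 f) :
    IsWeakGradient B f (gradient f) := by
  intro φ hφ h
  rw [integral_mul_fderiv_cell hp hφ.2 hf (hφ.1.of_le (by simp)) h]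
  simp

/-- A periodic `C¹` function as an element of `W12`. -/
def ofC1 {f : Plane → ℝ} (hp : IsDoublyPeriodic B f) (hf : ContDiff ℝ 1 f) : W12 B :=
  mkW12 f (gradient f) (memLp_of_continuous hf.continuous 2) (memLp_gradient hf)
    (isWeakGradient_gradient hp hf)

lemma fn_ofC1 {f : Plane → ℝ} (hp : IsDoublyPeriodic B f) (hf : ContDiff ℝ 1 f) :
    fn (ofC1 hp hf) =ᵐ[cellMeasure B] f := fn_mk

lemma gr_ofC1 {f : Plane → ℝ} (hp : IsDoublyPeriodic B f) (hf : ContDiff ℝ 1 f) :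
    gr (ofC1 hp hf) =ᵐ[cellMeasure B] gradient f := gr_mk

lemma laplacian_eq_sum (φ : Plane → ℝ) (x : Plane) (hφ : ContDiff ℝ 2 φ) :
    Laplacian.laplacian φ x =
      ∑ i, fderiv ℝ (fun z => fderiv ℝ φ z (EuclideanSpace.basisFun (Fin 2) ℝ i)) x
        (EuclideanSpace.basisFun (Fin 2) ℝ i) := by
  rw [InnerProductSpace.laplacian_eq_iteratedFDeriv_orthonormalBasis φ
    (EuclideanSpace.basisFun (Fin 2) ℝ)]
  refine Finset.sum_congr rfl fun i _ => ?_
  rw [iteratedFDeriv_two_apply]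
  have hd : DifferentiableAt ℝ (fderiv ℝ φ) x :=
    (hφ.fderiv_right (m := 1) (by norm_num)).differentiable (by simp) x
  rw [fderiv_clm_apply hd (differentiableAt_const _)]
  simp

lemma IsTest.fderiv {φ : Plane → ℝ} (hφ : IsTest B φ) (h : Plane) :
    IsTest B fun x => fderiv ℝ φ x h :=
  ⟨(hφ.1.fderiv_right (m := ∞) (by simp)).clm_apply contDiff_const, hφ.2.fderiv h⟩

lemma inner_eq_sum_basisFun (a b : Plane) : inner ℝ a b =
    ∑ i, inner ℝ a (EuclideanSpace.basisFun (Fin 2) ℝ i) *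
      inner ℝ b (EuclideanSpace.basisFun (Fin 2) ℝ i) := by
  simp [PiLp.inner_apply]; ring

/-- Integration by parts against the Laplacian of a test function. -/
lemma integral_mul_laplacian (w : W12 B) {φ : Plane → ℝ} (hφ : IsTest B φ) :
    ∫ x, fn w x * Laplacian.laplacian φ x ∂cellMeasure B =
      -∫ x, inner ℝ (gr w x) (gradient φ x) ∂cellMeasure B := by
  have hc : ContDiff ℝ 2 φ := hφ.1.of_le (WithTop.coe_le_coe.2 le_top)
  simp_rw [fun x => laplacian_eq_sum φ x hc, Finset.mul_sum]
  rw [integral_finsetSum]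
  · simp_rw [fun i => (weakGradient w) _ (hφ.fderiv (EuclideanSpace.basisFun (Fin 2) ℝ i))
      (EuclideanSpace.basisFun (Fin 2) ℝ i)]
    rw [Finset.sum_neg_distrib, ← integral_finsetSum]
    · congr 2
      ext x
      rw [inner_eq_sum_basisFun]
      refine Finset.sum_congr rfl fun i _ => ?_
      rw [inner_gradient]
    · intro i _
      exact integrable_mul_of_continuous ((integrable_gr w).inner_const (𝕜 := ℝ) _)
        ((hc.continuous_fderiv (by simp)).clm_apply continuous_const)
  · intro i _
    refine integrable_mul_of_continuous (integrable_fn w) ?_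
    exact ((((hφ.fderiv _).1).continuous_fderiv (by simp)).clm_apply continuous_const)

end ChernSimonsHiggs
end

open MeasureTheory
open scoped ContDiff
noncomputable section
namespace ChernSimonsHiggs
variable {B : Module.Basis (Fin 2) ℝ Plane} {N : ℕ}

/-! ### Fourier series on the cell -/

/-- The phase `x ↦ 2π ⟨k, x⟩` of the exponential with index `k`. -/
def phase (B : Module.Basis (Fin 2) ℝ Plane) (k : Fin 2 → ℤ) : Plane →L[ℝ] ℝ :=
  LinearMap.toContinuousLinearMap (∑ i, (2 * Real.pi * k i) • B.coord i)

lemma phase_apply (k : Fin 2 → ℤ) (x : Plane) :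
    phase B k x = ∑ i, 2 * Real.pi * k i * B.repr x i := by
  simp [phase]

lemma phase_basis (k : Fin 2 → ℤ) (j : Fin 2) : phase B k (B j) = k j * (2 * Real.pi) := by
  rw [phase_apply]
  simp [Finsupp.single_apply]
  ring

lemma phase_add (k l : Fin 2 → ℤ) (x : Plane) :
    phase B (k + l) x = phase B k x + phase B l x := by
  simp only [phase_apply, ← Finset.sum_add_distrib, Pi.add_apply]
  refine Finset.sum_congr rfl fun i _ => ?_
  push_cast
  ring

lemma phase_neg (k : Fin 2 → ℤ) (x : Plane) : phase B (-k) x = -phase B k x := by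
  simp only [phase_apply, ← Finset.sum_neg_distrib, Pi.neg_apply]
  refine Finset.sum_congr rfl fun i _ => ?_
  push_cast
  ring

lemma phase_sub (k l : Fin 2 → ℤ) (x : Plane) :
    phase B (k - l) x = phase B k x - phase B l x := by
  rw [sub_eq_add_neg, phase_add, phase_neg, sub_eq_add_neg]

lemma phase_zero (x : Plane) : phase B 0 x = 0 := by simp [phase_apply]

/-- The eigenvalue of `-Δ` on the exponential with index `k`. -/
def mu (B : Module.Basis (Fin 2) ℝ Plane) (k : Fin 2 → ℤ) : ℝ := ‖phase B k‖ ^ 2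

def cosk (B : Module.Basis (Fin 2) ℝ Plane) (k : Fin 2 → ℤ) (x : Plane) : ℝ :=
  Real.cos (phase B k x)

def sink (B : Module.Basis (Fin 2) ℝ Plane) (k : Fin 2 → ℤ) (x : Plane) : ℝ :=
  Real.sin (phase B k x)

lemma isTest_cosk (k : Fin 2 → ℤ) : IsTest B (cosk B k) := by
  refine ⟨Real.contDiff_cos.comp (phase B k).contDiff, fun j x => ?_⟩
  simp only [cosk, map_add, phase_basis]
  exact Real.cos_add_int_mul_two_pi _ _

lemma isTest_sink (k : Fin 2 → ℤ) : IsTest B (sink B k) := by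
  refine ⟨Real.contDiff_sin.comp (phase B k).contDiff, fun j x => ?_⟩
  simp only [sink, map_add, phase_basis]
  exact Real.sin_add_int_mul_two_pi _ _

lemma continuous_cosk (k : Fin 2 → ℤ) : Continuous (cosk B k) := (isTest_cosk k).1.continuous

lemma continuous_sink (k : Fin 2 → ℤ) : Continuous (sink B k) := (isTest_sink k).1.continuous

lemma fderiv_cosk (k : Fin 2 → ℤ) (x : Plane) :
    fderiv ℝ (cosk B k) x = -sink B k x • phase B k :=
  ((phase B k).hasFDerivAt.cos).fderiv

lemma fderiv_sink (k : Fin 2 → ℤ) (x : Plane) :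
    fderiv ℝ (sink B k) x = cosk B k x • phase B k :=
  ((phase B k).hasFDerivAt.sin).fderiv

/-- The cosine coefficient of `f`. -/
def ca (B : Module.Basis (Fin 2) ℝ Plane) (f : Plane → ℝ) (k : Fin 2 → ℤ) : ℝ :=
  ∫ x, f x * cosk B k x ∂cellMeasure B

/-- The sine coefficient of `f`. -/
def sa (B : Module.Basis (Fin 2) ℝ Plane) (f : Plane → ℝ) (k : Fin 2 → ℤ) : ℝ :=
  ∫ x, f x * sink B k x ∂cellMeasure B

/-- The squared modulus of the Fourier coefficient of `f`. -/
def en (B : Module.Basis (Fin 2) ℝ Plane) (f : Plane → ℝ) (k : Fin 2 → ℤ) : ℝ :=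
  ca B f k ^ 2 + sa B f k ^ 2

lemma en_nonneg (f : Plane → ℝ) (k : Fin 2 → ℤ) : 0 ≤ en B f k := by
  unfold en; positivity

lemma area_pos (B : Module.Basis (Fin 2) ℝ Plane) : 0 < area B :=
  ENNReal.toReal_pos (ZSpan.measure_fundamentalDomain_ne_zero B)
    (ZSpan.fundamentalDomain_isBounded B).measure_lt_top.ne

/-! ### Parseval's identity, transported from the standard torus -/

section Torus

local instance torusMeasureSpace : MeasureSpace UnitAddCircle := ⟨AddCircle.haarAddCircle⟩

local instance : IsProbabilityMeasure (volume : Measure UnitAddCircle) :=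
  inferInstanceAs (IsProbabilityMeasure AddCircle.haarAddCircle)

/-- The projection of the plane to the standard torus. -/
def toTorus (B : Module.Basis (Fin 2) ℝ Plane) (x : Plane) : UnitAddTorus (Fin 2) :=
  fun i => (B.repr x i : UnitAddCircle)

/-- The section of the projection with values in the cell. -/
def ofTorus (B : Module.Basis (Fin 2) ℝ Plane) (t : UnitAddTorus (Fin 2)) : Plane :=
  ∑ i, ((AddCircle.equivIco 1 0 (t i) : ℝ)) • B i

lemma continuous_repr (i : Fin 2) : Continuous fun x => B.repr x i :=
  (LinearMap.toContinuousLinearMap (B.coord i)).continuous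

lemma measurable_toTorus : Measurable (toTorus B) :=
  measurable_pi_lambda _ fun i => AddCircle.measurable_mk'.comp (continuous_repr i).measurable

lemma measurable_ofTorus : Measurable (ofTorus B) := by
  refine Finset.measurable_sum _ fun i _ => ?_
  refine Measurable.smul_const ?_ _
  exact measurable_subtype_coe.comp
    ((AddCircle.measurableEquivIco 1 0).measurable.comp (measurable_pi_apply i))

lemma ofTorus_toTorus {x : Plane} (hx : x ∈ cell B) : ofTorus B (toTorus B x) = x := by
  have h : ∀ i, ((AddCircle.equivIco 1 0 (toTorus B x i) : ℝ)) = B.repr x i := by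
    intro i
    have := (ZSpan.mem_fundamentalDomain B).1 hx i
    simp only [toTorus]
    rw [AddCircle.coe_equivIco_mk_apply]
    simpa using (Int.fract_eq_self.2 this)
  simp only [ofTorus, h]
  exact B.sum_repr x

/-- Coordinates send the cell to the unit box, and Lebesgue measure to a multiple of Lebesgue
measure by uniqueness of Haar measure. The factor is found by comparing total masses, so that no
determinant is computed. -/
lemma map_toTorus : (cellMeasure B).map (toTorus B) =
    ENNReal.ofReal (area B) • (volume : Measure (UnitAddTorus (Fin 2))) := by
  set e : Plane ≃L[ℝ] (Fin 2 → ℝ) := B.equivFun.toContinuousLinearEquiv with he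
  let box : Set (Fin 2 → ℝ) := Set.univ.pi fun _ => Set.Ico 0 1
  have hbox : MeasurableSet box := MeasurableSet.univ_pi fun _ => measurableSet_Ico
  obtain ⟨c, hc0, hctop, hc⟩ : ∃ c : ENNReal, c ≠ 0 ∧ c ≠ ⊤ ∧
      (volume : Measure Plane).map e = c • (volume : Measure (Fin 2 → ℝ)) := by
    have : ((volume : Measure Plane).map e).IsAddHaarMeasure := e.isAddHaarMeasure_map volume
    exact ⟨_, by
      simpa using (Measure.addHaarScalarFactor_pos_of_isAddHaarMeasure _ _).ne', by simp,
      Measure.isAddLeftInvariant_eq_smul _ volume⟩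
  have hcell : cell B = e ⁻¹' box := by
    ext x
    simp [box, ZSpan.mem_fundamentalDomain, he]
  have h1 : (cellMeasure B).map e = c • (volume.restrict box) := by
    rw [cellMeasure, hcell, ← Measure.restrict_map e.continuous.measurable hbox, hc,
      Measure.restrict_smul]
  have h2 : (volume.restrict box).map (fun (y : Fin 2 → ℝ) i => (y i : UnitAddCircle)) =
      (volume : Measure (UnitAddTorus (Fin 2))) := by
    have h3 : volume.restrict box = Measure.pi fun _ : Fin 2 => volume.restrict (Set.Ioc (0 : ℝ) 1) := by
      rw [volume_pi, Measure.restrict_pi_pi]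
      congr 1
      ext1 i
      exact Measure.restrict_congr_set Ico_ae_eq_Ioc
    rw [h3]
    have := (measurePreserving_pi (fun _ : Fin 2 => volume.restrict (Set.Ioc (0 : ℝ) (0 + 1))) _
      (fun i => AddCircle.measurePreserving_mk 1 0)).map_eq
    rw [zero_add] at this
    convert! this using 1
    simp [volume, AddCircle.haarAddCircle]
  have h4 : (cellMeasure B).map (toTorus B) = c • (volume : Measure (UnitAddTorus (Fin 2))) := by
    rw [← h2, ← Measure.map_smul, ← h1, Measure.map_map _ e.continuous.measurable]
    · rfl
    · exact measurable_pi_lambda _ fun i => AddCircle.measurable_mk'.comp (measurable_pi_apply i)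
  have h5 : c = ENNReal.ofReal (area B) := by
    have := congrArg (fun m => m Set.univ) h4
    simp only [Measure.map_apply measurable_toTorus MeasurableSet.univ, Set.preimage_univ,
      Measure.restrict_apply_univ, Measure.smul_apply, smul_eq_mul, measure_univ, mul_one] at this
    rw [← this, area, ofReal_measureReal (ZSpan.fundamentalDomain_isBounded B).measure_lt_top.ne]
  rw [h4, h5]

lemma mFourier_toTorus (k : Fin 2 → ℤ) (x : Plane) :
    UnitAddTorus.mFourier k (toTorus B x) = Complex.exp (phase B k x * Complex.I) := by
  simp only [UnitAddTorus.mFourier, ContinuousMap.coe_mk, toTorus, fourier_coe_apply,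
    ← Complex.exp_sum, phase_apply]
  congr 1
  push_cast
  rw [Finset.sum_mul]
  refine Finset.sum_congr rfl fun i _ => ?_
  ring

lemma integral_torus {E : Type*} [NormedAddCommGroup E] [NormedSpace ℝ E]
    (g : UnitAddTorus (Fin 2) → E) (hg : AEStronglyMeasurable g volume) :
    ∫ x, g (toTorus B x) ∂cellMeasure B = area B • ∫ t, g t := by
  rw [← integral_map measurable_toTorus.aemeasurable, map_toTorus, integral_smul_measure,
    ENNReal.toReal_ofReal (area_pos B).le]
  rw [map_toTorus]
  exact hg.smul_measure _

/-- This is Parseval's identity for `UnitAddTorus`, pulled back along `toTorus`. The factor `area B`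
appears because `ca` and `sa` are not normalised. -/
lemma hasSum_en (f : Plane → ℝ) (hf : MemLp f 2 (cellMeasure B)) :
    HasSum (en B f) (area B * ∫ x, f x ^ 2 ∂cellMeasure B) := by
  have hA := area_pos B
  set F : UnitAddTorus (Fin 2) → ℂ := fun t => (f (ofTorus B t) : ℂ) with hF
  have hFf : ∀ x ∈ cell B, F (toTorus B x) = f x := fun x hx => by
    simp only [hF, ofTorus_toTorus hx]
  have hmap : (volume : Measure (UnitAddTorus (Fin 2))).map (ofTorus B) =
      ENNReal.ofReal (area B)⁻¹ • cellMeasure B := by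
    have h1 : (cellMeasure B).map (ofTorus B ∘ toTorus B) = cellMeasure B := by
      conv_rhs => rw [← Measure.map_id (μ := cellMeasure B)]
      refine Measure.map_congr ?_
      filter_upwards [ae_restrict_mem (measurableSet_cell B)] with x hx
      exact ofTorus_toTorus hx
    rw [← Measure.map_map measurable_ofTorus measurable_toTorus, map_toTorus,
      Measure.map_smul] at h1
    rw [← h1, smul_smul, ← ENNReal.ofReal_mul (by positivity), inv_mul_cancel₀ hA.ne']
    simp
  have hFm : MemLp F 2 volume := by
    have h1 : MemLp f 2 ((volume : Measure (UnitAddTorus (Fin 2))).map (ofTorus B)) := by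
      rw [hmap]; exact hf.smul_measure ENNReal.ofReal_ne_top
    exact (h1.comp_of_map measurable_ofTorus.aemeasurable).ofReal
  have hP := UnitAddTorus.hasSum_sq_mFourierCoeff (hFm.toLp F)
  have hco := hFm.coeFn_toLp
  have e1 : ∫ t, ‖(hFm.toLp F) t‖ ^ 2 = (area B)⁻¹ * ∫ x, f x ^ 2 ∂cellMeasure B := by
    have h1 : ∫ t, ‖(hFm.toLp F) t‖ ^ 2 = ∫ t, ‖F t‖ ^ 2 := by
      refine integral_congr_ae ?_
      filter_upwards [hco] with t ht
      rw [ht]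
    have h2 := integral_torus (B := B) (fun t => ‖F t‖ ^ 2) (hFm.1.norm.pow 2)
    rw [h1, eq_inv_mul_iff_mul_eq₀ hA.ne', ← smul_eq_mul, ← h2]
    refine setIntegral_congr_fun (measurableSet_cell B) fun x hx => ?_
    simp [hFf x hx]
  have e2 : ∀ k, ‖UnitAddTorus.mFourierCoeff (hFm.toLp F) k‖ ^ 2 =
      (area B)⁻¹ ^ 2 * en B f k := by
    intro k
    have h1 : UnitAddTorus.mFourierCoeff (hFm.toLp F) k =
        ∫ t, UnitAddTorus.mFourier (-k) t • F t := by
      refine integral_congr_ae ?_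
      filter_upwards [hco] with t ht
      rw [ht]
    have h2 := integral_torus (B := B) (fun t => UnitAddTorus.mFourier (-k) t • F t)
      ((UnitAddTorus.mFourier (-k)).continuous.aestronglyMeasurable.smul hFm.1)
    have hi := hf.integrable (by norm_num)
    have i1 := integrable_mul_of_continuous hi (continuous_cosk (B := B) k)
    have i2 := integrable_mul_of_continuous hi (continuous_sink (B := B) k)
    have h3 : ∫ x, UnitAddTorus.mFourier (-k) (toTorus B x) • F (toTorus B x) ∂cellMeasure B =
        (ca B f k : ℂ) - (sa B f k : ℂ) * Complex.I := by
      rw [ca, sa, ← integral_complex_ofReal, ← integral_complex_ofReal, ← integral_mul_const,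
        ← integral_sub i1.ofReal (i2.ofReal.mul_const _)]
      refine setIntegral_congr_fun (measurableSet_cell B) fun x hx => ?_
      simp only [hFf x hx, mFourier_toTorus, phase_neg, smul_eq_mul, cosk, sink]
      rw [Complex.exp_mul_I]
      push_cast
      simp only [Complex.cos_neg, Complex.sin_neg]
      ring
    rw [h1]
    rw [h3] at h2
    have h4 : ∫ t, UnitAddTorus.mFourier (-k) t • F t =
        ((area B)⁻¹ : ℝ) • ((ca B f k : ℂ) - (sa B f k : ℂ) * Complex.I) := by
      rw [h2, smul_smul, inv_mul_cancel₀ hA.ne', one_smul]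
    rw [h4, norm_smul, mul_pow, Real.norm_of_nonneg (by positivity), en]
    congr 1
    rw [← Complex.normSq_eq_norm_sq, Complex.normSq_apply]
    simp
    ring
  simp only [e1, e2] at hP
  have := hP.mul_left (area B ^ 2)
  convert! this using 1
  · ext k; field_simp
  · field_simp

end Torus

end ChernSimonsHiggs
end

open MeasureTheory
open scoped ContDiff
noncomputable section
namespace ChernSimonsHiggs
variable {B : Module.Basis (Fin 2) ℝ Plane} {N : ℕ}

/-! ### Lattice sums -/

/-- The box of indices of size at most `R`. -/
def bx (R : ℕ) : Finset (Fin 2 → ℤ) := Fintype.piFinset fun _ => Finset.Icc (-(R : ℤ)) R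

/-- The size of an index. -/
def nk (k : Fin 2 → ℤ) : ℕ := max (k 0).natAbs (k 1).natAbs

lemma mem_bx {R : ℕ} {k : Fin 2 → ℤ} : k ∈ bx R ↔ nk k ≤ R := by
  simp only [bx, Fintype.mem_piFinset, Finset.mem_Icc, Fin.forall_fin_two, nk]
  omega

lemma neg_mem_bx {R : ℕ} {k : Fin 2 → ℤ} : -k ∈ bx R ↔ k ∈ bx R := by
  simp [mem_bx, nk]

lemma nk_eq_zero {k : Fin 2 → ℤ} : nk k = 0 ↔ k = 0 := by
  constructor
  · intro h
    ext i
    have : (k 0).natAbs ≤ 0 ∧ (k 1).natAbs ≤ 0 := by simpa [nk] using h.le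
    fin_cases i <;> simp <;> omega
  · rintro rfl; simp [nk]

lemma bx_subset {R S : ℕ} (h : R ≤ S) : bx R ⊆ bx S := fun _ hk =>
  mem_bx.2 ((mem_bx.1 hk).trans h)

lemma bx_zero : bx 0 = {0} := by
  ext k; simp [mem_bx, nk_eq_zero]

lemma card_bx (R : ℕ) : (bx R).card = (2 * R + 1) ^ 2 := by
  simp only [bx, Fintype.card_piFinset, Int.card_Icc, Finset.prod_const, Finset.card_univ,
    Fintype.card_fin]
  congr 1
  omega

/-- The shell of indices of size exactly `R + 1` has `(2R + 3)² - (2R + 1)² = 8 (R + 1)` elements.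
The lattice sums below are estimated shell by shell. -/
lemma sum_bx_succ_le {f : (Fin 2 → ℤ) → ℝ} {C : ℝ} (R : ℕ)
    (hf : ∀ k, nk k = R + 1 → f k ≤ C) :
    ∑ k ∈ bx (R + 1), f k ≤ ∑ k ∈ bx R, f k + 8 * (R + 1) * C := by
  rw [← Finset.sum_sdiff (bx_subset (Nat.le_succ R)), add_comm]
  gcongr
  have h1 : ∀ k ∈ bx (R + 1) \ bx R, f k ≤ C := by
    intro k hk
    rw [Finset.mem_sdiff, mem_bx, mem_bx] at hk
    exact hf k (by omega)
  refine (Finset.sum_le_card_nsmul _ _ _ h1).trans (le_of_eq ?_)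
  rw [Finset.card_sdiff_of_subset (bx_subset (Nat.le_succ R)), card_bx, card_bx, nsmul_eq_mul]
  congr 1
  have h : (2 * (R + 1) + 1) ^ 2 - (2 * R + 1) ^ 2 = 8 * (R + 1) := by
    have : (2 * (R + 1) + 1) ^ 2 = 8 * (R + 1) + (2 * R + 1) ^ 2 := by ring
    omega
  rw [h]
  push_cast
  ring

/-- The phase takes the value `2π kⱼ` at the basis vector `B j`, so its norm is at least a fixed
multiple of the size of `k`. -/
lemma exists_mu_lower (B : Module.Basis (Fin 2) ℝ Plane) :
    ∃ c, 0 < c ∧ ∀ k, c * (nk k : ℝ) ^ 2 ≤ mu B k := by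
  set m := ‖B 0‖ + ‖B 1‖ with hm
  have hm0 : 0 < m := by
    have : B 0 ≠ 0 := B.ne_zero 0
    have := norm_pos_iff.2 this
    positivity
  refine ⟨m⁻¹ ^ 2, by positivity, fun k => ?_⟩
  have h1 : ∀ j, |(k j : ℝ)| ≤ ‖phase B k‖ * m := by
    intro j
    have h2 := (phase B k).le_opNorm (B j)
    rw [phase_basis, Real.norm_eq_abs, abs_mul, abs_of_pos Real.two_pi_pos] at h2
    have h3 : ‖B j‖ ≤ m := by
      fin_cases j
      · simp [hm]
      · simp [hm]
    have h4 : |(k j : ℝ)| ≤ |(k j : ℝ)| * (2 * Real.pi) := by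
      have := Real.pi_gt_three
      nlinarith [abs_nonneg (k j : ℝ)]
    nlinarith [norm_nonneg (phase B k)]
  have h2 : (nk k : ℝ) ≤ ‖phase B k‖ * m := by
    have := h1 0
    have := h1 1
    simp only [nk, Nat.cast_max, Nat.cast_natAbs, Int.cast_abs]
    exact max_le (h1 0) (h1 1)
  rw [mu]
  have : m⁻¹ * nk k ≤ ‖phase B k‖ := by
    rw [inv_mul_le_iff₀ hm0, mul_comm]; exact h2
  rw [← mul_pow]
  gcongr

lemma mu_nonneg (k : Fin 2 → ℤ) : 0 ≤ mu B k := by unfold mu; positivity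

lemma mu_pos {k : Fin 2 → ℤ} (hk : k ≠ 0) : 0 < mu B k := by
  obtain ⟨c, hc, h⟩ := exists_mu_lower B
  have : 0 < nk k := Nat.pos_of_ne_zero (mt nk_eq_zero.1 hk)
  exact lt_of_lt_of_le (by positivity) (h k)

lemma mu_zero : mu B 0 = 0 := by
  have : phase B 0 = 0 := by ext x; simp [phase_zero]
  simp [mu, this]

/-- Logarithmic growth of `∑ 1 / mu`. -/
lemma exists_sum_inv_mu_le (B : Module.Basis (Fin 2) ℝ Plane) :
    ∃ C, 0 < C ∧ ∀ R : ℕ, 1 ≤ R → ∑ k ∈ bx R, (mu B k)⁻¹ ≤ C * (1 + Real.log R) := by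
  obtain ⟨c, hc, h⟩ := exists_mu_lower B
  refine ⟨8 / c, by positivity, fun R hR => ?_⟩
  have key : ∀ R : ℕ, ∑ k ∈ bx R, (mu B k)⁻¹ ≤ 8 / c * (harmonic R : ℝ) := by
    intro R
    induction R with
    -- The zero frequency contributes nothing, since `0⁻¹ = 0`.
    | zero => simp [bx_zero, mu_zero]
    | succ R ih =>
      refine (sum_bx_succ_le (C := (c * (R + 1 : ℝ) ^ 2)⁻¹) R fun k hk => ?_).trans ?_
      · have := h k
        rw [hk] at this
        push_cast at this
        gcongr
      · rw [harmonic_succ]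
        push_cast
        have : 8 * ((R : ℝ) + 1) * (c * (R + 1 : ℝ) ^ 2)⁻¹ = 8 / c * ((R : ℝ) + 1)⁻¹ := by
          field_simp
        rw [this]
        linarith
  refine (key R).trans ?_
  gcongr
  exact harmonic_le_one_add_log R

/-- The shell of size `R` contributes at most a multiple of `R⁻³`; the telescoping majorant `1 - 1 /
(R + 1)` makes this an induction on boxes, and every finite set of indices lies in a box. -/
lemma summable_inv_mu_sq (B : Module.Basis (Fin 2) ℝ Plane) :
    Summable fun k => (mu B k)⁻¹ ^ 2 := by
  obtain ⟨c, hc, h⟩ := exists_mu_lower B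
  have key : ∀ R : ℕ, ∑ k ∈ bx R, (mu B k)⁻¹ ^ 2 ≤ 16 / c ^ 2 * (1 - 1 / (R + 1)) := by
    intro R
    induction R with
    | zero => simp [bx_zero, mu_zero]
    | succ R ih =>
      refine (sum_bx_succ_le (C := (c * (R + 1 : ℝ) ^ 2)⁻¹ ^ 2) R fun k hk => ?_).trans ?_
      · have := h k
        rw [hk] at this
        push_cast at this
        have h0 := inv_nonneg.2 (mu_nonneg (B := B) k)
        gcongr
      · have h1 : 8 * ((R : ℝ) + 1) * (c * (R + 1 : ℝ) ^ 2)⁻¹ ^ 2 ≤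
            16 / c ^ 2 * (1 / (R + 1) - 1 / (R + 2)) := by
          have e1 : 8 * ((R : ℝ) + 1) * (c * (R + 1 : ℝ) ^ 2)⁻¹ ^ 2 =
              16 / c ^ 2 * (1 / (2 * ((R : ℝ) + 1) ^ 3)) := by
            field_simp; ring
          have e2 : 1 / ((R : ℝ) + 1) - 1 / (R + 2) = 1 / ((R + 1) * (R + 2)) := by
            field_simp; ring
          rw [e1, e2]
          refine mul_le_mul_of_nonneg_left (one_div_le_one_div_of_le (by positivity) ?_)
            (by positivity)
          have hR0 : (0 : ℝ) ≤ R := Nat.cast_nonneg R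
          nlinarith [mul_nonneg hR0 hR0, mul_nonneg hR0 (mul_nonneg hR0 hR0)]
        push_cast
        have e3 : (R : ℝ) + 1 + 1 = R + 2 := by ring
        rw [e3]
        linarith
  refine summable_of_sum_le (c := 16 / c ^ 2) (fun k => by positivity) fun s => ?_
  obtain ⟨R, hR⟩ : ∃ R, s ⊆ bx R := by
    refine ⟨s.sup nk, fun k hk => mem_bx.2 (Finset.le_sup hk)⟩
  refine (Finset.sum_le_sum_of_subset_of_nonneg hR fun _ _ _ => by positivity).trans ?_
  refine (key R).trans ?_
  have : 0 ≤ 1 / ((R : ℝ) + 1) := by positivity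
  have : 0 < 16 / c ^ 2 := by positivity
  nlinarith

/-! ### Fourier coefficients of elements of `W12` -/

lemma ca_congr {f g : Plane → ℝ} (h : f =ᵐ[cellMeasure B] g) : ca B f = ca B g := by
  ext k
  refine integral_congr_ae ?_
  filter_upwards [h] with x hx
  rw [hx]

lemma sa_congr {f g : Plane → ℝ} (h : f =ᵐ[cellMeasure B] g) : sa B f = sa B g := by
  ext k
  refine integral_congr_ae ?_
  filter_upwards [h] with x hx
  rw [hx]

lemma ca_inner_gr (w : W12 B) (h : Plane) (k : Fin 2 → ℤ) :
    ca B (fun x => inner ℝ (gr w x) h) k = phase B k h * sa B (fn w) k := by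
  have := weakGradient w _ (isTest_cosk k) h
  rw [ca, ← neg_eq_iff_eq_neg.2 this, sa, ← integral_const_mul, ← integral_neg]
  congr 1
  ext x
  simp [fderiv_cosk]
  ring

lemma sa_inner_gr (w : W12 B) (h : Plane) (k : Fin 2 → ℤ) :
    sa B (fun x => inner ℝ (gr w x) h) k = -(phase B k h * ca B (fn w) k) := by
  have := weakGradient w _ (isTest_sink k) h
  rw [sa, ← neg_eq_iff_eq_neg.2 this, ca, ← integral_const_mul]
  congr 2
  ext x
  simp [fderiv_sink]
  ring

lemma mu_eq_sum (k : Fin 2 → ℤ) :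
    mu B k = ∑ i, phase B k (EuclideanSpace.basisFun (Fin 2) ℝ i) ^ 2 := by
  rw [mu, ← LinearIsometryEquiv.norm_map (InnerProductSpace.toDual ℝ Plane).symm,
    ← real_inner_self_eq_norm_sq, inner_eq_sum_basisFun]
  simp [sq]

/-- Parseval's identity is applied to the two components of the gradient. Testing the weak gradient
with cosines and sines exchanges the two kinds of coefficients and multiplies them by the phase. -/
lemma hasSum_mu_en (w : W12 B) :
    HasSum (fun k => mu B k * en B (fn w) k) (area B * ∫ x, ‖gr w x‖ ^ 2 ∂cellMeasure B) := by
  have hm : ∀ h : Plane, MemLp (fun x => inner ℝ (gr w x) h) 2 (cellMeasure B) := fun h =>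
    (memLp_gr w).inner_const h
  have h1 := hasSum_sum (s := Finset.univ) fun i (_ : i ∈ Finset.univ) =>
    hasSum_en _ (hm (EuclideanSpace.basisFun (Fin 2) ℝ i))
  convert! h1 using 1
  · ext k
    rw [mu_eq_sum, Finset.sum_mul]
    refine Finset.sum_congr rfl fun i _ => ?_
    rw [en, en, ca_inner_gr, sa_inner_gr]
    ring
  · rw [← Finset.mul_sum, ← integral_finsetSum]
    · congr 2
      ext x
      rw [← real_inner_self_eq_norm_sq, inner_eq_sum_basisFun]
      simp [sq]
    · intro i _
      exact (hm _).integrable_sq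

/-- The high frequencies are controlled by the gradient. -/
lemma exists_tail_le (B : Module.Basis (Fin 2) ℝ Plane) : ∃ C, 0 < C ∧ ∀ (w : W12 B) (R : ℕ),
    area B * ∫ x, fn w x ^ 2 ∂cellMeasure B ≤ ∑ k ∈ bx R, en B (fn w) k +
      C / ((R : ℝ) + 1) ^ 2 * ∫ x, ‖gr w x‖ ^ 2 ∂cellMeasure B := by
  obtain ⟨c, hc, h⟩ := exists_mu_lower B
  refine ⟨area B / c, div_pos (area_pos B) hc, fun w R => ?_⟩
  have h1 := hasSum_en _ (memLp_fn w)
  have h2 := hasSum_mu_en w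
  have h3 := (h2.mul_left (1 / (c * ((R : ℝ) + 1) ^ 2)))
  have h4 : HasSum (fun k => if k ∈ bx R then en B (fn w) k else 0)
      (∑ k ∈ bx R, en B (fn w) k) := by
    have h4' : HasSum (fun k => if k ∈ bx R then en B (fn w) k else 0)
        (∑ k ∈ bx R, if k ∈ bx R then en B (fn w) k else 0) :=
      hasSum_sum_of_ne_finset_zero fun k hk => by simp [hk]
    rwa [Finset.sum_congr rfl fun k hk => if_pos hk] at h4'
  have h5 := hasSum_le (fun k => ?_) h1 (h4.add h3)
  · refine h5.trans (le_of_eq ?_)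
    field_simp
  · have hR : (0:ℝ) < c * ((R : ℝ) + 1) ^ 2 := by positivity
    split_ifs with hk
    · have := en_nonneg (B := B) (fn w) k
      have := mu_nonneg (B := B) k
      have : 0 ≤ 1 / (c * ((R : ℝ) + 1) ^ 2) * (mu B k * en B (fn w) k) := by positivity
      linarith
    · rw [mem_bx, not_le] at hk
      have h6 : c * ((R : ℝ) + 1) ^ 2 ≤ mu B k := by
        refine le_trans ?_ (h k)
        gcongr
        exact_mod_cast hk
      rw [zero_add, one_div, ← mul_assoc]
      have h7 : 1 ≤ (c * ((R : ℝ) + 1) ^ 2)⁻¹ * mu B k := by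
        rw [← div_eq_inv_mul, le_div_iff₀ hR, one_mul]; exact h6
      nlinarith [en_nonneg (B := B) (fn w) k]

lemma cosk_zero (x : Plane) : cosk B 0 x = 1 := by simp [cosk, phase_zero]

lemma sink_zero (x : Plane) : sink B 0 x = 0 := by simp [sink, phase_zero]

lemma en_zero (f : Plane → ℝ) : en B f 0 = (∫ x, f x ∂cellMeasure B) ^ 2 := by
  simp [en, ca, sa, cosk_zero, sink_zero]

/-- The Poincaré inequality. -/
lemma exists_poincare (B : Module.Basis (Fin 2) ℝ Plane) : ∃ C, 0 < C ∧ ∀ w : W12 B,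
    ∫ x, fn w x ∂cellMeasure B = 0 →
    ∫ x, fn w x ^ 2 ∂cellMeasure B ≤ C * ∫ x, ‖gr w x‖ ^ 2 ∂cellMeasure B := by
  obtain ⟨C, hC, h⟩ := exists_tail_le B
  refine ⟨C / area B, div_pos hC (area_pos B), fun w hw => ?_⟩
  have := h w 0
  rw [bx_zero, Finset.sum_singleton, en_zero, hw] at this
  have hA := area_pos B
  rw [div_mul_eq_mul_div, le_div_iff₀ hA]
  norm_num at this
  linarith

/-- The weak gradient is determined by the function: if the difference vanishes almost everywhere,
so do its Fourier coefficients, and `hasSum_mu_en` then gives zero Dirichlet energy. -/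
lemma eq_of_fn_ae_eq {v w : W12 B} (h : fn v =ᵐ[cellMeasure B] fn w) : v = w := by
  rw [← sub_eq_zero, ← norm_eq_zero, ← sq_eq_zero_iff, norm_sq_eq]
  have h0 : fn (v - w) =ᵐ[cellMeasure B] fun _ => 0 := by
    filter_upwards [fn_sub v w, h] with x h1 h2
    rw [h1, h2, sub_self]
  have h1 : en B (fn (v - w)) = fun _ => 0 := by
    ext k
    rw [en, ca_congr h0, sa_congr h0]
    simp [ca, sa]
  have h2 := hasSum_mu_en (v - w)
  rw [h1] at h2
  simp only [mul_zero] at h2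
  have h3 := h2.unique hasSum_zero
  have hA := (area_pos B).ne'
  have h4 : ∫ x, fn (v - w) x ^ 2 ∂cellMeasure B = 0 := by
    rw [integral_congr_ae (g := fun _ => 0)]
    · simp
    · filter_upwards [h0] with x hx
      simp [hx]
  rw [h4, (mul_eq_zero.1 h3).resolve_left hA, add_zero]

lemma integral_inner_gradient_cosk (w : W12 B) (k : Fin 2 → ℤ) :
    ∫ x, inner ℝ (gr w x) (gradient (cosk B k) x) ∂cellMeasure B = mu B k * ca B (fn w) k := by
  have h : ∀ x, inner ℝ (gr w x) (gradient (cosk B k) x) = ∑ i,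
      -(phase B k (EuclideanSpace.basisFun (Fin 2) ℝ i)) *
        (inner ℝ (gr w x) (EuclideanSpace.basisFun (Fin 2) ℝ i) * sink B k x) := by
    intro x
    rw [inner_eq_sum_basisFun]
    refine Finset.sum_congr rfl fun i _ => ?_
    rw [inner_gradient, fderiv_cosk]
    simp
    ring
  simp_rw [h]
  rw [integral_finsetSum]
  · simp_rw [integral_const_mul]
    have h2 := fun i => sa_inner_gr w (EuclideanSpace.basisFun (Fin 2) ℝ i) k
    simp only [sa] at h2
    simp_rw [h2, mu_eq_sum, Finset.sum_mul]
    refine Finset.sum_congr rfl fun i _ => ?_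
    ring
  · intro i _
    exact (integrable_mul_of_continuous ((integrable_gr w).inner_const (𝕜 := ℝ) _)
      (continuous_sink k)).const_mul _

lemma integral_inner_gradient_sink (w : W12 B) (k : Fin 2 → ℤ) :
    ∫ x, inner ℝ (gr w x) (gradient (sink B k) x) ∂cellMeasure B = mu B k * sa B (fn w) k := by
  have h : ∀ x, inner ℝ (gr w x) (gradient (sink B k) x) = ∑ i,
      (phase B k (EuclideanSpace.basisFun (Fin 2) ℝ i)) *
        (inner ℝ (gr w x) (EuclideanSpace.basisFun (Fin 2) ℝ i) * cosk B k x) := by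
    intro x
    rw [inner_eq_sum_basisFun]
    refine Finset.sum_congr rfl fun i _ => ?_
    rw [inner_gradient, fderiv_sink]
    simp
    ring
  simp_rw [h]
  rw [integral_finsetSum]
  · simp_rw [integral_const_mul]
    have h2 := fun i => ca_inner_gr w (EuclideanSpace.basisFun (Fin 2) ℝ i) k
    simp only [ca] at h2
    simp_rw [h2, mu_eq_sum, Finset.sum_mul]
    refine Finset.sum_congr rfl fun i _ => ?_
    ring
  · intro i _
    exact (integrable_mul_of_continuous ((integrable_gr w).inner_const (𝕜 := ℝ) _)
      (continuous_cosk k)).const_mul _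

/-- A test function as an element of `W12`. -/
def ofTest {φ : Plane → ℝ} (h : IsTest B φ) : W12 B := ofC1 h.2 (h.1.of_le (by simp))

lemma fn_ofTest {φ : Plane → ℝ} (h : IsTest B φ) : fn (ofTest h) =ᵐ[cellMeasure B] φ :=
  fn_ofC1 _ _

lemma gr_ofTest {φ : Plane → ℝ} (h : IsTest B φ) : gr (ofTest h) =ᵐ[cellMeasure B] gradient φ :=
  gr_ofC1 _ _

lemma inner_ofTest (w : W12 B) {φ : Plane → ℝ} (h : IsTest B φ) : inner ℝ w (ofTest h) =
    ∫ x, fn w x * φ x ∂cellMeasure B + ∫ x, inner ℝ (gr w x) (gradient φ x) ∂cellMeasure B := by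
  rw [inner_eq]
  congr 1
  · refine integral_congr_ae ?_
    filter_upwards [fn_ofTest h] with x hx
    rw [hx]
  · refine integral_congr_ae ?_
    filter_upwards [gr_ofTest h] with x hx
    rw [hx]

lemma inner_ofTest_cosk (w : W12 B) (k : Fin 2 → ℤ) :
    inner ℝ w (ofTest (isTest_cosk k)) = (1 + mu B k) * ca B (fn w) k := by
  rw [inner_ofTest, integral_inner_gradient_cosk, ca]; ring

lemma inner_ofTest_sink (w : W12 B) (k : Fin 2 → ℤ) :
    inner ℝ w (ofTest (isTest_sink k)) = (1 + mu B k) * sa B (fn w) k := by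
  rw [inner_ofTest, integral_inner_gradient_sink, sa]; ring

/-- Weak convergence in `W12` of a bounded family implies convergence in `L²`. -/
lemma tendsto_integral_sq_of_weak {ι : Type*} {l : Filter ι} {w : ι → W12 B} {D : ℝ}
    (hD : ∀ᶠ i in l, ‖w i‖ ≤ D) (hw : ∀ φ : W12 B, Filter.Tendsto (fun i => inner ℝ (w i) φ) l (nhds 0)) :
    Filter.Tendsto (fun i => ∫ x, fn (w i) x ^ 2 ∂cellMeasure B) l (nhds 0) := by
  have hA := area_pos B
  obtain ⟨C, hC, h⟩ := exists_tail_le B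
  have hen : ∀ k, Filter.Tendsto (fun i => en B (fn (w i)) k) l (nhds 0) := by
    intro k
    have hk : 0 < 1 + mu B k := by have := mu_nonneg (B := B) k; linarith
    have h1 := (hw (ofTest (isTest_cosk k))).const_mul (1 + mu B k)⁻¹
    have h2 := (hw (ofTest (isTest_sink k))).const_mul (1 + mu B k)⁻¹
    simp only [inner_ofTest_cosk, inner_ofTest_sink, inv_mul_cancel_left₀ hk.ne', mul_zero] at h1 h2
    simpa [en] using (h1.pow 2).add (h2.pow 2)
  have hS : Filter.Tendsto (fun i => area B * ∫ x, fn (w i) x ^ 2 ∂cellMeasure B) l (nhds 0) := by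
    rw [Metric.tendsto_nhds]
    intro ε hε
    -- This cut-off frequency makes the tail `C D² / (R + 1)²` at most `ε / 2`; the finitely many
    -- remaining coefficients tend to zero by weak convergence.
    obtain ⟨R, hR⟩ := exists_nat_gt (2 * (C * D ^ 2) / ε)
    have h1 : Filter.Tendsto (fun i => ∑ k ∈ bx R, en B (fn (w i)) k) l (nhds 0) := by
      simpa using tendsto_finsetSum (bx R) fun k _ => hen k
    filter_upwards [(Metric.tendsto_nhds.1 h1) (ε / 2) (by positivity), hD] with i hi hDi
    rw [Real.dist_eq, sub_zero] at hi ⊢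
    have h2 : 0 ≤ ∫ x, fn (w i) x ^ 2 ∂cellMeasure B := integral_nonneg fun x => sq_nonneg _
    rw [abs_of_nonneg (by positivity)]
    refine (h (w i) R).trans_lt ?_
    have h3 : ∫ x, ‖gr (w i) x‖ ^ 2 ∂cellMeasure B ≤ D ^ 2 := by
      have h4 := norm_sq_eq (w i)
      have h5 : ‖w i‖ ^ 2 ≤ D ^ 2 := by gcongr
      linarith
    have h4 : C / ((R : ℝ) + 1) ^ 2 * ∫ x, ‖gr (w i) x‖ ^ 2 ∂cellMeasure B ≤ ε / 2 := by
      have h5 : C / ((R : ℝ) + 1) ^ 2 * ∫ x, ‖gr (w i) x‖ ^ 2 ∂cellMeasure B ≤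
          C / ((R : ℝ) + 1) ^ 2 * D ^ 2 := by gcongr
      refine h5.trans ?_
      rw [div_mul_eq_mul_div, div_le_iff₀ (by positivity)]
      rw [div_lt_iff₀ hε] at hR
      nlinarith [sq_nonneg (R : ℝ), (Nat.cast_nonneg R : (0:ℝ) ≤ R)]
    have := le_abs_self (∑ k ∈ bx R, en B (fn (w i)) k)
    linarith
  have := hS.const_mul (area B)⁻¹
  simpa [inv_mul_cancel_left₀ hA.ne'] using this

end ChernSimonsHiggs
end

open MeasureTheory
open scoped ContDiff
noncomputable section
namespace ChernSimonsHiggs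
variable {B : Module.Basis (Fin 2) ℝ Plane} {N : ℕ}

/-! ### Trigonometric polynomials -/

lemma exists_phase_ne_zero {k : Fin 2 → ℤ} (hk : k ≠ 0) : ∃ h, phase B k h ≠ 0 := by
  obtain ⟨j, hj⟩ := Function.ne_iff.1 hk
  refine ⟨B j, ?_⟩
  rw [phase_basis]
  have : (k j : ℝ) ≠ 0 := by exact_mod_cast hj
  have := Real.two_pi_pos.ne'
  positivity

lemma integral_cosk (k : Fin 2 → ℤ) :
    ∫ x, cosk B k x ∂cellMeasure B = if k = 0 then area B else 0 := by
  split_ifs with hk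
  · subst hk
    simp [cosk_zero, area]
  · obtain ⟨h, hh⟩ := exists_phase_ne_zero (B := B) hk
    have := integral_cell_fderiv (isTest_sink (B := B) k).2 ((isTest_sink k).1.of_le (by simp)) h
    simp only [fderiv_sink, smul_apply, smul_eq_mul] at this
    rw [integral_mul_const] at this
    exact (mul_eq_zero.1 this).resolve_right hh

lemma integral_sink (k : Fin 2 → ℤ) : ∫ x, sink B k x ∂cellMeasure B = 0 := by
  by_cases hk : k = 0
  · subst hk
    simp [sink_zero]
  · obtain ⟨h, hh⟩ := exists_phase_ne_zero (B := B) hk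
    have := integral_cell_fderiv (isTest_cosk (B := B) k).2 ((isTest_cosk k).1.of_le (by simp)) h
    simp only [fderiv_cosk, smul_apply, smul_eq_mul, neg_mul] at this
    rw [integral_neg, integral_mul_const, neg_eq_zero] at this
    exact (mul_eq_zero.1 this).resolve_right hh

lemma integral_cosk_mul_cosk (k l : Fin 2 → ℤ) : ∫ x, cosk B k x * cosk B l x ∂cellMeasure B =
    ((if k = l then area B else 0) + if k = -l then area B else 0) / 2 := by
  have h : ∀ x, cosk B k x * cosk B l x = (cosk B (k - l) x + cosk B (k + l) x) / 2 := by
    intro x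
    simp only [cosk, phase_sub, phase_add, Real.cos_sub, Real.cos_add]; ring
  simp_rw [h]
  rw [integral_div, integral_add (integrable_of_continuous (continuous_cosk _))
    (integrable_of_continuous (continuous_cosk _)), integral_cosk, integral_cosk]
  simp only [sub_eq_zero, add_eq_zero_iff_eq_neg]

lemma integral_sink_mul_sink (k l : Fin 2 → ℤ) : ∫ x, sink B k x * sink B l x ∂cellMeasure B =
    ((if k = l then area B else 0) - if k = -l then area B else 0) / 2 := by
  have h : ∀ x, sink B k x * sink B l x = (cosk B (k - l) x - cosk B (k + l) x) / 2 := by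
    intro x
    simp only [cosk, sink, phase_sub, phase_add, Real.cos_sub, Real.cos_add]; ring
  simp_rw [h]
  rw [integral_div, integral_sub (integrable_of_continuous (continuous_cosk _))
    (integrable_of_continuous (continuous_cosk _)), integral_cosk, integral_cosk]
  simp only [sub_eq_zero, add_eq_zero_iff_eq_neg]

lemma integral_sink_mul_cosk (k l : Fin 2 → ℤ) :
    ∫ x, sink B k x * cosk B l x ∂cellMeasure B = 0 := by
  have h : ∀ x, sink B k x * cosk B l x = (sink B (k + l) x + sink B (k - l) x) / 2 := by
    intro x
    simp only [cosk, sink, phase_sub, phase_add, Real.sin_sub, Real.sin_add]; ring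
  simp_rw [h]
  rw [integral_div, integral_add (integrable_of_continuous (continuous_sink _))
    (integrable_of_continuous (continuous_sink _)), integral_sink, integral_sink]
  simp

/-- The trigonometric polynomial with coefficients `α`, `β` and frequencies in the box `R`. -/
def trig (B : Module.Basis (Fin 2) ℝ Plane) (R : ℕ) (α β : (Fin 2 → ℤ) → ℝ) (x : Plane) : ℝ :=
  ∑ k ∈ bx R, (α k * cosk B k x + β k * sink B k x)

lemma isTest_trig (R : ℕ) (α β : (Fin 2 → ℤ) → ℝ) : IsTest B (trig B R α β) := by
  refine ⟨?_, fun j x => ?_⟩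
  · refine ContDiff.sum fun k _ => ?_
    exact (contDiff_const.mul (isTest_cosk k).1).add (contDiff_const.mul (isTest_sink k).1)
  · refine Finset.sum_congr rfl fun k _ => ?_
    rw [(isTest_cosk k).2 j x, (isTest_sink k).2 j x]

/-- The indices `k` and `-k` carry the same functions up to sign, and orthogonality gives each of
them half the weight. The coefficient is recovered when `α` is even (and `β` odd in `sa_trig`), as
is the case for the Fourier coefficients of a real function. -/
lemma ca_trig (R : ℕ) {α β : (Fin 2 → ℤ) → ℝ} (hα : ∀ k, α (-k) = α k) (l : Fin 2 → ℤ) :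
    ca B (trig B R α β) l = if l ∈ bx R then area B * α l else 0 := by
  simp only [ca, trig, Finset.sum_mul, add_mul, mul_assoc]
  rw [integral_finsetSum]
  · have h : ∀ k, ∫ x, (α k * (cosk B k x * cosk B l x) + β k * (sink B k x * cosk B l x))
        ∂cellMeasure B =
        (if k = l then α k * (area B / 2) else 0) + if k = -l then α k * (area B / 2) else 0 := by
      intro k
      rw [integral_add, integral_const_mul, integral_const_mul, integral_cosk_mul_cosk,
        integral_sink_mul_cosk]
      · split_ifs <;> ring
      · exact integrable_of_continuous (continuous_const.mul
          ((continuous_cosk _).mul (continuous_cosk _)))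
      · exact integrable_of_continuous (continuous_const.mul
          ((continuous_sink _).mul (continuous_cosk _)))
    simp_rw [h]
    rw [Finset.sum_add_distrib, Finset.sum_ite_eq', Finset.sum_ite_eq', hα]
    simp only [neg_mem_bx]
    split_ifs <;> ring
  · intro k _
    refine integrable_of_continuous ?_
    have := continuous_cosk (B := B)
    have := continuous_sink (B := B)
    fun_prop

lemma sa_trig (R : ℕ) {α β : (Fin 2 → ℤ) → ℝ} (hβ : ∀ k, β (-k) = -β k) (l : Fin 2 → ℤ) :
    sa B (trig B R α β) l = if l ∈ bx R then area B * β l else 0 := by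
  simp only [sa, trig, Finset.sum_mul, add_mul, mul_assoc]
  rw [integral_finsetSum]
  · have h : ∀ k, ∫ x, (α k * (cosk B k x * sink B l x) + β k * (sink B k x * sink B l x))
        ∂cellMeasure B =
        (if k = l then β k * (area B / 2) else 0) - if k = -l then β k * (area B / 2) else 0 := by
      intro k
      have hs : ∫ x, cosk B k x * sink B l x ∂cellMeasure B = 0 := by
        simp_rw [mul_comm (cosk B k _)]
        exact integral_sink_mul_cosk l k
      rw [integral_add, integral_const_mul, integral_const_mul, integral_sink_mul_sink, hs]
      · split_ifs <;> ring
      · exact integrable_of_continuous (continuous_const.mul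
          ((continuous_cosk _).mul (continuous_sink _)))
      · exact integrable_of_continuous (continuous_const.mul
          ((continuous_sink _).mul (continuous_sink _)))
    simp_rw [h]
    rw [Finset.sum_sub_distrib, Finset.sum_ite_eq', Finset.sum_ite_eq', hβ]
    simp only [neg_mem_bx]
    split_ifs <;> ring
  · intro k _
    refine integrable_of_continuous ?_
    have := continuous_cosk (B := B)
    have := continuous_sink (B := B)
    fun_prop

lemma ca_neg (f : Plane → ℝ) (k : Fin 2 → ℤ) : ca B f (-k) = ca B f k := by
  simp [ca, cosk, phase_neg]

lemma sa_neg (f : Plane → ℝ) (k : Fin 2 → ℤ) : sa B f (-k) = -sa B f k := by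
  simp only [sa, sink, phase_neg, Real.sin_neg, mul_neg, integral_neg]

lemma mu_neg (k : Fin 2 → ℤ) : mu B (-k) = mu B k := by
  have : phase B (-k) = -phase B k := by ext x; simp [phase_neg]
  rw [mu, this, norm_neg, mu]

lemma abs_mul_cos_add_mul_sin_le (a b t : ℝ) :
    |a * Real.cos t + b * Real.sin t| ≤ √(a ^ 2 + b ^ 2) := by
  apply Real.abs_le_sqrt
  nlinarith [sq_nonneg (a * Real.sin t - b * Real.cos t), Real.sin_sq_add_cos_sq t]

lemma abs_trig_le (R : ℕ) (α β : (Fin 2 → ℤ) → ℝ) (x : Plane) :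
    |trig B R α β x| ≤ ∑ k ∈ bx R, √(α k ^ 2 + β k ^ 2) :=
  (Finset.abs_sum_le_sum_abs _ _).trans
    (Finset.sum_le_sum fun _ _ => abs_mul_cos_add_mul_sin_le _ _ _)

/-- The Fourier partial sum of `f`. -/
def proj (B : Module.Basis (Fin 2) ℝ Plane) (R : ℕ) (f : Plane → ℝ) : Plane → ℝ :=
  trig B R (fun k => ca B f k / area B) fun k => sa B f k / area B

lemma en_sub_proj {f : Plane → ℝ} (hf : Integrable f (cellMeasure B)) (R : ℕ) (k : Fin 2 → ℤ) :
    en B (fun x => f x - proj B R f x) k = if k ∈ bx R then 0 else en B f k := by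
  have hA := (area_pos B).ne'
  have ht : Continuous (proj B R f) := (isTest_trig R _ _).1.continuous
  have h1 : ca B (fun x => f x - proj B R f x) k = ca B f k - ca B (proj B R f) k := by
    rw [ca, ca, ca, ← integral_sub (integrable_mul_of_continuous hf (continuous_cosk k))
      (integrable_mul_of_continuous (integrable_of_continuous ht) (continuous_cosk k))]
    simp only [sub_mul]
  have h2 : sa B (fun x => f x - proj B R f x) k = sa B f k - sa B (proj B R f) k := by
    rw [sa, sa, sa, ← integral_sub (integrable_mul_of_continuous hf (continuous_sink k))
      (integrable_mul_of_continuous (integrable_of_continuous ht) (continuous_sink k))]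
    simp only [sub_mul]
  rw [en, h1, h2, proj, ca_trig R (fun k => by rw [ca_neg]),
    sa_trig R (fun k => by rw [sa_neg, neg_div])]
  split_ifs
  · field_simp; simp
  · simp [en]

lemma exists_sub_proj_le (B : Module.Basis (Fin 2) ℝ Plane) : ∃ C, 0 < C ∧
    ∀ (w : W12 B) (R : ℕ), ∫ x, (fn w x - proj B R (fn w) x) ^ 2 ∂cellMeasure B ≤
      C / ((R : ℝ) + 1) ^ 2 * ∫ x, ‖gr w x‖ ^ 2 ∂cellMeasure B := by
  obtain ⟨c, hc, h⟩ := exists_mu_lower B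
  have hA := area_pos B
  refine ⟨1 / c, by positivity, fun w R => ?_⟩
  have ht : Continuous (proj B R (fn w)) := (isTest_trig R _ _).1.continuous
  have h1 := hasSum_en _ ((memLp_fn w).sub (memLp_of_continuous ht 2))
  have h2 := hasSum_mu_en w
  have h3 := h2.mul_left (1 / (c * ((R : ℝ) + 1) ^ 2))
  have h5 := hasSum_le (fun k => ?_) h1 h3
  · simp only [Pi.sub_apply] at h5
    have h6 : area B * ∫ x, (fn w x - proj B R (fn w) x) ^ 2 ∂cellMeasure B ≤
        area B * (1 / c / ((R : ℝ) + 1) ^ 2 * ∫ x, ‖gr w x‖ ^ 2 ∂cellMeasure B) := by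
      refine h5.trans (le_of_eq ?_)
      field_simp
    exact le_of_mul_le_mul_left h6 hA
  · have hR : (0:ℝ) < c * ((R : ℝ) + 1) ^ 2 := by positivity
    have e := en_sub_proj (integrable_fn w) R k
    have e' : en B (fn w - proj B R (fn w)) k = _ := e
    rw [e']
    split_ifs with hk
    · have := en_nonneg (B := B) (fn w) k
      have := mu_nonneg (B := B) k
      positivity
    · rw [mem_bx, not_le] at hk
      have h6 : c * ((R : ℝ) + 1) ^ 2 ≤ mu B k := by
        refine le_trans ?_ (h k)
        gcongr
        exact_mod_cast hk
      rw [one_div, ← mul_assoc]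
      have h7 : 1 ≤ (c * ((R : ℝ) + 1) ^ 2)⁻¹ * mu B k := by
        rw [← div_eq_inv_mul, le_div_iff₀ hR, one_mul]; exact h6
      nlinarith [en_nonneg (B := B) (fn w) k]

/-! ### Supremum bounds for partial sums and the Trudinger inequality -/

lemma integral_sq_le_norm_sq (w : W12 B) : ∫ x, fn w x ^ 2 ∂cellMeasure B ≤ ‖w‖ ^ 2 := by
  have : 0 ≤ ∫ x, ‖gr w x‖ ^ 2 ∂cellMeasure B := integral_nonneg fun x => sq_nonneg _
  rw [norm_sq_eq]; linarith

lemma integral_gr_sq_le_norm_sq (w : W12 B) : ∫ x, ‖gr w x‖ ^ 2 ∂cellMeasure B ≤ ‖w‖ ^ 2 := by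
  have : 0 ≤ ∫ x, fn w x ^ 2 ∂cellMeasure B := integral_nonneg fun x => sq_nonneg _
  rw [norm_sq_eq]; linarith

/-- By Cauchy-Schwarz the moduli of the coefficients with non-zero frequency sum to at most the
square root of the Dirichlet energy times `∑ 1 / mu`, and the latter grows like the logarithm of `3
^ m`. The zero frequency is treated apart, by the `L²` norm. -/
lemma exists_abs_proj_le (B : Module.Basis (Fin 2) ℝ Plane) : ∃ C, 0 < C ∧
    ∀ (w : W12 B) (m : ℕ) (x : Plane),
      |proj B (3 ^ m) (fn w) x| ≤ C * ‖w‖ * √(1 + 2 * m) := by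
  obtain ⟨C, hC, h⟩ := exists_sum_inv_mu_le B
  have hA := area_pos B
  refine ⟨√(2 / area B * (1 + C)), by positivity, fun w m x => ?_⟩
  have h0 : |proj B (3 ^ m) (fn w) x| ≤ (area B)⁻¹ * ∑ k ∈ bx (3 ^ m), √(en B (fn w) k) := by
    refine (abs_trig_le _ _ _ x).trans (le_of_eq ?_)
    rw [Finset.mul_sum]
    refine Finset.sum_congr rfl fun k _ => ?_
    rw [← Real.sqrt_sq (inv_nonneg.2 hA.le), ← Real.sqrt_mul (by positivity), en]
    congr 1
    field_simp
  set R := 3 ^ m with hR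
  have h00 : (0 : Fin 2 → ℤ) ∈ bx R := by simp [mem_bx, nk]
  have hS : (∑ k ∈ bx R, √(en B (fn w) k)) ^ 2 ≤ area B * ‖w‖ ^ 2 * (2 * (1 + C) * (1 + 2 * m)) := by
    rw [← Finset.add_sum_erase _ _ h00]
    have e0 : √(en B (fn w) 0) ^ 2 ≤ area B * ‖w‖ ^ 2 := by
      rw [Real.sq_sqrt (en_nonneg _ _)]
      have h1 := hasSum_en _ (memLp_fn w)
      refine (le_hasSum h1 0 fun k _ => en_nonneg _ k).trans ?_
      gcongr
      exact integral_sq_le_norm_sq w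
    have e1 : (∑ k ∈ (bx R).erase 0, √(en B (fn w) k)) ^ 2 ≤
        area B * ‖w‖ ^ 2 * (C * (1 + 2 * m)) := by
      have cs := Finset.sum_mul_sq_le_sq_mul_sq ((bx R).erase 0)
        (fun k => √(mu B k * en B (fn w) k)) (fun k => √((mu B k)⁻¹))
      have e2 : ∀ k ∈ (bx R).erase 0, √(mu B k * en B (fn w) k) * √((mu B k)⁻¹) =
          √(en B (fn w) k) := by
        intro k hk
        have := mu_pos (B := B) (Finset.ne_of_mem_erase hk)
        rw [← Real.sqrt_mul (mul_nonneg this.le (en_nonneg _ _))]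
        congr 1
        field_simp
      rw [Finset.sum_congr rfl e2] at cs
      refine cs.trans ?_
      gcongr
      · have h2 := hasSum_mu_en w
        have : ∑ k ∈ (bx R).erase 0, √(mu B k * en B (fn w) k) ^ 2 =
            ∑ k ∈ (bx R).erase 0, mu B k * en B (fn w) k :=
          Finset.sum_congr rfl fun k _ => Real.sq_sqrt (mul_nonneg (mu_nonneg _) (en_nonneg _ _))
        rw [this]
        refine (sum_le_hasSum _ (fun k _ => mul_nonneg (mu_nonneg _) (en_nonneg _ _)) h2).trans ?_
        gcongr
        exact integral_gr_sq_le_norm_sq w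
      · have : ∑ k ∈ (bx R).erase 0, √((mu B k)⁻¹) ^ 2 ≤ ∑ k ∈ bx R, (mu B k)⁻¹ := by
          refine (Finset.sum_le_sum_of_subset_of_nonneg (Finset.erase_subset _ _)
            fun k _ _ => sq_nonneg _).trans (Finset.sum_le_sum fun k _ => ?_)
          rw [Real.sq_sqrt (inv_nonneg.2 (mu_nonneg _))]
        refine (this.trans (h R (Nat.one_le_pow _ _ (by norm_num)))).trans ?_
        gcongr
        rw [hR]
        push_cast
        rw [Real.log_pow]
        have : Real.log 3 ≤ 2 := by
          have := Real.log_le_sub_one_of_pos (show (0:ℝ) < 3 by norm_num)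
          linarith
        nlinarith [(Nat.cast_nonneg m : (0:ℝ) ≤ m)]
    have hm : (0:ℝ) ≤ m := Nat.cast_nonneg m
    have e3 : 0 ≤ area B * ‖w‖ ^ 2 := by positivity
    have e4 : area B * ‖w‖ ^ 2 ≤ area B * ‖w‖ ^ 2 * (1 + 2 * m) := by nlinarith
    nlinarith [sq_nonneg (√(en B (fn w) 0) - ∑ k ∈ (bx R).erase 0, √(en B (fn w) k))]
  refine h0.trans ?_
  have hsum : ∑ k ∈ bx R, √(en B (fn w) k) ≤
      √(area B * ‖w‖ ^ 2 * (2 * (1 + C) * (1 + 2 * m))) := Real.le_sqrt_of_sq_le hS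
  refine (mul_le_mul_of_nonneg_left hsum (inv_nonneg.2 hA.le)).trans (le_of_eq ?_)
  have hn : ‖w‖ = √(‖w‖ ^ 2) := (Real.sqrt_sq (norm_nonneg w)).symm
  conv_rhs => rw [hn]
  have hi : (area B)⁻¹ = √((area B)⁻¹ ^ 2) := (Real.sqrt_sq (inv_nonneg.2 hA.le)).symm
  rw [hi, ← Real.sqrt_mul (by positivity), ← Real.sqrt_mul (by positivity),
    ← Real.sqrt_mul (by positivity)]
  congr 1
  field_simp

lemma integrable_and_integral_le_of_lintegral_le {α : Type*} [MeasurableSpace α] {m : Measure α}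
    {f : α → ℝ} (hm : AEStronglyMeasurable f m) (h0 : ∀ x, 0 ≤ f x) {T : ℝ} (hT : 0 ≤ T)
    (h : ∫⁻ x, ENNReal.ofReal (f x) ∂m ≤ ENNReal.ofReal T) : Integrable f m ∧ ∫ x, f x ∂m ≤ T := by
  have hi : Integrable f m := by
    refine ⟨hm, ?_⟩
    rw [hasFiniteIntegral_iff_ofReal (Filter.Eventually.of_forall h0)]
    exact h.trans_lt ENNReal.ofReal_lt_top
  refine ⟨hi, ?_⟩
  rwa [← ENNReal.ofReal_le_ofReal_iff hT,
    ofReal_integral_eq_lintegral_ofReal hi (Filter.Eventually.of_forall h0)]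

/-- A Trudinger type inequality. -/
lemma exists_trudinger (B : Module.Basis (Fin 2) ℝ Plane) : ∃ C, 0 < C ∧ ∀ w : W12 B,
    Integrable (fun x => Real.exp |fn w x|) (cellMeasure B) ∧
    ∫ x, Real.exp |fn w x| ∂cellMeasure B ≤ C * Real.exp (C * ‖w‖ ^ 2) := by
  obtain ⟨C₁, hC₁, h₁⟩ := exists_abs_proj_le B
  obtain ⟨C₂, hC₂, h₂⟩ := exists_sub_proj_le B
  have hA := area_pos B
  set C₃ := area B * Real.exp 2 + C₂ * Real.exp 3 * 2 with hC₃
  have hC₃0 : 0 < C₃ := by positivity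
  set C := max C₃ (C₁ ^ 2 + 1) with hC
  refine ⟨C, lt_max_of_lt_left hC₃0, fun w => ?_⟩
  set D := ‖w‖ with hD
  have hD0 : 0 ≤ D := norm_nonneg w
  -- The level `s m` exceeds the bound for the partial sum of order `3 ^ m` by `1`, so the remainder
  -- is at least `1` in modulus wherever `|w| > s m`. On the band between `s m` and `C₁² D² / 2 + m
  -- + 5 / 2` the function `exp |w|` is therefore at most `t m` times the squared remainder.
  let s : ℕ → ℝ := fun m => C₁ * D * √(1 + 2 * m) + 1
  have hs : ∀ m : ℕ, s m ≤ C₁ ^ 2 * D ^ 2 / 2 + m + 3 / 2 := by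
    intro m
    have h1 : √(1 + 2 * (m : ℝ)) ^ 2 = 1 + 2 * m := Real.sq_sqrt (by positivity)
    simp only [s]
    nlinarith [sq_nonneg (C₁ * D - √(1 + 2 * (m : ℝ)))]
  let t : ℕ → ℝ := fun m => Real.exp (C₁ ^ 2 * D ^ 2 / 2 + m + 5 / 2)
  let g : ℕ → Plane → ℝ := fun m x => t m * (fn w x - proj B (3 ^ m) (fn w) x) ^ 2
  have hproj : ∀ m, Continuous (proj B (3 ^ m) (fn w)) := fun m =>
    (isTest_trig _ _ _).1.continuous
  have hgi : ∀ m, Integrable (g m) (cellMeasure B) := fun m =>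
    (((memLp_fn w).sub (memLp_of_continuous (hproj m) 2)).integrable_sq).const_mul _
  have hg0 : ∀ m x, 0 ≤ g m x := fun m x => mul_nonneg (Real.exp_pos _).le (sq_nonneg _)
  have hgint : ∀ m, ∫ x, g m x ∂cellMeasure B ≤
      C₂ * D ^ 2 * Real.exp (C₁ ^ 2 * D ^ 2 / 2 + 5 / 2) * (1 / 2) ^ m := by
    intro m
    simp only [g]
    rw [integral_const_mul]
    have e1 := h₂ w (3 ^ m)
    have e2 : ∫ x, (fn w x - proj B (3 ^ m) (fn w) x) ^ 2 ∂cellMeasure B ≤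
        C₂ * D ^ 2 / 9 ^ m := by
      refine e1.trans ?_
      rw [div_mul_eq_mul_div]
      have : (9:ℝ) ^ m ≤ (((3 ^ m : ℕ) : ℝ) + 1) ^ 2 := by
        have h9 : (9:ℝ) ^ m = ((3:ℝ) ^ m) ^ 2 := by rw [← pow_mul, mul_comm, pow_mul]; norm_num
        rw [h9]; push_cast; gcongr; simp
      gcongr
      exact integral_gr_sq_le_norm_sq w
    refine (mul_le_mul_of_nonneg_left (b := ∫ x, (fn w x - proj B (3 ^ m) (fn w) x) ^ 2
      ∂cellMeasure B) (a := t m) e2 (Real.exp_pos _).le).trans ?_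
    have e3 : t m = Real.exp (C₁ ^ 2 * D ^ 2 / 2 + 5 / 2) * Real.exp 1 ^ m := by
      simp only [t]
      rw [← Real.exp_nat_mul, ← Real.exp_add]; congr 1; ring
    rw [e3]
    -- The growth `e ^ m` of the weight `t m` is beaten by the decay `9⁻ᵐ` of the squared remainder;
    -- this is what the boxes of size `3 ^ m` are for.
    have e4 : Real.exp 1 ^ m / 9 ^ m ≤ (1 / 2 : ℝ) ^ m := by
      rw [← div_pow]
      have := Real.exp_one_lt_d9
      exact pow_le_pow_left₀ (by positivity) (by linarith) m
    calc Real.exp (C₁ ^ 2 * D ^ 2 / 2 + 5 / 2) * Real.exp 1 ^ m * (C₂ * D ^ 2 / 9 ^ m)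
        = C₂ * D ^ 2 * Real.exp (C₁ ^ 2 * D ^ 2 / 2 + 5 / 2) * (Real.exp 1 ^ m / 9 ^ m) := by ring
      _ ≤ _ := by gcongr
  have hgeo : Summable fun m : ℕ => (1 / 2 : ℝ) ^ m := summable_geometric_two
  have hpt : ∀ x, ENNReal.ofReal (Real.exp |fn w x|) ≤
      ENNReal.ofReal (Real.exp (s 0)) + ∑' m, ENNReal.ofReal (g m x) := by
    intro x
    by_cases hc : |fn w x| ≤ s 0
    · exact (ENNReal.ofReal_le_ofReal (Real.exp_le_exp.2 hc)).trans le_self_add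
    · obtain ⟨m, hm1, hm2⟩ : ∃ m, s m < |fn w x| ∧ |fn w x| ≤ C₁ ^ 2 * D ^ 2 / 2 + m + 5 / 2 := by
        -- The top of each band lies above the bottom of the next. A value above `s 0` in no band
        -- would therefore, by induction, exceed all of them.
        by_contra hcon
        push Not at hcon hc
        have key : ∀ m : ℕ, s m < |fn w x| ∧ C₁ ^ 2 * D ^ 2 / 2 + m + 5 / 2 < |fn w x| := by
          intro m
          induction m with
          | zero => exact ⟨hc, hcon 0 hc⟩
          | succ m ih =>
            have h1 : s (m + 1) < |fn w x| := by
              refine lt_of_le_of_lt (hs (m + 1)) ?_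
              push_cast
              linarith [ih.2]
            exact ⟨h1, hcon _ h1⟩
        obtain ⟨m, hm⟩ := exists_nat_gt |fn w x|
        have := (key m).2
        have : 0 ≤ C₁ ^ 2 * D ^ 2 / 2 := by positivity
        linarith
      have h5 : 1 ≤ (fn w x - proj B (3 ^ m) (fn w) x) ^ 2 := by
        have h6 := h₁ w m x
        have h7 := abs_sub_abs_le_abs_sub (fn w x) (proj B (3 ^ m) (fn w) x)
        have h8 : 1 ≤ |fn w x - proj B (3 ^ m) (fn w) x| := by
          simp only [s] at hm1
          linarith
        rw [← sq_abs]
        nlinarith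
      have h9 : Real.exp |fn w x| ≤ g m x := by
        have e5 := Real.exp_le_exp.2 hm2
        have e6 : 0 ≤ t m := (Real.exp_pos _).le
        simp only [g]
        nlinarith
      exact (ENNReal.ofReal_le_ofReal h9).trans
        ((ENNReal.le_tsum (f := fun m => ENNReal.ofReal (g m x)) m).trans le_add_self)
  have hmeas : AEStronglyMeasurable (fun x => Real.exp |fn w x|) (cellMeasure B) :=
    Real.continuous_exp.comp_aestronglyMeasurable
      (continuous_abs.comp_aestronglyMeasurable (memLp_fn w).1)
  have e9 : Real.exp (s 0) ≤ Real.exp 2 * Real.exp (C * D ^ 2) := by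
    rw [← Real.exp_add]
    apply Real.exp_le_exp.2
    have h1 := hs 0
    have h2 : (C₁ ^ 2 + 1) * D ^ 2 ≤ C * D ^ 2 := by gcongr; exact le_max_right _ _
    push_cast at h1
    nlinarith [sq_nonneg (C₁ * D), sq_nonneg D]
  have e10 : D ^ 2 * Real.exp (C₁ ^ 2 * D ^ 2 / 2 + 5 / 2) ≤ Real.exp 3 * Real.exp (C * D ^ 2) := by
    have h1 : D ^ 2 ≤ Real.exp (D ^ 2) := by
      have := Real.add_one_le_exp (D ^ 2); linarith
    refine (mul_le_mul_of_nonneg_right h1 (Real.exp_pos _).le).trans ?_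
    rw [← Real.exp_add, ← Real.exp_add]
    apply Real.exp_le_exp.2
    have h2 : (C₁ ^ 2 + 1) * D ^ 2 ≤ C * D ^ 2 := by gcongr; exact le_max_right _ _
    nlinarith [sq_nonneg (C₁ * D), sq_nonneg D]
  have e11 : C₃ * Real.exp (C * D ^ 2) ≤ C * Real.exp (C * D ^ 2) := by
    gcongr; exact le_max_left _ _
  refine integrable_and_integral_le_of_lintegral_le hmeas (fun x => (Real.exp_pos _).le)
    (mul_nonneg (hC₃0.le.trans (le_max_left _ _)) (Real.exp_pos _).le) ?_
  calc ∫⁻ x, ENNReal.ofReal (Real.exp |fn w x|) ∂cellMeasure B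
      ≤ ∫⁻ x, (ENNReal.ofReal (Real.exp (s 0)) + ∑' m, ENNReal.ofReal (g m x)) ∂cellMeasure B :=
        lintegral_mono hpt
    _ = ENNReal.ofReal (area B * Real.exp (s 0)) +
          ∑' m, ENNReal.ofReal (∫ x, g m x ∂cellMeasure B) := by
        rw [lintegral_add_left measurable_const, lintegral_const,
          lintegral_tsum fun m => (hgi m).1.aemeasurable.ennreal_ofReal]
        congr 1
        · rw [mul_comm, ENNReal.ofReal_mul hA.le, Measure.restrict_apply_univ, area,
            ofReal_measureReal (ZSpan.fundamentalDomain_isBounded B).measure_lt_top.ne]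
        · refine tsum_congr fun m => ?_
          rw [ofReal_integral_eq_lintegral_ofReal (hgi m) (Filter.Eventually.of_forall (hg0 m))]
    _ ≤ ENNReal.ofReal (area B * Real.exp (s 0)) + ENNReal.ofReal
          (C₂ * D ^ 2 * Real.exp (C₁ ^ 2 * D ^ 2 / 2 + 5 / 2) * 2) := by
        gcongr
        have hg2 := (hasSum_geometric_two.mul_left
          (C₂ * D ^ 2 * Real.exp (C₁ ^ 2 * D ^ 2 / 2 + 5 / 2))).tsum_eq
        rw [← hg2, ENNReal.ofReal_tsum_of_nonneg (fun m => by positivity) (hgeo.mul_left _)]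
        exact ENNReal.tsum_le_tsum fun m => ENNReal.ofReal_le_ofReal (hgint m)
    _ ≤ ENNReal.ofReal (C * Real.exp (C * D ^ 2)) := by
        rw [← ENNReal.ofReal_add (by positivity) (by positivity)]
        apply ENNReal.ofReal_le_ofReal
        refine le_trans ?_ e11
        have e12 := mul_le_mul_of_nonneg_left e9 hA.le
        have e13 := mul_le_mul_of_nonneg_left e10 (mul_nonneg hC₂.le (zero_le_two (α := ℝ)))
        rw [hC₃]
        nlinarith

end ChernSimonsHiggs
end

open MeasureTheory
open scoped ContDiff
noncomputable section
namespace ChernSimonsHiggs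
variable {B : Module.Basis (Fin 2) ℝ Plane} {N : ℕ}

/-! ### The periodic heat kernel -/

lemma summable_exp_neg_mu (B : Module.Basis (Fin 2) ℝ Plane) {t : ℝ} (ht : 0 < t) :
    Summable fun k => Real.exp (-t * mu B k) := by
  have h1 := ((summable_inv_mu_sq B).mul_left (2 / t ^ 2)).add
    (hasSum_ite_eq (0 : Fin 2 → ℤ) (1 : ℝ)).summable
  refine Summable.of_nonneg_of_le (fun k => (Real.exp_pos _).le) (fun k => ?_) h1
  by_cases hk : k = 0
  · subst hk
    simp [mu_zero]
  · have hm := mu_pos (B := B) hk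
    have h2 := Real.quadratic_le_exp_of_nonneg (mul_pos ht hm).le
    have h3 : (t * mu B k) ^ 2 / 2 ≤ Real.exp (t * mu B k) := by
      have := mul_pos ht hm
      linarith
    simp only [hk, if_false, add_zero]
    rw [neg_mul, Real.exp_neg, inv_le_comm₀ (Real.exp_pos _) (by positivity)]
    refine le_trans (le_of_eq ?_) h3
    field_simp

/-- The heat kernel of the torus. -/
def heat (B : Module.Basis (Fin 2) ℝ Plane) (t : ℝ) (x : Plane) : ℝ :=
  (area B)⁻¹ * ∑' k, Real.exp (-t * mu B k) * cosk B k x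

lemma abs_cosk_le (k : Fin 2 → ℤ) (x : Plane) : |cosk B k x| ≤ 1 := Real.abs_cos_le_one _

lemma abs_sink_le (k : Fin 2 → ℤ) (x : Plane) : |sink B k x| ≤ 1 := Real.abs_sin_le_one _

lemma summable_mul_cosk {c : (Fin 2 → ℤ) → ℝ} (hc : Summable fun k => |c k|) (x : Plane) :
    Summable fun k => c k * cosk B k x := by
  refine Summable.of_norm_bounded hc fun k => ?_
  rw [Real.norm_eq_abs, abs_mul]
  exact mul_le_of_le_one_right (abs_nonneg _) (abs_cosk_le k x)

lemma continuous_tsum_cosk {c : (Fin 2 → ℤ) → ℝ} (hc : Summable fun k => |c k|) :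
    Continuous fun x => ∑' k, c k * cosk B k x := by
  refine continuous_tsum (fun k => continuous_const.mul (continuous_cosk k)) hc fun k x => ?_
  rw [Real.norm_eq_abs, abs_mul]
  exact mul_le_of_le_one_right (abs_nonneg _) (abs_cosk_le k x)

lemma isDoublyPeriodic_tsum_cosk (c : (Fin 2 → ℤ) → ℝ) :
    IsDoublyPeriodic B fun x => ∑' k, c k * cosk B k x := by
  intro j x
  simp only [(isTest_cosk (B := B) _).2 j x]

lemma summable_abs_exp {t : ℝ} (ht : 0 < t) : Summable fun k => |Real.exp (-t * mu B k)| := by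
  simpa only [abs_of_pos (Real.exp_pos _)] using summable_exp_neg_mu B ht

lemma continuous_heat {t : ℝ} (ht : 0 < t) : Continuous (heat B t) :=
  continuous_const.mul (continuous_tsum_cosk (summable_abs_exp ht))

lemma isDoublyPeriodic_heat (t : ℝ) : IsDoublyPeriodic B (heat B t) := by
  intro j x
  have := isDoublyPeriodic_tsum_cosk (B := B) (fun k => Real.exp (-t * mu B k)) j x
  simp only [heat, this]

/-- Termwise integration of a cosine series against a bounded or integrable function. -/
lemma integral_tsum_cosk_mul {c : (Fin 2 → ℤ) → ℝ} (hc : Summable fun k => |c k|) (p : Plane)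
    {f : Plane → ℝ} (hf : Integrable f (cellMeasure B)) :
    HasSum (fun k => c k * ∫ x, cosk B k (x - p) * f x ∂cellMeasure B)
      (∫ x, (∑' k, c k * cosk B k (x - p)) * f x ∂cellMeasure B) := by
  have hcs : ∀ k, Continuous fun x => cosk B k (x - p) := fun k =>
    (continuous_cosk k).comp (continuous_id.sub continuous_const)
  have hi : ∀ k, Integrable (fun x => c k * (cosk B k (x - p) * f x)) (cellMeasure B) := fun k => by
    simpa only [mul_comm] using (integrable_mul_of_continuous hf (hcs k)).const_mul (c k)
  have hs : Summable fun k => ∫ x, ‖c k * (cosk B k (x - p) * f x)‖ ∂cellMeasure B := by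
    refine Summable.of_nonneg_of_le (fun k => integral_nonneg fun x => norm_nonneg _) (fun k => ?_)
      (hc.mul_right (∫ x, |f x| ∂cellMeasure B))
    rw [← integral_const_mul]
    refine integral_mono (hi k).norm (hf.abs.const_mul _) fun x => ?_
    simp only [Real.norm_eq_abs, abs_mul]
    gcongr
    exact mul_le_of_le_one_left (abs_nonneg _) (abs_cosk_le k _)
  have := hasSum_integral_of_summable_integral_norm hi hs
  simp only [integral_const_mul] at this
  convert! this using 1
  refine integral_congr_ae (Filter.Eventually.of_forall fun x => ?_)
  simp only [← mul_assoc]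
  rw [tsum_mul_right]

lemma integral_heat_mul_cosk {t : ℝ} (ht : 0 < t) (m : Fin 2 → ℤ) :
    ∫ x, heat B t x * cosk B m x ∂cellMeasure B = Real.exp (-t * mu B m) := by
  have h := integral_tsum_cosk_mul (B := B) (summable_abs_exp (B := B) ht) 0
    (integrable_of_continuous (continuous_cosk (B := B) m))
  have hA := (area_pos B).ne'
  simp only [sub_zero, integral_cosk_mul_cosk] at h
  simp only [heat, mul_assoc]
  rw [integral_const_mul, ← h.tsum_eq]
  have h2 : ∀ k : Fin 2 → ℤ, Real.exp (-t * mu B k) *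
      (((if k = m then area B else 0) + if k = -m then area B else 0) / 2) =
      (if k = m then Real.exp (-t * mu B m) * area B / 2 else 0) +
      (if k = -m then Real.exp (-t * mu B m) * area B / 2 else 0) := by
    intro k
    by_cases h1 : k = m <;> by_cases h2 : k = -m
    · subst h1; rw [if_pos rfl, if_pos h2, if_pos rfl, if_pos h2]; ring
    · subst h1; rw [if_pos rfl, if_neg h2, if_pos rfl, if_neg h2]; ring
    · subst h2; rw [if_neg h1, if_pos rfl, if_neg h1, if_pos rfl, mu_neg]; ring
    · rw [if_neg h1, if_neg h2, if_neg h1, if_neg h2]; ring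
  simp_rw [h2]
  rw [((hasSum_ite_eq m _).add (hasSum_ite_eq (-m) _)).tsum_eq]
  field_simp
  ring

lemma integral_heat_mul_sink {t : ℝ} (ht : 0 < t) (m : Fin 2 → ℤ) :
    ∫ x, heat B t x * sink B m x ∂cellMeasure B = 0 := by
  have h := integral_tsum_cosk_mul (B := B) (summable_abs_exp (B := B) ht) 0
    (integrable_of_continuous (continuous_sink (B := B) m))
  have h0 : ∀ k, ∫ x, cosk B k x * sink B m x ∂cellMeasure B = 0 := fun k => by
    simp_rw [mul_comm (cosk B k _)]
    exact integral_sink_mul_cosk m k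
  simp only [sub_zero, h0, mul_zero] at h
  simp only [heat, mul_assoc]
  rw [integral_const_mul, h.unique hasSum_zero, mul_zero]

lemma integral_gaussian_phase {b : ℝ} (hb : 0 < b) (m : Fin 2 → ℤ) :
    Integrable (fun x : Plane => Real.exp (-b * ‖x‖ ^ 2)) ∧
    ∫ x : Plane, Real.exp (-b * ‖x‖ ^ 2) * cosk B m x =
      Real.pi / b * Real.exp (-(1 / (4 * b)) * mu B m) ∧
    ∫ x : Plane, Real.exp (-b * ‖x‖ ^ 2) * sink B m x = 0 := by
  have hbc : 0 < (b : ℂ).re := by simpa using hb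
  set w : Plane := (InnerProductSpace.toDual ℝ Plane).symm (phase B m) with hw
  have hph : ∀ x, inner ℝ w x = phase B m x := fun x => by simp [hw]
  have hnw : ‖w‖ ^ 2 = mu B m := by rw [hw, LinearIsometryEquiv.norm_map, mu]
  have h1 := GaussianFourier.integral_cexp_neg_mul_sq_norm_add hbc Complex.I w
  have hI := GaussianFourier.integrable_cexp_neg_mul_sq_norm_add hbc Complex.I w
  have hI0 := GaussianFourier.integrable_cexp_neg_mul_sq_norm_add hbc 0 (0 : Plane)
  have e1 : ∀ x : Plane, Complex.exp (-(b : ℂ) * ‖x‖ ^ 2 + Complex.I * (inner ℝ w x : ℝ)) =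
      ((Real.exp (-b * ‖x‖ ^ 2) * cosk B m x : ℝ) : ℂ) +
        ((Real.exp (-b * ‖x‖ ^ 2) * sink B m x : ℝ) : ℂ) * Complex.I := by
    intro x
    rw [hph, Complex.exp_add, mul_comm Complex.I, Complex.exp_mul_I, cosk, sink]
    push_cast
    ring
  have hre := integral_re hI
  have him := integral_im hI
  have hval : ((Real.pi : ℂ) / b) ^ (Module.finrank ℝ Plane / 2 : ℂ) *
      Complex.exp (Complex.I ^ 2 * ‖w‖ ^ 2 / (4 * b)) =
      ((Real.pi / b * Real.exp (-(1 / (4 * b)) * mu B m) : ℝ) : ℂ) := by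
    have : (Module.finrank ℝ Plane / 2 : ℂ) = 1 := by simp
    rw [this, Complex.cpow_one, Complex.I_sq, ← hnw]
    push_cast
    congr 2
    field_simp
  rw [h1, hval] at hre him
  have r1 : ∀ a c : ℝ, RCLike.re ((a : ℂ) + (c : ℂ) * Complex.I) = a := fun a c => by simp
  have r2 : ∀ a c : ℝ, RCLike.im ((a : ℂ) + (c : ℂ) * Complex.I) = c := fun a c => by simp
  have r3 : ∀ a : ℝ, RCLike.re (a : ℂ) = a := fun a => by simp
  have r4 : ∀ a : ℝ, RCLike.im (a : ℂ) = 0 := fun a => by simp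
  simp only [e1, r1, r2, r3, r4] at hre him
  refine ⟨?_, ?_, ?_⟩
  · have := hI0.re
    refine this.congr (Filter.Eventually.of_forall fun x => ?_)
    have e2 : -(b : ℂ) * ‖x‖ ^ 2 + 0 * ((inner ℝ (0 : Plane) x : ℝ) : ℂ) =
        ((-b * ‖x‖ ^ 2 : ℝ) : ℂ) := by push_cast; ring
    simp only [e2]
    rw [← Complex.ofReal_exp, r3]
  · exact hre
  · exact him

/-- The heat kernel and a Gaussian have the same integral against products of
trigonometric functions. -/
lemma integral_heat_mul_trig_sq_nonneg {t : ℝ} (ht : 0 < t) (R : ℕ) (α β : (Fin 2 → ℤ) → ℝ) :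
    0 ≤ ∫ x, heat B t x * trig B R α β x ^ 2 ∂cellMeasure B := by
  -- For this `b` the Fourier transform of the Gaussian `exp (-b |x|²)` at the dual lattice is `π /
  -- b` times `exp (-t mu)`. Hence the heat kernel on the cell and the Gaussian on the whole plane
  -- pair in the same way, up to this factor, with all trigonometric polynomials; squares of such
  -- polynomials are among them, and the Gaussian is positive. This argument takes the place of
  -- Poisson summation.
  set b := 1 / (4 * t) with hb
  have hb0 : 0 < b := by positivity
  have hbt : 1 / (4 * b) = t := by rw [hb]; field_simp
  let g : Plane → ℝ := fun x => Real.exp (-b * ‖x‖ ^ 2)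
  have hg : Integrable g := (integral_gaussian_phase (B := B) hb0 0).1
  have hgm : ∀ {f : Plane → ℝ}, Continuous f → (∃ C, ∀ x, |f x| ≤ C) →
      Integrable fun x => g x * f x := by
    rintro f hf ⟨C, hC⟩
    exact hg.mul_bdd (c := C) hf.aestronglyMeasurable (Filter.Eventually.of_forall hC)
  have hh := continuous_heat (B := B) ht
  have hhm : ∀ {f : Plane → ℝ}, Continuous f → Integrable (fun x => heat B t x * f x) (cellMeasure B) :=
    fun hf => integrable_of_continuous (hh.mul hf)
  have bc : ∀ k, ∃ C, ∀ x, |cosk B k x| ≤ C := fun k => ⟨1, abs_cosk_le k⟩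
  have bs : ∀ k, ∃ C, ∀ x, |sink B k x| ≤ C := fun k => ⟨1, abs_sink_le k⟩
  let P : (Plane → ℝ) → Prop := fun f => Continuous f ∧ (∃ C, ∀ x, |f x| ≤ C) ∧
    Real.pi / b * ∫ x, heat B t x * f x ∂cellMeasure B = ∫ x, g x * f x
  have Pc : ∀ k, P (cosk B k) := fun k => by
    refine ⟨continuous_cosk k, bc k, ?_⟩
    rw [integral_heat_mul_cosk ht, (integral_gaussian_phase hb0 k).2.1, hbt]
  have Ps : ∀ k, P (sink B k) := fun k => by
    refine ⟨continuous_sink k, bs k, ?_⟩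
    rw [integral_heat_mul_sink ht, (integral_gaussian_phase hb0 k).2.2, mul_zero]
  have Pl : ∀ {f h : Plane → ℝ} (a c : ℝ), P f → P h → P fun x => a * f x + c * h x := by
    rintro f h a c ⟨cf, ⟨C, hC⟩, ef⟩ ⟨ch, ⟨C', hC'⟩, eh⟩
    refine ⟨(continuous_const.mul cf).add (continuous_const.mul ch),
      ⟨|a| * C + |c| * C', fun x => ?_⟩, ?_⟩
    · refine (abs_add_le _ _).trans ?_
      rw [abs_mul, abs_mul]
      have := hC x
      have := hC' x
      gcongr
    · have e1 : ∀ x, heat B t x * (a * f x + c * h x) =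
          a * (heat B t x * f x) + c * (heat B t x * h x) := fun x => by ring
      have e2 : ∀ x, g x * (a * f x + c * h x) = a * (g x * f x) + c * (g x * h x) :=
        fun x => by ring
      simp_rw [e1, e2]
      rw [integral_add ((hhm cf).const_mul a) ((hhm ch).const_mul c),
        integral_add ((hgm cf ⟨C, hC⟩).const_mul a) ((hgm ch ⟨C', hC'⟩).const_mul c)]
      simp only [integral_const_mul]
      rw [← ef, ← eh]
      ring
  have Psum : ∀ (s : Finset (Fin 2 → ℤ)) (F : (Fin 2 → ℤ) → Plane → ℝ), (∀ k ∈ s, P (F k)) →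
      P fun x => ∑ k ∈ s, F k x := by
    intro s F hF
    classical
    induction s using Finset.induction_on with
    | empty => exact ⟨by simpa using continuous_const, ⟨0, by simp⟩, by simp⟩
    | insert k s hk ih =>
      simp only [Finset.sum_insert hk]
      simpa using Pl 1 1 (hF k (Finset.mem_insert_self _ _))
        (ih fun l hl => hF l (Finset.mem_insert_of_mem hl))
  have Pprod : ∀ k l, P fun x => (α k * cosk B k x + β k * sink B k x) *
      (α l * cosk B l x + β l * sink B l x) := by
    intro k l
    have h1 := Pl ((α k * α l + β k * β l) / 2) ((α k * α l - β k * β l) / 2)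
      (Pc (k - l)) (Pc (k + l))
    have h2 := Pl ((α k * β l + β k * α l) / 2) ((β k * α l - α k * β l) / 2)
      (Ps (k + l)) (Ps (k - l))
    have h3 := Pl 1 1 h1 h2
    convert! h3 using 2 with x
    simp only [cosk, sink, phase_sub, phase_add, Real.cos_sub, Real.cos_add, Real.sin_sub,
      Real.sin_add]
    ring
  have Pq : P fun x => trig B R α β x ^ 2 := by
    have h1 := Psum (bx R) (fun k x => ∑ l ∈ bx R, (α k * cosk B k x + β k * sink B k x) *
      (α l * cosk B l x + β l * sink B l x)) fun k _ => Psum (bx R) _ fun l _ => Pprod k l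
    convert! h1 using 2 with x
    rw [trig, sq, Finset.sum_mul_sum]
  have h0 : 0 ≤ ∫ x, g x * trig B R α β x ^ 2 :=
    integral_nonneg fun x => mul_nonneg (Real.exp_pos _).le (sq_nonneg _)
  rw [← Pq.2.2] at h0
  exact nonneg_of_mul_nonneg_right h0 (by have := Real.pi_pos; positivity)

/-! ### Positivity of the heat kernel -/

lemma tendsto_integral_sub_proj {f : Plane → ℝ} (hf : MemLp f 2 (cellMeasure B)) :
    Filter.Tendsto (fun R => ∫ x, (f x - proj B R f x) ^ 2 ∂cellMeasure B) Filter.atTop (nhds 0) := by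
  have hA := area_pos B
  have h1 := hasSum_en _ hf
  have h2 : ∀ R, area B * ∫ x, (f x - proj B R f x) ^ 2 ∂cellMeasure B =
      area B * ∫ x, f x ^ 2 ∂cellMeasure B - ∑ k ∈ bx R, en B f k := by
    intro R
    have ht : Continuous (proj B R f) := (isTest_trig R _ _).1.continuous
    have h3 := hasSum_en _ (hf.sub (memLp_of_continuous ht 2))
    have h4 : HasSum (fun k => if k ∈ bx R then en B f k else 0) (∑ k ∈ bx R, en B f k) := by
      have h4' : HasSum (fun k => if k ∈ bx R then en B f k else 0)
          (∑ k ∈ bx R, if k ∈ bx R then en B f k else 0) :=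
        hasSum_sum_of_ne_finset_zero fun k hk => by simp [hk]
      rwa [Finset.sum_congr rfl fun k hk => if_pos hk] at h4'
    refine h3.unique ?_
    convert! h1.sub h4 using 1
    ext k
    have e := en_sub_proj (hf.integrable (by norm_num)) R k
    have e' : en B (f - proj B R f) k = _ := e
    rw [e']
    split_ifs <;> simp
  have h5 : Filter.Tendsto (fun R => ∑ k ∈ bx R, en B f k) Filter.atTop
      (nhds (area B * ∫ x, f x ^ 2 ∂cellMeasure B)) := by
    refine h1.comp (Filter.tendsto_atTop_finset_of_monotone (fun R S h => bx_subset h) fun k => ?_)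
    exact ⟨nk k, mem_bx.2 le_rfl⟩
  have h6 := (tendsto_const_nhds (x := area B * ∫ x, f x ^ 2 ∂cellMeasure B)).sub h5
  rw [sub_self] at h6
  simp_rw [← h2] at h6
  have := h6.const_mul (area B)⁻¹
  simpa [inv_mul_cancel_left₀ hA.ne'] using this

lemma ae_volume_of_ae_cell {f : Plane → ℝ} (hp : IsDoublyPeriodic B f)
    (h : ∀ᵐ x ∂cellMeasure B, f x = 0) : ∀ᵐ x ∂(volume : Measure Plane), f x = 0 := by
  have : VAddInvariantMeasure (Submodule.span ℤ (Set.range B)) Plane volume :=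
    ⟨fun c s _ => by simp [Submodule.vadd_def]⟩
  have hD := ZSpan.isAddFundamentalDomain B (volume : Measure Plane)
  have hD0 : volume ({x | f x ≠ 0} ∩ cell B) = 0 := by
    rw [ae_iff, Measure.restrict_apply₀'] at h
    · exact h
    · exact (measurableSet_cell B).nullMeasurableSet
  refine hD.measure_zero_of_invariant {x | f x ≠ 0} (fun l => ?_) hD0
  ext x
  rw [Set.mem_vadd_set_iff_neg_vadd_mem]
  simp only [Set.mem_ofPred_eq, Submodule.vadd_def, vadd_eq_add]
  rw [add_comm, hp.add_mem (Submodule.coe_mem _)]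

/-- The kernel has nonnegative integral against squares of trigonometric polynomials. Approximating
the square root `f` of its negative part by such polynomials in `L²` gives `-∫ (f²)² ≥ 0`. So the
negative part vanishes almost everywhere on the cell, hence on the plane by periodicity, and
everywhere by continuity. -/
lemma heat_nonneg {t : ℝ} (ht : 0 < t) (x : Plane) : 0 ≤ heat B t x := by
  have hh := continuous_heat (B := B) ht
  have hn : Continuous fun x => max (-heat B t x) 0 := hh.neg.max continuous_const
  set f : Plane → ℝ := fun x => √(max (-heat B t x) 0) with hf
  have hfc : Continuous f := hn.sqrt
  have hfsq : ∀ x, f x ^ 2 = max (-heat B t x) 0 := fun x => Real.sq_sqrt (le_max_right _ _)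
  obtain ⟨C, hC0, hC⟩ := (isDoublyPeriodic_heat (B := B) t).exists_bound hh
  have hlim : Filter.Tendsto (fun R => ∫ x, heat B t x * proj B R f x ^ 2 ∂cellMeasure B)
      Filter.atTop (nhds (∫ x, heat B t x * f x ^ 2 ∂cellMeasure B)) := by
    have hz := tendsto_integral_sub_proj (B := B) (memLp_of_continuous hfc 2)
    rw [tendsto_iff_norm_sub_tendsto_zero]
    have hq : ∀ R, Continuous (proj B R f) := fun R => (isTest_trig R _ _).1.continuous
    have hbd : ∀ R, ‖∫ x, heat B t x * proj B R f x ^ 2 ∂cellMeasure B -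
        ∫ x, heat B t x * f x ^ 2 ∂cellMeasure B‖ ≤
        C * (∫ x, (f x - proj B R f x) ^ 2 ∂cellMeasure B +
          2 * (√(∫ x, f x ^ 2 ∂cellMeasure B) * √(∫ x, (f x - proj B R f x) ^ 2 ∂cellMeasure B))) := by
      intro R
      have i1 : Integrable (fun x => heat B t x * proj B R f x ^ 2) (cellMeasure B) :=
        integrable_of_continuous (hh.mul ((hq R).pow 2))
      have i2 : Integrable (fun x => heat B t x * f x ^ 2) (cellMeasure B) :=
        integrable_of_continuous (hh.mul (hfc.pow 2))
      have i3 : Integrable (fun x => (f x - proj B R f x) ^ 2) (cellMeasure B) :=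
        integrable_of_continuous ((hfc.sub (hq R)).pow 2)
      have i4 : Integrable (fun x => |f x| * |f x - proj B R f x|) (cellMeasure B) :=
        integrable_of_continuous (hfc.abs.mul (hfc.sub (hq R)).abs)
      rw [← integral_sub i1 i2]
      refine (norm_integral_le_integral_norm _).trans ?_
      have h1 : ∫ x, |f x| * |f x - proj B R f x| ∂cellMeasure B ≤
          √(∫ x, f x ^ 2 ∂cellMeasure B) * √(∫ x, (f x - proj B R f x) ^ 2 ∂cellMeasure B) := by
        have := integral_mul_norm_le_Lp_mul_Lq (μ := cellMeasure B) (f := f)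
          (g := fun x => f x - proj B R f x) (p := 2) (q := 2)
          (by constructor <;> norm_num)
          (by simpa using memLp_of_continuous hfc 2)
          (by
            have := memLp_of_continuous (B := B) (f := fun x => f x - proj B R f x)
              (hfc.sub (hq R)) 2
            simpa using this)
        simpa [Real.sqrt_eq_rpow] using this
      calc ∫ x, ‖heat B t x * proj B R f x ^ 2 - heat B t x * f x ^ 2‖ ∂cellMeasure B
          ≤ ∫ x, C * ((f x - proj B R f x) ^ 2 + 2 * (|f x| * |f x - proj B R f x|))
              ∂cellMeasure B := by
            refine integral_mono (i1.sub i2).norm ((i3.add (i4.const_mul 2)).const_mul C) fun x => ?_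
            simp only [Real.norm_eq_abs]
            rw [← mul_sub, abs_mul]
            gcongr
            · exact hC x
            · have e : proj B R f x ^ 2 - f x ^ 2 = (f x - proj B R f x) ^ 2 -
                2 * (f x * (f x - proj B R f x)) := by ring
              rw [e]
              refine (abs_sub _ _).trans (le_of_eq ?_)
              rw [abs_of_nonneg (sq_nonneg _), abs_mul, abs_mul, abs_two]
        _ ≤ _ := by
            rw [integral_const_mul, integral_add i3 (i4.const_mul 2), integral_const_mul]
            gcongr
    refine squeeze_zero (fun R => norm_nonneg _) hbd ?_
    have h1 := (hz.add (((Filter.Tendsto.sqrt hz).const_mul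
      (√(∫ x, f x ^ 2 ∂cellMeasure B))).const_mul 2)).const_mul C
    simpa using h1
  have h0 : 0 ≤ ∫ x, heat B t x * f x ^ 2 ∂cellMeasure B :=
    ge_of_tendsto' hlim fun R => integral_heat_mul_trig_sq_nonneg ht R _ _
  have h1 : ∫ x, (max (-heat B t x) 0) ^ 2 ∂cellMeasure B ≤ 0 := by
    have e : ∀ x, heat B t x * f x ^ 2 = -(max (-heat B t x) 0) ^ 2 := by
      intro x
      rw [hfsq]
      rcases le_total (heat B t x) 0 with h | h
      · rw [max_eq_left (by linarith)]; ring
      · rw [max_eq_right (by linarith)]; ring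
    simp_rw [e] at h0
    rw [integral_neg] at h0
    linarith
  have hsqc : Continuous fun x => (max (-heat B t x) 0) ^ 2 := hn.pow 2
  have h2 : ∀ᵐ x ∂cellMeasure B, (max (-heat B t x) 0) ^ 2 = 0 := by
    have := (integral_eq_zero_iff_of_nonneg (fun x => sq_nonneg _)
      (integrable_of_continuous hsqc)).1 (le_antisymm h1 (integral_nonneg fun x => sq_nonneg _))
    exact this
  have h3 := ae_volume_of_ae_cell (B := B) (fun k x => by
    simp only [isDoublyPeriodic_heat t k x]) h2
  have h4 : (fun x => (max (-heat B t x) 0) ^ 2) = fun _ => (0 : ℝ) :=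
    (Continuous.ae_eq_iff_eq volume hsqc continuous_const).1 h3
  have h5 := congrFun h4 x
  simp only [sq_eq_zero_iff] at h5
  have := le_max_left (-heat B t x) 0
  linarith

end ChernSimonsHiggs
end

open MeasureTheory
open scoped ContDiff
noncomputable section
namespace ChernSimonsHiggs
variable {B : Module.Basis (Fin 2) ℝ Plane} {N : ℕ}

/-! ### Completeness and bounded forms on the Sobolev space -/

lemma isClosed_W12 (B : Module.Basis (Fin 2) ℝ Plane) : IsClosed (W12 B : Set
    (WithLp 2 (Lp ℝ 2 (cellMeasure B) × Lp Plane 2 (cellMeasure B)))) := by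
  have key : (W12 B : Set (WithLp 2 (Lp ℝ 2 (cellMeasure B) × Lp Plane 2 (cellMeasure B)))) =
      ⋂ φ : {φ : Plane → ℝ // IsTest B φ}, ⋂ h : Plane,
        {w | ∫ x, w.fst x * fderiv ℝ φ.1 x h ∂cellMeasure B =
          -∫ x, inner ℝ (w.snd x) h * φ.1 x ∂cellMeasure B} := by
    ext w
    simp only [Set.mem_iInter, SetLike.mem_coe]
    exact ⟨fun hw φ h => hw φ.1 φ.2 h, fun hw φ hφ h => hw ⟨φ, hφ⟩ h⟩
  rw [key]
  refine isClosed_iInter fun φ => isClosed_iInter fun h => ?_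
  have hd : Continuous fun x => fderiv ℝ φ.1 x h :=
    (φ.2.1.continuous_fderiv (by simp)).clm_apply continuous_const
  have m1 : MemLp (fun x => fderiv ℝ φ.1 x h) 2 (cellMeasure B) := memLp_of_continuous hd 2
  have m2 : MemLp (fun x => φ.1 x • h) 2 (cellMeasure B) := by
    obtain ⟨C, -, hC⟩ := exists_bound_cell φ.2.1.continuous B
    refine MemLp.of_bound (φ.2.1.continuous.smul continuous_const).aestronglyMeasurable
      (C * ‖h‖) ?_
    filter_upwards [ae_restrict_mem (measurableSet_cell B)] with x hx
    rw [norm_smul]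
    gcongr
    exact hC x hx
  have c1 : Continuous fun w : WithLp 2 (Lp ℝ 2 (cellMeasure B) × Lp Plane 2 (cellMeasure B)) =>
      inner ℝ m1.toLp w.fst := continuous_const.inner (WithLp.prod_continuous_ofLp 2 _ _).fst
  have c2 : Continuous fun w : WithLp 2 (Lp ℝ 2 (cellMeasure B) × Lp Plane 2 (cellMeasure B)) =>
      inner ℝ m2.toLp w.snd := continuous_const.inner (WithLp.prod_continuous_ofLp 2 _ _).snd
  have e := isClosed_eq c1 c2.neg
  convert! e using 1
  ext w
  simp only [Set.mem_ofPred_eq, L2.inner_def]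
  have e1 : ∫ x, w.fst x * fderiv ℝ φ.1 x h ∂cellMeasure B =
      ∫ x, inner ℝ ((m1.toLp : Lp ℝ 2 (cellMeasure B)) x) (w.fst x) ∂cellMeasure B := by
    refine integral_congr_ae ?_
    filter_upwards [m1.coeFn_toLp] with x hx
    rw [hx]
    simp
  have e2 : ∫ x, inner ℝ (w.snd x) h * φ.1 x ∂cellMeasure B =
      ∫ x, inner ℝ ((m2.toLp : Lp Plane 2 (cellMeasure B)) x) (w.snd x) ∂cellMeasure B := by
    refine integral_congr_ae ?_
    filter_upwards [m2.coeFn_toLp] with x hx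
    rw [hx, inner_smul_left, real_inner_comm, mul_comm]
    simp
  rw [e1, e2]
  rfl

instance completeSpace_W12 (B : Module.Basis (Fin 2) ℝ Plane) : CompleteSpace (W12 B) :=
  (isClosed_W12 B).completeSpace_coe

/-- The pairing with an `L²` function, as a continuous linear form. -/
def pairL {h : Plane → ℝ} (hh : MemLp h 2 (cellMeasure B)) : W12 B →L[ℝ] ℝ :=
  LinearMap.mkContinuous
    { toFun := fun w => inner ℝ hh.toLp w.1.fst
      map_add' := fun v w => by simp [inner_add_right]
      map_smul' := fun c w => by simp [inner_smul_right] } ‖hh.toLp‖ fun w => by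
    refine (norm_inner_le_norm (𝕜 := ℝ) hh.toLp w.1.fst).trans ?_
    gcongr
    exact WithLp.norm_fst_le _ w.1

lemma pairL_apply {h : Plane → ℝ} (hh : MemLp h 2 (cellMeasure B)) (w : W12 B) :
    pairL hh w = ∫ x, h x * fn w x ∂cellMeasure B := by
  change inner ℝ hh.toLp w.1.fst = _
  rw [L2.inner_def]
  refine integral_congr_ae ?_
  filter_upwards [hh.coeFn_toLp] with x hx
  rw [hx]
  simp [fn, mul_comm]

/-- The Dirichlet form. -/
def dirL (B : Module.Basis (Fin 2) ℝ Plane) : W12 B →L[ℝ] W12 B →L[ℝ] ℝ :=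
  LinearMap.mkContinuous₂ (LinearMap.mk₂ ℝ (fun v w : W12 B => inner ℝ v.1.snd w.1.snd)
    (fun u v w => by simp [inner_add_left]) (fun c u v => by simp [inner_smul_left])
    (fun u v w => by simp [inner_add_right]) (fun c u v => by simp [inner_smul_right])) 1
    fun v w => by
      refine (norm_inner_le_norm (𝕜 := ℝ) v.1.snd w.1.snd).trans ?_
      rw [one_mul]
      gcongr
      · exact WithLp.norm_snd_le _ v.1
      · exact WithLp.norm_snd_le _ w.1

lemma dirL_apply (v w : W12 B) :
    dirL B v w = ∫ x, inner ℝ (gr v x) (gr w x) ∂cellMeasure B := by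
  change inner ℝ v.1.snd w.1.snd = _
  rw [L2.inner_def]
  rfl

lemma dirL_comm (v w : W12 B) : dirL B v w = dirL B w v := by
  simp only [dirL_apply, real_inner_comm]

lemma dirL_self (v : W12 B) : dirL B v v = ∫ x, ‖gr v x‖ ^ 2 ∂cellMeasure B := by
  simp only [dirL_apply, real_inner_self_eq_norm_sq]

lemma dirL_self_nonneg (v : W12 B) : 0 ≤ dirL B v v := by
  rw [dirL_self]; exact integral_nonneg fun x => by positivity

lemma inner_eq_dirL (v w : W12 B) :
    inner ℝ v w = ∫ x, fn v x * fn w x ∂cellMeasure B + dirL B v w := by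
  rw [inner_eq, dirL_apply]

/-- The constant functions. -/
def cst (B : Module.Basis (Fin 2) ℝ Plane) (c : ℝ) : W12 B :=
  ofTest (B := B) (φ := fun _ => c) ⟨contDiff_const, fun _ _ => rfl⟩

lemma fn_cst (c : ℝ) : fn (cst B c) =ᵐ[cellMeasure B] fun _ => c := fn_ofTest _

lemma gr_cst (c : ℝ) : gr (cst B c) =ᵐ[cellMeasure B] fun _ => 0 := by
  filter_upwards [gr_ofTest (B := B) (φ := fun _ => c) ⟨contDiff_const, fun _ _ => rfl⟩] with x hx
  rw [cst, hx, gradient_fun_const]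

lemma dirL_cst (c : ℝ) (w : W12 B) : dirL B (cst B c) w = 0 := by
  rw [dirL_apply, integral_congr_ae (g := fun _ => 0), integral_zero]
  filter_upwards [gr_cst (B := B) c] with x hx
  rw [hx, inner_zero_left]

/-- Polarisation of `hasSum_en`. -/
lemma hasSum_ca_mul {f g : Plane → ℝ} (hf : MemLp f 2 (cellMeasure B))
    (hg : MemLp g 2 (cellMeasure B)) :
    HasSum (fun k => ca B f k * ca B g k + sa B f k * sa B g k)
      (area B * ∫ x, f x * g x ∂cellMeasure B) := by
  have h1 := hasSum_en _ (hf.add hg)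
  have h2 := hasSum_en _ (hf.sub hg)
  have hfi := hf.integrable (by norm_num)
  have hgi := hg.integrable (by norm_num)
  have e1 : ∀ k, ca B (f + g) k = ca B f k + ca B g k := fun k => by
    simp only [ca, Pi.add_apply, add_mul]
    exact integral_add (integrable_mul_of_continuous hfi (continuous_cosk k))
      (integrable_mul_of_continuous hgi (continuous_cosk k))
  have e2 : ∀ k, sa B (f + g) k = sa B f k + sa B g k := fun k => by
    simp only [sa, Pi.add_apply, add_mul]
    exact integral_add (integrable_mul_of_continuous hfi (continuous_sink k))
      (integrable_mul_of_continuous hgi (continuous_sink k))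
  have e3 : ∀ k, ca B (f - g) k = ca B f k - ca B g k := fun k => by
    simp only [ca, Pi.sub_apply, sub_mul]
    exact integral_sub (integrable_mul_of_continuous hfi (continuous_cosk k))
      (integrable_mul_of_continuous hgi (continuous_cosk k))
  have e4 : ∀ k, sa B (f - g) k = sa B f k - sa B g k := fun k => by
    simp only [sa, Pi.sub_apply, sub_mul]
    exact integral_sub (integrable_mul_of_continuous hfi (continuous_sink k))
      (integrable_mul_of_continuous hgi (continuous_sink k))
  have h3 := (h1.sub h2).mul_left (1 / 4)
  convert! h3 using 1
  · ext k
    simp only [en, e1, e2, e3, e4]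
    ring
  · have e5 : ∫ x, f x * g x ∂cellMeasure B = 1 / 4 * (∫ x, (f + g) x ^ 2 ∂cellMeasure B -
        ∫ x, (f - g) x ^ 2 ∂cellMeasure B) := by
      rw [← integral_sub (hf.add hg).integrable_sq (hf.sub hg).integrable_sq, ← integral_const_mul]
      refine integral_congr_ae (Filter.Eventually.of_forall fun x => ?_)
      simp only [Pi.add_apply, Pi.sub_apply]
      ring
    rw [e5]
    ring

end ChernSimonsHiggs
end

open MeasureTheory
open scoped ContDiff
noncomputable section
namespace ChernSimonsHiggs
variable {B : Module.Basis (Fin 2) ℝ Plane} {N : ℕ}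

/-! ### The regularised Green function -/

/-- The coefficients of the regularised Green function. -/
def greenCoef (B : Module.Basis (Fin 2) ℝ Plane) (t : ℝ) (k : Fin 2 → ℤ) : ℝ :=
  -(area B)⁻¹ * (Real.exp (-t * mu B k) * (mu B k)⁻¹)

/-- The Green function of the torus, regularised by the heat flow. -/
def green (B : Module.Basis (Fin 2) ℝ Plane) (t : ℝ) (x : Plane) : ℝ :=
  ∑' k, greenCoef B t k * cosk B k x

lemma summable_abs_greenCoef {t : ℝ} (ht : 0 < t) : Summable fun k => |greenCoef B t k| := by
  have hA := area_pos B
  refine Summable.of_nonneg_of_le (fun k => abs_nonneg _) (fun k => ?_)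
    ((summable_inv_mu_sq B).mul_left ((area B)⁻¹ * t⁻¹))
  rw [greenCoef, abs_mul, abs_neg, abs_of_pos (inv_pos.2 hA), mul_assoc]
  gcongr
  by_cases hk : k = 0
  · subst hk; simp [mu_zero]
  have hm := mu_pos (B := B) hk
  rw [abs_of_pos (by positivity)]
  have h1 : t * mu B k ≤ Real.exp (t * mu B k) := by
    linarith [Real.add_one_le_exp (t * mu B k)]
  have h2 : Real.exp (-t * mu B k) ≤ (t * mu B k)⁻¹ := by
    rw [neg_mul, Real.exp_neg]
    exact inv_anti₀ (by positivity) h1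
  calc Real.exp (-t * mu B k) * (mu B k)⁻¹ ≤ (t * mu B k)⁻¹ * (mu B k)⁻¹ := by gcongr
    _ = _ := by field_simp

lemma continuous_green {t : ℝ} (ht : 0 < t) : Continuous (green B t) :=
  continuous_tsum_cosk (summable_abs_greenCoef (B := B) ht)

lemma isDoublyPeriodic_green (t : ℝ) : IsDoublyPeriodic B (green B t) :=
  isDoublyPeriodic_tsum_cosk _

/-- This is `(1 - Δ) G = G - heat + 1 / |Ω|` in terms of coefficients. Because `0⁻¹ = 0`, the
coefficient of `G` at index `0` vanishes, which normalises the mean to zero; the case distinction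
supplies the constant. -/
lemma one_add_mu_mul_greenCoef (t : ℝ) (k : Fin 2 → ℤ) : (1 + mu B k) * greenCoef B t k =
    greenCoef B t k - (area B)⁻¹ * Real.exp (-t * mu B k) + if k = 0 then (area B)⁻¹ else 0 := by
  by_cases hk : k = 0
  · subst hk; simp [greenCoef, mu_zero]
  · have hm := (mu_pos (B := B) hk).ne'
    rw [if_neg hk, greenCoef]
    field_simp
    ring

lemma summable_abs_one_add_mu {t : ℝ} (ht : 0 < t) :
    Summable fun k => |(1 + mu B k) * greenCoef B t k| := by
  have hA := area_pos B
  refine Summable.of_nonneg_of_le (fun k => abs_nonneg _) (fun k => ?_)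
    (((summable_abs_greenCoef (B := B) ht).add ((summable_exp_neg_mu B ht).mul_left (area B)⁻¹)).add
      (hasSum_ite_eq (0 : Fin 2 → ℤ) (area B)⁻¹).summable)
  rw [one_add_mu_mul_greenCoef]
  refine (abs_add_le _ _).trans (add_le_add ((abs_sub _ _).trans (add_le_add le_rfl ?_)) ?_)
  · rw [abs_of_nonneg (by positivity)]
  · split_ifs
    · rw [abs_of_nonneg (by positivity)]
    · simp

lemma tsum_one_add_mu {t : ℝ} (ht : 0 < t) (x : Plane) :
    ∑' k, (1 + mu B k) * greenCoef B t k * cosk B k x = green B t x - heat B t x + (area B)⁻¹ := by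
  have h1 := (summable_mul_cosk (B := B) (summable_abs_greenCoef (B := B) ht) x).hasSum
  have h2 := ((summable_mul_cosk (B := B) (summable_abs_exp (B := B) ht) x).hasSum).mul_left (area B)⁻¹
  have h3 := hasSum_ite_eq (0 : Fin 2 → ℤ) (area B)⁻¹
  refine HasSum.tsum_eq ?_
  convert! (h1.sub h2).add h3 using 1
  ext k
  rw [one_add_mu_mul_greenCoef]
  split_ifs with hk
  · subst hk; rw [cosk_zero]; ring
  · ring

/-- Differentiation in time brings down `-mu`, which cancels the inverse in the coefficient and
leaves the heat kernel without its zero mode. The differentiated series is dominated on times larger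
than `t / 2`. -/
lemma hasDerivAt_green (x : Plane) {t : ℝ} (ht : 0 < t) :
    HasDerivAt (fun s => green B s x) (heat B t x - (area B)⁻¹) t := by
  have hA := area_pos B
  have ha : 0 < t / 2 := by positivity
  have hc : ∀ s k, ((area B)⁻¹ * Real.exp (-s * mu B k) - if k = 0 then (area B)⁻¹ else 0) =
      -mu B k * greenCoef B s k := fun s k => by
    have := one_add_mu_mul_greenCoef (B := B) s k
    linarith
  have h := hasDerivAt_tsum_of_isPreconnected (𝕜 := ℝ) (g := fun k s => greenCoef B s k * cosk B k x)
    (g' := fun k s => ((area B)⁻¹ * Real.exp (-s * mu B k) - if k = 0 then (area B)⁻¹ else 0) *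
      cosk B k x) (t := Set.Ioi (t / 2)) (y := t) (y₀ := t)
    (u := fun k => (area B)⁻¹ * Real.exp (-(t / 2) * mu B k) + if k = 0 then (area B)⁻¹ else 0)
    (((summable_exp_neg_mu B ha).mul_left _).add (hasSum_ite_eq (0 : Fin 2 → ℤ) _).summable)
    isOpen_Ioi isPreconnected_Ioi ?_ ?_ (by simp [Set.mem_Ioi]; linarith)
    (summable_mul_cosk (summable_abs_greenCoef (B := B) ht) x) (by simp [Set.mem_Ioi]; linarith)
  · convert! h using 1
    have h2 := ((summable_mul_cosk (B := B) (summable_abs_exp (B := B) ht) x).hasSum).mul_left (area B)⁻¹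
    have h3 := hasSum_ite_eq (0 : Fin 2 → ℤ) (area B)⁻¹
    symm
    refine HasSum.tsum_eq ?_
    convert! h2.sub h3 using 1
    ext k
    split_ifs with hk
    · subst hk; rw [cosk_zero]; ring
    · ring
  · intro k s _
    simp only [hc]
    refine HasDerivAt.mul_const ?_ _
    simp only [greenCoef]
    have h1 : HasDerivAt (fun s => Real.exp (-s * mu B k)) (Real.exp (-s * mu B k) * (-1 * mu B k)) s :=
      ((hasDerivAt_neg s).mul_const _).exp
    convert! (h1.mul_const (mu B k)⁻¹).const_mul (-(area B)⁻¹) using 1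
    ring
  · intro k s hs
    rw [Real.norm_eq_abs, abs_mul]
    refine (mul_le_of_le_one_right (abs_nonneg _) (abs_cosk_le k x)).trans ?_
    refine (abs_sub _ _).trans (add_le_add ?_ ?_)
    · rw [abs_of_pos (by positivity)]
      have hm := mu_nonneg (B := B) k
      have hs' : t / 2 < s := hs
      gcongr
    · split_ifs
      · rw [abs_of_nonneg (by positivity)]
      · simp

/-- The derivative in time is the heat kernel, which is nonnegative. Hence these regularisations
decrease as the time decreases to zero, and a limit exists without any analysis of the singularity.
-/
lemma green_add_mono (x : Plane) {s t : ℝ} (hs : 0 < s) (hst : s ≤ t) :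
    green B s x + s * (area B)⁻¹ ≤ green B t x + t * (area B)⁻¹ := by
  have hd : ∀ u ∈ Set.Ioi (0 : ℝ), HasDerivAt (fun s => green B s x + s * (area B)⁻¹)
      (heat B u x) u := fun u hu => by
    convert! (hasDerivAt_green x hu).add ((hasDerivAt_id u).mul_const (area B)⁻¹) using 1
    ring
  have := monotoneOn_of_deriv_nonneg (convex_Ioi (0 : ℝ))
    (f := fun s => green B s x + s * (area B)⁻¹)
    (fun u hu => (hd u hu).continuousAt.continuousWithinAt)
    (by rw [interior_Ioi]; exact fun u hu => (hd u hu).differentiableAt.differentiableWithinAt)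
    (by rw [interior_Ioi]; exact fun u hu => by rw [(hd u hu).deriv]; exact heat_nonneg hu x)
  exact this hs (lt_of_lt_of_le hs hst) hst

lemma cosk_sub (k : Fin 2 → ℤ) (x p : Plane) :
    cosk B k (x - p) = cosk B k p * cosk B k x + sink B k p * sink B k x := by
  simp only [cosk, sink, map_sub, Real.cos_sub]
  ring

lemma integral_cosk_sub_mul (k : Fin 2 → ℤ) (p : Plane) {f : Plane → ℝ}
    (hf : Integrable f (cellMeasure B)) :
    ∫ x, cosk B k (x - p) * f x ∂cellMeasure B = cosk B k p * ca B f k + sink B k p * sa B f k := by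
  have i1 := integrable_mul_of_continuous hf (continuous_cosk (B := B) k)
  have i2 := integrable_mul_of_continuous hf (continuous_sink (B := B) k)
  rw [ca, sa, ← integral_const_mul, ← integral_const_mul,
    ← integral_add (i1.const_mul _) (i2.const_mul _)]
  refine integral_congr_ae (Filter.Eventually.of_forall fun x => ?_)
  simp only [cosk_sub]
  ring

lemma mu_mul_ca_cosk (k l : Fin 2 → ℤ) : mu B k * ca B (cosk B l) k = mu B l * ca B (cosk B l) k := by
  simp only [ca, integral_cosk_mul_cosk]
  by_cases h1 : l = k
  · subst h1; rfl
  by_cases h2 : l = -k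
  · subst h2; rw [mu_neg]
  · simp [h1, h2]

lemma mu_mul_sa_sink (k l : Fin 2 → ℤ) : mu B k * sa B (sink B l) k = mu B l * sa B (sink B l) k := by
  simp only [sa, integral_sink_mul_sink]
  by_cases h1 : l = k
  · subst h1; rfl
  by_cases h2 : l = -k
  · subst h2; rw [mu_neg]
  · simp [h1, h2]

lemma sa_cosk (k l : Fin 2 → ℤ) : sa B (cosk B l) k = 0 := by
  simp only [sa]
  simp_rw [mul_comm (cosk B l _)]
  exact integral_sink_mul_cosk k l

lemma ca_sink (k l : Fin 2 → ℤ) : ca B (sink B l) k = 0 := integral_sink_mul_cosk l k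

/-- The function with the coefficients of the right-hand side of the equation for the Green
function. -/
def greenSource (B : Module.Basis (Fin 2) ℝ Plane) (t : ℝ) (p x : Plane) : ℝ :=
  ∑' k, (1 + mu B k) * greenCoef B t k * cosk B k (x - p)

lemma continuous_sub_right (p : Plane) : Continuous fun x : Plane => x - p :=
  continuous_id.sub continuous_const

lemma continuous_greenSource {t : ℝ} (ht : 0 < t) (p : Plane) : Continuous (greenSource B t p) :=
  (continuous_tsum_cosk (summable_abs_one_add_mu (B := B) ht)).comp (continuous_sub_right p)

lemma greenSource_eq {t : ℝ} (ht : 0 < t) (p x : Plane) :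
    greenSource B t p x = green B t (x - p) - heat B t (x - p) + (area B)⁻¹ :=
  tsum_one_add_mu ht _

/-- The regularised Green function with pole `p`, as an element of the Sobolev space. -/
def greenW (B : Module.Basis (Fin 2) ℝ Plane) {t : ℝ} (ht : 0 < t) (p : Plane) : W12 B :=
  (InnerProductSpace.toDual ℝ (W12 B)).symm
    (pairL (memLp_of_continuous (continuous_greenSource (B := B) ht p) 2))

lemma inner_greenW {t : ℝ} (ht : 0 < t) (p : Plane) (w : W12 B) :
    inner ℝ (greenW B ht p) w = ∫ x, greenSource B t p x * fn w x ∂cellMeasure B := by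
  rw [greenW, InnerProductSpace.toDual_symm_apply, pairL_apply]

lemma ae_eq_of_coef {f g : Plane → ℝ} (hf : MemLp f 2 (cellMeasure B))
    (hg : MemLp g 2 (cellMeasure B)) (hc : ∀ k, ca B f k = ca B g k)
    (hs : ∀ k, sa B f k = sa B g k) : f =ᵐ[cellMeasure B] g := by
  have hA := area_pos B
  have hfg := hf.sub hg
  have h1 := hasSum_ca_mul hfg hf
  have h2 := hasSum_ca_mul hfg hg
  simp only [hc, hs] at h1
  have h3 := mul_left_cancel₀ hA.ne' (h1.unique h2)
  have i1 : Integrable (fun x => (f - g) x * f x) (cellMeasure B) := hfg.integrable_mul hf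
  have i2 : Integrable (fun x => (f - g) x * g x) (cellMeasure B) := hfg.integrable_mul hg
  have h4 : ∫ x, (f x - g x) ^ 2 ∂cellMeasure B = 0 := by
    rw [← sub_eq_zero, ← integral_sub i1 i2] at h3
    rw [← h3]
    refine integral_congr_ae (Filter.Eventually.of_forall fun x => ?_)
    simp only [Pi.sub_apply]
    ring
  have h5 := (integral_eq_zero_iff_of_nonneg (fun x => sq_nonneg _) hfg.integrable_sq).1 h4
  filter_upwards [h5] with x hx
  have : f x - g x = 0 := by simpa using hx
  linarith

/-- The element is defined by the Riesz representation of the equation `(1 - Δ) G = greenSource`,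
which supplies a weak gradient without differentiating the series. Testing with cosines and sines
shows that its coefficients are those of the Green series. -/
lemma fn_greenW {t : ℝ} (ht : 0 < t) (p : Plane) :
    fn (greenW B ht p) =ᵐ[cellMeasure B] fun x => green B t (x - p) := by
  have hgc : Continuous fun x => green B t (x - p) := (continuous_green ht).comp (continuous_sub_right p)
  refine ae_eq_of_coef (memLp_fn _) (memLp_of_continuous hgc 2) (fun l => ?_) (fun l => ?_)
  · have hl : (1 + mu B l) ≠ 0 := by have := mu_nonneg (B := B) l; positivity
    refine mul_left_cancel₀ hl ?_
    rw [← inner_ofTest_cosk, inner_greenW]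
    have e1 : ∫ x, greenSource B t p x * fn (ofTest (isTest_cosk (B := B) l)) x ∂cellMeasure B =
        ∫ x, greenSource B t p x * cosk B l x ∂cellMeasure B := by
      refine integral_congr_ae ?_
      filter_upwards [fn_ofTest (isTest_cosk (B := B) l)] with x hx
      rw [hx]
    have hi := integrable_of_continuous (B := B) (continuous_cosk (B := B) l)
    have h1 := integral_tsum_cosk_mul (B := B) (summable_abs_one_add_mu (B := B) ht) p hi
    have h2 := (integral_tsum_cosk_mul (B := B) (summable_abs_greenCoef (B := B) ht) p hi).mul_left (1 + mu B l)
    rw [e1]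
    refine h1.unique ?_
    convert! h2 using 1
    ext k
    rw [integral_cosk_sub_mul k p hi, sa_cosk]
    have := mu_mul_ca_cosk (B := B) k l
    linear_combination (greenCoef B t k * cosk B k p) * this
  · have hl : (1 + mu B l) ≠ 0 := by have := mu_nonneg (B := B) l; positivity
    refine mul_left_cancel₀ hl ?_
    rw [← inner_ofTest_sink, inner_greenW]
    have e1 : ∫ x, greenSource B t p x * fn (ofTest (isTest_sink (B := B) l)) x ∂cellMeasure B =
        ∫ x, greenSource B t p x * sink B l x ∂cellMeasure B := by
      refine integral_congr_ae ?_
      filter_upwards [fn_ofTest (isTest_sink (B := B) l)] with x hx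
      rw [hx]
    have hi := integrable_of_continuous (B := B) (continuous_sink (B := B) l)
    have h1 := integral_tsum_cosk_mul (B := B) (summable_abs_one_add_mu (B := B) ht) p hi
    have h2 := (integral_tsum_cosk_mul (B := B) (summable_abs_greenCoef (B := B) ht) p hi).mul_left (1 + mu B l)
    rw [e1]
    refine h1.unique ?_
    convert! h2 using 1
    ext k
    rw [integral_cosk_sub_mul k p hi, ca_sink]
    have := mu_mul_sa_sink (B := B) k l
    linear_combination (greenCoef B t k * sink B k p) * this

/-- The weak form of `-Δ G = 1 / |Ω| - heat`: the zeroth order terms of the equation that defines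
`greenW` cancel. -/
lemma dirL_greenW {t : ℝ} (ht : 0 < t) (p : Plane) (w : W12 B) :
    dirL B (greenW B ht p) w = (area B)⁻¹ * ∫ x, fn w x ∂cellMeasure B -
      ∫ x, heat B t (x - p) * fn w x ∂cellMeasure B := by
  have hh : Continuous fun x => heat B t (x - p) := (continuous_heat ht).comp (continuous_sub_right p)
  have hg : Continuous fun x => green B t (x - p) := (continuous_green ht).comp (continuous_sub_right p)
  have ih := integrable_mul_of_continuous (integrable_fn w) hh
  have ig := integrable_mul_of_continuous (integrable_fn w) hg
  have h := inner_eq_dirL (greenW B ht p) w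
  rw [inner_greenW] at h
  have e1 : ∫ x, fn (greenW B ht p) x * fn w x ∂cellMeasure B =
      ∫ x, fn w x * green B t (x - p) ∂cellMeasure B := by
    refine integral_congr_ae ?_
    filter_upwards [fn_greenW ht p] with x hx
    rw [hx, mul_comm]
  have e2 : ∫ x, greenSource B t p x * fn w x ∂cellMeasure B =
      ∫ x, fn w x * green B t (x - p) ∂cellMeasure B - ∫ x, fn w x * heat B t (x - p) ∂cellMeasure B +
        (area B)⁻¹ * ∫ x, fn w x ∂cellMeasure B := by
    have igh : Integrable (fun x => fn w x * green B t (x - p) - fn w x * heat B t (x - p))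
      (cellMeasure B) := ig.sub ih
    rw [← integral_const_mul, ← integral_sub ig ih,
      ← integral_add igh ((integrable_fn w).const_mul _)]
    refine integral_congr_ae (Filter.Eventually.of_forall fun x => ?_)
    simp only [greenSource_eq ht]
    ring
  have e3 : ∫ x, heat B t (x - p) * fn w x ∂cellMeasure B =
      ∫ x, fn w x * heat B t (x - p) ∂cellMeasure B := by simp only [mul_comm]
  rw [e1, e2] at h
  rw [e3]
  linarith

lemma integral_green {t : ℝ} (ht : 0 < t) (p : Plane) :
    ∫ x, green B t (x - p) ∂cellMeasure B = 0 := by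
  have hi : Integrable (fun _ : Plane => (1 : ℝ)) (cellMeasure B) := integrable_const 1
  have h := integral_tsum_cosk_mul (B := B) (summable_abs_greenCoef (B := B) ht) p hi
  simp only [mul_one] at h
  refine h.unique ?_
  convert! hasSum_zero using 1
  ext k
  have e := integral_cosk_sub_mul (B := B) k p hi
  simp only [mul_one, ca, sa, one_mul, integral_cosk, integral_sink] at e
  rw [e]
  by_cases hk : k = 0
  · subst hk; simp [greenCoef, mu_zero]
  · simp [hk]

end ChernSimonsHiggs
end

open MeasureTheory
open scoped ContDiff
noncomputable section
namespace ChernSimonsHiggs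
variable {B : Module.Basis (Fin 2) ℝ Plane} {N : ℕ}

/-! ### Fourier inversion for test functions -/

lemma IsTest.continuous_laplacian {φ : Plane → ℝ} (hφ : IsTest B φ) :
    Continuous (Laplacian.laplacian φ) := by
  have h2 : ContDiff ℝ 2 φ := hφ.1.of_le (WithTop.coe_le_coe.2 le_top)
  have : Laplacian.laplacian φ = fun x => _ := funext fun x => laplacian_eq_sum φ x h2
  rw [this]
  refine continuous_finsetSum _ fun i _ => ?_
  exact (((hφ.fderiv _).1.continuous_fderiv (by simp)).clm_apply continuous_const)

lemma ca_laplacian {φ : Plane → ℝ} (hφ : IsTest B φ) (k : Fin 2 → ℤ) :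
    ca B (Laplacian.laplacian φ) k = -(mu B k * ca B φ k) := by
  have h1 := integral_mul_laplacian (ofTest (isTest_cosk (B := B) k)) hφ
  have h2 := integral_inner_gradient_cosk (ofTest hφ) k
  have e1 : ∫ x, fn (ofTest (isTest_cosk (B := B) k)) x * Laplacian.laplacian φ x ∂cellMeasure B =
      ca B (Laplacian.laplacian φ) k := by
    refine integral_congr_ae ?_
    filter_upwards [fn_ofTest (isTest_cosk (B := B) k)] with x hx
    rw [hx, mul_comm]
  have e2 : ∫ x, inner ℝ (gr (ofTest (isTest_cosk (B := B) k)) x) (gradient φ x) ∂cellMeasure B =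
      ∫ x, inner ℝ (gr (ofTest hφ) x) (gradient (cosk B k) x) ∂cellMeasure B := by
    refine integral_congr_ae ?_
    filter_upwards [gr_ofTest (isTest_cosk (B := B) k), gr_ofTest hφ] with x hx hx'
    rw [hx, hx', real_inner_comm]
  rw [← e1, h1, e2, h2, ca_congr (fn_ofTest hφ)]

lemma sa_laplacian {φ : Plane → ℝ} (hφ : IsTest B φ) (k : Fin 2 → ℤ) :
    sa B (Laplacian.laplacian φ) k = -(mu B k * sa B φ k) := by
  have h1 := integral_mul_laplacian (ofTest (isTest_sink (B := B) k)) hφ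
  have h2 := integral_inner_gradient_sink (ofTest hφ) k
  have e1 : ∫ x, fn (ofTest (isTest_sink (B := B) k)) x * Laplacian.laplacian φ x ∂cellMeasure B =
      sa B (Laplacian.laplacian φ) k := by
    refine integral_congr_ae ?_
    filter_upwards [fn_ofTest (isTest_sink (B := B) k)] with x hx
    rw [hx, mul_comm]
  have e2 : ∫ x, inner ℝ (gr (ofTest (isTest_sink (B := B) k)) x) (gradient φ x) ∂cellMeasure B =
      ∫ x, inner ℝ (gr (ofTest hφ) x) (gradient (sink B k) x) ∂cellMeasure B := by
    refine integral_congr_ae ?_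
    filter_upwards [gr_ofTest (isTest_sink (B := B) k), gr_ofTest hφ] with x hx hx'
    rw [hx, hx', real_inner_comm]
  rw [← e1, h1, e2, h2, sa_congr (fn_ofTest hφ)]

/-- Away from index `0` a coefficient of `φ` is `1 / mu` times one of its Laplacian, and both
factors are square summable in two dimensions. -/
lemma summable_abs_coef {φ : Plane → ℝ} (hφ : IsTest B φ) :
    Summable fun k => |ca B φ k| + |sa B φ k| := by
  have h1 := (hasSum_en _ (memLp_of_continuous (B := B) hφ.continuous_laplacian 2)).summable
  have h2 := ((summable_inv_mu_sq B).add h1).add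
    (hasSum_ite_eq (0 : Fin 2 → ℤ) (|ca B φ 0| + |sa B φ 0|)).summable
  refine Summable.of_nonneg_of_le (fun k => by positivity) (fun k => ?_) h2
  by_cases hk : k = 0
  · subst hk
    have := en_nonneg (B := B) (Laplacian.laplacian φ) 0
    simp only [if_true]
    have h3 : 0 ≤ ((mu B 0) ^ 2)⁻¹ := by positivity
    simp [mu_zero]
    linarith
  · have hm := mu_pos (B := B) hk
    rw [if_neg hk, add_zero]
    simp only [en, ca_laplacian hφ, sa_laplacian hφ]
    have e1 : |ca B φ k| = (mu B k)⁻¹ * |mu B k * ca B φ k| := by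
      rw [abs_mul, abs_of_pos hm, inv_mul_cancel_left₀ hm.ne']
    have e2 : |sa B φ k| = (mu B k)⁻¹ * |mu B k * sa B φ k| := by
      rw [abs_mul, abs_of_pos hm, inv_mul_cancel_left₀ hm.ne']
    rw [e1, e2, neg_sq, neg_sq, ← sq_abs (mu B k * ca B φ k),
      ← sq_abs (mu B k * sa B φ k)]
    nlinarith [sq_nonneg ((mu B k)⁻¹ - 2 * |mu B k * ca B φ k|),
      sq_nonneg ((mu B k)⁻¹ - 2 * |mu B k * sa B φ k|), sq_nonneg ((mu B k)⁻¹ - |mu B k * ca B φ k|),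
      sq_nonneg ((mu B k)⁻¹ - |mu B k * sa B φ k|), sq_nonneg (|mu B k * ca B φ k|)]

/-- The series converges uniformly to a continuous periodic function with the same pairings as `φ`.
Both are continuous, so they agree at every point; pointwise equality is needed because the vortex
points are null sets. -/
lemma hasSum_fourier {φ : Plane → ℝ} (hφ : IsTest B φ) (p : Plane) :
    HasSum (fun k => (area B)⁻¹ * (cosk B k p * ca B φ k + sink B k p * sa B φ k)) (φ p) := by
  have hA := area_pos B
  have hφc := hφ.1.continuous
  set T : (Fin 2 → ℤ) → Plane → ℝ := fun k x =>
    (area B)⁻¹ * (cosk B k x * ca B φ k + sink B k x * sa B φ k) with hT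
  have hTb : ∀ k x, ‖T k x‖ ≤ (area B)⁻¹ * (|ca B φ k| + |sa B φ k|) := by
    intro k x
    rw [hT, Real.norm_eq_abs, abs_mul, abs_of_pos (inv_pos.2 hA)]
    gcongr
    refine (abs_add_le _ _).trans ?_
    rw [abs_mul, abs_mul]
    exact add_le_add (mul_le_of_le_one_left (abs_nonneg _) (abs_cosk_le k x))
      (mul_le_of_le_one_left (abs_nonneg _) (abs_sink_le k x))
  have hsum := (summable_abs_coef hφ).mul_left (area B)⁻¹
  have hTc : ∀ k, Continuous (T k) := fun k =>
    continuous_const.mul (((continuous_cosk k).mul continuous_const).add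
      ((continuous_sink k).mul continuous_const))
  set F : Plane → ℝ := fun x => ∑' k, T k x with hF
  have hFc : Continuous F := continuous_tsum hTc hsum hTb
  have hFp : IsDoublyPeriodic B F := by
    intro j x
    simp only [hF, hT, (isTest_cosk (B := B) _).2 j x, (isTest_sink (B := B) _).2 j x]
  have hFs : ∀ x, HasSum (fun k => T k x) (F x) := fun x =>
    (Summable.of_norm_bounded hsum fun k => hTb k x).hasSum
  have key : ∀ w : Plane → ℝ, Continuous w →
      ∫ x, F x * w x ∂cellMeasure B = ∫ x, φ x * w x ∂cellMeasure B := by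
    intro w hw
    have hwi := integrable_of_continuous (B := B) hw
    have hi : ∀ k, Integrable (fun x => T k x * w x) (cellMeasure B) := fun k =>
      integrable_of_continuous ((hTc k).mul hw)
    have hs : Summable fun k => ∫ x, ‖T k x * w x‖ ∂cellMeasure B := by
      refine Summable.of_nonneg_of_le (fun k => integral_nonneg fun x => norm_nonneg _) (fun k => ?_)
        (hsum.mul_right (∫ x, |w x| ∂cellMeasure B))
      rw [← integral_const_mul]
      refine integral_mono (hi k).norm (hwi.abs.const_mul _) fun x => ?_
      simp only [norm_mul]
      exact mul_le_mul_of_nonneg_right (hTb k x) (norm_nonneg _)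
    have h1 := hasSum_integral_of_summable_integral_norm hi hs
    have h2 := (hasSum_ca_mul (memLp_of_continuous (B := B) hφc 2)
      (memLp_of_continuous (B := B) hw 2)).mul_left (area B)⁻¹
    rw [inv_mul_cancel_left₀ hA.ne'] at h2
    have e1 : (fun k => ∫ x, T k x * w x ∂cellMeasure B) = fun k => (area B)⁻¹ *
        (ca B φ k * ca B w k + sa B φ k * sa B w k) := by
      ext k
      have i1 := integrable_mul_of_continuous hwi (continuous_cosk (B := B) k)
      have i2 := integrable_mul_of_continuous hwi (continuous_sink (B := B) k)
      rw [ca.eq_def B w, sa.eq_def B w, ← integral_const_mul, ← integral_const_mul,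
        ← integral_add (i1.const_mul _) (i2.const_mul _), ← integral_const_mul]
      refine integral_congr_ae (Filter.Eventually.of_forall fun x => ?_)
      simp only [hT]
      ring
    rw [e1] at h1
    have h3 := h1.unique h2
    rw [← h3]
    refine integral_congr_ae (Filter.Eventually.of_forall fun x => ?_)
    simp only [hF, tsum_mul_right]
  have hd : Continuous fun x => F x - φ x := hFc.sub hφc
  have h1 := key _ hd
  have i1 : Integrable (fun x => F x * (F x - φ x)) (cellMeasure B) :=
    integrable_of_continuous (hFc.mul hd)
  have i2 : Integrable (fun x => φ x * (F x - φ x)) (cellMeasure B) :=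
    integrable_of_continuous (hφc.mul hd)
  have h2 : ∫ x, (F x - φ x) ^ 2 ∂cellMeasure B = 0 := by
    rw [← sub_eq_zero, ← integral_sub i1 i2] at h1
    rw [← h1]
    refine integral_congr_ae (Filter.Eventually.of_forall fun x => ?_)
    ring
  have h3 : ∀ᵐ x ∂cellMeasure B, (F x - φ x) ^ 2 = 0 :=
    (integral_eq_zero_iff_of_nonneg (fun x => sq_nonneg _)
      (integrable_of_continuous (hd.pow 2))).1 h2
  have h4 := ae_volume_of_ae_cell (B := B) (fun k x => by simp only [hFp k x, hφ.2 k x]) h3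
  have h5 : (fun x => (F x - φ x) ^ 2) = fun _ => (0 : ℝ) :=
    (Continuous.ae_eq_iff_eq volume (hd.pow 2) continuous_const).1 h4
  have h6 := congrFun h5 p
  simp only [sq_eq_zero_iff] at h6
  have h7 : F p = φ p := by linarith
  rw [← h7]
  exact hFs p

lemma tendsto_integral_heat_mul {φ : Plane → ℝ} (hφ : IsTest B φ) (p : Plane) {t : ℕ → ℝ}
    (ht : ∀ n, 0 < t n) (ht0 : Filter.Tendsto t Filter.atTop (nhds 0)) :
    Filter.Tendsto (fun n => ∫ x, heat B (t n) (x - p) * φ x ∂cellMeasure B) Filter.atTop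
      (nhds (φ p)) := by
  have hA := area_pos B
  have hi := integrable_of_continuous (B := B) hφ.1.continuous
  have e : ∀ n, ∫ x, heat B (t n) (x - p) * φ x ∂cellMeasure B =
      ∑' k, Real.exp (-t n * mu B k) *
        ((area B)⁻¹ * (cosk B k p * ca B φ k + sink B k p * sa B φ k)) := by
    intro n
    have h1 := (integral_tsum_cosk_mul (B := B) (summable_abs_exp (B := B) (ht n)) p hi).mul_left
      (area B)⁻¹
    simp only [integral_cosk_sub_mul _ p hi] at h1
    simp only [heat, mul_assoc]
    rw [integral_const_mul, ← h1.tsum_eq]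
    congr 1
    ext k
    ring
  simp_rw [e]
  rw [← (hasSum_fourier hφ p).tsum_eq]
  refine tendsto_tsum_of_dominated_convergence ((summable_abs_coef hφ).mul_left (area B)⁻¹) ?_ ?_
  · intro k
    have h1 : Filter.Tendsto (fun n => Real.exp (-t n * mu B k)) Filter.atTop (nhds 1) := by
      have h2 : Filter.Tendsto (fun n => -t n * mu B k) Filter.atTop (nhds 0) := by
        simpa using ht0.neg.mul_const (mu B k)
      have := (Real.continuous_exp.tendsto 0).comp h2
      rwa [Real.exp_zero] at this
    simpa using h1.mul_const ((area B)⁻¹ * (cosk B k p * ca B φ k + sink B k p * sa B φ k))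
  · refine Filter.Eventually.of_forall fun n k => ?_
    have h1 : Real.exp (-t n * mu B k) ≤ 1 := by
      rw [Real.exp_le_one_iff]
      have := mul_nonneg (ht n).le (mu_nonneg (B := B) k)
      linarith
    rw [Real.norm_eq_abs, abs_mul, abs_of_pos (Real.exp_pos _)]
    refine (mul_le_of_le_one_left (abs_nonneg _) h1).trans ?_
    rw [abs_mul, abs_of_pos (inv_pos.2 hA)]
    gcongr
    refine (abs_add_le _ _).trans ?_
    rw [abs_mul, abs_mul]
    exact add_le_add (mul_le_of_le_one_left (abs_nonneg _) (abs_cosk_le k p))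
      (mul_le_of_le_one_left (abs_nonneg _) (abs_sink_le k p))

/-! ### Decreasing limits -/

/-- Monotone convergence for `f 0 - f n`, whose integrals stay below `∫ f 0 - c`. Where the sequence
is unbounded below, the real infimum takes the default value `0`; such points form a null set. -/
lemma integrable_iInf_of_antitone {α : Type*} [MeasurableSpace α] {m : Measure α}
    {f : ℕ → α → ℝ} (hi : ∀ n, Integrable (f n) m) (hm : ∀ n, Measurable (f n))
    (ha : ∀ x, Antitone fun n => f n x) {c : ℝ} (hc : ∀ n, c ≤ ∫ x, f n x ∂m) :
    (∀ᵐ x ∂m, BddBelow (Set.range fun n => f n x)) ∧ Integrable (fun x => ⨅ n, f n x) m := by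
  have hg0 : ∀ n x, 0 ≤ f 0 x - f n x := fun n x => sub_nonneg.2 (ha x (Nat.zero_le n))
  have hgi : ∀ n, Integrable (fun x => f 0 x - f n x) m := fun n => (hi 0).sub (hi n)
  have h1 : ∫⁻ x, ⨆ n, ENNReal.ofReal (f 0 x - f n x) ∂m ≤ ENNReal.ofReal (∫ x, f 0 x ∂m - c) := by
    have hme : ∀ n, Measurable fun x => ENNReal.ofReal (f 0 x - f n x) := fun n =>
      ((hm 0).sub (hm n)).ennreal_ofReal
    rw [lintegral_iSup hme (fun n k h x =>
      ENNReal.ofReal_le_ofReal (sub_le_sub_left (ha x h) _))]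
    refine iSup_le fun n => ?_
    rw [← ofReal_integral_eq_lintegral_ofReal (hgi n) (Filter.Eventually.of_forall (hg0 n)),
      integral_sub (hi 0) (hi n)]
    exact ENNReal.ofReal_le_ofReal (sub_le_sub_left (hc n) _)
  have hfin : ∀ᵐ x ∂m, ⨆ n, ENNReal.ofReal (f 0 x - f n x) < ⊤ := by
    refine ae_lt_top (Measurable.iSup fun n => (((hm 0).sub (hm n)).ennreal_ofReal)) ?_
    exact (h1.trans_lt ENNReal.ofReal_lt_top).ne
  have hbdd : ∀ᵐ x ∂m, BddBelow (Set.range fun n => f n x) := by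
    filter_upwards [hfin] with x hx
    refine ⟨f 0 x - (⨆ n, ENNReal.ofReal (f 0 x - f n x)).toReal, ?_⟩
    rintro _ ⟨n, rfl⟩
    have h2 : ENNReal.ofReal (f 0 x - f n x) ≤ ⨆ n, ENNReal.ofReal (f 0 x - f n x) :=
      le_iSup (fun n => ENNReal.ofReal (f 0 x - f n x)) n
    have h3 := (ENNReal.ofReal_le_iff_le_toReal hx.ne).1 h2
    dsimp only
    linarith
  refine ⟨hbdd, ?_⟩
  have hmi : Measurable fun x => ⨅ n, f n x := Measurable.iInf hm
  have h4 : Integrable (fun x => f 0 x - ⨅ n, f n x) m := by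
    refine ⟨((hm 0).sub hmi).aestronglyMeasurable, ?_⟩
    refine lt_of_le_of_lt ?_ (h1.trans_lt ENNReal.ofReal_lt_top)
    refine lintegral_mono_ae ?_
    filter_upwards [hbdd] with x hx
    have h5 : Filter.Tendsto (fun n => f 0 x - f n x) Filter.atTop (nhds (f 0 x - ⨅ n, f n x)) :=
      tendsto_const_nhds.sub (tendsto_atTop_ciInf (ha x) hx)
    have h6 : 0 ≤ f 0 x - ⨅ n, f n x := sub_nonneg.2 (ciInf_le hx 0)
    rw [Real.enorm_eq_ofReal h6]
    refine le_of_tendsto ((ENNReal.continuous_ofReal.tendsto _).comp h5)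
      (Filter.Eventually.of_forall fun n => ?_)
    exact le_iSup (fun n => ENNReal.ofReal (f 0 x - f n x)) n
  refine ((hi 0).sub h4).congr (Filter.Eventually.of_forall fun x => ?_)
  simp

end ChernSimonsHiggs
end

open MeasureTheory
open scoped ContDiff
noncomputable section
namespace ChernSimonsHiggs
variable {B : Module.Basis (Fin 2) ℝ Plane} {N : ℕ}

/-! ### The background function -/

lemma fn_sum {ι : Type*} (s : Finset ι) (w : ι → W12 B) :
    fn (∑ i ∈ s, w i) =ᵐ[cellMeasure B] fun x => ∑ i ∈ s, fn (w i) x := by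
  classical
  induction s using Finset.induction_on with
  | empty => simpa using fn_zero
  | insert i s hi ih =>
    rw [Finset.sum_insert hi]
    filter_upwards [fn_add (w i) (∑ i ∈ s, w i), ih] with x h1 h2
    rw [h1, h2, Finset.sum_insert hi]

/-- The regularised background function. -/
def bgN (B : Module.Basis (Fin 2) ℝ Plane) {m : ℕ} (p : Fin m → Plane) (n : ℕ) (x : Plane) : ℝ :=
  4 * Real.pi * ∑ s, (green B (1 / (n + 1 : ℝ)) (x - p s) + 1 / (n + 1 : ℝ) * (area B)⁻¹)

/-- The background function. -/
def bg (B : Module.Basis (Fin 2) ℝ Plane) {m : ℕ} (p : Fin m → Plane) (x : Plane) : ℝ :=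
  ⨅ n, bgN B p n x

/-- The regularised background function, as an element of the Sobolev space. -/
def bgW (B : Module.Basis (Fin 2) ℝ Plane) {m : ℕ} (p : Fin m → Plane) (n : ℕ) : W12 B :=
  (4 * Real.pi) • ∑ s, (greenW B (Nat.one_div_pos_of_nat (α := ℝ) (n := n)) (p s) +
    cst B (1 / (n + 1 : ℝ) * (area B)⁻¹))

/-- A background function with `m` poles and approximations of it in the Sobolev space, from above
and with the same lower bound for the Laplacian. -/
structure IsApproxBackground (m : ℕ) (u₀ : Plane → ℝ) (g : ℕ → W12 B) : Prop where
  measurable : Measurable u₀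
  integrable : Integrable u₀ (cellMeasure B)
  bdd_above : ∃ C, ∀ n, ∀ᵐ x ∂cellMeasure B, fn (g n) x ≤ C
  le : ∀ n, ∀ᵐ x ∂cellMeasure B, u₀ x ≤ fn (g n) x
  tendsto : ∀ᵐ x ∂cellMeasure B, Filter.Tendsto (fun n => fn (g n) x) Filter.atTop (nhds (u₀ x))
  dir_le : ∀ n (w : W12 B), (∀ᵐ x ∂cellMeasure B, 0 ≤ fn w x) →
    dirL B (g n) w ≤ 4 * Real.pi * m / area B * ∫ x, fn w x ∂cellMeasure B

section
variable {m : ℕ} (p : Fin m → Plane)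

lemma continuous_bgN (n : ℕ) : Continuous (bgN B p n) := by
  refine continuous_const.mul (continuous_finsetSum _ fun s _ => ?_)
  exact ((continuous_green Nat.one_div_pos_of_nat).comp (continuous_sub_right _)).add
    continuous_const

lemma isDoublyPeriodic_bgN (n : ℕ) : IsDoublyPeriodic B (bgN B p n) := by
  intro k x
  have : ∀ s, x + B k - p s = x - p s + B k := fun s => by abel
  simp only [bgN, this, isDoublyPeriodic_green _ k _]

lemma antitone_bgN (x : Plane) : Antitone fun n => bgN B p n x := by
  intro n k h
  have := Real.pi_pos
  refine mul_le_mul_of_nonneg_left (Finset.sum_le_sum fun s _ => ?_) (by positivity)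
  exact green_add_mono _ Nat.one_div_pos_of_nat (Nat.one_div_le_one_div h)

lemma integral_bgN (n : ℕ) : ∫ x, bgN B p n x ∂cellMeasure B = 4 * Real.pi * (m * (1 / (n + 1 : ℝ))) := by
  have hA := area_pos B
  have hi : ∀ s, Integrable (fun x => green B (1 / (n + 1 : ℝ)) (x - p s)) (cellMeasure B) := fun s =>
    integrable_of_continuous ((continuous_green Nat.one_div_pos_of_nat).comp (continuous_sub_right _))
  have hi' : ∀ s, Integrable (fun x => green B (1 / (n + 1 : ℝ)) (x - p s) +
      1 / (n + 1 : ℝ) * (area B)⁻¹) (cellMeasure B) := fun s => (hi s).add (integrable_const _)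
  simp only [bgN]
  rw [integral_const_mul, integral_finsetSum _ fun s _ => hi' s]
  simp_rw [fun s => integral_add (hi s) (integrable_const (1 / (n + 1 : ℝ) * (area B)⁻¹)),
    integral_green (B := B) (t := 1 / (n + 1 : ℝ)) Nat.one_div_pos_of_nat, integral_const]
  have : (cellMeasure B).real Set.univ = area B := by simp [area, Measure.real]
  rw [this]
  simp only [zero_add, smul_eq_mul, Finset.sum_const, Finset.card_univ, Fintype.card_fin, nsmul_eq_mul]
  field_simp

lemma fn_bgW (n : ℕ) : fn (bgW B p n) =ᵐ[cellMeasure B] bgN B p n := by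
  have h1 : ∀ᵐ x ∂cellMeasure B, ∀ s, fn (greenW B (Nat.one_div_pos_of_nat (α := ℝ) (n := n)) (p s) +
      cst B (1 / (n + 1 : ℝ) * (area B)⁻¹)) x =
      green B (1 / (n + 1 : ℝ)) (x - p s) + 1 / (n + 1 : ℝ) * (area B)⁻¹ := by
    refine ae_all_iff.2 fun s => ?_
    filter_upwards [fn_add (greenW B (Nat.one_div_pos_of_nat (α := ℝ) (n := n)) (p s))
      (cst B (1 / (n + 1 : ℝ) * (area B)⁻¹)), fn_greenW (B := B)
      (Nat.one_div_pos_of_nat (α := ℝ) (n := n)) (p s),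
      fn_cst (B := B) (1 / (n + 1 : ℝ) * (area B)⁻¹)] with x h1 h2 h3
    rw [h1, h2, h3]
  filter_upwards [fn_smul (4 * Real.pi) (∑ s, (greenW B (Nat.one_div_pos_of_nat (α := ℝ) (n := n)) (p s) +
    cst B (1 / (n + 1 : ℝ) * (area B)⁻¹))), fn_sum Finset.univ (fun s =>
      greenW B (Nat.one_div_pos_of_nat (α := ℝ) (n := n)) (p s) +
    cst B (1 / (n + 1 : ℝ) * (area B)⁻¹)), h1] with x h2 h3 h4
  rw [bgW, h2, h3, bgN]
  simp only [h4]

lemma dirL_bgW (n : ℕ) (w : W12 B) : dirL B (bgW B p n) w =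
    4 * Real.pi * m / area B * ∫ x, fn w x ∂cellMeasure B -
      4 * Real.pi * ∑ s, ∫ x, heat B (1 / (n + 1 : ℝ)) (x - p s) * fn w x ∂cellMeasure B := by
  simp only [bgW, map_smul, map_sum, map_add, add_apply,
    FunLike.coe_sum, Finset.sum_apply, smul_apply, dirL_cst, dirL_greenW, smul_eq_mul,
    add_zero, Finset.sum_sub_distrib, Finset.sum_const, Finset.card_univ, Fintype.card_fin,
    nsmul_eq_mul]
  ring

lemma bddBelow_bgN : ∀ᵐ x ∂cellMeasure B, BddBelow (Set.range fun n => bgN B p n x) :=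
  (integrable_iInf_of_antitone (c := 0) (fun n => integrable_of_continuous (continuous_bgN p n))
    (fun n => (continuous_bgN p n).measurable) (antitone_bgN p) fun n => by
      rw [integral_bgN]; have := Real.pi_pos; positivity).1

lemma integrable_bg : Integrable (bg B p) (cellMeasure B) :=
  (integrable_iInf_of_antitone (c := 0) (fun n => integrable_of_continuous (continuous_bgN p n))
    (fun n => (continuous_bgN p n).measurable) (antitone_bgN p) fun n => by
      rw [integral_bgN]; have := Real.pi_pos; positivity).2

lemma tendsto_bgN : ∀ᵐ x ∂cellMeasure B,
    Filter.Tendsto (fun n => bgN B p n x) Filter.atTop (nhds (bg B p x)) := by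
  filter_upwards [bddBelow_bgN p] with x hx
  exact tendsto_atTop_ciInf (antitone_bgN p x) hx

lemma tendsto_integral_bgN_mul {ψ : Plane → ℝ} (hψ : Continuous ψ) :
    Filter.Tendsto (fun n => ∫ x, bgN B p n x * ψ x ∂cellMeasure B) Filter.atTop
      (nhds (∫ x, bg B p x * ψ x ∂cellMeasure B)) := by
  refine tendsto_integral_of_dominated_convergence
    (fun x => |bgN B p 0 x * ψ x| + |bg B p x * ψ x|)
    (fun n => ((continuous_bgN p n).mul hψ).aestronglyMeasurable)
    ((integrable_of_continuous ((continuous_bgN p 0).mul hψ)).abs.add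
      (integrable_mul_of_continuous (integrable_bg p) hψ).abs) (fun n => ?_) ?_
  · filter_upwards [bddBelow_bgN p] with x hx
    have h1 : bg B p x ≤ bgN B p n x := ciInf_le hx n
    have h2 := antitone_bgN (B := B) p x (Nat.zero_le n)
    simp only [Real.norm_eq_abs, abs_mul, ← add_mul]
    gcongr
    refine (abs_le_max_abs_abs h1 h2).trans (max_le ?_ ?_)
    · linarith [abs_nonneg (bgN B p 0 x)]
    · linarith [abs_nonneg (bg B p x)]
  · filter_upwards [tendsto_bgN p] with x hx
    exact hx.mul_const _

/-- Each regularisation satisfies the equation with heat kernels in place of Dirac masses. The left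
side passes to the limit by dominated convergence, and the heat kernels concentrate at the points by
`tendsto_integral_heat_mul`. -/
lemma isBackground_bg : IsBackground B p (bg B p) where
  periodic := fun k x => by simp only [bg, isDoublyPeriodic_bgN p _ k x]
  integrable := integrable_bg p
  mean_zero := by
    have h1 := tendsto_integral_bgN_mul (B := B) p (continuous_const (y := (1 : ℝ)))
    simp only [mul_one, integral_bgN] at h1
    refine tendsto_nhds_unique h1 ?_
    have h2 := ((tendsto_one_div_add_atTop_nhds_zero_nat (𝕜 := ℝ)).const_mul (m : ℝ)).const_mul
      (4 * Real.pi)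
    simpa using h2
  equation := fun φ hφ => by
    have h1 := tendsto_integral_bgN_mul (B := B) p hφ.continuous_laplacian
    refine tendsto_nhds_unique h1 ?_
    have e : ∀ n, ∫ x, bgN B p n x * Laplacian.laplacian φ x ∂cellMeasure B =
        4 * Real.pi * (∑ s, ∫ x, heat B (1 / (n + 1 : ℝ)) (x - p s) * φ x ∂cellMeasure B) -
          4 * Real.pi * m / area B * ∫ x, φ x ∂cellMeasure B := by
      intro n
      have h2 := integral_mul_laplacian (bgW B p n) hφ
      have e1 : ∫ x, fn (bgW B p n) x * Laplacian.laplacian φ x ∂cellMeasure B =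
          ∫ x, bgN B p n x * Laplacian.laplacian φ x ∂cellMeasure B := by
        refine integral_congr_ae ?_
        filter_upwards [fn_bgW p n] with x hx
        rw [hx]
      have e2 : ∫ x, inner ℝ (gr (bgW B p n) x) (gradient φ x) ∂cellMeasure B =
          dirL B (bgW B p n) (ofTest hφ) := by
        rw [dirL_apply]
        refine integral_congr_ae ?_
        filter_upwards [gr_ofTest hφ] with x hx
        rw [hx]
      have e3 : ∀ s, ∫ x, heat B (1 / (n + 1 : ℝ)) (x - p s) * fn (ofTest hφ) x ∂cellMeasure B =
          ∫ x, heat B (1 / (n + 1 : ℝ)) (x - p s) * φ x ∂cellMeasure B := fun s => by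
        refine integral_congr_ae ?_
        filter_upwards [fn_ofTest hφ] with x hx
        rw [hx]
      rw [← e1, h2, e2, dirL_bgW, integral_congr_ae (fn_ofTest hφ)]
      simp only [e3]
      ring
    simp_rw [e]
    refine Filter.Tendsto.sub_const (Filter.Tendsto.const_mul _ ?_) _
    exact tendsto_finsetSum _ fun s _ => tendsto_integral_heat_mul hφ (p s)
      (fun n => Nat.one_div_pos_of_nat) tendsto_one_div_add_atTop_nhds_zero_nat

/-- The bound on the Dirichlet form comes from discarding the nonnegative heat kernels in
`dirL_bgW`. What remains is a one-sided form of the background equation that is uniform in the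
regularisation, and this suffices for the Palais-Smale estimate. -/
lemma isApproxBackground_bg : IsApproxBackground m (bg B p) (bgW B p) where
  measurable := Measurable.iInf fun n => (continuous_bgN p n).measurable
  integrable := integrable_bg p
  bdd_above := by
    obtain ⟨C, -, hC⟩ := (isDoublyPeriodic_bgN (B := B) p 0).exists_bound (continuous_bgN p 0)
    refine ⟨C, fun n => ?_⟩
    filter_upwards [fn_bgW p n] with x hx
    rw [hx]
    exact (antitone_bgN p x (Nat.zero_le n)).trans ((le_abs_self _).trans (hC x))
  le := fun n => by
    filter_upwards [fn_bgW p n, bddBelow_bgN p] with x hx hb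
    rw [hx]
    exact ciInf_le hb n
  tendsto := by
    filter_upwards [ae_all_iff.2 (fn_bgW (B := B) p), tendsto_bgN p] with x hx ht
    simpa only [hx] using ht
  dir_le := fun n w hw => by
    have h1 : ∀ s, 0 ≤ ∫ x, heat B (1 / (n + 1 : ℝ)) (x - p s) * fn w x ∂cellMeasure B := fun s => by
      refine integral_nonneg_of_ae ?_
      filter_upwards [hw] with x hx
      exact mul_nonneg (heat_nonneg Nat.one_div_pos_of_nat _) hx
    have h2 := Finset.sum_nonneg fun s (_ : s ∈ Finset.univ) => h1 s
    rw [dirL_bgW]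
    have := mul_nonneg (mul_nonneg (by norm_num : (0 : ℝ) ≤ 4) Real.pi_pos.le) h2
    linarith

end

end ChernSimonsHiggs
end

open MeasureTheory
open scoped ContDiff
noncomputable section
namespace ChernSimonsHiggs
variable {B : Module.Basis (Fin 2) ℝ Plane} {N : ℕ}

/-! ### Exponential integrals on the Sobolev space -/

lemma integral_abs_mul_abs_le {α : Type*} [MeasurableSpace α] {m : Measure α} {f g : α → ℝ}
    (hf : MemLp f 2 m) (hg : MemLp g 2 m) :
    ∫ x, |f x| * |g x| ∂m ≤ √(∫ x, f x ^ 2 ∂m) * √(∫ x, g x ^ 2 ∂m) := by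
  have := integral_mul_norm_le_Lp_mul_Lq (μ := m) (f := f) (g := g) (p := 2) (q := 2)
    (by constructor <;> norm_num) (by simpa using hf) (by simpa using hg)
  simpa [Real.sqrt_eq_rpow] using this

/-- On the unit sphere `|t| ^ n ≤ n! exp |t|` reduces the claim to the Trudinger inequality; the
general case follows by homogeneity. -/
lemma exists_integral_pow_le (B : Module.Basis (Fin 2) ℝ Plane) (n : ℕ) : ∃ C, 0 < C ∧
    ∀ w : W12 B, Integrable (fun x => |fn w x| ^ n) (cellMeasure B) ∧
      ∫ x, |fn w x| ^ n ∂cellMeasure B ≤ C * ‖w‖ ^ n := by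
  obtain ⟨C, hC, h⟩ := exists_trudinger B
  have hb : ∀ (w : W12 B) x, |fn w x| ^ n ≤ n.factorial * Real.exp |fn w x| := fun w x => by
    have := Real.pow_div_factorial_le_exp _ (abs_nonneg (fn w x)) n
    rwa [div_le_iff₀' (by positivity)] at this
  have hi : ∀ w : W12 B, Integrable (fun x => |fn w x| ^ n) (cellMeasure B) := fun w =>
    ((h w).1.const_mul n.factorial).mono' ((memLp_fn w).1.norm.pow n)
      (Filter.Eventually.of_forall fun x => by
        rw [Real.norm_eq_abs, abs_of_nonneg (by positivity)]; exact hb w x)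
  refine ⟨n.factorial * (C * Real.exp C) + area B, by have := area_pos B; positivity,
    fun w => ⟨hi w, ?_⟩⟩
  have hA := area_pos B
  by_cases hw : w = 0
  · subst hw
    have e : ∫ x, |fn (0 : W12 B) x| ^ n ∂cellMeasure B = ∫ x, (0 : ℝ) ^ n ∂cellMeasure B := by
      refine integral_congr_ae ?_
      filter_upwards [fn_zero (B := B)] with x hx
      rw [hx, abs_zero]
    have : (cellMeasure B).real Set.univ = area B := by simp [area, Measure.real]
    rw [e, integral_const, norm_zero, this, smul_eq_mul]
    gcongr
    have : 0 ≤ n.factorial * (C * Real.exp C) := by positivity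
    linarith
  have hw0 : 0 < ‖w‖ := norm_pos_iff.2 hw
  set z := ‖w‖⁻¹ • w with hz
  have hzn : ‖z‖ = 1 := by rw [hz, norm_smul, norm_inv, norm_norm, inv_mul_cancel₀ hw0.ne']
  have h1 : ∫ x, |fn z x| ^ n ∂cellMeasure B ≤ n.factorial * (C * Real.exp C) := by
    calc ∫ x, |fn z x| ^ n ∂cellMeasure B ≤ ∫ x, n.factorial * Real.exp |fn z x| ∂cellMeasure B :=
          integral_mono (hi z) ((h z).1.const_mul _) (hb z)
      _ = n.factorial * ∫ x, Real.exp |fn z x| ∂cellMeasure B := integral_const_mul _ _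
      _ ≤ _ := by
        have := (h z).2
        rw [hzn, one_pow, mul_one] at this
        gcongr
  have e : ∫ x, |fn w x| ^ n ∂cellMeasure B = ‖w‖ ^ n * ∫ x, |fn z x| ^ n ∂cellMeasure B := by
    rw [← integral_const_mul]
    refine integral_congr_ae ?_
    filter_upwards [fn_smul ‖w‖⁻¹ w] with x hx
    rw [hz, hx, abs_mul, mul_pow, abs_of_pos (inv_pos.2 hw0), ← mul_assoc, ← mul_pow,
      mul_inv_cancel₀ hw0.ne', one_pow, one_mul]
  rw [e, mul_comm]
  gcongr
  linarith

lemma aestronglyMeasurable_exp (w : W12 B) :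
    AEStronglyMeasurable (fun x => Real.exp (fn w x)) (cellMeasure B) :=
  Real.continuous_exp.comp_aestronglyMeasurable (memLp_fn w).1

lemma exists_integral_exp_sq_le (B : Module.Basis (Fin 2) ℝ Plane) (R : ℝ) : ∃ C, 0 < C ∧
    ∀ w : W12 B, ‖w‖ ≤ R → ∫ x, Real.exp (fn w x) ^ 2 ∂cellMeasure B ≤ C := by
  obtain ⟨C, hC, h⟩ := exists_trudinger B
  refine ⟨C * Real.exp (C * (2 * R) ^ 2), by positivity, fun w hw => ?_⟩
  have h1 := (h ((2 : ℝ) • w)).2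
  have h2 : ‖(2 : ℝ) • w‖ ≤ 2 * R := by rw [norm_smul, Real.norm_two]; gcongr
  refine le_trans ?_ (h1.trans ?_)
  · refine integral_mono_of_nonneg (Filter.Eventually.of_forall fun x => by positivity)
      (h ((2 : ℝ) • w)).1 ?_
    filter_upwards [fn_smul 2 w] with x hx
    rw [← Real.exp_nat_mul, hx]
    exact Real.exp_le_exp.2 (le_abs_self _)
  · gcongr

lemma memLp_exp (w : W12 B) : MemLp (fun x => Real.exp (fn w x)) 2 (cellMeasure B) := by
  obtain ⟨C, hC, h⟩ := exists_trudinger B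
  rw [memLp_two_iff_integrable_sq (aestronglyMeasurable_exp w)]
  refine (h ((2 : ℝ) • w)).1.mono' ((aestronglyMeasurable_exp w).pow 2) ?_
  filter_upwards [fn_smul 2 w] with x hx
  rw [Real.norm_eq_abs, abs_of_nonneg (by positivity), ← Real.exp_nat_mul, hx]
  exact Real.exp_le_exp.2 (le_abs_self _)

/-- Bounded measurable weights. -/
def IsWeight (B : Module.Basis (Fin 2) ℝ Plane) (h : Plane → ℝ) : Prop :=
  AEStronglyMeasurable h (cellMeasure B) ∧ ∃ C, 0 ≤ C ∧ ∀ᵐ x ∂cellMeasure B, |h x| ≤ C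

lemma IsWeight.memLp_mul_exp {h : Plane → ℝ} (hh : IsWeight B h) (w : W12 B) :
    MemLp (fun x => h x * Real.exp (fn w x)) 2 (cellMeasure B) := by
  obtain ⟨hm, C, hC0, hC⟩ := hh
  refine MemLp.of_le_mul (memLp_exp w) (hm.mul (aestronglyMeasurable_exp w)) (c := C) ?_
  filter_upwards [hC] with x hx
  rw [norm_mul]
  exact mul_le_mul_of_nonneg_right hx (norm_nonneg _)

/-- The weighted exponential integral. -/
def expFun (B : Module.Basis (Fin 2) ℝ Plane) (h : Plane → ℝ) (w : W12 B) : ℝ :=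
  ∫ x, h x * Real.exp (fn w x) ∂cellMeasure B

/-- The derivative of the weighted exponential integral. -/
def expDer {h : Plane → ℝ} (hh : IsWeight B h) (w : W12 B) : W12 B →L[ℝ] ℝ :=
  pairL (hh.memLp_mul_exp w)

lemma abs_exp_sub_exp_le (a b : ℝ) : |Real.exp a - Real.exp b| ≤ |a - b| * (Real.exp a + Real.exp b) := by
  rcases le_total a b with h | h
  · have h1 := Real.add_one_le_exp (a - b)
    rw [Real.exp_sub, le_div_iff₀ (Real.exp_pos _)] at h1
    rw [abs_of_nonpos (by linarith [Real.exp_le_exp.2 h]), abs_of_nonpos (by linarith)]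
    nlinarith [Real.exp_pos a, Real.exp_pos b]
  · have h1 := Real.add_one_le_exp (b - a)
    rw [Real.exp_sub, le_div_iff₀ (Real.exp_pos _)] at h1
    rw [abs_of_nonneg (by linarith [Real.exp_le_exp.2 h]), abs_of_nonneg (by linarith)]
    nlinarith [Real.exp_pos a, Real.exp_pos b]

lemma abs_exp_taylor_le (a s : ℝ) :
    |Real.exp (a + s) - Real.exp a - Real.exp a * s| ≤ s ^ 2 * (Real.exp (a + s) + Real.exp a) := by
  have h1 := Real.add_one_le_exp s
  have h2 := Real.add_one_le_exp (-s)
  rw [Real.exp_neg] at h2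
  have h3 : (-s + 1) * Real.exp s ≤ 1 := by
    calc (-s + 1) * Real.exp s ≤ (Real.exp s)⁻¹ * Real.exp s := by gcongr
      _ = 1 := inv_mul_cancel₀ (Real.exp_pos s).ne'
  have e : Real.exp (a + s) - Real.exp a - Real.exp a * s = Real.exp a * (Real.exp s - 1 - s) := by
    rw [Real.exp_add]; ring
  rw [e, abs_mul, abs_of_pos (Real.exp_pos a), Real.exp_add, abs_of_nonneg (by linarith)]
  have h4 : Real.exp s - 1 - s ≤ s ^ 2 * (Real.exp s + 1) := by
    rcases le_total 0 s with hs | hs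
    · nlinarith [Real.exp_pos s, mul_nonneg hs (sub_nonneg.2 h1), mul_nonneg hs hs]
    · nlinarith [Real.exp_pos s, mul_nonneg (neg_nonneg.2 hs) (sub_nonneg.2 h1),
        mul_nonneg (neg_nonneg.2 hs) (neg_nonneg.2 hs), mul_nonneg (neg_nonneg.2 hs) (Real.exp_pos s).le]
  nlinarith [Real.exp_pos a]

lemma memLp_fn_sq (w : W12 B) : MemLp (fun x => fn w x ^ 2) 2 (cellMeasure B) := by
  obtain ⟨C, hC, h⟩ := exists_integral_pow_le B 4
  have hm : AEStronglyMeasurable (fun x => fn w x ^ 2) (cellMeasure B) := (memLp_fn w).1.pow 2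
  rw [memLp_two_iff_integrable_sq hm]
  refine (h w).1.congr (Filter.Eventually.of_forall fun x => ?_)
  simp only
  rw [← pow_mul]
  exact Even.pow_abs (by decide) _

lemma exists_sqrt_integral_fn_four_le (B : Module.Basis (Fin 2) ℝ Plane) : ∃ C, 0 < C ∧
    ∀ w : W12 B, √(∫ x, (fn w x ^ 2) ^ 2 ∂cellMeasure B) ≤ C * ‖w‖ ^ 2 := by
  obtain ⟨C, hC, h⟩ := exists_integral_pow_le B 4
  refine ⟨√C, by positivity, fun w => ?_⟩
  have e : ∫ x, (fn w x ^ 2) ^ 2 ∂cellMeasure B = ∫ x, |fn w x| ^ 4 ∂cellMeasure B := by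
    refine integral_congr_ae (Filter.Eventually.of_forall fun x => ?_)
    simp only
    rw [← pow_mul]
    exact (Even.pow_abs (by decide) _).symm
  rw [e]
  refine Real.sqrt_le_iff.2 ⟨by positivity, (h w).2.trans (le_of_eq ?_)⟩
  rw [mul_pow, Real.sq_sqrt hC.le]
  ring

/-- Three-fold Hölder inequality. -/
lemma integral_mul_mul_le {F : Plane → ℝ} (hF : MemLp F 2 (cellMeasure B)) (v w : W12 B) :
    Integrable (fun x => |F x| * (|fn v x| * |fn w x|)) (cellMeasure B) ∧
    ∫ x, |F x| * (|fn v x| * |fn w x|) ∂cellMeasure B ≤ √(∫ x, F x ^ 2 ∂cellMeasure B) *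
      (√√(∫ x, (fn v x ^ 2) ^ 2 ∂cellMeasure B) * √√(∫ x, (fn w x ^ 2) ^ 2 ∂cellMeasure B)) := by
  have hvw : MemLp (fun x => fn v x * fn w x) 2 (cellMeasure B) := by
    have hm : AEStronglyMeasurable (fun x => fn v x * fn w x) (cellMeasure B) :=
      (memLp_fn v).1.mul (memLp_fn w).1
    rw [memLp_two_iff_integrable_sq hm]
    refine ((memLp_fn_sq v).integrable_mul (memLp_fn_sq w)).congr
      (Filter.Eventually.of_forall fun x => ?_)
    simp only [Pi.mul_apply]
    ring
  constructor
  · have := (hF.integrable_mul hvw).abs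
    refine this.congr (Filter.Eventually.of_forall fun x => ?_)
    simp only [Pi.mul_apply, abs_mul]
  · have h1 := integral_abs_mul_abs_le hF hvw
    simp only [abs_mul] at h1
    refine h1.trans ?_
    gcongr
    rw [← Real.sqrt_mul (Real.sqrt_nonneg _)]
    refine Real.sqrt_le_sqrt ?_
    have h2 := integral_abs_mul_abs_le (memLp_fn_sq v) (memLp_fn_sq w)
    refine le_trans (le_of_eq ?_) h2
    refine integral_congr_ae (Filter.Eventually.of_forall fun x => ?_)
    simp only [abs_pow, sq_abs]
    ring

lemma exists_sqrt_integral_exp_add_le (B : Module.Basis (Fin 2) ℝ Plane) (R : ℝ) : ∃ C, 0 < C ∧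
    ∀ v w : W12 B, ‖v‖ ≤ R → ‖w‖ ≤ R →
      √(∫ x, (Real.exp (fn v x) + Real.exp (fn w x)) ^ 2 ∂cellMeasure B) ≤ C := by
  obtain ⟨C, hC, h⟩ := exists_integral_exp_sq_le B R
  refine ⟨√(4 * C), by positivity, fun v w hv hw => Real.sqrt_le_sqrt ?_⟩
  have i1 := (memLp_exp v).integrable_sq
  have i2 := (memLp_exp w).integrable_sq
  calc ∫ x, (Real.exp (fn v x) + Real.exp (fn w x)) ^ 2 ∂cellMeasure B
      ≤ ∫ x, (2 * Real.exp (fn v x) ^ 2 + 2 * Real.exp (fn w x) ^ 2) ∂cellMeasure B := by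
        refine integral_mono ((memLp_exp v).add (memLp_exp w)).integrable_sq
          ((i1.const_mul 2).add (i2.const_mul 2)) fun x => ?_
        simp only
        nlinarith [sq_nonneg (Real.exp (fn v x) - Real.exp (fn w x))]
    _ = 2 * ∫ x, Real.exp (fn v x) ^ 2 ∂cellMeasure B + 2 * ∫ x, Real.exp (fn w x) ^ 2 ∂cellMeasure B := by
        rw [integral_add (i1.const_mul 2) (i2.const_mul 2), integral_const_mul, integral_const_mul]
    _ ≤ 4 * C := by linarith [h v hv, h w hw]

/-- The pointwise Taylor remainder is at most `s² (exp (a + s) + exp a)`. Hölder's inequality with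
exponents `2, 4, 4` and the uniform `L²` bound for exponentials on balls make the remainder
quadratic in the norm. -/
lemma hasFDerivAt_expFun {h : Plane → ℝ} (hh : IsWeight B h) (w : W12 B) :
    HasFDerivAt (expFun B h) (expDer hh w) w := by
  obtain ⟨hm, K₀, hK0, hK⟩ := id hh
  obtain ⟨C₁, hC₁, h1⟩ := exists_sqrt_integral_exp_add_le B (‖w‖ + 1)
  obtain ⟨C₂, hC₂, h2⟩ := exists_sqrt_integral_fn_four_le B
  have hi : ∀ v : W12 B, Integrable (fun x => h x * Real.exp (fn v x)) (cellMeasure B) := fun v =>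
    (hh.memLp_mul_exp v).integrable (by norm_num)
  have key : ∀ v : W12 B, ‖v - w‖ ≤ 1 →
      ‖expFun B h v - expFun B h w - expDer hh w (v - w)‖ ≤ K₀ * (C₁ * C₂) * ‖v - w‖ ^ 2 := by
    intro v hv
    have hv' : ‖v‖ ≤ ‖w‖ + 1 := by
      have := norm_le_norm_add_norm_sub' v w
      linarith
    have i3 : Integrable (fun x => h x * Real.exp (fn w x) * fn (v - w) x) (cellMeasure B) :=
      (hh.memLp_mul_exp w).integrable_mul (memLp_fn _)
    have hF : MemLp (fun x => Real.exp (fn v x) + Real.exp (fn w x)) 2 (cellMeasure B) :=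
      (memLp_exp v).add (memLp_exp w)
    obtain ⟨i4, h4⟩ := integral_mul_mul_le hF (v - w) (v - w)
    have i5 : Integrable (fun x => h x * Real.exp (fn v x) - h x * Real.exp (fn w x))
      (cellMeasure B) := (hi v).sub (hi w)
    rw [expDer, pairL_apply, expFun, expFun, ← integral_sub (hi v) (hi w), ← integral_sub i5 i3]
    refine (norm_integral_le_integral_norm _).trans ?_
    calc ∫ x, ‖h x * Real.exp (fn v x) - h x * Real.exp (fn w x) -
          h x * Real.exp (fn w x) * fn (v - w) x‖ ∂cellMeasure B
        ≤ ∫ x, K₀ * (|Real.exp (fn v x) + Real.exp (fn w x)| *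
          (|fn (v - w) x| * |fn (v - w) x|)) ∂cellMeasure B := by
          refine integral_mono_ae (i5.sub i3).norm (i4.const_mul _) ?_
          filter_upwards [hK, fn_sub v w] with x hx hs
          have h5 := abs_exp_taylor_le (fn w x) (fn (v - w) x)
          rw [hs] at h5 ⊢
          rw [show fn w x + (fn v x - fn w x) = fn v x by ring] at h5
          rw [Real.norm_eq_abs, show h x * Real.exp (fn v x) - h x * Real.exp (fn w x) -
            h x * Real.exp (fn w x) * (fn v x - fn w x) = h x * (Real.exp (fn v x) -
              Real.exp (fn w x) - Real.exp (fn w x) * (fn v x - fn w x)) by ring, abs_mul]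
          rw [abs_of_pos (by positivity : 0 < Real.exp (fn v x) + Real.exp (fn w x)),
            abs_mul_abs_self, mul_comm (Real.exp (fn v x) + Real.exp (fn w x)), ← sq]
          gcongr
      _ ≤ K₀ * (√(∫ x, (Real.exp (fn v x) + Real.exp (fn w x)) ^ 2 ∂cellMeasure B) *
          (√√(∫ x, (fn (v - w) x ^ 2) ^ 2 ∂cellMeasure B) *
            √√(∫ x, (fn (v - w) x ^ 2) ^ 2 ∂cellMeasure B))) := by
          rw [integral_const_mul]
          gcongr
      _ ≤ K₀ * (C₁ * (C₂ * ‖v - w‖ ^ 2)) := by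
          rw [Real.mul_self_sqrt (Real.sqrt_nonneg _)]
          have := h1 v w hv' (by linarith)
          have := h2 (v - w)
          gcongr
      _ = _ := by ring
  have hO : (fun v => expFun B h v - expFun B h w - expDer hh w (v - w)) =O[nhds w]
      fun v => ‖v - w‖ ^ 2 := by
    refine Asymptotics.IsBigO.of_bound (K₀ * (C₁ * C₂)) ?_
    filter_upwards [Metric.closedBall_mem_nhds w one_pos] with v hv
    rw [norm_pow, norm_norm]
    exact key v (by rwa [mem_closedBall_iff_norm] at hv)
  have h3 := Asymptotics.IsBigO.hasFDerivAt (𝕜 := ℝ) hO (by norm_num)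
  have h5 := h3.add (((expDer hh w).hasFDerivAt (x := w)).const_add
    (expFun B h w - expDer hh w w))
  rw [zero_add] at h5
  refine h5.congr_of_eventuallyEq (Filter.Eventually.of_forall fun v => ?_)
  simp only [Pi.add_apply, map_sub]
  ring

end ChernSimonsHiggs
end

open MeasureTheory
open scoped ContDiff
noncomputable section
namespace ChernSimonsHiggs
variable {B : Module.Basis (Fin 2) ℝ Plane} {N : ℕ}

/-! ### Weak convergence and weakly continuous functionals -/

section
variable {H H' : Type*} [NormedAddCommGroup H] [InnerProductSpace ℝ H]
  [NormedAddCommGroup H'] [InnerProductSpace ℝ H']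

/-- Bounded weak convergence along a filter. -/
structure WeakTendsto (v : ℕ → H) (l : Filter ℕ) (z : H) : Prop where
  bdd : ∃ R, ∀ᶠ n in l, ‖v n‖ ≤ R
  tendsto_inner : ∀ φ, Filter.Tendsto (fun n => inner ℝ (v n) φ) l (nhds (inner ℝ z φ))

/-- Continuously differentiable functionals whose derivative is Lipschitz on balls, and which are
weakly continuous together with the derivative. -/
structure IsNice (G : H → ℝ) (G' : H → H →L[ℝ] ℝ) : Prop where
  hasFDerivAt : ∀ v, HasFDerivAt G (G' v) v
  lip : ∀ R, ∃ L, ∀ v w, ‖v‖ ≤ R → ‖w‖ ≤ R → ‖G' v - G' w‖ ≤ L * ‖v - w‖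
  tendsto : ∀ {v : ℕ → H} {l : Filter ℕ} {z : H}, WeakTendsto v l z →
    Filter.Tendsto (fun n => G (v n)) l (nhds (G z))
  tendsto_deriv : ∀ {v : ℕ → H} {l : Filter ℕ} {z : H}, WeakTendsto v l z →
    Filter.Tendsto (fun n => G' (v n)) l (nhds (G' z))

lemma WeakTendsto.map [CompleteSpace H] [CompleteSpace H'] {v : ℕ → H} {l : Filter ℕ} {z : H}
    (h : WeakTendsto v l z) (T : H →L[ℝ] H') : WeakTendsto (fun n => T (v n)) l (T z) := by
  obtain ⟨⟨R, hR⟩, h2⟩ := h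
  refine ⟨⟨‖T‖ * R, ?_⟩, fun φ => ?_⟩
  · filter_upwards [hR] with n hn
    exact (T.le_opNorm _).trans (by gcongr)
  · simpa only [ContinuousLinearMap.adjoint_inner_right] using h2 (ContinuousLinearMap.adjoint T φ)

lemma WeakTendsto.apply [CompleteSpace H] {v : ℕ → H} {l : Filter ℕ} {z : H}
    (h : WeakTendsto v l z) (T : H →L[ℝ] ℝ) :
    Filter.Tendsto (fun n => T (v n)) l (nhds (T z)) := by
  have e : ∀ w, inner ℝ w ((InnerProductSpace.toDual ℝ H).symm T) = T w := fun w => by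
    rw [real_inner_comm, InnerProductSpace.toDual_symm_apply]
  simpa only [e] using h.tendsto_inner ((InnerProductSpace.toDual ℝ H).symm T)

lemma WeakTendsto.sub {v : ℕ → H} {l : Filter ℕ} {z : H} (h : WeakTendsto v l z) :
    WeakTendsto (fun n => v n - z) l 0 := by
  obtain ⟨⟨R, hR⟩, h2⟩ := h
  refine ⟨⟨R + ‖z‖, ?_⟩, fun φ => ?_⟩
  · filter_upwards [hR] with n hn
    exact (norm_sub_le _ _).trans (by gcongr)
  · simp only [inner_sub_left, inner_zero_left]
    simpa using (h2 φ).sub_const (inner ℝ z φ)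

/-- Bounded sequences converge weakly along ultrafilters. -/
lemma exists_weakTendsto [CompleteSpace H] {v : ℕ → H} {l : Ultrafilter ℕ} {R : ℝ}
    (h : ∀ᶠ n in l, ‖v n‖ ≤ R) : ∃ z, WeakTendsto v l z ∧ ‖z‖ ≤ R := by
  have hc := WeakDual.isCompact_closedBall (𝕜 := ℝ) (E := H) 0 R
  let T : H → WeakDual ℝ H := fun w => StrongDual.toWeakDual (InnerProductSpace.toDual ℝ H w)
  have hT : ((l.map fun n => T (v n) : Ultrafilter (WeakDual ℝ H)) : Filter (WeakDual ℝ H)) ≤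
      Filter.principal (WeakDual.toStrongDual ⁻¹' Metric.closedBall 0 R) := by
    rw [Filter.le_principal_iff]
    refine Filter.mem_map.2 ?_
    filter_upwards [h] with n hn
    simp [T, hn]
  obtain ⟨f, hf, hlim⟩ := hc.ultrafilter_le_nhds _ hT
  have hf' : ‖WeakDual.toStrongDual f‖ ≤ R := by simpa using hf
  refine ⟨(InnerProductSpace.toDual ℝ H).symm (WeakDual.toStrongDual f), ⟨⟨R, h⟩, fun φ => ?_⟩, ?_⟩
  · have h1 : Filter.Tendsto (fun n => T (v n)) l (nhds f) := hlim
    have h2 := ((WeakDual.eval_continuous φ).tendsto f).comp h1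
    rw [InnerProductSpace.toDual_symm_apply]
    exact h2
  · rw [LinearIsometryEquiv.norm_map]
    exact hf'

lemma IsNice.const_mul {G : H → ℝ} {G' : H → H →L[ℝ] ℝ} (h : IsNice G G') (c : ℝ) :
    IsNice (fun v => c * G v) (fun v => c • G' v) where
  hasFDerivAt v := (h.hasFDerivAt v).const_mul c
  lip R := by
    obtain ⟨L, hL⟩ := h.lip R
    refine ⟨|c| * L, fun v w hv hw => ?_⟩
    have e : c • G' v - c • G' w = c • (G' v - G' w) := by ext x; simp [mul_sub]
    rw [e, norm_smul, mul_assoc]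
    exact mul_le_mul_of_nonneg_left (hL v w hv hw) (norm_nonneg _)
  tendsto hv := (h.tendsto hv).const_mul c
  tendsto_deriv hv := (h.tendsto_deriv hv).const_smul c

lemma IsNice.add {G F : H → ℝ} {G' F' : H → H →L[ℝ] ℝ} (h : IsNice G G') (k : IsNice F F') :
    IsNice (fun v => G v + F v) (fun v => G' v + F' v) where
  hasFDerivAt v := (h.hasFDerivAt v).add (k.hasFDerivAt v)
  lip R := by
    obtain ⟨L, hL⟩ := h.lip R
    obtain ⟨L', hL'⟩ := k.lip R
    refine ⟨L + L', fun v w hv hw => ?_⟩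
    rw [add_sub_add_comm, add_mul]
    exact (norm_add_le _ _).trans (add_le_add (hL v w hv hw) (hL' v w hv hw))
  tendsto hv := (h.tendsto hv).add (k.tendsto hv)
  tendsto_deriv hv := (h.tendsto_deriv hv).add (k.tendsto_deriv hv)

lemma IsNice.const (c : ℝ) : IsNice (fun _ : H => c) (fun _ => 0) where
  hasFDerivAt v := hasFDerivAt_const c v
  lip R := ⟨0, fun v w _ _ => by simp⟩
  tendsto _ := tendsto_const_nhds
  tendsto_deriv _ := tendsto_const_nhds

lemma IsNice.sum {ι : Type*} (s : Finset ι) {G : ι → H → ℝ} {G' : ι → H → H →L[ℝ] ℝ}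
    (h : ∀ i ∈ s, IsNice (G i) (G' i)) :
    IsNice (fun v => ∑ i ∈ s, G i v) (fun v => ∑ i ∈ s, G' i v) := by
  classical
  induction s using Finset.induction_on with
  | empty => simpa using IsNice.const (H := H) 0
  | insert i s hi ih =>
    simp only [Finset.sum_insert hi]
    exact (h i (Finset.mem_insert_self _ _)).add (ih fun j hj => h j (Finset.mem_insert_of_mem hj))

lemma IsNice.linear [CompleteSpace H] (T : H →L[ℝ] ℝ) : IsNice (fun v => T v) (fun _ => T) where
  hasFDerivAt v := T.hasFDerivAt
  lip R := ⟨0, fun v w _ _ => by simp⟩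
  tendsto hv := hv.apply T
  tendsto_deriv _ := tendsto_const_nhds

lemma IsNice.comp [CompleteSpace H] [CompleteSpace H'] {G : H' → ℝ} {G' : H' → H' →L[ℝ] ℝ}
    (h : IsNice G G') (T : H →L[ℝ] H') : IsNice (fun v => G (T v)) (fun v => (G' (T v)).comp T) where
  hasFDerivAt v := (h.hasFDerivAt (T v)).comp v T.hasFDerivAt
  lip R := by
    obtain ⟨L, hL⟩ := h.lip (‖T‖ * R)
    refine ⟨|L| * ‖T‖ * ‖T‖, fun v w hv hw => ?_⟩
    have h1 : ∀ {u : H}, ‖u‖ ≤ R → ‖T u‖ ≤ ‖T‖ * R := fun hu => (T.le_opNorm _).trans (by gcongr)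
    have h2 := hL _ _ (h1 hv) (h1 hw)
    rw [← ContinuousLinearMap.sub_comp]
    refine (ContinuousLinearMap.opNorm_comp_le _ _).trans ?_
    calc ‖G' (T v) - G' (T w)‖ * ‖T‖ ≤ (|L| * ‖T v - T w‖) * ‖T‖ := by
          gcongr
          refine h2.trans ?_
          gcongr
          exact le_abs_self L
      _ ≤ (|L| * (‖T‖ * ‖v - w‖)) * ‖T‖ := by
          gcongr
          rw [← map_sub]
          exact T.le_opNorm _
      _ = _ := by ring
  tendsto hv := h.tendsto (hv.map T)
  tendsto_deriv hv := by
    have h1 := h.tendsto_deriv (hv.map T)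
    exact ((ContinuousLinearMap.compL ℝ H H' ℝ).flip T).continuous.tendsto _ |>.comp h1

lemma IsNice.congr {G F : H → ℝ} {G' : H → H →L[ℝ] ℝ} (h : IsNice G G') (e : ∀ v, F v = G v) :
    IsNice F G' := by
  have : F = G := funext e
  rwa [this]

end

/-! ### The exponential integral is weakly continuous -/

/-- The `L⁴` norm. -/
def norm4 (w : W12 B) : ℝ := √√(∫ x, (fn w x ^ 2) ^ 2 ∂cellMeasure B)

lemma norm4_nonneg (w : W12 B) : 0 ≤ norm4 w := Real.sqrt_nonneg _

lemma exists_norm4_le (B : Module.Basis (Fin 2) ℝ Plane) : ∃ C, 0 < C ∧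
    ∀ w : W12 B, norm4 w ≤ C * ‖w‖ := by
  obtain ⟨C, hC, h⟩ := exists_sqrt_integral_fn_four_le B
  refine ⟨√C, by positivity, fun w => ?_⟩
  refine Real.sqrt_le_iff.2 ⟨by positivity, (h w).trans (le_of_eq ?_)⟩
  rw [mul_pow, Real.sq_sqrt hC.le]

lemma WeakTendsto.tendsto_integral_sq {v : ℕ → W12 B} {l : Filter ℕ} {z : W12 B}
    (h : WeakTendsto v l z) :
    Filter.Tendsto (fun n => ∫ x, fn (v n - z) x ^ 2 ∂cellMeasure B) l (nhds 0) := by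
  obtain ⟨⟨R, hR⟩, h2⟩ := h.sub
  exact tendsto_integral_sq_of_weak hR (by simpa using h2)

/-- Interpolation: `∫ w⁴ ≤ ‖w‖₂ ‖w‖₆³`, where the `L²` norm tends to zero by Rellich compactness and
the `L⁶` norm stays bounded. -/
lemma WeakTendsto.tendsto_norm4 {v : ℕ → W12 B} {l : Filter ℕ} {z : W12 B}
    (h : WeakTendsto v l z) : Filter.Tendsto (fun n => norm4 (v n - z)) l (nhds 0) := by
  obtain ⟨C, hC, hp⟩ := exists_integral_pow_le B 6
  obtain ⟨⟨R, hR⟩, -⟩ := h.sub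
  have h1 : Filter.Tendsto (fun n => √√(√(∫ x, fn (v n - z) x ^ 2 ∂cellMeasure B) * √(C * R ^ 6))) l
      (nhds 0) := by
    have := ((h.tendsto_integral_sq.sqrt.mul_const (√(C * R ^ 6))).sqrt).sqrt
    simpa using this
  refine squeeze_zero' (Filter.Eventually.of_forall fun n => norm4_nonneg _) ?_ h1
  filter_upwards [hR] with n hn
  refine Real.sqrt_le_sqrt (Real.sqrt_le_sqrt ?_)
  set w := v n - z
  have hw3 : MemLp (fun x => fn w x ^ 3) 2 (cellMeasure B) := by
    have hm : AEStronglyMeasurable (fun x => fn w x ^ 3) (cellMeasure B) := (memLp_fn w).1.pow 3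
    rw [memLp_two_iff_integrable_sq hm]
    refine (hp w).1.congr (Filter.Eventually.of_forall fun x => ?_)
    simp only
    rw [← pow_mul]
    exact Even.pow_abs (by decide) _
  have h2 := integral_abs_mul_abs_le (memLp_fn w) hw3
  have e1 : ∫ x, (fn w x ^ 2) ^ 2 ∂cellMeasure B = ∫ x, |fn w x| * |fn w x ^ 3| ∂cellMeasure B := by
    refine integral_congr_ae (Filter.Eventually.of_forall fun x => ?_)
    simp only
    rw [← abs_mul, ← pow_succ', abs_of_nonneg (Even.pow_nonneg (by decide) _)]
    ring
  have e2 : ∫ x, (fn w x ^ 3) ^ 2 ∂cellMeasure B = ∫ x, |fn w x| ^ 6 ∂cellMeasure B := by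
    refine integral_congr_ae (Filter.Eventually.of_forall fun x => ?_)
    simp only
    rw [← pow_mul]
    exact (Even.pow_abs (by decide) _).symm
  rw [e1]
  refine h2.trans ?_
  rw [e2]
  have h3 : ∫ x, |fn w x| ^ 6 ∂cellMeasure B ≤ C * R ^ 6 := (hp w).2.trans (by gcongr)
  gcongr

/-- The bound by the `L⁴` norm of the difference, instead of its Sobolev norm, serves twice: it
implies the Lipschitz property on balls, and it implies weak continuity of the derivative, since
`L⁴` norms of weakly null sequences tend to zero. -/
lemma exists_norm_expDer_sub_le {h : Plane → ℝ} (hh : IsWeight B h) (R : ℝ) : ∃ C, 0 ≤ C ∧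
    ∀ v w : W12 B, ‖v‖ ≤ R → ‖w‖ ≤ R → ‖expDer hh v - expDer hh w‖ ≤ C * norm4 (v - w) := by
  obtain ⟨hm, K₀, hK0, hK⟩ := id hh
  obtain ⟨C₁, hC₁, h1⟩ := exists_sqrt_integral_exp_add_le B R
  obtain ⟨C₂, hC₂, h2⟩ := exists_norm4_le B
  refine ⟨K₀ * C₁ * C₂, by positivity, fun v w hv hw => ?_⟩
  have hn := norm4_nonneg (v - w)
  refine ContinuousLinearMap.opNorm_le_bound _ (by positivity) fun φ => ?_
  have hF : MemLp (fun x => Real.exp (fn v x) + Real.exp (fn w x)) 2 (cellMeasure B) :=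
    (memLp_exp v).add (memLp_exp w)
  obtain ⟨i4, h4⟩ := integral_mul_mul_le hF (v - w) φ
  have iv : Integrable (fun x => h x * Real.exp (fn v x) * fn φ x) (cellMeasure B) :=
    (hh.memLp_mul_exp v).integrable_mul (memLp_fn _)
  have iw : Integrable (fun x => h x * Real.exp (fn w x) * fn φ x) (cellMeasure B) :=
    (hh.memLp_mul_exp w).integrable_mul (memLp_fn _)
  rw [sub_apply, expDer, expDer, pairL_apply, pairL_apply, ← integral_sub iv iw]
  refine (norm_integral_le_integral_norm _).trans ?_
  calc ∫ x, ‖h x * Real.exp (fn v x) * fn φ x - h x * Real.exp (fn w x) * fn φ x‖ ∂cellMeasure B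
      ≤ ∫ x, K₀ * (|Real.exp (fn v x) + Real.exp (fn w x)| * (|fn (v - w) x| * |fn φ x|))
        ∂cellMeasure B := by
        refine integral_mono_ae (iv.sub iw).norm (i4.const_mul _) ?_
        filter_upwards [hK, fn_sub v w] with x hx hs
        have h5 := abs_exp_sub_exp_le (fn v x) (fn w x)
        rw [hs, Real.norm_eq_abs, show h x * Real.exp (fn v x) * fn φ x -
          h x * Real.exp (fn w x) * fn φ x = h x * ((Real.exp (fn v x) - Real.exp (fn w x)) * fn φ x)
            by ring, abs_mul, abs_mul,
          abs_of_pos (by positivity : 0 < Real.exp (fn v x) + Real.exp (fn w x)), ← mul_assoc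
            (Real.exp (fn v x) + Real.exp (fn w x)), mul_comm (Real.exp (fn v x) + Real.exp (fn w x))]
        gcongr
    _ = K₀ * ∫ x, |Real.exp (fn v x) + Real.exp (fn w x)| * (|fn (v - w) x| * |fn φ x|)
        ∂cellMeasure B := integral_const_mul _ _
    _ ≤ K₀ * (C₁ * (norm4 (v - w) * (C₂ * ‖φ‖))) := by
        have h5 := h1 v w hv hw
        have h6 := h2 φ
        gcongr
        refine h4.trans ?_
        change _ * (norm4 (v - w) * norm4 φ) ≤ _
        have := norm4_nonneg φ
        gcongr
    _ = _ := by ring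

lemma exists_abs_expFun_sub_le {h : Plane → ℝ} (hh : IsWeight B h) (R : ℝ) : ∃ C, 0 ≤ C ∧
    ∀ v w : W12 B, ‖v‖ ≤ R → ‖w‖ ≤ R →
      |expFun B h v - expFun B h w| ≤ C * √(∫ x, fn (v - w) x ^ 2 ∂cellMeasure B) := by
  obtain ⟨hm, K₀, hK0, hK⟩ := id hh
  obtain ⟨C₁, hC₁, h1⟩ := exists_sqrt_integral_exp_add_le B R
  refine ⟨K₀ * C₁, by positivity, fun v w hv hw => ?_⟩
  have hF : MemLp (fun x => Real.exp (fn v x) + Real.exp (fn w x)) 2 (cellMeasure B) :=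
    (memLp_exp v).add (memLp_exp w)
  have h4 := integral_abs_mul_abs_le hF (memLp_fn (v - w))
  have i4 : Integrable (fun x => |Real.exp (fn v x) + Real.exp (fn w x)| * |fn (v - w) x|)
      (cellMeasure B) := by
    have := (hF.integrable_mul (memLp_fn (v - w))).abs
    refine this.congr (Filter.Eventually.of_forall fun x => ?_)
    simp only [Pi.mul_apply, abs_mul]
  have hi : ∀ v : W12 B, Integrable (fun x => h x * Real.exp (fn v x)) (cellMeasure B) := fun v =>
    (hh.memLp_mul_exp v).integrable (by norm_num)
  rw [expFun, expFun, ← integral_sub (hi v) (hi w), ← Real.norm_eq_abs]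
  refine (norm_integral_le_integral_norm _).trans ?_
  calc ∫ x, ‖h x * Real.exp (fn v x) - h x * Real.exp (fn w x)‖ ∂cellMeasure B
      ≤ ∫ x, K₀ * (|Real.exp (fn v x) + Real.exp (fn w x)| * |fn (v - w) x|) ∂cellMeasure B := by
        refine integral_mono_ae ((hi v).sub (hi w)).norm (i4.const_mul _) ?_
        filter_upwards [hK, fn_sub v w] with x hx hs
        have h5 := abs_exp_sub_exp_le (fn v x) (fn w x)
        rw [hs, Real.norm_eq_abs, ← mul_sub, abs_mul,
          abs_of_pos (by positivity : 0 < Real.exp (fn v x) + Real.exp (fn w x)),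
          mul_comm (Real.exp (fn v x) + Real.exp (fn w x))]
        gcongr
    _ = K₀ * ∫ x, |Real.exp (fn v x) + Real.exp (fn w x)| * |fn (v - w) x| ∂cellMeasure B :=
        integral_const_mul _ _
    _ ≤ K₀ * (C₁ * √(∫ x, fn (v - w) x ^ 2 ∂cellMeasure B)) := by
        have h5 := h1 v w hv hw
        gcongr
        exact h4.trans (by gcongr)
    _ = _ := by ring

lemma isNice_expFun {h : Plane → ℝ} (hh : IsWeight B h) : IsNice (expFun B h) (expDer hh) where
  hasFDerivAt := hasFDerivAt_expFun hh
  lip R := by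
    obtain ⟨C, hC, h1⟩ := exists_norm_expDer_sub_le hh R
    obtain ⟨C₂, hC₂, h2⟩ := exists_norm4_le B
    refine ⟨C * C₂, fun v w hv hw => (h1 v w hv hw).trans ?_⟩
    rw [mul_assoc]
    have := h2 (v - w)
    gcongr
  tendsto {v l z} hv := by
    obtain ⟨R, hR⟩ := hv.bdd
    obtain ⟨C, hC, h1⟩ := exists_abs_expFun_sub_le hh (max R ‖z‖)
    rw [tendsto_iff_norm_sub_tendsto_zero]
    have h2 := hv.tendsto_integral_sq.sqrt.const_mul C
    rw [Real.sqrt_zero, mul_zero] at h2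
    refine squeeze_zero' (Filter.Eventually.of_forall fun n => norm_nonneg _) ?_ h2
    filter_upwards [hR] with n hn
    exact h1 _ _ (hn.trans (le_max_left _ _)) (le_max_right _ _)
  tendsto_deriv {v l z} hv := by
    obtain ⟨R, hR⟩ := hv.bdd
    obtain ⟨C, hC, h1⟩ := exists_norm_expDer_sub_le hh (max R ‖z‖)
    refine (tendsto_iff_norm_sub_tendsto_zero (E := W12 B →L[ℝ] ℝ)).2 ?_
    have h2 := hv.tendsto_norm4.const_mul C
    rw [mul_zero] at h2
    refine squeeze_zero' (Filter.Eventually.of_forall fun n => ?_) ?_ h2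
    · exact norm_nonneg (expDer hh (v n) - expDer hh z)
    filter_upwards [hR] with n hn
    exact h1 _ _ (hn.trans (le_max_left _ _)) (le_max_right _ _)

end ChernSimonsHiggs
end

open MeasureTheory
open scoped ContDiff
noncomputable section
namespace ChernSimonsHiggs
variable {B : Module.Basis (Fin 2) ℝ Plane} {N : ℕ}

/-! ### The Cartan matrix -/

lemma K_symm (j k : Fin N) : K N j k = K N k j := by
  have : (CartanMatrix.A N).IsSymm := by
    ext i j
    simp [CartanMatrix.A, Matrix.transpose_apply]
    grind
  simp only [K, Matrix.map_apply]
  rw [this.apply]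

lemma K_diag (j : Fin N) : K N j j = 2 := by simp [K, CartanMatrix.A]

lemma K_nonpos {j k : Fin N} (h : j ≠ k) : K N j k ≤ 0 := by
  simp only [K, CartanMatrix.A, Matrix.map_apply, Matrix.of_apply, if_neg h]
  split_ifs <;> simp

lemma abs_K_le (j k : Fin N) : |K N j k| ≤ 2 := by
  simp only [K, CartanMatrix.A, Matrix.map_apply, Matrix.of_apply]
  split_ifs <;> simp

lemma K_apply (i j : Fin N) : K N i j =
    if i = j then 2 else if i.val + 1 = j.val ∨ j.val + 1 = i.val then -1 else 0 := by
  simp only [K, CartanMatrix.A, Matrix.map_apply, Matrix.of_apply]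
  split_ifs <;> simp

/-- The squares come from the elimination of the tridiagonal matrix `K - 1/4`, whose successive
pivots are `7/4`, `33/28`, `119/132`, `305/476` and `231/1220`, all positive. The smallest
eigenvalue of `K` is `2 - 2 cos (π / (N + 1))`, which exceeds `1/4` for `N ≤ 5`. -/
lemma K_coercive (hN : N = 3 ∨ N = 4 ∨ N = 5) (x : Fin N → ℝ) :
    1 / 4 * ∑ j, x j ^ 2 ≤ ∑ j, ∑ k, K N j k * (x j * x k) := by
  rcases hN with rfl | rfl | rfl
  · simp [K_apply, Fin.sum_univ_three]
    nlinarith [sq_nonneg (x 0 - 4 / 7 * x 1), sq_nonneg (x 1 - 28 / 33 * x 2), sq_nonneg (x 2)]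
  · simp [K_apply, Fin.sum_univ_four]
    nlinarith [sq_nonneg (x 0 - 4 / 7 * x 1), sq_nonneg (x 1 - 28 / 33 * x 2),
      sq_nonneg (x 2 - 132 / 119 * x 3), sq_nonneg (x 3)]
  · simp [K_apply, Fin.sum_univ_five]
    nlinarith [sq_nonneg (x 0 - 4 / 7 * x 1), sq_nonneg (x 1 - 28 / 33 * x 2),
      sq_nonneg (x 2 - 132 / 119 * x 3), sq_nonneg (x 3 - 476 / 305 * x 4), sq_nonneg (x 4)]

/-- The adjugate Cartan matrix. -/
def adjK (N : ℕ) : Matrix (Fin N) (Fin N) ℤ := Matrix.of fun i j =>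
  ((min i.val j.val + 1 : ℕ) : ℤ) * ((N - max i.val j.val : ℕ) : ℤ)

lemma A_mul_adjK (hN : N = 3 ∨ N = 4 ∨ N = 5) (i j : Fin N) :
    ∑ k, CartanMatrix.A N i k * adjK N k j = if i = j then (N + 1 : ℤ) else 0 := by
  rcases hN with rfl | rfl | rfl <;> revert i j <;> decide

lemma adjK_pos (i j : Fin N) : 0 < adjK N i j := by
  simp only [adjK, Matrix.of_apply]
  have h1 := i.2
  have h2 := j.2
  have : 0 < N - max i.val j.val := by omega
  positivity

lemma K_mul_adj (hN : N = 3 ∨ N = 4 ∨ N = 5) :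
    K N * ((N + 1 : ℝ)⁻¹ • (adjK N).map (Int.cast : ℤ → ℝ)) = 1 := by
  ext i j
  have h := congrArg (Int.cast : ℤ → ℝ) (A_mul_adjK hN i j)
  push_cast at h
  rw [Matrix.mul_smul, Matrix.smul_apply, Matrix.mul_apply, Matrix.one_apply]
  simp only [K, Matrix.map_apply, smul_eq_mul]
  rw [h]
  have : (N + 1 : ℝ) ≠ 0 := by positivity
  split_ifs
  · simp [this]
  · simp

lemma A_eq (hN : N = 3 ∨ N = 4 ∨ N = 5) :
    A N = (N + 1 : ℝ)⁻¹ • (adjK N).map (Int.cast : ℤ → ℝ) :=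
  Matrix.inv_eq_right_inv (K_mul_adj hN)

lemma K_mul_A (hN : N = 3 ∨ N = 4 ∨ N = 5) : K N * A N = 1 := by
  rw [A_eq hN]; exact K_mul_adj hN

lemma A_mul_K (hN : N = 3 ∨ N = 4 ∨ N = 5) : A N * K N = 1 :=
  mul_eq_one_comm.1 (K_mul_A hN)

lemma A_pos (hN : N = 3 ∨ N = 4 ∨ N = 5) (i j : Fin N) : 0 < A N i j := by
  rw [A_eq hN, Matrix.smul_apply, Matrix.map_apply, smul_eq_mul]
  have : (0 : ℝ) < adjK N i j := by exact_mod_cast adjK_pos i j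
  positivity

lemma sum_K_mul_A (hN : N = 3 ∨ N = 4 ∨ N = 5) (i j : Fin N) :
    ∑ k, K N i k * A N k j = if i = j then 1 else 0 := by
  rw [← Matrix.mul_apply, K_mul_A hN, Matrix.one_apply]

lemma sum_A_mul_K (hN : N = 3 ∨ N = 4 ∨ N = 5) (i j : Fin N) :
    ∑ k, A N i k * K N k j = if i = j then 1 else 0 := by
  rw [← Matrix.mul_apply, A_mul_K hN, Matrix.one_apply]

lemma A_symm (j k : Fin N) : A N j k = A N k j := by
  have h : (K N).IsSymm := by ext j k; exact K_symm k j
  have h2 : (A N).IsSymm := h.inv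
  exact h2.apply k j

lemma pos_of_hN (hN : N = 3 ∨ N = 4 ∨ N = 5) : 0 < N := by omega

lemma r_pos (hN : N = 3 ∨ N = 4 ∨ N = 5) (j : Fin N) : 0 < r N j :=
  Finset.sum_pos (fun k _ => A_pos hN j k) ⟨j, Finset.mem_univ _⟩

/-- Here `r = A 1`, so that `K r = 1`. Thus `U = 1`, that is `y = r`, is the vacuum at which the
factors `(K y)ⱼ - 1` vanish. -/
lemma sum_K_mul_r (hN : N = 3 ∨ N = 4 ∨ N = 5) (i : Fin N) : ∑ k, K N i k * r N k = 1 := by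
  simp only [r, Finset.mul_sum]
  rw [Finset.sum_comm]
  simp [sum_K_mul_A hN]

lemma b_pos (hN : N = 3 ∨ N = 4 ∨ N = 5) {n : Fin N → ℕ} (hn : ∃ i, 0 < n i) (j : Fin N) :
    0 < b n j := by
  obtain ⟨i, hi⟩ := hn
  have h1 : 0 < ∑ k, A N j k * n k := by
    refine Finset.sum_pos' (fun k _ => ?_) ⟨i, Finset.mem_univ _, ?_⟩
    · exact mul_nonneg (A_pos hN j k).le (Nat.cast_nonneg _)
    · exact mul_pos (A_pos hN j i) (Nat.cast_pos.2 hi)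
  have := Real.pi_pos
  rw [b]
  positivity

lemma sum_K_mul_b (hN : N = 3 ∨ N = 4 ∨ N = 5) (n : Fin N → ℕ) (i : Fin N) :
    ∑ k, K N i k * b n k = 4 * Real.pi * n i := by
  have e : ∀ k, K N i k * b n k = ∑ l, 4 * Real.pi * (n l * (K N i k * A N k l)) := fun k => by
    rw [b, Finset.mul_sum, Finset.mul_sum]
    exact Finset.sum_congr rfl fun l _ => by ring
  simp only [e]
  rw [Finset.sum_comm]
  simp only [← Finset.mul_sum, sum_K_mul_A hN]
  simp

lemma M_apply (j k : Fin N) : M N j k = r N j * K N j k * r N k := by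
  simp [M, Matrix.diagonal_mul, Matrix.mul_diagonal]

/-- With `y = A x` the form becomes `yᵀ K y`, and `x = K y` bounds `x` by `y` since the entries of
`K` are at most `2` in modulus. -/
lemma exists_A_coercive (hN : N = 3 ∨ N = 4 ∨ N = 5) : ∃ α, 0 < α ∧ ∀ x : Fin N → ℝ,
    α * ∑ j, x j ^ 2 ≤ ∑ j, ∑ k, A N j k * (x j * x k) := by
  have hN0 : (0 : ℝ) < N := Nat.cast_pos.2 (pos_of_hN hN)
  refine ⟨1 / (16 * N ^ 2), by positivity, fun x => ?_⟩
  set y : Fin N → ℝ := fun j => ∑ k, A N j k * x k with hy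
  have hx : ∀ i, x i = ∑ k, K N i k * y k := fun i => by
    simp only [hy, Finset.mul_sum]
    rw [Finset.sum_comm]
    simp only [← mul_assoc, ← Finset.sum_mul, sum_K_mul_A hN]
    simp
  have h1 : ∑ j, ∑ k, A N j k * (x j * x k) = ∑ j, ∑ k, K N j k * (y j * y k) := by
    have e1 : ∑ j, ∑ k, A N j k * (x j * x k) = ∑ j, x j * y j := by
      refine Finset.sum_congr rfl fun j _ => ?_
      rw [hy, Finset.mul_sum]
      exact Finset.sum_congr rfl fun k _ => by ring
    rw [e1]
    refine Finset.sum_congr rfl fun j _ => ?_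
    rw [hx j, Finset.sum_mul]
    exact Finset.sum_congr rfl fun k _ => by ring
  have h2 := K_coercive hN y
  have h3 : ∀ i, x i ^ 2 ≤ 4 * N * ∑ k, y k ^ 2 := fun i => by
    have h4 := Finset.sum_mul_sq_le_sq_mul_sq Finset.univ (fun k => K N i k) y
    rw [← hx i] at h4
    refine h4.trans ?_
    gcongr
    calc ∑ k, K N i k ^ 2 ≤ ∑ k : Fin N, (4 : ℝ) := by
          refine Finset.sum_le_sum fun k _ => ?_
          have := abs_K_le i k
          rw [← sq_abs]
          nlinarith [abs_nonneg (K N i k)]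
      _ = 4 * N := by simp [mul_comm]
  have h4 : ∑ i, x i ^ 2 ≤ N * (4 * N * ∑ k, y k ^ 2) := by
    calc ∑ i, x i ^ 2 ≤ ∑ i : Fin N, 4 * N * ∑ k, y k ^ 2 := Finset.sum_le_sum fun i _ => h3 i
      _ = _ := by simp
  rw [h1]
  refine le_trans ?_ h2
  rw [div_mul_eq_mul_div, one_mul, div_le_iff₀ (by positivity)]
  linarith

end ChernSimonsHiggs
end

open MeasureTheory
open scoped ContDiff
noncomputable section
namespace ChernSimonsHiggs
variable {B : Module.Basis (Fin 2) ℝ Plane} {N : ℕ}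

/-! ### The action functional and its derivative -/

instance innerProductSpace_W12N : InnerProductSpace ℝ (W12N B N) :=
  PiLp.innerProductSpace (fun _ : Fin N => W12 B)

instance completeSpace_W12N : CompleteSpace (W12N B N) :=
  inferInstanceAs (CompleteSpace (PiLp 2 fun _ : Fin N => W12 B))

/-- Measurable functions that are bounded above. -/
def IsAdm (B : Module.Basis (Fin 2) ℝ Plane) (u₀ : Fin N → Plane → ℝ) : Prop :=
  (∀ j, AEStronglyMeasurable (u₀ j) (cellMeasure B)) ∧
    ∃ C, 0 ≤ C ∧ ∀ j, ∀ᵐ x ∂cellMeasure B, u₀ j x ≤ C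

/-- The components of an element of the product space. -/
def pr (B : Module.Basis (Fin 2) ℝ Plane) {N : ℕ} (j : Fin N) : W12N B N →L[ℝ] W12 B :=
  PiLp.proj 2 (fun _ : Fin N => W12 B) j

lemma pr_apply (j : Fin N) (v : W12N B N) : pr B j v = v j := rfl

lemma val_eq (v : W12N B N) (j : Fin N) : v.val j = fn (v j) := rfl

lemma grad_eq (v : W12N B N) (j : Fin N) : v.grad j = gr (v j) := rfl

/-- The mean value form, up to the area. -/
def intL (B : Module.Basis (Fin 2) ℝ Plane) : W12 B →L[ℝ] ℝ :=
  pairL (B := B) (h := fun _ => 1) (memLp_of_continuous continuous_const 2)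

lemma intL_apply (w : W12 B) : intL B w = ∫ x, fn w x ∂cellMeasure B := by
  simp [intL, pairL_apply]

lemma cellMeasure_univ (B : Module.Basis (Fin 2) ℝ Plane) :
    (cellMeasure B).real Set.univ = area B := by simp [area, Measure.real]

lemma integral_cst (c : ℝ) : ∫ _, c ∂cellMeasure B = area B * c := by
  rw [integral_const, cellMeasure_univ, smul_eq_mul]

section
variable {u₀ : Fin N → Plane → ℝ}

lemma IsAdm.isWeight (hu : IsAdm B u₀) (j : Fin N) : IsWeight B fun x => Real.exp (u₀ j x) := by
  obtain ⟨hm, C, hC, h⟩ := hu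
  refine ⟨Real.continuous_exp.comp_aestronglyMeasurable (hm j), Real.exp C, (Real.exp_pos _).le, ?_⟩
  filter_upwards [h j] with x hx
  rw [abs_of_pos (Real.exp_pos _)]
  exact Real.exp_le_exp.2 hx

lemma IsAdm.isWeight_add (hu : IsAdm B u₀) (j k : Fin N) :
    IsWeight B fun x => Real.exp (u₀ j x + u₀ k x) := by
  obtain ⟨hm, C, hC, h⟩ := hu
  refine ⟨Real.continuous_exp.comp_aestronglyMeasurable ((hm j).add (hm k)), Real.exp (C + C),
    (Real.exp_pos _).le, ?_⟩
  filter_upwards [h j, h k] with x hx hx'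
  rw [abs_of_pos (Real.exp_pos _)]
  exact Real.exp_le_exp.2 (add_le_add hx hx')

lemma U_eq (v : W12N B N) (j : Fin N) (x : Plane) :
    U u₀ v j x = Real.exp (u₀ j x) * Real.exp (fn (v j) x) := by
  rw [U, Real.exp_add]; rfl

lemma U_mul_U_ae (v : W12N B N) (j k : Fin N) :
    (fun x => U u₀ v j x * U u₀ v k x) =ᵐ[cellMeasure B]
      fun x => Real.exp (u₀ j x + u₀ k x) * Real.exp (fn (v j + v k) x) := by
  filter_upwards [fn_add (v j) (v k)] with x hx
  rw [U_eq, U_eq, hx, Real.exp_add, Real.exp_add]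
  ring

lemma U_pos (v : W12N B N) (j : Fin N) (x : Plane) : 0 < U u₀ v j x := Real.exp_pos _

lemma memLp_U (hu : IsAdm B u₀) (v : W12N B N) (j : Fin N) :
    MemLp (U u₀ v j) 2 (cellMeasure B) := by
  refine MemLp.ae_eq (Filter.Eventually.of_forall fun x => ?_) ((hu.isWeight j).memLp_mul_exp (v j))
  rw [U_eq]

lemma memLp_U_mul_U (hu : IsAdm B u₀) (v : W12N B N) (j k : Fin N) :
    MemLp (fun x => U u₀ v j x * U u₀ v k x) 2 (cellMeasure B) :=
  MemLp.ae_eq (U_mul_U_ae v j k).symm ((hu.isWeight_add j k).memLp_mul_exp (v j + v k))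

lemma integrable_U (hu : IsAdm B u₀) (v : W12N B N) (j : Fin N) :
    Integrable (U u₀ v j) (cellMeasure B) := (memLp_U hu v j).integrable (by norm_num)

lemma integrable_U_mul_U (hu : IsAdm B u₀) (v : W12N B N) (j k : Fin N) :
    Integrable (fun x => U u₀ v j x * U u₀ v k x) (cellMeasure B) :=
  (memLp_U_mul_U hu v j k).integrable (by norm_num)

lemma integral_U (v : W12N B N) (j : Fin N) : ∫ x, U u₀ v j x ∂cellMeasure B =
    expFun B (fun x => Real.exp (u₀ j x)) (pr B j v) := by
  simp only [U_eq, expFun, pr_apply]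

lemma integral_U_mul_U (v : W12N B N) (j k : Fin N) :
    ∫ x, U u₀ v j x * U u₀ v k x ∂cellMeasure B =
      expFun B (fun x => Real.exp (u₀ j x + u₀ k x)) ((pr B j + pr B k) v) :=
  integral_congr_ae (U_mul_U_ae v j k)

/-- The functions `yⱼ = rⱼ Uⱼ`. -/
def yy (u₀ : Fin N → Plane → ℝ) (v : W12N B N) (j : Fin N) (x : Plane) : ℝ := r N j * U u₀ v j x

/-- The nonlinearity `yⱼ ((K y)ⱼ - 1)`. -/
def dens (u₀ : Fin N → Plane → ℝ) (v : W12N B N) (j : Fin N) (x : Plane) : ℝ :=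
  yy u₀ v j x * ((∑ k, K N j k * yy u₀ v k x) - 1)

lemma dens_eq (v : W12N B N) (j : Fin N) (x : Plane) : dens u₀ v j x =
    (∑ k, M N j k * (U u₀ v j x * U u₀ v k x)) - r N j * U u₀ v j x := by
  simp only [dens, yy, M_apply, mul_sub, mul_one, Finset.mul_sum]
  congr 1
  exact Finset.sum_congr rfl fun k _ => by ring

lemma memLp_dens (hu : IsAdm B u₀) (v : W12N B N) (j : Fin N) :
    MemLp (dens u₀ v j) 2 (cellMeasure B) := by
  have h1 : MemLp (fun x => (∑ k, M N j k * (U u₀ v j x * U u₀ v k x)) - r N j * U u₀ v j x) 2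
      (cellMeasure B) :=
    (memLp_finsetSum _ fun k _ => (memLp_U_mul_U hu v j k).const_mul (M N j k)).sub
      ((memLp_U hu v j).const_mul (r N j))
  refine MemLp.ae_eq (Filter.Eventually.of_forall fun x => ?_) h1
  rw [dens_eq]

lemma integrable_mul_fn {f : Plane → ℝ} (hf : MemLp f 2 (cellMeasure B)) (w : W12 B) :
    Integrable (fun x => f x * fn w x) (cellMeasure B) := hf.integrable_mul (memLp_fn w)

lemma integral_dens_mul (hu : IsAdm B u₀) (v : W12N B N) (j : Fin N) (w : W12 B) :
    ∫ x, dens u₀ v j x * fn w x ∂cellMeasure B =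
      (∑ k, M N j k * ∫ x, U u₀ v j x * U u₀ v k x * fn w x ∂cellMeasure B) -
        r N j * ∫ x, U u₀ v j x * fn w x ∂cellMeasure B := by
  have i1 : ∀ k, Integrable (fun x => M N j k * (U u₀ v j x * U u₀ v k x * fn w x)) (cellMeasure B) :=
    fun k => (integrable_mul_fn (memLp_U_mul_U hu v j k) w).const_mul _
  have i2 : Integrable (fun x => r N j * (U u₀ v j x * fn w x)) (cellMeasure B) :=
    (integrable_mul_fn (memLp_U hu v j) w).const_mul _
  simp only [← integral_const_mul]
  rw [← integral_finsetSum _ fun k _ => i1 k, ← integral_sub (integrable_finsetSum _ fun k _ => i1 k) i2]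
  refine integral_congr_ae (Filter.Eventually.of_forall fun x => ?_)
  simp only [dens_eq, sub_mul, Finset.sum_mul]
  congr 1
  · exact Finset.sum_congr rfl fun k _ => by ring
  · ring

/-- The quadratic part of the action. -/
def quadL (B : Module.Basis (Fin 2) ℝ Plane) (N : ℕ) : W12N B N →L[ℝ] W12N B N →L[ℝ] ℝ :=
  ∑ j, ∑ k, A N j k • (dirL B).bilinearComp (pr B j) (pr B k)

lemma quadL_apply (v w : W12N B N) :
    quadL B N v w = ∑ j, ∑ k, A N j k * dirL B (v j) (w k) := by
  simp only [quadL, FunLike.coe_sum, Finset.sum_apply, smul_apply, smul_eq_mul,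
    ContinuousLinearMap.bilinearComp_apply, pr_apply]

lemma quadL_comm (v w : W12N B N) : quadL B N v w = quadL B N w v := by
  rw [quadL_apply, quadL_apply, Finset.sum_comm]
  refine Finset.sum_congr rfl fun j _ => Finset.sum_congr rfl fun k _ => ?_
  rw [A_symm, dirL_comm]

/-- The potential energy. -/
def potential (n : Fin N → ℕ) (u₀ : Fin N → Plane → ℝ) (lam : ℝ) (v : W12N B N) : ℝ :=
  lam / 2 * (∑ j, ∑ k, M N j k * ∫ x, (U u₀ v j x - 1) * (U u₀ v k x - 1) ∂cellMeasure B) +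
  ∑ j, b n j / area B * intL B (v j)

lemma memLp_U_sub_one (hu : IsAdm B u₀) (v : W12N B N) (j : Fin N) :
    MemLp (fun x => U u₀ v j x - 1) 2 (cellMeasure B) := (memLp_U hu v j).sub (memLp_const 1)

lemma integrable_U_sub_mul (hu : IsAdm B u₀) (v : W12N B N) (j k : Fin N) :
    Integrable (fun x => (U u₀ v j x - 1) * (U u₀ v k x - 1)) (cellMeasure B) :=
  (memLp_U_sub_one hu v j).integrable_mul (memLp_U_sub_one hu v k)

lemma action_eq (hu : IsAdm B u₀) (n : Fin N → ℕ) (lam : ℝ) (v : W12N B N) :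
    action n u₀ lam v = 1 / 2 * quadL B N v v + potential n u₀ lam v := by
  have i1 : ∀ j k, Integrable (fun x => A N j k * inner ℝ (gr (v j) x) (gr (v k) x)) (cellMeasure B) :=
    fun j k => (integrable_inner_gr _ _).const_mul _
  have i2 : ∀ j k, Integrable (fun x => M N j k * ((U u₀ v j x - 1) * (U u₀ v k x - 1)))
      (cellMeasure B) := fun j k => (integrable_U_sub_mul hu v j k).const_mul _
  have i3 : ∀ j, Integrable (fun x => b n j * fn (v j) x) (cellMeasure B) :=
    fun j => (integrable_fn _).const_mul _
  rw [action, potential, quadL_apply]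
  simp only [val_eq, grad_eq]
  rw [integral_finsetSum _ fun j _ => integrable_finsetSum _ fun k _ => i1 j k,
    integral_finsetSum _ fun j _ => integrable_finsetSum _ fun k _ => i2 j k,
    integral_finsetSum _ fun j _ => i3 j]
  simp only [fun j => integral_finsetSum Finset.univ fun k (_ : k ∈ Finset.univ) => i1 j k,
    fun j => integral_finsetSum Finset.univ fun k (_ : k ∈ Finset.univ) => i2 j k,
    integral_const_mul, dirL_apply, intL_apply]
  rw [add_assoc]
  congr 2
  rw [Finset.mul_sum]
  exact Finset.sum_congr rfl fun j _ => by ring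

/-- The derivative of the potential energy. -/
def potentialDer (hu : IsAdm B u₀) (n : Fin N → ℕ) (lam : ℝ) (v : W12N B N) : W12N B N →L[ℝ] ℝ :=
  ∑ j, (lam • (pairL (memLp_dens hu v j)).comp (pr B j) + (b n j / area B) • (intL B).comp (pr B j))

lemma potentialDer_apply (hu : IsAdm B u₀) (n : Fin N → ℕ) (lam : ℝ) (v φ : W12N B N) :
    potentialDer hu n lam v φ = ∑ j, (lam * ∫ x, dens u₀ v j x * fn (φ j) x ∂cellMeasure B +
      b n j / area B * intL B (φ j)) := by
  simp only [potentialDer, FunLike.coe_sum, Finset.sum_apply, add_apply, smul_apply, smul_eq_mul,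
    ContinuousLinearMap.comp_apply, pr_apply, pairL_apply]

lemma integral_U_sub_mul (hu : IsAdm B u₀) (v : W12N B N) (j k : Fin N) :
    ∫ x, (U u₀ v j x - 1) * (U u₀ v k x - 1) ∂cellMeasure B =
      ∫ x, U u₀ v j x * U u₀ v k x ∂cellMeasure B - ∫ x, U u₀ v j x ∂cellMeasure B -
        ∫ x, U u₀ v k x ∂cellMeasure B + area B := by
  have i1 := integrable_U_mul_U hu v j k
  have i2 : Integrable (fun x => U u₀ v j x * U u₀ v k x - U u₀ v j x) (cellMeasure B) :=
    i1.sub (integrable_U hu v j)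
  have i3 : Integrable (fun x => U u₀ v j x * U u₀ v k x - U u₀ v j x - U u₀ v k x) (cellMeasure B) :=
    i2.sub (integrable_U hu v k)
  have e : area B = ∫ x, (1 : ℝ) ∂cellMeasure B := by rw [integral_cst, mul_one]
  rw [e, ← integral_sub i1 (integrable_U hu v j), ← integral_sub i2 (integrable_U hu v k),
    ← integral_add i3 (integrable_const 1)]
  refine integral_congr_ae (Filter.Eventually.of_forall fun x => ?_)
  ring

lemma sum_M (hN : N = 3 ∨ N = 4 ∨ N = 5) (j : Fin N) : ∑ k, M N j k = r N j := by
  simp only [M_apply, mul_assoc, ← Finset.mul_sum, sum_K_mul_r hN, mul_one]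

lemma M_symm (j k : Fin N) : M N j k = M N k j := by
  rw [M_apply, M_apply, K_symm]; ring

/-- The derivative of `∫ Uⱼ`. -/
def intUDer (hu : IsAdm B u₀) (j : Fin N) (v : W12N B N) : W12N B N →L[ℝ] ℝ :=
  (expDer (hu.isWeight j) (pr B j v)).comp (pr B j)

/-- The derivative of `∫ Uⱼ Uₖ`. -/
def intUUDer (hu : IsAdm B u₀) (j k : Fin N) (v : W12N B N) : W12N B N →L[ℝ] ℝ :=
  (expDer (hu.isWeight_add j k) ((pr B j + pr B k) v)).comp (pr B j + pr B k)

lemma isNice_integral_U (hu : IsAdm B u₀) (j : Fin N) :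
    IsNice (fun v : W12N B N => ∫ x, U u₀ v j x ∂cellMeasure B) (intUDer hu j) :=
  ((isNice_expFun (hu.isWeight j)).comp (pr B j)).congr fun v => integral_U v j

lemma isNice_integral_U_mul_U (hu : IsAdm B u₀) (j k : Fin N) :
    IsNice (fun v : W12N B N => ∫ x, U u₀ v j x * U u₀ v k x ∂cellMeasure B) (intUUDer hu j k) :=
  ((isNice_expFun (hu.isWeight_add j k)).comp (pr B j + pr B k)).congr
    fun v => integral_U_mul_U v j k

lemma intUDer_apply (hu : IsAdm B u₀) (j : Fin N) (v φ : W12N B N) :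
    intUDer hu j v φ = ∫ x, U u₀ v j x * fn (φ j) x ∂cellMeasure B := by
  rw [intUDer, ContinuousLinearMap.comp_apply, expDer, pairL_apply]
  simp only [U_eq, pr_apply]

lemma intUUDer_apply (hu : IsAdm B u₀) (j k : Fin N) (v φ : W12N B N) :
    intUUDer hu j k v φ = ∫ x, U u₀ v j x * U u₀ v k x * fn (φ j) x ∂cellMeasure B +
        ∫ x, U u₀ v j x * U u₀ v k x * fn (φ k) x ∂cellMeasure B := by
  rw [intUUDer, ContinuousLinearMap.comp_apply, expDer, pairL_apply,
    ← integral_add (integrable_mul_fn (memLp_U_mul_U hu v j k) _)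
      (integrable_mul_fn (memLp_U_mul_U hu v j k) _)]
  refine integral_congr_ae ?_
  have ej : ∀ ψ : W12N B N, (pr B j + pr B k) ψ = ψ j + ψ k := fun ψ => rfl
  simp only [ej]
  filter_upwards [U_mul_U_ae (u₀ := u₀) v j k, fn_add (φ j) (φ k)] with x h h'
  rw [← h, h', mul_add]

/-- The derivative of `(Uⱼ - 1) (Uₖ - 1)` contains terms in both directions `j` and `k`. Symmetry of
`M` identifies them, and the row sums `∑ₖ Mⱼₖ = rⱼ` turn the linear terms into those of `dens`. -/
lemma sum_M_mul_eq (hN : N = 3 ∨ N = 4 ∨ N = 5) {P : Fin N → Fin N → Fin N → ℝ} (q : Fin N → ℝ)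
    (hP : ∀ i j k, P j k i = P k j i) :
    ∑ j, ∑ k, M N j k * (P j k j + P j k k + -1 * q j + -1 * q k) =
      2 * ∑ j, ((∑ k, M N j k * P j k j) - r N j * q j) := by
  have s1 : ∑ j, ∑ k, M N j k * P j k k = ∑ j, ∑ k, M N j k * P j k j := by
    rw [Finset.sum_comm]
    refine Finset.sum_congr rfl fun j _ => Finset.sum_congr rfl fun k _ => ?_
    rw [M_symm, hP]
  have s2 : ∑ j, ∑ k, M N j k * q j = ∑ j, r N j * q j :=
    Finset.sum_congr rfl fun j _ => by rw [← Finset.sum_mul, sum_M hN]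
  have s3 : ∑ j, ∑ k, M N j k * q k = ∑ j, r N j * q j := by
    rw [Finset.sum_comm, ← s2]
    refine Finset.sum_congr rfl fun j _ => Finset.sum_congr rfl fun k _ => by rw [M_symm]
  have : ∀ j k, M N j k * (P j k j + P j k k + -1 * q j + -1 * q k) =
    M N j k * P j k j + M N j k * P j k k - M N j k * q j - M N j k * q k := fun j k => by ring
  simp only [this, Finset.sum_add_distrib, Finset.sum_sub_distrib, s1, s2, s3]
  ring

lemma potentialDer_eq (hN : N = 3 ∨ N = 4 ∨ N = 5) (hu : IsAdm B u₀) (n : Fin N → ℕ) (lam : ℝ)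
    (v : W12N B N) : potentialDer hu n lam v =
      (lam / 2) • ∑ j, ∑ k, M N j k • (intUUDer hu j k v + (-1 : ℝ) • intUDer hu j v +
        (-1 : ℝ) • intUDer hu k v + 0) + ∑ j, (b n j / area B) • (intL B).comp (pr B j) := by
  ext φ
  rw [potentialDer_apply]
  simp only [FunLike.coe_sum, Finset.sum_apply, add_apply, smul_apply, smul_eq_mul,
    ContinuousLinearMap.comp_apply, pr_apply, add_zero, intUDer_apply, intUUDer_apply,
    integral_dens_mul hu]
  rw [Finset.sum_add_distrib, sum_M_mul_eq hN
    (P := fun j k i => ∫ x, U u₀ v j x * U u₀ v k x * fn (φ i) x ∂cellMeasure B)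
    (fun j => ∫ x, U u₀ v j x * fn (φ j) x ∂cellMeasure B)
    (fun i j k => by simp only [mul_comm (U u₀ v j _)]), ← Finset.mul_sum]
  ring

/-- After expansion the potential is a linear combination of `∫ Uⱼ Uₖ`, `∫ Uⱼ`, mean values and
constants. The first two are exponential integrals whose weights are bounded because `u⁰` is bounded
above. -/
lemma isNice_potential (hN : N = 3 ∨ N = 4 ∨ N = 5) (hu : IsAdm B u₀) (n : Fin N → ℕ) (lam : ℝ) :
    IsNice (potential (B := B) n u₀ lam) (potentialDer hu n lam) := by
  have h3 := ((IsNice.sum Finset.univ fun j _ => IsNice.sum Finset.univ fun k _ =>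
    ((((isNice_integral_U_mul_U hu j k).add ((isNice_integral_U hu j).const_mul (-1))).add
      ((isNice_integral_U hu k).const_mul (-1))).add
      (IsNice.const (area B))).const_mul (M N j k)).const_mul (lam / 2)).add
    (IsNice.sum Finset.univ fun j _ => (IsNice.linear ((intL B).comp (pr B j))).const_mul
      (b n j / area B))
  have e : potentialDer (B := B) hu n lam = _ := funext (potentialDer_eq hN hu n lam)
  rw [e]
  refine h3.congr fun v => ?_
  rw [potential]
  congr 2
  refine Finset.sum_congr rfl fun j _ => Finset.sum_congr rfl fun k _ => ?_
  rw [integral_U_sub_mul hu]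
  ring

end

end ChernSimonsHiggs
end

open MeasureTheory
open scoped ContDiff
noncomputable section
namespace ChernSimonsHiggs

/-! ### Variational functionals and the mountain pass theorem -/

section
variable {H : Type*} [NormedAddCommGroup H] [InnerProductSpace ℝ H]

/-- Functionals with a derivative that is Lipschitz on balls, weakly lower semicontinuous, and such
that weakly convergent sequences which are almost critical, or along which the functional is
continuous, converge strongly. -/
structure IsVariational (I : H → ℝ) (I' : H → H →L[ℝ] ℝ) : Prop where
  hasFDerivAt : ∀ v, HasFDerivAt I (I' v) v
  lip : ∀ R, ∃ L, ∀ v w, ‖v‖ ≤ R → ‖w‖ ≤ R → ‖I' v - I' w‖ ≤ L * ‖v - w‖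
  strong : ∀ {v : ℕ → H} {l : Filter ℕ} {z : H}, WeakTendsto v l z →
    Filter.Tendsto (fun n => ‖I' (v n)‖) l (nhds 0) → Filter.Tendsto v l (nhds z)
  lsc : ∀ {v : ℕ → H} {l : Filter ℕ} {z : H} {a : ℝ}, l.NeBot → WeakTendsto v l z →
    Filter.Tendsto (fun n => I (v n)) l (nhds a) →
      I z ≤ a ∧ (a ≤ I z → Filter.Tendsto v l (nhds z))

lemma tendsto_of_coercive {Q : H →L[ℝ] H →L[ℝ] ℝ} {p : H → ℝ} {α : ℝ} (hα : 0 < α)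
    (hQ : ∀ v, α * ‖v‖ ^ 2 ≤ Q v v + p v)
    {v : ℕ → H} {l : Filter ℕ} {z : H}
    (hp : Filter.Tendsto (fun n => p (v n - z)) l (nhds 0))
    (h : Filter.Tendsto (fun n => Q (v n - z) (v n - z)) l (nhds 0)) :
    Filter.Tendsto v l (nhds z) := by
  rw [tendsto_iff_norm_sub_tendsto_zero]
  have h1 : Filter.Tendsto (fun n => √(α⁻¹ * (Q (v n - z) (v n - z) + p (v n - z)))) l (nhds 0) := by
    have := ((h.add hp).const_mul α⁻¹).sqrt
    simpa using this
  refine squeeze_zero (fun n => norm_nonneg _) (fun n => ?_) h1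
  refine Real.le_sqrt_of_sq_le ?_
  rw [le_inv_mul_iff₀ hα]
  exact hQ _

/-- Everything follows from expanding `Q` at the weak limit. The number `Q (v n - z) (v n - z)` is
expressed through the derivative at `v n`, or through the value at `v n`, up to terms that tend to
zero by weak continuity of `G` and `G'`. Coercivity modulo `p` turns its convergence to zero into
strong convergence. -/
lemma isVariational_of_quadratic [CompleteSpace H] {Q : H →L[ℝ] H →L[ℝ] ℝ} {p : H → ℝ} {α : ℝ}
    (hα : 0 < α) (hQ : ∀ v, α * ‖v‖ ^ 2 ≤ Q v v + p v) (hQ0 : ∀ v, 0 ≤ Q v v)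
    (hQs : ∀ v w, Q v w = Q w v)
    (hp : ∀ {v : ℕ → H} {l : Filter ℕ} {z : H}, WeakTendsto v l z →
      Filter.Tendsto (fun n => p (v n - z)) l (nhds 0))
    {G : H → ℝ} {G' : H → H →L[ℝ] ℝ} (hG : IsNice G G') :
    IsVariational (fun v => 1 / 2 * Q v v + G v) (fun v => Q v + G' v) where
  hasFDerivAt v := by
    have h1 : HasFDerivAt (fun v => Q v v) (Q.precompR H v (ContinuousLinearMap.id ℝ H) +
        Q.precompL H (ContinuousLinearMap.id ℝ H) v) v :=
      Q.hasFDerivAt_of_bilinear (hasFDerivAt_id v) (hasFDerivAt_id v)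
    have h2 := (h1.const_mul (1 / 2)).add (hG.hasFDerivAt v)
    convert! h2 using 1
    ext w
    simp [ContinuousLinearMap.precompR, ContinuousLinearMap.precompL, hQs w v]
    ring
  lip R := by
    obtain ⟨L, hL⟩ := hG.lip R
    refine ⟨‖Q‖ + L, fun v w hv hw => ?_⟩
    rw [add_sub_add_comm, add_mul, ← map_sub]
    exact (norm_add_le _ _).trans (add_le_add (Q.le_opNorm _) (hL v w hv hw))
  strong {v l z} hv hI := by
    refine tendsto_of_coercive hα hQ (hp hv) ?_
    obtain ⟨R, hR⟩ := hv.sub.bdd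
    have e : ∀ n, Q (v n - z) (v n - z) = (Q (v n) + G' (v n)) (v n - z) -
        (G' (v n) - G' z) (v n - z) - G' z (v n - z) - Q z (v n - z) := fun n => by
      simp only [map_sub, add_apply, sub_apply]
      ring
    have hb : ∀ {T : ℕ → H →L[ℝ] ℝ}, Filter.Tendsto (fun n => ‖T n‖) l (nhds 0) →
        Filter.Tendsto (fun n => T n (v n - z)) l (nhds 0) := by
      intro T hT
      have h1 := hT.mul_const R
      rw [zero_mul] at h1
      refine squeeze_zero_norm' ?_ h1
      filter_upwards [hR] with n hn
      exact ((T n).le_opNorm _).trans (by gcongr)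
    have h1 := hb hI
    have h2 := hb (T := fun n => G' (v n) - G' z)
      (by
        have := ((hG.tendsto_deriv hv).sub_const (G' z)).norm
        rwa [sub_self, norm_zero] at this)
    have h3 := hv.sub.apply (G' z)
    have h4 := hv.sub.apply (Q z)
    simp_rw [e]
    simpa using ((h1.sub h2).sub h3).sub h4
  lsc {v l z a} hl hv ha := by
    have e : ∀ n, Q (v n - z) (v n - z) = 2 * ((1 / 2 * Q (v n) (v n) + G (v n)) -
        (1 / 2 * Q z z + G z) - (G (v n) - G z) - Q z (v n - z)) := fun n => by
      simp only [map_sub, sub_apply, hQs z (v n)]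
      ring
    have h1 : Filter.Tendsto (fun n => Q (v n - z) (v n - z)) l
        (nhds (2 * (a - (1 / 2 * Q z z + G z)))) := by
      simp_rw [e]
      refine Filter.Tendsto.const_mul 2 ?_
      have h2 := (hG.tendsto hv).sub_const (G z)
      have h3 := hv.sub.apply (Q z)
      simpa using ((ha.sub_const (1 / 2 * Q z z + G z)).sub h2).sub h3
    have h2 : 0 ≤ 2 * (a - (1 / 2 * Q z z + G z)) :=
      ge_of_tendsto h1 (Filter.Eventually.of_forall fun n => hQ0 _)
    refine ⟨by linarith, fun h => ?_⟩
    refine tendsto_of_coercive hα hQ (hp hv) ?_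
    rwa [show 2 * (a - (1 / 2 * Q z z + G z)) = 0 by linarith] at h1

namespace IsVariational
variable {I : H → ℝ} {I' : H → H →L[ℝ] ℝ}

lemma continuous (hI : IsVariational I I') : Continuous I :=
  continuous_iff_continuousAt.2 fun v => (hI.hasFDerivAt v).continuousAt

lemma continuous_deriv (hI : IsVariational I I') : Continuous I' := by
  refine continuous_iff_continuousAt.2 fun v => ?_
  obtain ⟨L, hL⟩ := hI.lip (‖v‖ + 1)
  refine (tendsto_iff_norm_sub_tendsto_zero (E := H →L[ℝ] ℝ)).2 ?_
  have h1 : Filter.Tendsto (fun w => L * ‖w - v‖) (nhds v) (nhds 0) := by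
    have : Continuous fun w => L * ‖w - v‖ := by fun_prop
    simpa using this.tendsto v
  refine squeeze_zero' (Filter.Eventually.of_forall fun w => ?_) ?_ h1
  · exact norm_nonneg (I' w - I' v)
  · filter_upwards [Metric.closedBall_mem_nhds v one_pos] with w hw
    refine hL w v ?_ (by linarith)
    rw [mem_closedBall_iff_norm] at hw
    have := norm_le_norm_add_norm_sub' w v
    linarith

/-- The mean value inequality for `I - I' u` on the ball of radius `‖d‖` around `u`. The Lipschitz
constant is taken on the ball of radius `R + 1`, since the increment has norm at most `1`. -/
lemma exists_descent (hI : IsVariational I I') (R : ℝ) : ∃ L, 0 < L ∧ ∀ u d, ‖u‖ ≤ R → ‖d‖ ≤ 1 →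
    I (u + d) ≤ I u + I' u d + L * ‖d‖ ^ 2 := by
  obtain ⟨L, hL⟩ := hI.lip (R + 1)
  refine ⟨|L| + 1, by positivity, fun u d hu hd => ?_⟩
  have h := (convex_closedBall u ‖d‖).norm_image_sub_le_of_norm_hasFDerivWithin_le' (f := I)
    (f' := I') (φ := I' u) (C := |L| * ‖d‖) (x := u) (y := u + d)
    (fun z _ => (hI.hasFDerivAt z).hasFDerivWithinAt) (fun z hz => ?_)
    (Metric.mem_closedBall_self (norm_nonneg _)) (by simp)
  · rw [add_sub_cancel_left, Real.norm_eq_abs] at h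
    have := le_abs_self (I (u + d) - I u - I' u d)
    nlinarith [sq_nonneg ‖d‖]
  · rw [mem_closedBall_iff_norm] at hz
    have h1 : ‖z‖ ≤ R + 1 := by
      have := norm_le_norm_add_norm_sub' z u
      linarith
    refine (hL z u h1 (by linarith)).trans ?_
    calc L * ‖z - u‖ ≤ |L| * ‖z - u‖ := by gcongr; exact le_abs_self L
      _ ≤ _ := by gcongr

end IsVariational

/-! ### A discrete pseudo-gradient deformation -/

variable {I : H → ℝ} {I' : H → H →L[ℝ] ℝ}

/-- A cut-off function. -/
def cutoff (a ε s : ℝ) : ℝ := max 0 (min 1 ((s - a) / ε))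

lemma cutoff_nonneg (a ε s : ℝ) : 0 ≤ cutoff a ε s := le_max_left _ _

lemma cutoff_le_one (a ε s : ℝ) : cutoff a ε s ≤ 1 := max_le zero_le_one (min_le_left _ _)

lemma cutoff_of_le {a ε s : ℝ} (hε : 0 < ε) (h : s ≤ a) : cutoff a ε s = 0 :=
  max_eq_left ((min_le_right _ _).trans (div_nonpos_of_nonpos_of_nonneg (by linarith) hε.le))

lemma cutoff_of_ge {a ε s : ℝ} (hε : 0 < ε) (h : a + ε ≤ s) : cutoff a ε s = 1 := by
  have : 1 ≤ (s - a) / ε := by rw [le_div_iff₀ hε]; linarith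
  rw [cutoff, min_eq_left this, max_eq_right zero_le_one]

lemma continuous_cutoff (a ε : ℝ) : Continuous (cutoff a ε) := by
  unfold cutoff; fun_prop

/-- The pseudo-gradient step. -/
def gradStep [CompleteSpace H] (I : H → ℝ) (I' : H → H →L[ℝ] ℝ) (c ε h : ℝ) (u : H) : H :=
  u - (h * cutoff (c - ε) (ε / 2) (I u) / max ‖I' u‖ ε) • (InnerProductSpace.toDual ℝ H).symm (I' u)

lemma continuous_gradStep [CompleteSpace H] (hI : IsVariational I I') (c h : ℝ) {ε : ℝ} (hε : 0 < ε) :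
    Continuous (gradStep I I' c ε h) := by
  have h1 := hI.continuous
  have h2 := hI.continuous_deriv
  refine continuous_id.sub (Continuous.smul ?_ ?_)
  · refine Continuous.div (continuous_const.mul ((continuous_cutoff _ _).comp h1))
      ((continuous_norm.comp h2).max continuous_const) fun u => ?_
    exact (lt_max_of_lt_right hε).ne'
  · exact (LinearIsometryEquiv.continuous _).comp h2

lemma gradStep_of_le [CompleteSpace H] {c ε h : ℝ} (hε : 0 < ε) {u : H} (hu : I u ≤ c - ε) :
    gradStep I I' c ε h u = u := by
  rw [gradStep, cutoff_of_le (by positivity) hu]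
  simp

lemma norm_gradStep_sub_le [CompleteSpace H] {c ε h : ℝ} (hε : 0 < ε) (hh : 0 ≤ h) (u : H) :
    ‖gradStep I I' c ε h u - u‖ ≤ h * cutoff (c - ε) (ε / 2) (I u) := by
  have h0 := cutoff_nonneg (c - ε) (ε / 2) (I u)
  have hm : 0 < max ‖I' u‖ ε := lt_max_of_lt_right hε
  rw [gradStep, sub_sub_cancel_left, norm_neg, norm_smul, LinearIsometryEquiv.norm_map,
    Real.norm_eq_abs, abs_of_nonneg (by positivity), div_mul_eq_mul_div, div_le_iff₀ hm]
  gcongr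
  exact le_max_left _ _

/-- A step of length `h χ` along the gradient lowers the linear part by `h χ ‖I' u‖ ≥ h χ ε`, and `L
h ≤ ε / 2` limits the quadratic error to half of this. The maximum in the denominator of the step
serves continuity only: where the cut-off is active the gradient has norm at least `ε`. -/
lemma apply_gradStep_le [CompleteSpace H] {c ε h L : ℝ} (hε : 0 < ε) (hh : 0 < h)
    (hLh : L * h ≤ ε / 2) (hL : 0 < L) {u : H} (hh1 : h ≤ 1)
    (hd : ∀ d, ‖d‖ ≤ 1 → I (u + d) ≤ I u + I' u d + L * ‖d‖ ^ 2)
    (hc : |I u - c| ≤ ε → ε ≤ ‖I' u‖) (hu : I u ≤ c + ε) :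
    I (gradStep I I' c ε h u) ≤ I u - h * cutoff (c - ε) (ε / 2) (I u) * (ε / 2) := by
  set χ := cutoff (c - ε) (ε / 2) (I u) with hχ
  have h0 : 0 ≤ χ := cutoff_nonneg _ _ _
  have h1 : χ ≤ 1 := cutoff_le_one _ _ _
  by_cases hlow : I u ≤ c - ε
  · rw [gradStep_of_le hε hlow, hχ, cutoff_of_le (by positivity) hlow]
    simp
  push Not at hlow
  have hg := hc (abs_le.2 ⟨by linarith, by linarith⟩)
  have hg0 : 0 < ‖I' u‖ := hε.trans_le hg
  set d := gradStep I I' c ε h u - u with hdd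
  have e1 : d = -((h * χ / ‖I' u‖) • (InnerProductSpace.toDual ℝ H).symm (I' u)) := by
    rw [hdd, gradStep, sub_sub_cancel_left, max_eq_left hg]
  have e2 : I' u d = -(h * χ * ‖I' u‖) := by
    have e3 : I' u ((InnerProductSpace.toDual ℝ H).symm (I' u)) = ‖I' u‖ ^ 2 := by
      rw [← InnerProductSpace.toDual_symm_apply, real_inner_self_eq_norm_sq,
        LinearIsometryEquiv.norm_map]
    rw [e1, map_neg, map_smul, e3, smul_eq_mul]
    field_simp
  have hdn : ‖d‖ ≤ h * χ := norm_gradStep_sub_le hε hh.le u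
  have hd1 : ‖d‖ ≤ 1 := hdn.trans (by nlinarith)
  have h3 := hd d hd1
  rw [show u + d = gradStep I I' c ε h u by rw [hdd]; abel] at h3
  rw [e2] at h3
  have h4 : ‖d‖ ^ 2 ≤ (h * χ) ^ 2 := by gcongr
  have h5 : L * ‖d‖ ^ 2 ≤ h * χ * (ε / 2) := by
    calc L * ‖d‖ ^ 2 ≤ L * (h * χ) ^ 2 := by gcongr
      _ = (L * h) * χ * (h * χ) := by ring
      _ ≤ (ε / 2) * 1 * (h * χ) := by gcongr
      _ = _ := by ring
  have h6 : h * χ * ε ≤ h * χ * ‖I' u‖ := by gcongr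
  linarith

end

end ChernSimonsHiggs
end

/-! ### The mountain pass theorem -/

open MeasureTheory
open scoped ContDiff
noncomputable section
namespace ChernSimonsHiggs

section
variable {H : Type*} [NormedAddCommGroup H] [InnerProductSpace ℝ H]
variable {I : H → ℝ} {I' : H → H →L[ℝ] ℝ}

lemma bddAbove_path (hI : IsVariational I I') {v e : H} (Γ : Path v e) :
    BddAbove (Set.range fun t : unitInterval => I (Γ t)) :=
  (isCompact_range (hI.continuous.comp Γ.continuous)).bddAbove

variable [CompleteSpace H]

/-- Below the minimax level there is no path, hence almost critical points exist. -/
lemma exists_almost_critical (hI : IsVariational I I') {v₀ e : H} {c : ℝ}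
    (hc : IsGLB (Set.range fun Γ : Path v₀ e => ⨆ t : unitInterval, I (Γ t)) c)
    (hv : I v₀ < c) (he : I e < c) {ε₀ : ℝ} (hε₀ : 0 < ε₀) :
    ∃ u, |I u - c| ≤ ε₀ ∧ ‖I' u‖ ≤ ε₀ := by
  by_contra! hcon
  -- With this `ε` both end points lie at level `c - ε` or below, where the step is the identity, so
  -- that the deformed curve joins the same points.
  obtain ⟨ε, hε, hεle, hεv, hεe⟩ : ∃ ε, 0 < ε ∧ ε ≤ ε₀ ∧ I v₀ ≤ c - ε ∧ I e ≤ c - ε := by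
    refine ⟨min ε₀ (min (c - I v₀) (c - I e)), ?_, min_le_left _ _, ?_, ?_⟩
    · exact lt_min hε₀ (lt_min (by linarith) (by linarith))
    · have := (min_le_right ε₀ (min (c - I v₀) (c - I e))).trans (min_le_left _ _)
      linarith
    · have := (min_le_right ε₀ (min (c - I v₀) (c - I e))).trans (min_le_right _ _)
      linarith
  have hcon' : ∀ u, |I u - c| ≤ ε → ε ≤ ‖I' u‖ := fun u hu =>
    hεle.trans (hcon u (hu.trans hεle)).le
  obtain ⟨Γ, hΓ⟩ : ∃ Γ : Path v₀ e, (⨆ t : unitInterval, I (Γ t)) < c + ε := by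
    by_contra! hno
    have : c + ε ≤ c := hc.2 (by rintro _ ⟨Γ, rfl⟩; exact hno Γ)
    linarith
  obtain ⟨R, hR⟩ := (isCompact_range Γ.continuous).isBounded.exists_norm_le
  have hR' : ∀ t, ‖Γ t‖ ≤ R := fun t => hR _ ⟨t, rfl⟩
  -- The `m` steps of length at most `h = 4 / m` move a point by at most `4`, which accounts for the
  -- radius `R + 4`. At a rate of `ε / 2` per unit of length they lower the level by `2 ε`, from `c
  -- + ε` to `c - ε`, unless the level `c - ε / 2` has been passed before.
  obtain ⟨L, hL, hdesc⟩ := hI.exists_descent (R + 4)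
  obtain ⟨m, hm⟩ := exists_nat_gt (8 * L / ε + 4)
  have hm0 : (0 : ℝ) < m := lt_trans (by positivity) hm
  set h : ℝ := 4 / m with hh
  have hh0 : 0 < h := by positivity
  have hmh : m * h = 4 := by rw [hh]; field_simp
  have hh1 : h ≤ 1 := by
    rw [hh, div_le_one hm0]
    have : 0 < 8 * L / ε := by positivity
    linarith
  have hLh : L * h ≤ ε / 2 := by
    have h1 : 8 * L / ε < m := by linarith
    rw [div_lt_iff₀ hε] at h1
    rw [hh, mul_div_assoc', div_le_iff₀ hm0]
    linarith
  set σ := gradStep I I' c ε h with hσ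
  have hσc : Continuous σ := continuous_gradStep hI c h hε
  have key : ∀ k : ℕ, k ≤ m → ∀ t, ‖σ^[k] (Γ t)‖ ≤ R + k * h ∧ I (σ^[k] (Γ t)) ≤ c + ε ∧
      (I (σ^[k] (Γ t)) ≤ c - ε / 2 ∨ I (σ^[k] (Γ t)) ≤ c + ε - k * h * (ε / 2)) := by
    intro k
    induction k with
    | zero =>
      intro _ t
      have h1 : I (Γ t) ≤ c + ε := (le_ciSup (bddAbove_path hI Γ) t).trans hΓ.le
      simpa using ⟨hR' t, h1, Or.inr h1⟩
    | succ k ih =>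
      intro hk t
      obtain ⟨a1, a2, a3⟩ := ih (by omega) t
      set u := σ^[k] (Γ t) with hu
      rw [Function.iterate_succ_apply', ← hu]
      have hkm : (k : ℝ) * h ≤ 4 := by
        rw [← hmh]
        have : (k : ℝ) ≤ m := by exact_mod_cast (by omega : k ≤ m)
        gcongr
      have hs := apply_gradStep_le (I := I) (I' := I') (c := c) hε hh0 hLh hL hh1 (u := u)
        (fun d hd => hdesc u d (by linarith) hd) (hcon' u) a2
      have h0 := cutoff_nonneg (c - ε) (ε / 2) (I u)
      have hp : 0 ≤ h * cutoff (c - ε) (ε / 2) (I u) * (ε / 2) := by positivity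
      have hle : I (σ u) ≤ I u := by rw [hσ]; linarith
      refine ⟨?_, hle.trans a2, ?_⟩
      · have h1 := norm_gradStep_sub_le (I := I) (I' := I') (c := c) hε hh0.le u
        have h2 := cutoff_le_one (c - ε) (ε / 2) (I u)
        have h3 : ‖σ u‖ ≤ ‖u‖ + ‖σ u - u‖ := norm_le_norm_add_norm_sub' _ _
        have h4 : h * cutoff (c - ε) (ε / 2) (I u) ≤ h := mul_le_of_le_one_right hh0.le h2
        push_cast
        rw [← hσ] at h1
        linarith
      · rcases le_total (I u) (c - ε / 2) with h1 | h1
        · exact Or.inl (hle.trans h1)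
        · rw [cutoff_of_ge (by positivity) (by linarith), mul_one] at hs
          rcases a3 with a3 | a3
          · exact Or.inl (hle.trans a3)
          · right
            push_cast
            rw [← hσ] at hs
            linarith
  have hfix : ∀ {w : H}, I w ≤ c - ε → σ^[m] w = w := fun hw =>
    Function.iterate_fixed (gradStep_of_le hε hw) m
  let Γ' : Path v₀ e := (Γ.map (hσc.iterate m)).cast (hfix hεv).symm (hfix hεe).symm
  have hΓ' : (⨆ t : unitInterval, I (Γ' t)) ≤ c - ε / 2 := by
    refine ciSup_le fun t => ?_
    obtain ⟨-, -, a⟩ := key m le_rfl t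
    change I (σ^[m] (Γ t)) ≤ _
    rcases a with a | a
    · exact a
    · rw [hmh] at a
      linarith
  have := hc.1 ⟨Γ', rfl⟩
  dsimp only at this
  linarith

/-- The mountain pass theorem for a local minimum that need not be strict. -/
theorem exists_mountainPass (hI : IsVariational I I') {v₀ e : H} (hmin : IsLocalMin I v₀)
    (he : I e < I v₀)
    (hPS : ∀ (v : ℕ → H) (c : ℝ), Filter.Tendsto (fun n => I (v n)) Filter.atTop (nhds c) →
      Filter.Tendsto (fun n => ‖I' (v n)‖) Filter.atTop (nhds 0) →
        ∃ R, ∀ᶠ n in (Filter.hyperfilter ℕ : Filter ℕ), ‖v n‖ ≤ R) :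
    ∃ v, v ≠ v₀ ∧ I' v = 0 ∧
      IsGLB (Set.range fun Γ : Path v₀ e => ⨆ t : unitInterval, I (Γ t)) (I v) := by
  set S := Set.range fun Γ : Path v₀ e => ⨆ t : unitInterval, I (Γ t) with hS
  have hlow : I v₀ ∈ lowerBounds S := by
    rintro _ ⟨Γ, rfl⟩
    have := le_ciSup (bddAbove_path hI Γ) 0
    rwa [Γ.source] at this
  have hne : S.Nonempty := ⟨_, PathConnectedSpace.somePath v₀ e, rfl⟩
  have hc := isGLB_csInf hne ⟨_, hlow⟩
  set c := sInf S with hcdef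
  have hle : I v₀ ≤ c := hc.2 hlow
  have hyp : (Filter.hyperfilter ℕ : Filter ℕ) ≤ Filter.atTop := by
    rw [← Nat.cofinite_eq_atTop]; exact Filter.hyperfilter_le_cofinite
  rcases hle.lt_or_eq with hlt | heq
  · have h1 : ∀ n : ℕ, ∃ u, |I u - c| ≤ 1 / (n + 1 : ℝ) ∧ ‖I' u‖ ≤ 1 / (n + 1 : ℝ) := fun n =>
      exists_almost_critical hI hc hlt (he.trans hlt) Nat.one_div_pos_of_nat
    choose u hu1 hu2 using h1
    have t1 : Filter.Tendsto (fun n => I (u n)) Filter.atTop (nhds c) := by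
      rw [tendsto_iff_norm_sub_tendsto_zero]
      exact squeeze_zero (fun n => norm_nonneg _) hu1 tendsto_one_div_add_atTop_nhds_zero_nat
    have t2 : Filter.Tendsto (fun n => ‖I' (u n)‖) Filter.atTop (nhds 0) :=
      squeeze_zero (fun n => norm_nonneg _) hu2 tendsto_one_div_add_atTop_nhds_zero_nat
    obtain ⟨R, hR⟩ := hPS u c t1 t2
    obtain ⟨z, hz, -⟩ := exists_weakTendsto (l := Filter.hyperfilter ℕ) hR
    have hs := hI.strong hz (t2.mono_left hyp)
    have h3 : I z = c := tendsto_nhds_unique ((hI.continuous.tendsto z).comp hs) (t1.mono_left hyp)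
    have h4 : ‖I' z‖ = 0 := tendsto_nhds_unique
      (((continuous_norm.comp hI.continuous_deriv).tendsto z).comp hs) (t2.mono_left hyp)
    refine ⟨z, fun hzv => ?_, norm_eq_zero.1 h4, h3 ▸ hc⟩
    rw [hzv] at h3
    linarith
  -- The degenerate case: the minimax level equals `I v₀`. Every path to `e` crosses the sphere of
  -- radius `δ / 2`, and paths of almost minimal height give points there with values tending to `I
  -- v₀`. Their weak limit stays in the ball where `v₀` is minimal, so lower semicontinuity holds
  -- with equality and the convergence is strong. The limit thus lies on the sphere, differs from
  -- `v₀`, and is again a local minimum.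
  · obtain ⟨δ, hδ, hball⟩ := Metric.eventually_nhds_iff.1 hmin
    have hed : δ ≤ dist e v₀ := by
      by_contra! hlt
      exact absurd (hball hlt) (not_le.2 he)
    have h1 : ∀ n : ℕ, ∃ z, dist z v₀ = δ / 2 ∧ I z ≤ c + 1 / (n + 1 : ℝ) := by
      intro n
      have hn : (0 : ℝ) < 1 / (n + 1 : ℝ) := Nat.one_div_pos_of_nat
      obtain ⟨Γ, hΓ⟩ : ∃ Γ : Path v₀ e, (⨆ t : unitInterval, I (Γ t)) < c + 1 / (n + 1 : ℝ) := by
        by_contra! hno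
        have : c + 1 / (n + 1 : ℝ) ≤ c := hc.2 (by rintro _ ⟨Γ, rfl⟩; exact hno Γ)
        linarith
      have hcont : Continuous fun t : unitInterval => dist (Γ t) v₀ := Γ.continuous.dist continuous_const
      obtain ⟨t, ht⟩ := mem_range_of_exists_le_of_exists_ge hcont (c := δ / 2)
        ⟨0, by rw [Γ.source, dist_self]; positivity⟩ ⟨1, by rw [Γ.target]; linarith⟩
      exact ⟨Γ t, ht, (le_ciSup (bddAbove_path hI Γ) t).trans hΓ.le⟩
    choose z hz1 hz2 using h1
    have hzI : ∀ n, I v₀ ≤ I (z n) := fun n => hball (by rw [hz1]; linarith)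
    have t1 : Filter.Tendsto (fun n => I (z n)) Filter.atTop (nhds (I v₀)) := by
      have h2 : Filter.Tendsto (fun n : ℕ => c + 1 / (n + 1 : ℝ)) Filter.atTop (nhds (I v₀)) := by
        have := (tendsto_one_div_add_atTop_nhds_zero_nat (𝕜 := ℝ)).const_add c
        rw [heq]
        simpa using this
      exact tendsto_of_tendsto_of_tendsto_of_le_of_le tendsto_const_nhds h2 hzI hz2
    obtain ⟨d, hd, hdn⟩ := exists_weakTendsto (l := Filter.hyperfilter ℕ) (v := fun n => z n - v₀)
      (R := δ / 2) (Filter.Eventually.of_forall fun n => by rw [← dist_eq_norm, hz1])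
    have hw : WeakTendsto z (Filter.hyperfilter ℕ) (d + v₀) := by
      refine ⟨⟨δ / 2 + ‖v₀‖, Filter.Eventually.of_forall fun n => ?_⟩, fun φ => ?_⟩
      · have h2 : ‖z n‖ ≤ ‖v₀‖ + ‖z n - v₀‖ := norm_le_norm_add_norm_sub' _ _
        rw [← dist_eq_norm, hz1] at h2
        linarith
      · have h2 := (hd.tendsto_inner φ).add_const (inner ℝ v₀ φ)
        simpa only [← inner_add_left, sub_add_cancel] using h2
    obtain ⟨l1, l2⟩ := hI.lsc (Ultrafilter.neBot _) hw (t1.mono_left hyp)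
    have hin : dist (d + v₀) v₀ < δ := by
      rw [dist_eq_norm, add_sub_cancel_right]; linarith
    have hge := hball hin
    have hs := l2 hge
    have hdist : dist (d + v₀) v₀ = δ / 2 := by
      refine tendsto_nhds_unique (hs.dist tendsto_const_nhds) ?_
      simp only [hz1]
      exact tendsto_const_nhds
    have hval : I (d + v₀) = I v₀ := le_antisymm l1 hge
    have hlm : IsLocalMin I (d + v₀) := by
      have : ∀ᶠ w in nhds (d + v₀), w ∈ Metric.ball v₀ δ := Metric.isOpen_ball.mem_nhds hin
      filter_upwards [this] with w hw
      rw [hval]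
      exact hball hw
    refine ⟨d + v₀, fun hEq => ?_, hlm.hasFDerivAt_eq_zero (hI.hasFDerivAt _), ?_⟩
    · rw [hEq, dist_self] at hdist
      linarith
    · rw [hval, heq]
      exact hc

end

end ChernSimonsHiggs
end

open MeasureTheory
open scoped ContDiff
noncomputable section
namespace ChernSimonsHiggs
variable {B : Module.Basis (Fin 2) ℝ Plane} {N : ℕ}

/-! ### The action functional is variational -/

lemma norm_sq_W12N (v : W12N B N) :
    ‖v‖ ^ 2 = ∑ j, (∫ x, fn (v j) x ^ 2 ∂cellMeasure B + dirL B (v j) (v j)) := by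
  rw [PiLp.norm_sq_eq_of_L2]
  refine Finset.sum_congr rfl fun j _ => ?_
  rw [norm_sq_eq, dirL_self]

lemma exists_quadL_coercive (hN : N = 3 ∨ N = 4 ∨ N = 5) : ∃ α, 0 < α ∧
    ∀ (B : Module.Basis (Fin 2) ℝ Plane) (v : W12N B N),
      α * ∑ j, dirL B (v j) (v j) ≤ quadL B N v v := by
  obtain ⟨α, hα, h⟩ := exists_A_coercive hN
  refine ⟨α, hα, fun B v => ?_⟩
  have i1 : ∀ j, Integrable (fun x => inner ℝ (gr (v j) x) (gr (v j) x)) (cellMeasure B) :=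
    fun j => integrable_inner_gr _ _
  have i2 : ∀ j k, Integrable (fun x => A N j k * inner ℝ (gr (v j) x) (gr (v k) x)) (cellMeasure B) :=
    fun j k => (integrable_inner_gr _ _).const_mul _
  have e1 : α * ∑ j, dirL B (v j) (v j) =
      ∫ x, α * ∑ j, inner ℝ (gr (v j) x) (gr (v j) x) ∂cellMeasure B := by
    rw [integral_const_mul, integral_finsetSum _ fun j _ => i1 j]
    simp only [dirL_apply]
  have e2 : quadL B N v v =
      ∫ x, ∑ j, ∑ k, A N j k * inner ℝ (gr (v j) x) (gr (v k) x) ∂cellMeasure B := by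
    rw [integral_finsetSum _ fun j _ => integrable_finsetSum _ fun k _ => i2 j k, quadL_apply]
    simp only [fun j => integral_finsetSum Finset.univ fun k (_ : k ∈ Finset.univ) => i2 j k,
      integral_const_mul, dirL_apply]
  rw [e1, e2]
  refine integral_mono ((integrable_finsetSum _ fun j _ => i1 j).const_mul α)
    (integrable_finsetSum _ fun j _ => integrable_finsetSum _ fun k _ => i2 j k) fun x => ?_
  have e3 : ∀ a c : Plane, inner ℝ a c = a 0 * c 0 + a 1 * c 1 := fun a c => by
    simp [PiLp.inner_apply, Fin.sum_univ_two, mul_comm]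
  simp only [e3]
  have h0 := h fun j => gr (v j) x 0
  have h1 := h fun j => gr (v j) x 1
  have := add_le_add h0 h1
  rw [← mul_add, ← Finset.sum_add_distrib, ← Finset.sum_add_distrib] at this
  refine le_trans (le_of_eq ?_) (this.trans (le_of_eq ?_))
  · congr 1
    exact Finset.sum_congr rfl fun j _ => by ring
  · refine Finset.sum_congr rfl fun j _ => ?_
    rw [← Finset.sum_add_distrib]
    exact Finset.sum_congr rfl fun k _ => by ring

/-- The derivative of the action. -/
def actionDer {u₀ : Fin N → Plane → ℝ} (hu : IsAdm B u₀) (n : Fin N → ℕ) (lam : ℝ) (v : W12N B N) :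
    W12N B N →L[ℝ] ℝ := quadL B N v + potentialDer hu n lam v

lemma actionDer_apply {u₀ : Fin N → Plane → ℝ} (hu : IsAdm B u₀) (n : Fin N → ℕ) (lam : ℝ)
    (v φ : W12N B N) : actionDer hu n lam v φ = ∑ j, ∑ k, A N j k * dirL B (v j) (φ k) +
      ∑ j, (lam * ∫ x, dens u₀ v j x * fn (φ j) x ∂cellMeasure B + b n j / area B * intL B (φ j)) := by
  rw [actionDer, add_apply, quadL_apply, potentialDer_apply]

lemma isVariational_action (hN : N = 3 ∨ N = 4 ∨ N = 5) {u₀ : Fin N → Plane → ℝ} (hu : IsAdm B u₀)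
    (n : Fin N → ℕ) (lam : ℝ) : IsVariational (action (B := B) n u₀ lam) (actionDer hu n lam) := by
  obtain ⟨α, hα, h⟩ := exists_quadL_coercive hN
  -- The form `quadL` controls gradients only. The `L²` part of the norm is put into the correction
  -- `p`, which tends to zero along weakly null sequences by Rellich compactness.
  have h1 := isVariational_of_quadratic (H := W12N B N) (Q := quadL B N)
    (p := fun v => α * ∑ j, ∫ x, fn (v j) x ^ 2 ∂cellMeasure B) hα (fun v => ?_) (fun v => ?_)
    quadL_comm ?_ (isNice_potential hN hu n lam)
  · have e : action (B := B) n u₀ lam = fun v => 1 / 2 * quadL B N v v + potential n u₀ lam v :=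
      funext fun v => action_eq hu n lam v
    rw [e]
    exact h1
  · rw [norm_sq_W12N, Finset.sum_add_distrib]
    linarith [h B v]
  · refine le_trans ?_ (h B v)
    exact mul_nonneg hα.le (Finset.sum_nonneg fun j _ => dirL_self_nonneg _)
  · intro v l z hv
    have h2 := (tendsto_finsetSum Finset.univ fun j (_ : j ∈ Finset.univ) =>
      (hv.map (pr B j)).tendsto_integral_sq).const_mul α
    rw [Finset.sum_const_zero, mul_zero] at h2
    exact h2

end ChernSimonsHiggs
end

open MeasureTheory
open scoped ContDiff
noncomputable section
namespace ChernSimonsHiggs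
variable {B : Module.Basis (Fin 2) ℝ Plane} {N : ℕ}

/-! ### Density of test functions and the chain rule -/

/-- The subspace of test functions. -/
def testSubmodule (B : Module.Basis (Fin 2) ℝ Plane) : Submodule ℝ (W12 B) where
  carrier := {w | ∃ (φ : Plane → ℝ) (h : IsTest B φ), w = ofTest h}
  zero_mem' := ⟨fun _ => 0, ⟨contDiff_const, fun _ _ => rfl⟩, eq_of_fn_ae_eq
    (fn_zero.trans (fn_ofTest _).symm)⟩
  add_mem' := by
    rintro _ _ ⟨φ, hφ, rfl⟩ ⟨ψ, hψ, rfl⟩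
    refine ⟨fun x => φ x + ψ x, ⟨hφ.1.add hψ.1, fun k x => ?_⟩, eq_of_fn_ae_eq ?_⟩
    · simp only [hφ.2 k x, hψ.2 k x]
    · refine Filter.EventuallyEq.trans ?_ (fn_ofTest _).symm
      filter_upwards [fn_add (ofTest hφ) (ofTest hψ), fn_ofTest hφ, fn_ofTest hψ] with x h1 h2 h3
      rw [h1, h2, h3]
  smul_mem' := by
    rintro c _ ⟨φ, hφ, rfl⟩
    refine ⟨fun x => c * φ x, ⟨contDiff_const.mul hφ.1, fun k x => ?_⟩, eq_of_fn_ae_eq ?_⟩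
    · simp only [hφ.2 k x]
    · refine Filter.EventuallyEq.trans ?_ (fn_ofTest _).symm
      filter_upwards [fn_smul c (ofTest hφ), fn_ofTest hφ] with x h1 h2
      rw [h1, h2]

/-- An element orthogonal to all cosines and sines has vanishing Fourier coefficients, hence is
zero. -/
lemma exists_tendsto_ofTest (w : W12 B) : ∃ (φ : ℕ → Plane → ℝ) (h : ∀ n, IsTest B (φ n)),
    Filter.Tendsto (fun n => ofTest (h n)) Filter.atTop (nhds w) := by
  have h1 : (testSubmodule B).topologicalClosure = ⊤ := by
    rw [Submodule.topologicalClosure_eq_top_iff, Submodule.eq_bot_iff]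
    intro z hz
    rw [Submodule.mem_orthogonal'] at hz
    refine eq_of_fn_ae_eq (ae_eq_of_coef (memLp_fn _) (memLp_fn _) (fun k => ?_) fun k => ?_)
    · have h2 := hz _ ⟨_, isTest_cosk (B := B) k, rfl⟩
      have h3 : (1 + mu B k) ≠ 0 := by have := mu_nonneg (B := B) k; positivity
      rw [inner_ofTest_cosk, mul_eq_zero, or_iff_right h3] at h2
      rw [h2, ca_congr fn_zero]
      simp [ca]
    · have h2 := hz _ ⟨_, isTest_sink (B := B) k, rfl⟩
      have h3 : (1 + mu B k) ≠ 0 := by have := mu_nonneg (B := B) k; positivity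
      rw [inner_ofTest_sink, mul_eq_zero, or_iff_right h3] at h2
      rw [h2, sa_congr fn_zero]
      simp [sa]
  have h2 : w ∈ closure (testSubmodule B : Set (W12 B)) := by
    rw [← Submodule.topologicalClosure_coe, h1]
    trivial
  obtain ⟨z, hz, hzw⟩ := mem_closure_iff_seq_limit.1 h2
  choose φ hφ e using hz
  refine ⟨φ, hφ, ?_⟩
  simpa only [← e] using hzw

lemma integral_abs_fn_le (w : W12 B) : ∫ x, |fn w x| ∂cellMeasure B ≤ √(area B) * ‖w‖ := by
  have h := integral_abs_mul_abs_le (memLp_fn w) (memLp_const (μ := cellMeasure B) (1 : ℝ))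
  simp only [abs_one, mul_one, one_pow, integral_cst] at h
  rw [mul_comm]
  refine h.trans ?_
  gcongr
  exact Real.sqrt_le_iff.2 ⟨norm_nonneg _, integral_sq_le_norm_sq w⟩

lemma memLp_norm_gr (w : W12 B) : MemLp (fun x => ‖gr w x‖) 2 (cellMeasure B) := (memLp_gr w).norm

lemma integral_norm_gr_le (w : W12 B) : ∫ x, ‖gr w x‖ ∂cellMeasure B ≤ √(area B) * ‖w‖ := by
  have h := integral_abs_mul_abs_le (memLp_norm_gr w) (memLp_const (μ := cellMeasure B) (1 : ℝ))
  simp only [abs_one, mul_one, one_pow, integral_cst, abs_norm] at h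
  rw [mul_comm]
  refine h.trans ?_
  gcongr
  exact Real.sqrt_le_iff.2 ⟨norm_nonneg _, integral_gr_sq_le_norm_sq w⟩

lemma integral_fn_mul_gr_le (w u : W12 B) :
    Integrable (fun x => |fn w x| * ‖gr u x‖) (cellMeasure B) ∧
    ∫ x, |fn w x| * ‖gr u x‖ ∂cellMeasure B ≤ ‖w‖ * ‖u‖ := by
  have h := integral_abs_mul_abs_le (memLp_fn w) (memLp_norm_gr u)
  simp only [abs_norm] at h
  refine ⟨(memLp_fn w).norm.integrable_mul (memLp_norm_gr u), h.trans ?_⟩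
  gcongr
  · exact Real.sqrt_le_iff.2 ⟨norm_nonneg _, integral_sq_le_norm_sq w⟩
  · exact Real.sqrt_le_iff.2 ⟨norm_nonneg _, integral_gr_sq_le_norm_sq u⟩

/-- A smooth function of several variables with bounded values, and bounded and Lipschitz partial
derivatives. -/
structure IsTame (F : (Fin N → ℝ) → ℝ) (F' : Fin N → (Fin N → ℝ) → ℝ) (C : ℝ) : Prop where
  contDiff : ContDiff ℝ ∞ F
  hasFDerivAt : ∀ a, HasFDerivAt F (∑ k, F' k a • (ContinuousLinearMap.proj k : (Fin N → ℝ) →L[ℝ] ℝ)) a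
  cont : ∀ k, Continuous (F' k)
  bdd : ∀ a, |F a| ≤ C
  bdd' : ∀ k a, |F' k a| ≤ C
  lip : ∀ a c, |F a - F c| ≤ C * ∑ l, |a l - c l|
  lip' : ∀ k a c, |F' k a - F' k c| ≤ C * ∑ l, |a l - c l|

lemma IsTame.gradient_comp {F : (Fin N → ℝ) → ℝ} {F' : Fin N → (Fin N → ℝ) → ℝ} {C : ℝ}
    (hF : IsTame F F' C) {φ : Fin N → Plane → ℝ} (hφ : ∀ k, IsTest B (φ k)) (x : Plane) :
    gradient (fun x => F fun k => φ k x) x = ∑ k, F' k (fun k => φ k x) • gradient (φ k) x := by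
  have h1 : ∀ k, HasFDerivAt (φ k) (fderiv ℝ (φ k) x) x := fun k =>
    ((hφ k).1.differentiable (by simp) x).hasFDerivAt
  have h2 := (hF.hasFDerivAt fun k => φ k x).comp x (hasFDerivAt_pi.2 h1)
  refine ext_inner_right ℝ fun y => ?_
  rw [inner_gradient]
  have h3 := h2.fderiv
  simp only [Function.comp_def] at h3
  rw [h3, sum_inner]
  simp only [inner_smul_left, inner_gradient, ContinuousLinearMap.comp_apply, FunLike.coe_sum,
    Finset.sum_apply, smul_apply, ContinuousLinearMap.proj_apply, ContinuousLinearMap.pi_apply]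
  simp

/-- The chain rule is classical along test functions that approximate `u`. Bounds and Lipschitz
estimates for `F` and its partial derivatives allow both sides of the weak formulation to pass to
the limit in `L¹`. -/
lemma IsTame.exists_comp {F : (Fin N → ℝ) → ℝ} {F' : Fin N → (Fin N → ℝ) → ℝ} {C : ℝ}
    (hF : IsTame F F' C) (u : Fin N → W12 B) : ∃ η : W12 B,
      fn η =ᵐ[cellMeasure B] (fun x => F fun k => fn (u k) x) ∧
      gr η =ᵐ[cellMeasure B] fun x => ∑ k, F' k (fun k => fn (u k) x) • gr (u k) x := by
  have hC : 0 ≤ C := (abs_nonneg _).trans (hF.bdd 0)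
  have hum : AEStronglyMeasurable (fun x k => fn (u k) x) (cellMeasure B) :=
    (aemeasurable_pi_iff.2 fun k => (memLp_fn (u k)).1.aemeasurable).aestronglyMeasurable
  have m1 : MemLp (fun x => F fun k => fn (u k) x) 2 (cellMeasure B) :=
    MemLp.of_bound (hF.contDiff.continuous.comp_aestronglyMeasurable hum) C
      (Filter.Eventually.of_forall fun x => hF.bdd _)
  have m2k : ∀ k, MemLp (fun x => F' k (fun k => fn (u k) x) • gr (u k) x) 2 (cellMeasure B) :=
    fun k => by
    refine MemLp.of_le_mul (memLp_gr (u k))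
      (((hF.cont k).comp_aestronglyMeasurable hum).smul (memLp_gr (u k)).1) (c := C)
      (Filter.Eventually.of_forall fun x => ?_)
    rw [norm_smul]
    exact mul_le_mul_of_nonneg_right (hF.bdd' k _) (norm_nonneg _)
  have m2 : MemLp (fun x => ∑ k, F' k (fun k => fn (u k) x) • gr (u k) x) 2 (cellMeasure B) :=
    memLp_finsetSum _ fun k _ => m2k k
  suffices hw : IsWeakGradient B (fun x => F fun k => fn (u k) x)
      (fun x => ∑ k, F' k (fun k => fn (u k) x) • gr (u k) x) from
    ⟨mkW12 _ _ m1 m2 hw, fn_mk, gr_mk⟩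
  choose φ hφ hlim using fun k => exists_tendsto_ofTest (u k)
  intro ψ hψ h
  set d : ℕ → Fin N → W12 B := fun n k => ofTest (hφ k n) - u k with hd
  have hd0 : ∀ k, Filter.Tendsto (fun n => ‖d n k‖) Filter.atTop (nhds 0) := fun k =>
    tendsto_iff_norm_sub_tendsto_zero.1 (hlim k)
  have hdfn : ∀ n, ∀ᵐ x ∂cellMeasure B, ∀ k, fn (d n k) x = φ k n x - fn (u k) x := fun n =>
    ae_all_iff.2 fun k => by
      filter_upwards [fn_sub (ofTest (hφ k n)) (u k), fn_ofTest (hφ k n)] with x h1 h2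
      rw [hd, h1, h2]
  have hdgr : ∀ n, ∀ᵐ x ∂cellMeasure B, ∀ k, gr (d n k) x = gradient (φ k n) x - gr (u k) x := fun n =>
    ae_all_iff.2 fun k => by
      filter_upwards [gr_sub (ofTest (hφ k n)) (u k), gr_ofTest (hφ k n)] with x h1 h2
      rw [hd, h1, h2]
  have hFp : ∀ n, IsDoublyPeriodic B fun x => F fun k => φ k n x := fun n j x => by
    simp only [(hφ _ n).2 j x]
  have hFs : ∀ n, ContDiff ℝ ∞ fun x => F fun k => φ k n x := fun n =>
    hF.contDiff.comp (contDiff_pi.2 fun k => (hφ k n).1)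
  have hFs1 : ∀ n, ContDiff ℝ 1 fun x => F fun k => φ k n x := fun n => (hFs n).of_le (by simp)
  have hweak := fun n => isWeakGradient_gradient (hFp n) (hFs1 n) ψ hψ h
  have hψd : Continuous fun x => fderiv ℝ ψ x h :=
    (hψ.1.continuous_fderiv (by simp)).clm_apply continuous_const
  obtain ⟨M₁, hM₁0, hM₁⟩ := exists_bound_cell hψd B
  obtain ⟨M₂, hM₂0, hM₂⟩ := exists_bound_cell hψ.1.continuous B
  have hcell := ae_restrict_mem (μ := (volume : Measure Plane)) (measurableSet_cell B)
  have iF : ∀ n, Integrable (fun x => (F fun k => φ k n x) * fderiv ℝ ψ x h) (cellMeasure B) :=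
    fun n => integrable_of_continuous ((hFs n).continuous.mul hψd)
  have iF0 : Integrable (fun x => (F fun k => fn (u k) x) * fderiv ℝ ψ x h) (cellMeasure B) :=
    integrable_mul_of_continuous (m1.integrable (by norm_num)) hψd
  have iG : ∀ n, Integrable (fun x => inner ℝ (gradient (fun x => F fun k => φ k n x) x) h * ψ x)
      (cellMeasure B) := fun n =>
    integrable_of_continuous (((continuous_gradient (hFs1 n)).inner continuous_const).mul
      hψ.1.continuous)
  have iG0 : Integrable (fun x => inner ℝ (∑ k, F' k (fun k => fn (u k) x) • gr (u k) x) h * ψ x)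
      (cellMeasure B) :=
    integrable_mul_of_continuous ((m2.integrable (by norm_num)).inner_const (𝕜 := ℝ) h)
      hψ.1.continuous
  have T1 : Filter.Tendsto (fun n => ∫ x, (F fun k => φ k n x) * fderiv ℝ ψ x h ∂cellMeasure B)
      Filter.atTop (nhds (∫ x, (F fun k => fn (u k) x) * fderiv ℝ ψ x h ∂cellMeasure B)) := by
    rw [tendsto_iff_norm_sub_tendsto_zero]
    have hb : Filter.Tendsto (fun n => ∑ l, C * M₁ * (√(area B) * ‖d n l‖)) Filter.atTop (nhds 0) := by
      have := tendsto_finsetSum Finset.univ fun l (_ : l ∈ Finset.univ) =>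
        ((hd0 l).const_mul (√(area B))).const_mul (C * M₁)
      simpa using this
    refine squeeze_zero (fun n => norm_nonneg _) (fun n => ?_) hb
    rw [← integral_sub (iF n) iF0]
    refine (norm_integral_le_integral_norm _).trans ?_
    calc ∫ x, ‖(F fun k => φ k n x) * fderiv ℝ ψ x h - (F fun k => fn (u k) x) * fderiv ℝ ψ x h‖
          ∂cellMeasure B ≤ ∫ x, ∑ l, C * M₁ * |fn (d n l) x| ∂cellMeasure B := by
          refine integral_mono_ae ((iF n).sub iF0).norm
            (integrable_finsetSum _ fun l _ => (integrable_fn _).abs.const_mul _) ?_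
          filter_upwards [hdfn n, hcell] with x h1 h2
          rw [← sub_mul, norm_mul, ← Finset.mul_sum]
          simp only [h1]
          have h3 := hF.lip (fun k => φ k n x) fun k => fn (u k) x
          have h4 := hM₁ x h2
          calc _ ≤ (C * ∑ l, |φ l n x - fn (u l) x|) * M₁ :=
                mul_le_mul h3 h4 (abs_nonneg _) (by positivity)
            _ = _ := by ring
      _ ≤ _ := by
          rw [integral_finsetSum _ fun l _ => (integrable_fn _).abs.const_mul _]
          refine Finset.sum_le_sum fun l _ => ?_
          rw [integral_const_mul]
          exact mul_le_mul_of_nonneg_left (integral_abs_fn_le _) (by positivity)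
  have T2 : Filter.Tendsto (fun n => ∫ x, inner ℝ (gradient (fun x => F fun k => φ k n x) x) h * ψ x
      ∂cellMeasure B) Filter.atTop (nhds (∫ x, inner ℝ (∑ k, F' k (fun k => fn (u k) x) • gr (u k) x) h
        * ψ x ∂cellMeasure B)) := by
    rw [tendsto_iff_norm_sub_tendsto_zero]
    have hb : Filter.Tendsto (fun n => ∑ k, ((∑ l, C * ‖h‖ * M₂ * (‖d n l‖ * ‖u k‖)) +
        C * ‖h‖ * M₂ * (√(area B) * ‖d n k‖))) Filter.atTop (nhds 0) := by
      have := tendsto_finsetSum Finset.univ fun k (_ : k ∈ Finset.univ) =>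
        (tendsto_finsetSum Finset.univ fun l (_ : l ∈ Finset.univ) =>
          ((hd0 l).mul_const ‖u k‖).const_mul (C * ‖h‖ * M₂)).add
        (((hd0 k).const_mul (√(area B))).const_mul (C * ‖h‖ * M₂))
      simpa using this
    refine squeeze_zero (fun n => norm_nonneg _) (fun n => ?_) hb
    rw [← integral_sub (iG n) iG0]
    refine (norm_integral_le_integral_norm _).trans ?_
    have j1 : ∀ k l, Integrable (fun x => C * ‖h‖ * M₂ * (|fn (d n l) x| * ‖gr (u k) x‖))
        (cellMeasure B) := fun k l => (integral_fn_mul_gr_le _ _).1.const_mul _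
    have j2 : ∀ k, Integrable (fun x => C * ‖h‖ * M₂ * ‖gr (d n k) x‖) (cellMeasure B) :=
      fun k => (integrable_gr _).norm.const_mul _
    have j3 : ∀ k, Integrable (fun x => ∑ l, C * ‖h‖ * M₂ * (|fn (d n l) x| * ‖gr (u k) x‖))
        (cellMeasure B) := fun k => integrable_finsetSum _ fun l _ => j1 k l
    have j4 : ∀ k, Integrable (fun x => (∑ l, C * ‖h‖ * M₂ * (|fn (d n l) x| * ‖gr (u k) x‖)) +
        C * ‖h‖ * M₂ * ‖gr (d n k) x‖) (cellMeasure B) := fun k => (j3 k).add (j2 k)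
    calc ∫ x, ‖inner ℝ (gradient (fun x => F fun k => φ k n x) x) h * ψ x -
          inner ℝ (∑ k, F' k (fun k => fn (u k) x) • gr (u k) x) h * ψ x‖ ∂cellMeasure B
        ≤ ∫ x, ∑ k, ((∑ l, C * ‖h‖ * M₂ * (|fn (d n l) x| * ‖gr (u k) x‖)) +
            C * ‖h‖ * M₂ * ‖gr (d n k) x‖) ∂cellMeasure B := by
          refine integral_mono_ae ((iG n).sub iG0).norm (integrable_finsetSum _ fun k _ => j4 k) ?_
          filter_upwards [hdfn n, hdgr n, hcell] with x h1 h2 h3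
          rw [← sub_mul, ← inner_sub_left, hF.gradient_comp (fun k => hφ k n), ← Finset.sum_sub_distrib,
            norm_mul]
          have h4 := hM₂ x h3
          have h5 : ‖∑ k, (F' k (fun k => φ k n x) • gradient (φ k n) x -
              F' k (fun k => fn (u k) x) • gr (u k) x)‖ ≤
              ∑ k, ((∑ l, C * (|fn (d n l) x| * ‖gr (u k) x‖)) + C * ‖gr (d n k) x‖) := by
            refine (norm_sum_le _ _).trans (Finset.sum_le_sum fun k _ => ?_)
            have e : F' k (fun k => φ k n x) • gradient (φ k n) x -
                F' k (fun k => fn (u k) x) • gr (u k) x =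
                (F' k (fun k => φ k n x) - F' k (fun k => fn (u k) x)) • gr (u k) x +
                F' k (fun k => φ k n x) • gr (d n k) x := by
              rw [h2, smul_sub, sub_smul]; abel
            rw [e]
            refine (norm_add_le _ _).trans (add_le_add ?_ ?_)
            · rw [norm_smul]
              have h6 := hF.lip' k (fun k => φ k n x) fun k => fn (u k) x
              simp only [h1]
              calc _ ≤ (C * ∑ l, |φ l n x - fn (u l) x|) * ‖gr (u k) x‖ :=
                    mul_le_mul_of_nonneg_right h6 (norm_nonneg _)
                _ = _ := by
                  rw [Finset.mul_sum, Finset.sum_mul]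
                  exact Finset.sum_congr rfl fun l _ => by ring
            · rw [norm_smul]
              exact mul_le_mul_of_nonneg_right (hF.bdd' k _) (norm_nonneg _)
          calc _ ≤ (‖∑ k, (F' k (fun k => φ k n x) • gradient (φ k n) x -
              F' k (fun k => fn (u k) x) • gr (u k) x)‖ * ‖h‖) * M₂ :=
                mul_le_mul (norm_inner_le_norm _ _) h4 (abs_nonneg _) (by positivity)
            _ ≤ ((∑ k, ((∑ l, C * (|fn (d n l) x| * ‖gr (u k) x‖)) + C * ‖gr (d n k) x‖)) * ‖h‖) * M₂ := by
                gcongr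
            _ = _ := by
                rw [Finset.sum_mul, Finset.sum_mul]
                refine Finset.sum_congr rfl fun k _ => ?_
                rw [add_mul, add_mul, Finset.sum_mul, Finset.sum_mul]
                congr 1
                · exact Finset.sum_congr rfl fun l _ => by ring
                · ring
      _ ≤ _ := by
          rw [integral_finsetSum _ fun k _ => j4 k]
          refine Finset.sum_le_sum fun k _ => ?_
          rw [integral_add (j3 k) (j2 k), integral_finsetSum _ fun l _ => j1 k l]
          refine add_le_add (Finset.sum_le_sum fun l _ => ?_) ?_
          · rw [integral_const_mul]
            exact mul_le_mul_of_nonneg_left (integral_fn_mul_gr_le _ _).2 (by positivity)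
          · rw [integral_const_mul]
            exact mul_le_mul_of_nonneg_left (integral_norm_gr_le _) (by positivity)
  refine tendsto_nhds_unique T1 ?_
  simp_rw [hweak]
  exact T2.neg

end ChernSimonsHiggs
end

open MeasureTheory
open scoped ContDiff
noncomputable section
namespace ChernSimonsHiggs
variable {B : Module.Basis (Fin 2) ℝ Plane} {N : ℕ}

/-! ### Truncated exponentials -/

/-- The function `exp aᵢ / (1 + δ ∑ₖ exp aₖ)`. -/
def sm (δ : ℝ) (i : Fin N) (a : Fin N → ℝ) : ℝ := Real.exp (a i) / (1 + δ * ∑ k, Real.exp (a k))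

/-- The partial derivatives of `sm`. -/
def smDer (δ : ℝ) (i k : Fin N) (a : Fin N → ℝ) : ℝ :=
  sm δ i a * ((if i = k then 1 else 0) - δ * sm δ k a)

section
variable {δ : ℝ}

lemma sm_denom_pos (hδ : 0 < δ) (a : Fin N → ℝ) : 0 < 1 + δ * ∑ k, Real.exp (a k) := by
  have : 0 ≤ ∑ k, Real.exp (a k) := Finset.sum_nonneg fun k _ => (Real.exp_pos _).le
  positivity

lemma sm_pos (hδ : 0 < δ) (i : Fin N) (a : Fin N → ℝ) : 0 < sm δ i a :=
  div_pos (Real.exp_pos _) (sm_denom_pos hδ a)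

lemma sum_mul_sm_le (hδ : 0 < δ) (a : Fin N → ℝ) : ∑ i, δ * sm δ i a ≤ 1 := by
  have h := sm_denom_pos hδ a
  simp only [sm]
  rw [← Finset.mul_sum, ← Finset.sum_div, ← mul_div_assoc, div_le_one h]
  linarith

lemma mul_sm_le (hδ : 0 < δ) (i : Fin N) (a : Fin N → ℝ) : δ * sm δ i a ≤ 1 :=
  (Finset.single_le_sum (f := fun i => δ * sm δ i a)
    (fun j _ => mul_nonneg hδ.le (sm_pos hδ j a).le) (Finset.mem_univ i)).trans (sum_mul_sm_le hδ a)

lemma abs_sm_le (hδ : 0 < δ) (i : Fin N) (a : Fin N → ℝ) : |sm δ i a| ≤ 1 / δ := by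
  rw [abs_of_pos (sm_pos hδ i a), le_div_iff₀ hδ, mul_comm]
  exact mul_sm_le hδ i a

lemma abs_ite_sub_le (hδ : 0 < δ) (i k : Fin N) (a : Fin N → ℝ) :
    |(if i = k then 1 else 0) - δ * sm δ k a| ≤ 1 := by
  have h1 := mul_sm_le hδ k a
  have h2 := mul_pos hδ (sm_pos hδ k a)
  rw [abs_le]
  split_ifs <;> constructor <;> linarith

lemma abs_smDer_le (hδ : 0 < δ) (i k : Fin N) (a : Fin N → ℝ) : |smDer δ i k a| ≤ 1 / δ := by
  rw [smDer, abs_mul, ← mul_one (1 / δ)]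
  exact mul_le_mul (abs_sm_le hδ i a) (abs_ite_sub_le hδ i k a) (abs_nonneg _) (by positivity)

lemma contDiff_sm (hδ : 0 < δ) (i : Fin N) : ContDiff ℝ ∞ (sm δ i) := by
  refine ContDiff.div (by fun_prop) (by fun_prop) fun a => (sm_denom_pos hδ a).ne'

lemma continuous_smDer (hδ : 0 < δ) (i k : Fin N) : Continuous (smDer δ i k) :=
  (contDiff_sm hδ i).continuous.mul (continuous_const.sub
    (continuous_const.mul (contDiff_sm hδ k).continuous))

lemma hasFDerivAt_sm (hδ : 0 < δ) (i : Fin N) (a : Fin N → ℝ) : HasFDerivAt (sm δ i)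
    (∑ k, smDer δ i k a • (ContinuousLinearMap.proj k : (Fin N → ℝ) →L[ℝ] ℝ)) a := by
  have h1 : ∀ k : Fin N, HasFDerivAt (fun a : Fin N → ℝ => Real.exp (a k))
      (Real.exp (a k) • (ContinuousLinearMap.proj k : (Fin N → ℝ) →L[ℝ] ℝ)) a := fun k =>
    (ContinuousLinearMap.proj (R := ℝ) (φ := fun _ : Fin N => ℝ) k).hasFDerivAt.exp
  have h2 : HasFDerivAt (fun a : Fin N → ℝ => 1 + δ * ∑ k, Real.exp (a k))
      (δ • ∑ k, Real.exp (a k) • (ContinuousLinearMap.proj k : (Fin N → ℝ) →L[ℝ] ℝ)) a :=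
    ((HasFDerivAt.fun_sum fun k _ => h1 k).const_mul δ).const_add 1
  have h0 := sm_denom_pos hδ a
  have h3 := (h1 i).mul ((hasDerivAt_inv h0.ne').comp_hasFDerivAt a h2)
  have e : sm δ i = fun a : Fin N → ℝ => Real.exp (a i) * (Inv.inv ∘ fun a : Fin N → ℝ =>
      1 + δ * ∑ k, Real.exp (a k)) a := by
    funext a; simp [sm, div_eq_mul_inv]
  rw [e]
  refine h3.congr_fderiv ?_
  ext h
  simp only [smDer, add_apply, smul_apply, FunLike.coe_sum, Finset.sum_apply, smul_eq_mul,
    ContinuousLinearMap.proj_apply, Function.comp_apply]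
  have e2 : ∑ k, sm δ i a * ((if i = k then 1 else 0) - δ * sm δ k a) * h k =
      sm δ i a * h i - sm δ i a * δ * ∑ k, sm δ k a * h k := by
    simp only [mul_sub, sub_mul, Finset.sum_sub_distrib, Finset.mul_sum]
    congr 1
    · simp
    · exact Finset.sum_congr rfl fun k _ => by ring
  rw [e2]
  have e3 : ∑ k, sm δ k a * h k = (∑ k, Real.exp (a k) * h k) / (1 + δ * ∑ k, Real.exp (a k)) := by
    rw [Finset.sum_div]
    exact Finset.sum_congr rfl fun k _ => by rw [sm]; ring
  rw [e3, sm]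
  field_simp
  ring

lemma abs_sub_le_of_partial_bound {G : (Fin N → ℝ) → ℝ} {G' : Fin N → (Fin N → ℝ) → ℝ} {C : ℝ}
    (hC : 0 ≤ C)
    (h : ∀ a, HasFDerivAt G (∑ k, G' k a • (ContinuousLinearMap.proj k : (Fin N → ℝ) →L[ℝ] ℝ)) a)
    (hb : ∀ k a, |G' k a| ≤ C) (a c : Fin N → ℝ) : |G a - G c| ≤ N * C * ∑ l, |a l - c l| := by
  have h1 := Convex.norm_image_sub_le_of_norm_hasFDerivWithin_le (C := N * C) (s := Set.univ)
    (fun x _ => (h x).hasFDerivWithinAt) (fun x _ => ?_) convex_univ (Set.mem_univ c) (Set.mem_univ a)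
  · refine h1.trans ?_
    gcongr
    refine (pi_norm_le_iff_of_nonneg (Finset.sum_nonneg fun l _ => abs_nonneg _)).2 fun l => ?_
    exact Finset.single_le_sum (f := fun l => |a l - c l|) (fun j _ => abs_nonneg _) (Finset.mem_univ l)
  · refine ContinuousLinearMap.opNorm_le_bound _ (by positivity) fun y => ?_
    simp only [FunLike.coe_sum, Finset.sum_apply, smul_apply, ContinuousLinearMap.proj_apply]
    refine (norm_sum_le _ _).trans ?_
    have : ∀ k ∈ Finset.univ, ‖G' k x • y k‖ ≤ C * ‖y‖ := fun k _ => by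
      rw [norm_smul]
      exact mul_le_mul (hb k x) (norm_le_pi_norm y k) (norm_nonneg _) hC
    refine (Finset.sum_le_sum this).trans (le_of_eq ?_)
    simp [mul_assoc]

lemma isTame_sm (hδ : 0 < δ) (i : Fin N) :
    IsTame (sm δ i) (smDer δ i) ((N + 1) * (2 / δ)) := by
  have hd : 1 / δ ≤ (N + 1) * (2 / δ) := by
    rw [mul_div_assoc', div_le_div_iff_of_pos_right hδ]
    have : (0 : ℝ) ≤ N := Nat.cast_nonneg N
    linarith
  have hd' : 0 < 1 / δ := by positivity
  have hNN : (0 : ℝ) ≤ N := Nat.cast_nonneg N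
  refine ⟨contDiff_sm hδ i, hasFDerivAt_sm hδ i, continuous_smDer hδ i,
    fun a => (abs_sm_le hδ i a).trans hd, fun k a => (abs_smDer_le hδ i k a).trans hd, ?_, ?_⟩
  · intro a c
    refine (abs_sub_le_of_partial_bound (C := 1 / δ) (by positivity) (hasFDerivAt_sm hδ i)
      (fun k a => abs_smDer_le hδ i k a) a c).trans ?_
    refine mul_le_mul_of_nonneg_right ?_ (Finset.sum_nonneg fun l _ => abs_nonneg _)
    have : (2 : ℝ) / δ = 2 * (1 / δ) := by ring
    rw [this]
    nlinarith
  · intro k a c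
    have h1 : ∀ a, HasFDerivAt (smDer δ i k) (∑ l, (smDer δ i l a *
        ((if i = k then 1 else 0) - δ * sm δ k a) - sm δ i a * δ * smDer δ k l a) •
        (ContinuousLinearMap.proj l : (Fin N → ℝ) →L[ℝ] ℝ)) a := fun a => by
      have := (hasFDerivAt_sm hδ i a).mul
        (((hasFDerivAt_sm hδ k a).const_mul δ).const_sub (if i = k then 1 else 0))
      refine this.congr_fderiv ?_
      ext h
      simp only [add_apply, smul_apply, FunLike.coe_sum, Finset.sum_apply, smul_eq_mul,
        ContinuousLinearMap.proj_apply, neg_apply, Finset.mul_sum, ← Finset.sum_neg_distrib,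
        ← Finset.sum_add_distrib]
      exact Finset.sum_congr rfl fun l _ => by ring
    refine (abs_sub_le_of_partial_bound (C := 2 / δ) (by positivity) h1 (fun l a => ?_) a c).trans ?_
    · refine (abs_sub _ _).trans ?_
      have e : 2 / δ = 1 / δ * 1 + 1 * (1 / δ) := by ring
      rw [e, abs_mul, abs_mul]
      refine add_le_add (mul_le_mul (abs_smDer_le hδ i l a) (abs_ite_sub_le hδ i k a) (abs_nonneg _)
        (by positivity)) (mul_le_mul ?_ (abs_smDer_le hδ k l a) (abs_nonneg _) (by positivity))
      rw [abs_mul, abs_of_pos hδ, abs_of_pos (sm_pos hδ i a), mul_comm]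
      exact mul_sm_le hδ i a
    · refine mul_le_mul_of_nonneg_right ?_ (Finset.sum_nonneg fun l _ => abs_nonneg _)
      have : 0 < 2 / δ := by positivity
      nlinarith

/-- The vector field with components `sm δ i` is the gradient of the convex function `δ⁻¹ log (1 + δ
∑ exp aₖ)`, hence monotone. Quantitatively, the right-hand side is a variance of the `g i` around
the weighted mean `m`; the weights `δ sm δ i` have total mass at most `1`, and the missing mass
contributes a nonnegative multiple of `|m|²`. -/
lemma sum_inner_sm_le {E : Type*} [NormedAddCommGroup E] [InnerProductSpace ℝ E] (hδ : 0 < δ)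
    (a : Fin N → ℝ) (g : Fin N → E) :
    δ * ∑ i, inner ℝ (∑ k, smDer δ i k a • g k) (∑ k, smDer δ i k a • g k) ≤
      ∑ i, inner ℝ (g i) (∑ k, smDer δ i k a • g k) := by
  set m : E := ∑ k, (δ * sm δ k a) • g k with hm
  have e : ∀ i, ∑ k, smDer δ i k a • g k = sm δ i a • (g i - m) := fun i => by
    simp only [smDer, mul_smul, ← Finset.smul_sum, sub_smul, Finset.sum_sub_distrib, hm]
    congr 2
    simp
  simp only [e, inner_smul_left, inner_smul_right, RCLike.conj_to_real]
  have hs := sum_mul_sm_le hδ a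
  have e1 : ∑ i, sm δ i a * inner ℝ (g i) (g i - m) = ∑ i, sm δ i a * inner ℝ (g i - m) (g i - m) +
      δ⁻¹ * ((1 - ∑ i, δ * sm δ i a) * inner ℝ m m) := by
    have e2 : ∀ i, sm δ i a * inner ℝ (g i) (g i - m) = sm δ i a * inner ℝ (g i - m) (g i - m) +
        δ⁻¹ * (inner ℝ ((δ * sm δ i a) • g i) m - (δ * sm δ i a) * inner ℝ m m) := fun i => by
      simp only [inner_sub_left, inner_sub_right, inner_smul_left, RCLike.conj_to_real,
        real_inner_comm m (g i)]
      field_simp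
      ring
    simp only [e2, Finset.sum_add_distrib, ← Finset.mul_sum, Finset.sum_sub_distrib, ← Finset.sum_mul,
      ← sum_inner]
    rw [← hm]
    ring
  rw [e1, Finset.mul_sum]
  have h2 : ∑ i, δ * (sm δ i a * (sm δ i a * inner ℝ (g i - m) (g i - m))) ≤
      ∑ i, sm δ i a * inner ℝ (g i - m) (g i - m) := Finset.sum_le_sum fun i _ => by
    have h3 := mul_sm_le hδ i a
    have h4 : 0 ≤ sm δ i a * inner ℝ (g i - m) (g i - m) :=
      mul_nonneg (sm_pos hδ i a).le real_inner_self_nonneg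
    calc _ = (δ * sm δ i a) * (sm δ i a * inner ℝ (g i - m) (g i - m)) := by ring
      _ ≤ 1 * (sm δ i a * inner ℝ (g i - m) (g i - m)) := mul_le_mul_of_nonneg_right h3 h4
      _ = _ := one_mul _
  have h5 : 0 ≤ δ⁻¹ * ((1 - ∑ i, δ * sm δ i a) * inner ℝ m m) :=
    mul_nonneg (by positivity) (mul_nonneg (by linarith) real_inner_self_nonneg)
  linarith

/-- Composition with the truncated exponentials controls the Dirichlet energy. -/
lemma exists_sm_comp (hδ : 0 < δ) (u : Fin N → W12 B) : ∃ η : Fin N → W12 B,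
    (∀ i, fn (η i) =ᵐ[cellMeasure B] fun x => sm δ i fun k => fn (u k) x) ∧
    δ * ∑ i, dirL B (η i) (η i) ≤ ∑ i, dirL B (u i) (η i) := by
  choose η h1 h2 using fun i => (isTame_sm hδ i).exists_comp u
  refine ⟨η, h1, ?_⟩
  have i1 : ∀ i, Integrable (fun x => inner ℝ (gr (η i) x) (gr (η i) x)) (cellMeasure B) :=
    fun i => integrable_inner_gr _ _
  have i2 : ∀ i, Integrable (fun x => inner ℝ (gr (u i) x) (gr (η i) x)) (cellMeasure B) :=
    fun i => integrable_inner_gr _ _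
  simp only [dirL_apply]
  rw [← integral_finsetSum _ fun i _ => i1 i, ← integral_finsetSum _ fun i _ => i2 i,
    ← integral_const_mul]
  refine integral_mono_ae ((integrable_finsetSum _ fun i _ => i1 i).const_mul δ)
    (integrable_finsetSum _ fun i _ => i2 i) ?_
  filter_upwards [ae_all_iff.2 h2] with x hx
  simp only [hx]
  exact sum_inner_sm_le hδ _ fun k => gr (u k) x

end

end ChernSimonsHiggs
end

open MeasureTheory
open scoped ContDiff
noncomputable section
namespace ChernSimonsHiggs
variable {B : Module.Basis (Fin 2) ℝ Plane} {N : ℕ}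

/-! ### The inequality obtained from truncated exponentials as test functions -/

lemma norm_le_sqrt_add_sqrt (w : W12 B) :
    ‖w‖ ≤ √(∫ x, fn w x ^ 2 ∂cellMeasure B) + √(dirL B w w) := by
  have h1 : 0 ≤ ∫ x, fn w x ^ 2 ∂cellMeasure B := integral_nonneg fun x => sq_nonneg _
  have h2 := dirL_self_nonneg w
  refine abs_le_of_sq_le_sq' ?_ (by positivity) |>.2
  rw [norm_sq_eq, ← dirL_self, add_sq, Real.sq_sqrt h1, Real.sq_sqrt h2]
  have : 0 ≤ 2 * √(∫ x, fn w x ^ 2 ∂cellMeasure B) * √(dirL B w w) := by positivity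
  linarith

lemma norm_W12N_le (v : W12N B N) : ‖v‖ ≤ ∑ j, ‖v j‖ := by
  have h0 : 0 ≤ ∑ j, ‖v j‖ := Finset.sum_nonneg fun j _ => norm_nonneg _
  refine abs_le_of_sq_le_sq' ?_ h0 |>.2
  rw [PiLp.norm_sq_eq_of_L2]
  exact Finset.sum_sq_le_sq_sum_of_nonneg fun j _ => norm_nonneg _

section
variable {u₀ : Fin N → Plane → ℝ} {n : Fin N → ℕ} {g : Fin N → ℕ → W12 B}

/-- The vector `K η`. -/
def mulK (η : Fin N → W12 B) : W12N B N := WithLp.toLp 2 fun k => ∑ i, K N k i • η i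

lemma mulK_apply (η : Fin N → W12 B) (k : Fin N) : mulK η k = ∑ i, K N k i • η i := rfl

lemma norm_mulK_le (η : Fin N → W12 B) : ‖mulK η‖ ≤ 2 * N * ∑ i, ‖η i‖ := by
  refine (norm_W12N_le _).trans ?_
  have : ∀ k ∈ Finset.univ, ‖mulK η k‖ ≤ 2 * ∑ i, ‖η i‖ := fun k _ => by
    rw [mulK_apply, Finset.mul_sum]
    refine (norm_sum_le _ _).trans (Finset.sum_le_sum fun i _ => ?_)
    rw [norm_smul]
    exact mul_le_mul_of_nonneg_right (abs_K_le k i) (norm_nonneg _)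
  refine (Finset.sum_le_sum this).trans (le_of_eq ?_)
  simp
  ring

/-- Test vectors of the form `K η` are used because `A K = 1` decouples the Dirichlet form. -/
lemma sum_A_mul_dirL_mulK (hN : N = 3 ∨ N = 4 ∨ N = 5) (v : W12N B N) (η : Fin N → W12 B) :
    ∑ j, ∑ k, A N j k * dirL B (v j) (mulK η k) = ∑ j, dirL B (v j) (η j) := by
  refine Finset.sum_congr rfl fun j _ => ?_
  simp only [mulK_apply, map_sum, map_smul, smul_eq_mul, Finset.mul_sum]
  rw [Finset.sum_comm]
  simp only [← mul_assoc, ← Finset.sum_mul, sum_A_mul_K hN]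
  simp

lemma sum_b_mul_intL_mulK (hN : N = 3 ∨ N = 4 ∨ N = 5) (n : Fin N → ℕ) (η : Fin N → W12 B) :
    ∑ j, b n j / area B * intL B (mulK η j) =
      ∑ i, 4 * Real.pi * n i / area B * intL B (η i) := by
  simp only [mulK_apply, map_sum, map_smul, smul_eq_mul, Finset.mul_sum]
  rw [Finset.sum_comm]
  refine Finset.sum_congr rfl fun i _ => ?_
  rw [← sum_K_mul_b hN n i, Finset.sum_div, Finset.sum_mul]
  refine Finset.sum_congr rfl fun j _ => ?_
  rw [K_symm i j]
  ring

lemma actionDer_mulK (hN : N = 3 ∨ N = 4 ∨ N = 5) (hu : IsAdm B u₀) (lam : ℝ) (v : W12N B N)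
    (η : Fin N → W12 B) : actionDer hu n lam v (mulK η) = ∑ j, dirL B (v j) (η j) +
      lam * ∑ j, ∫ x, dens u₀ v j x * fn (mulK η j) x ∂cellMeasure B +
      ∑ i, 4 * Real.pi * n i / area B * intL B (η i) := by
  rw [actionDer_apply, sum_A_mul_dirL_mulK hN, Finset.sum_add_distrib, sum_b_mul_intL_mulK hN,
    Finset.mul_sum]
  ring

lemma fn_mulK (η : Fin N → W12 B) (j : Fin N) :
    fn (mulK η j) =ᵐ[cellMeasure B] fun x => ∑ i, K N j i * fn (η i) x := by
  rw [mulK_apply]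
  filter_upwards [fn_sum Finset.univ fun i => K N j i • η i,
    ae_all_iff.2 fun i => fn_smul (K N j i) (η i)] with x h1 h2
  rw [h1]
  exact Finset.sum_congr rfl fun i _ => h2 i

/-- The `L²` part of `‖η i‖` is bounded by `s`; the gradient part is moved by Young's inequality
into `δ ∑ dirL (η i) (η i)`, exactly the energy that `exists_sm_comp` gives back. -/
lemma apply_mulK_le (L : W12N B N →L[ℝ] ℝ) (η : Fin N → W12 B) {δ s : ℝ} (hδ : 0 < δ)
    (hs : ∀ i, √(∫ x, fn (η i) x ^ 2 ∂cellMeasure B) ≤ s) :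
    L (mulK η) ≤ 2 * N ^ 2 * ‖L‖ * s + N ^ 3 * ‖L‖ ^ 2 / δ +
      δ * ∑ i, dirL B (η i) (η i) := by
  set ε := ‖L‖ with hε
  have hε0 : 0 ≤ ε := norm_nonneg L
  have h1 : ∀ i, 2 * N * ε * ‖η i‖ ≤
      2 * N * ε * s + N ^ 2 * ε ^ 2 / δ + δ * dirL B (η i) (η i) := fun i => by
    have hd := dirL_self_nonneg (η i)
    have h6 := Real.sq_sqrt hd
    set q := √(dirL B (η i) (η i)) with hq
    have h7 : 0 ≤ (δ * q - N * ε) ^ 2 / δ := by positivity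
    have e7 : (δ * q - N * ε) ^ 2 / δ = δ * q ^ 2 + N ^ 2 * ε ^ 2 / δ - 2 * N * ε * q := by
      field_simp
      ring
    have h8 : ‖η i‖ ≤ s + q := (norm_le_sqrt_add_sqrt (η i)).trans (add_le_add (hs i) le_rfl)
    have h9 : 2 * N * ε * ‖η i‖ ≤ 2 * N * ε * (s + q) :=
      mul_le_mul_of_nonneg_left h8 (by positivity)
    rw [e7, h6] at h7
    linarith
  have h2 : L (mulK η) ≤ ∑ i, 2 * N * ε * ‖η i‖ := by
    rw [← Finset.mul_sum]
    calc L (mulK η) ≤ ε * ‖mulK η‖ := (le_abs_self _).trans (L.le_opNorm _)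
      _ ≤ ε * (2 * N * ∑ i, ‖η i‖) := mul_le_mul_of_nonneg_left (norm_mulK_le η) hε0
      _ = _ := by ring
  refine h2.trans ((Finset.sum_le_sum fun i _ => h1 i).trans (le_of_eq ?_))
  simp only [Finset.sum_add_distrib, ← Finset.mul_sum, Finset.sum_const, Finset.card_univ,
    Fintype.card_fin, nsmul_eq_mul]
  ring

/-- The constant in the estimate for truncated exponentials. -/
def truncBound (B : Module.Basis (Fin 2) ℝ Plane) (N : ℕ) (δ ε : ℝ) : ℝ :=
  2 * N ^ 2 * ε * (√(area B) / δ) + N ^ 3 * ε ^ 2 / δ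

/-- The derivative is tested with `K η`, where `η` consists of the truncated exponentials of `ln r +
g + v`. Including the background approximation in the exponent costs at most `4π n / |Ω| ∫ η`, which
the linear term of the derivative pays for. The Dirichlet term that remains is at least `δ` times
the energy of `η` and absorbs the gradient part of the error. -/
lemma sum_integral_dens_mul_sm_le (hN : N = 3 ∨ N = 4 ∨ N = 5) (hu : IsAdm B u₀)
    (hg : ∀ i, IsApproxBackground (n i) (u₀ i) (g i)) (lam : ℝ) (v : W12N B N) {δ : ℝ} (hδ : 0 < δ)
    (t : ℕ) :
    lam * ∑ j, ∫ x, dens u₀ v j x * ∑ i, K N j i *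
      sm δ i (fun k => Real.log (r N k) + fn (g k t) x + fn (v k) x) ∂cellMeasure B ≤
      truncBound B N δ ‖actionDer hu n lam v‖ := by
  set u : Fin N → W12 B := fun k => cst B (Real.log (r N k)) + g k t + v k with hudef
  obtain ⟨η, h1, h2⟩ := exists_sm_comp hδ u
  set ε := ‖actionDer hu n lam v‖ with hε
  have hfu : ∀ᵐ x ∂cellMeasure B, ∀ k, fn (u k) x = Real.log (r N k) + fn (g k t) x + fn (v k) x :=
    ae_all_iff.2 fun k => by
      filter_upwards [fn_add (cst B (Real.log (r N k)) + g k t) (v k),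
        fn_add (cst B (Real.log (r N k))) (g k t), fn_cst (B := B) (Real.log (r N k))] with x a1 a2 a3
      rw [hudef, a1, a2, a3]
  have hpos : ∀ i, ∀ᵐ x ∂cellMeasure B, 0 ≤ fn (η i) x := fun i => by
    filter_upwards [h1 i] with x hx
    rw [hx]
    exact (sm_pos hδ _ _).le
  have e1 : ∑ j, ∫ x, dens u₀ v j x * ∑ i, K N j i *
      sm δ i (fun k => Real.log (r N k) + fn (g k t) x + fn (v k) x) ∂cellMeasure B =
      ∑ j, ∫ x, dens u₀ v j x * fn (mulK η j) x ∂cellMeasure B := by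
    refine Finset.sum_congr rfl fun j _ => integral_congr_ae ?_
    filter_upwards [fn_mulK η j, hfu, ae_all_iff.2 h1] with x a1 a2 a3
    rw [a1]
    simp only [a3, a2]
  rw [e1]
  have h3 := actionDer_mulK (n := n) hN hu lam v η
  have h4 : ∑ i, dirL B (u i) (η i) ≤ ∑ i, dirL B (v i) (η i) +
      ∑ i, 4 * Real.pi * n i / area B * intL B (η i) := by
    rw [← Finset.sum_add_distrib]
    refine Finset.sum_le_sum fun i _ => ?_
    rw [hudef]
    simp only [map_add, add_apply, dirL_cst, zero_add]
    rw [add_comm, intL_apply]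
    exact add_le_add le_rfl ((hg i).dir_le t (η i) (hpos i))
  have hsq : ∀ i, √(∫ x, fn (η i) x ^ 2 ∂cellMeasure B) ≤ √(area B) / δ := fun i => by
    have : ∫ x, fn (η i) x ^ 2 ∂cellMeasure B ≤ area B * (1 / δ) ^ 2 := by
      rw [← integral_cst]
      refine integral_mono_ae (integrable_sq _) (integrable_const _) ?_
      filter_upwards [h1 i] with x hx
      rw [hx]
      exact sq_le_sq.2 ((abs_sm_le hδ i _).trans (le_abs_self _))
    refine (Real.sqrt_le_sqrt this).trans (le_of_eq ?_)
    rw [Real.sqrt_mul (area_pos B).le, Real.sqrt_sq (by positivity)]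
    ring
  have h5 := apply_mulK_le (actionDer hu n lam v) η hδ hsq
  rw [h3] at h5
  rw [truncBound]
  linarith

lemma exp_log_r_add (hN : N = 3 ∨ N = 4 ∨ N = 5) (v : W12N B N) (k : Fin N) (x : Plane) :
    Real.exp (Real.log (r N k) + u₀ k x + fn (v k) x) = yy u₀ v k x := by
  rw [add_assoc, Real.exp_add, Real.exp_log (r_pos hN k)]
  rfl

/-- The limit of the previous estimate along the background approximations. They are needed because
`u⁰` itself need not lie in the Sobolev space; the truncation makes dominated convergence immediate.
-/
lemma sum_integral_dens_mul_le (hN : N = 3 ∨ N = 4 ∨ N = 5) (hu : IsAdm B u₀)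
    (hg : ∀ i, IsApproxBackground (n i) (u₀ i) (g i)) (lam : ℝ) (v : W12N B N) {δ : ℝ} (hδ : 0 < δ) :
    lam * ∑ j, ∫ x, dens u₀ v j x * ((∑ i, K N j i * yy u₀ v i x) /
      (1 + δ * ∑ k, yy u₀ v k x)) ∂cellMeasure B ≤ truncBound B N δ ‖actionDer hu n lam v‖ := by
  have hlim : Filter.Tendsto (fun t => lam * ∑ j, ∫ x, dens u₀ v j x * ∑ i, K N j i *
      sm δ i (fun k => Real.log (r N k) + fn (g k t) x + fn (v k) x) ∂cellMeasure B) Filter.atTop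
      (nhds (lam * ∑ j, ∫ x, dens u₀ v j x * ((∑ i, K N j i * yy u₀ v i x) /
      (1 + δ * ∑ k, yy u₀ v k x)) ∂cellMeasure B)) := by
    refine (tendsto_finsetSum _ fun j _ => ?_).const_mul lam
    have hmeas : ∀ t, AEStronglyMeasurable (fun x => ∑ i, K N j i *
        sm δ i (fun k => Real.log (r N k) + fn (g k t) x + fn (v k) x)) (cellMeasure B) := fun t => by
      have hc : Continuous fun a : Fin N → ℝ => ∑ i, K N j i * sm δ i a :=
        continuous_finsetSum _ fun i _ => continuous_const.mul (contDiff_sm hδ i).continuous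
      refine hc.comp_aestronglyMeasurable
        (aemeasurable_pi_iff.2 fun k => ?_).aestronglyMeasurable
      exact ((aemeasurable_const.add (memLp_fn (g k t)).1.aemeasurable).add
        (memLp_fn (v k)).1.aemeasurable)
    refine tendsto_integral_of_dominated_convergence (fun x => |dens u₀ v j x| * ∑ i : Fin N, 2 * (1 / δ))
      (fun t => (memLp_dens hu v j).1.mul (hmeas t))
      (((memLp_dens hu v j).integrable (by norm_num)).abs.mul_const _) (fun t => ?_) ?_
    · refine Filter.Eventually.of_forall fun x => ?_
      rw [norm_mul]
      refine mul_le_mul_of_nonneg_left ?_ (norm_nonneg _)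
      refine (norm_sum_le _ _).trans (Finset.sum_le_sum fun i _ => ?_)
      rw [norm_mul]
      exact mul_le_mul (abs_K_le j i) (abs_sm_le hδ i _) (abs_nonneg _) (by norm_num)
    · filter_upwards [ae_all_iff.2 fun k => (hg k).tendsto] with x hx
      have e : (∑ i, K N j i * yy u₀ v i x) / (1 + δ * ∑ k, yy u₀ v k x) =
          ∑ i, K N j i * sm δ i (fun k => Real.log (r N k) + u₀ k x + fn (v k) x) := by
        simp only [sm, exp_log_r_add hN, Finset.sum_div]
        exact Finset.sum_congr rfl fun i _ => by ring
      rw [e]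
      refine (tendsto_finsetSum _ fun i _ => ?_).const_mul _
      refine (((contDiff_sm hδ i).continuous.tendsto _).comp ?_).const_mul _
      exact tendsto_pi_nhds.2 fun k => ((hx k).const_add _).add_const _
  exact le_of_tendsto' hlim fun t => sum_integral_dens_mul_sm_le hN hu hg lam v hδ t

end

end ChernSimonsHiggs
end

open MeasureTheory
open scoped ContDiff
noncomputable section
namespace ChernSimonsHiggs
variable {B : Module.Basis (Fin 2) ℝ Plane} {N : ℕ}

/-! ### Estimates for almost critical points -/

/-- The mean value. -/
def mean (B : Module.Basis (Fin 2) ℝ Plane) (w : W12 B) : ℝ := intL B w / area B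

lemma integral_fn_eq_mean (w : W12 B) : ∫ x, fn w x ∂cellMeasure B = area B * mean B w := by
  rw [mean, mul_div_cancel₀ _ (area_pos B).ne', intL_apply]

lemma exists_integral_sub_mean_sq_le (B : Module.Basis (Fin 2) ℝ Plane) : ∃ C, 0 < C ∧ ∀ w : W12 B,
    ∫ x, (fn w x - mean B w) ^ 2 ∂cellMeasure B ≤ C * dirL B w w := by
  obtain ⟨C, hC, h⟩ := exists_poincare B
  refine ⟨C, hC, fun w => ?_⟩
  set z := w - cst B (mean B w) with hz
  have hzf : fn z =ᵐ[cellMeasure B] fun x => fn w x - mean B w := by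
    filter_upwards [fn_sub w (cst B (mean B w)), fn_cst (B := B) (mean B w)] with x h1 h2
    rw [hz, h1, h2]
  have h1 := h z (by
    rw [integral_congr_ae hzf, integral_sub (integrable_fn w) (integrable_const _), integral_cst,
      integral_fn_eq_mean, sub_self])
  have h2 : dirL B z z = dirL B w w := by
    rw [hz]
    simp only [map_sub, sub_apply, dirL_cst, dirL_comm w (cst B _)]
    ring
  rw [← dirL_self, h2] at h1
  refine le_trans (le_of_eq (integral_congr_ae ?_)) h1
  filter_upwards [hzf] with x hx
  rw [hx]

lemma integrable_fn_sub_const_sq (w : W12 B) (c : ℝ) :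
    Integrable (fun x => (fn w x - c) ^ 2) (cellMeasure B) :=
  ((memLp_fn w).sub (memLp_const c)).integrable_sq

lemma exists_norm_sq_le_mean (B : Module.Basis (Fin 2) ℝ Plane) (N : ℕ) : ∃ C, 0 < C ∧
    ∀ v : W12N B N, ‖v‖ ^ 2 ≤ C * ∑ j, (dirL B (v j) (v j) + mean B (v j) ^ 2) := by
  obtain ⟨C, hC, h⟩ := exists_integral_sub_mean_sq_le B
  have hA := area_pos B
  refine ⟨2 * C + 1 + 2 * area B, by positivity, fun v => ?_⟩
  rw [norm_sq_W12N, Finset.mul_sum]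
  refine Finset.sum_le_sum fun j _ => ?_
  have h1 : ∫ x, fn (v j) x ^ 2 ∂cellMeasure B ≤
      ∫ x, (2 * (fn (v j) x - mean B (v j)) ^ 2 + 2 * mean B (v j) ^ 2) ∂cellMeasure B := by
    refine integral_mono (integrable_sq _)
      (((integrable_fn_sub_const_sq _ _).const_mul 2).add (integrable_const _)) fun x => ?_
    nlinarith [sq_nonneg (fn (v j) x - 2 * mean B (v j))]
  rw [integral_add ((integrable_fn_sub_const_sq _ _).const_mul 2) (integrable_const _),
    integral_const_mul, integral_cst] at h1
  have h2 := h (v j)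
  have h3 := dirL_self_nonneg (v j)
  have h4 := sq_nonneg (mean B (v j))
  nlinarith [mul_nonneg hA.le h3, mul_nonneg hC.le h4]

/-- Cauchy-Schwarz with weights `y` gives `(yᵀ K y)² ≤ (∑ yⱼ) ∑ yⱼ (K y)ⱼ²`, and `yᵀ K y ≥ (∑ yⱼ)² /
(4 N)` by coercivity. -/
lemma cube_le_sum (hN : N = 3 ∨ N = 4 ∨ N = 5) {y : Fin N → ℝ} (hy : ∀ j, 0 ≤ y j) :
    1 / (16 * N ^ 2) * (∑ j, y j) ^ 3 ≤ ∑ j, y j * (∑ k, K N j k * y k) ^ 2 := by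
  have hN0 : (0 : ℝ) < N := Nat.cast_pos.2 (pos_of_hN hN)
  set S := ∑ j, y j with hS
  set T := ∑ j, y j * (∑ k, K N j k * y k) ^ 2 with hT
  have hS0 : 0 ≤ S := Finset.sum_nonneg fun j _ => hy j
  have hT0 : 0 ≤ T := Finset.sum_nonneg fun j _ => mul_nonneg (hy j) (sq_nonneg _)
  have h1 : (∑ j, y j * ∑ k, K N j k * y k) ^ 2 ≤ S * T :=
    Finset.sum_sq_le_sum_mul_sum_of_sq_le_mul _ (fun j _ => hy j)
      (fun j _ => mul_nonneg (hy j) (sq_nonneg _)) fun j _ => le_of_eq (by ring)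
  have h2 := K_coercive hN y
  have e2 : ∑ j, ∑ k, K N j k * (y j * y k) = ∑ j, y j * ∑ k, K N j k * y k :=
    Finset.sum_congr rfl fun j _ => by
      rw [Finset.mul_sum]
      exact Finset.sum_congr rfl fun k _ => by ring
  rw [e2] at h2
  have h3 : S ^ 2 ≤ N * ∑ j, y j ^ 2 := by
    have := sq_sum_le_card_mul_sum_sq (s := Finset.univ) (f := y)
    simpa using this
  have h4 : S ^ 2 / (4 * N) ≤ ∑ j, y j * ∑ k, K N j k * y k := by
    refine le_trans ?_ h2
    rw [div_le_iff₀ (by positivity)]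
    linarith
  have h5 : (S ^ 2 / (4 * N)) ^ 2 ≤ S * T := (pow_le_pow_left₀ (by positivity) h4 2).trans h1
  rcases hS0.eq_or_lt with h0 | h0
  · rw [← h0]; simpa using hT0
  · refine le_of_mul_le_mul_left ?_ h0
    refine le_trans (le_of_eq ?_) h5
    field_simp
    ring

lemma sum_mul_K_le {y : Fin N → ℝ} (hy : ∀ j, 0 ≤ y j) :
    ∑ j, y j * ∑ k, K N j k * y k ≤ 2 * (∑ j, y j) ^ 2 := by
  have : ∀ j ∈ Finset.univ, y j * ∑ k, K N j k * y k ≤ y j * (2 * ∑ k, y k) := fun j _ => by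
    refine mul_le_mul_of_nonneg_left ?_ (hy j)
    rw [Finset.mul_sum]
    exact Finset.sum_le_sum fun k _ => mul_le_mul_of_nonneg_right
      ((le_abs_self _).trans (abs_K_le j k)) (hy k)
  refine (Finset.sum_le_sum this).trans (le_of_eq ?_)
  rw [← Finset.sum_mul]
  ring

section
variable {u₀ : Fin N → Plane → ℝ} {n : Fin N → ℕ}

lemma yy_pos (hN : N = 3 ∨ N = 4 ∨ N = 5) (v : W12N B N) (j : Fin N) (x : Plane) : 0 < yy u₀ v j x :=
  mul_pos (r_pos hN j) (U_pos v j x)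

lemma memLp_yy (hu : IsAdm B u₀) (v : W12N B N) (j : Fin N) : MemLp (yy u₀ v j) 2 (cellMeasure B) :=
  (memLp_U hu v j).const_mul _

lemma integrable_yy (hu : IsAdm B u₀) (v : W12N B N) (j : Fin N) :
    Integrable (yy u₀ v j) (cellMeasure B) := (memLp_yy hu v j).integrable (by norm_num)

lemma integrable_yy_sq (hu : IsAdm B u₀) (v : W12N B N) (j : Fin N) :
    Integrable (fun x => yy u₀ v j x ^ 2) (cellMeasure B) := (memLp_yy hu v j).integrable_sq

lemma integrable_dens (hu : IsAdm B u₀) (v : W12N B N) (j : Fin N) :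
    Integrable (dens u₀ v j) (cellMeasure B) := (memLp_dens hu v j).integrable (by norm_num)

/-- The `j`-th unit vector, as a constant function. -/
def unitV (B : Module.Basis (Fin 2) ℝ Plane) (j : Fin N) : W12N B N :=
  WithLp.toLp 2 (Pi.single j (cst B 1))

lemma unitV_same (j : Fin N) : unitV B j j = cst B 1 := by simp [unitV]

lemma unitV_ne {j k : Fin N} (h : k ≠ j) : unitV B j k = 0 := by simp [unitV, h]

lemma dirL_unitV (w : W12 B) (j k : Fin N) : dirL B w (unitV B j k) = 0 := by
  by_cases h : k = j
  · rw [h, unitV_same, dirL_comm, dirL_cst]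
  · rw [unitV_ne h, map_zero]

lemma actionDer_unitV (hu : IsAdm B u₀) (lam : ℝ) (v : W12N B N) (j : Fin N) :
    actionDer hu n lam v (unitV B j) = lam * ∫ x, dens u₀ v j x ∂cellMeasure B + b n j := by
  have hA := (area_pos B).ne'
  rw [actionDer_apply]
  simp only [dirL_unitV, mul_zero, Finset.sum_const_zero, zero_add]
  rw [Finset.sum_eq_single j]
  · have e1 : ∫ x, dens u₀ v j x * fn (unitV B j j) x ∂cellMeasure B =
        ∫ x, dens u₀ v j x ∂cellMeasure B := by
      refine integral_congr_ae ?_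
      rw [unitV_same]
      filter_upwards [fn_cst (B := B) 1] with x hx
      rw [hx, mul_one]
    have e2 : intL B (unitV B j j) = area B := by
      rw [intL_apply, unitV_same, integral_congr_ae (fn_cst (B := B) 1), integral_cst, mul_one]
    rw [e1, e2, div_mul_cancel₀ _ hA]
  · intro k _ hk
    rw [unitV_ne hk, map_zero, mul_zero, add_zero]
    have : ∫ x, dens u₀ v k x * fn (0 : W12 B) x ∂cellMeasure B = 0 := by
      rw [integral_congr_ae (g := fun _ => (0 : ℝ)), integral_zero]
      filter_upwards [fn_zero (B := B)] with x hx
      rw [hx, mul_zero]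
    rw [this, mul_zero]
  · simp

lemma abs_mul_integral_dens_add_le (hu : IsAdm B u₀) (lam : ℝ) (v : W12N B N) (j : Fin N) :
    |lam * ∫ x, dens u₀ v j x ∂cellMeasure B + b n j| ≤ ‖actionDer hu n lam v‖ * ‖unitV B j‖ := by
  rw [← actionDer_unitV hu lam v j]
  exact (actionDer hu n lam v).le_opNorm _

lemma sum_dens_ge (hN : N = 3 ∨ N = 4 ∨ N = 5) (v : W12N B N) (x : Plane) :
    1 / 8 * (∑ j, yy u₀ v j x ^ 2) - 2 * N ≤ ∑ j, dens u₀ v j x := by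
  have h1 := K_coercive hN fun j => yy u₀ v j x
  have e : ∑ j, dens u₀ v j x = ∑ j, ∑ k, K N j k * (yy u₀ v j x * yy u₀ v k x) -
      ∑ j, yy u₀ v j x := by
    rw [← Finset.sum_sub_distrib]
    refine Finset.sum_congr rfl fun j _ => ?_
    rw [dens, mul_sub, mul_one, Finset.mul_sum]
    congr 1
    exact Finset.sum_congr rfl fun k _ => by ring
  have h2 : ∑ j, yy u₀ v j x ≤ ∑ j : Fin N, (1 / 8 * yy u₀ v j x ^ 2 + 2) :=
    Finset.sum_le_sum fun j _ => by nlinarith [sq_nonneg (yy u₀ v j x - 4)]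
  rw [Finset.sum_add_distrib, ← Finset.mul_sum] at h2
  simp only [Finset.sum_const, Finset.card_univ, Fintype.card_fin, nsmul_eq_mul] at h2
  rw [e]
  linarith

/-- The derivative in constant directions gives the integrated equations up to an error at most `1`,
hence an upper bound for each `∫ dens`. The sum of the densities is `yᵀ K y - ∑ yⱼ`, which controls
`∑ yⱼ²`. -/
lemma sum_integral_yy_sq_le (hN : N = 3 ∨ N = 4 ∨ N = 5) (hu : IsAdm B u₀) {lam : ℝ} (hlam : 0 < lam)
    (hn : ∃ i, 0 < n i) {v : W12N B N} (hv : ∀ j : Fin N, ‖actionDer hu n lam v‖ * ‖unitV B j‖ ≤ 1) :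
    ∑ j, ∫ x, yy u₀ v j x ^ 2 ∂cellMeasure B ≤ 8 * (N / lam + 2 * N * area B) := by
  have h1 : ∀ j ∈ Finset.univ, ∫ x, dens u₀ v j x ∂cellMeasure B ≤ 1 / lam := fun j _ => by
    have h2 := (abs_le.1 ((abs_mul_integral_dens_add_le (n := n) hu lam v j).trans (hv j))).2
    have h3 := b_pos hN hn j
    rw [le_div_iff₀ hlam]
    linarith
  have h2 := Finset.sum_le_sum h1
  rw [← integral_finsetSum _ fun j _ => integrable_dens hu v j] at h2
  have i1 : Integrable (fun x => ∑ j, yy u₀ v j x ^ 2) (cellMeasure B) :=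
    integrable_finsetSum _ fun j _ => integrable_yy_sq hu v j
  have i2 : Integrable (fun x => 1 / 8 * ∑ j, yy u₀ v j x ^ 2) (cellMeasure B) := i1.const_mul _
  have h3 : ∫ x, (1 / 8 * (∑ j, yy u₀ v j x ^ 2) - 2 * N) ∂cellMeasure B ≤
      ∫ x, ∑ j, dens u₀ v j x ∂cellMeasure B :=
    integral_mono (i2.sub (integrable_const _)) (integrable_finsetSum _ fun j _ => integrable_dens hu v j)
      fun x => sum_dens_ge hN v x
  rw [integral_sub i2 (integrable_const _), integral_const_mul, integral_cst,
    integral_finsetSum _ fun j _ => integrable_yy_sq hu v j] at h3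
  simp only [Finset.sum_const, Finset.card_univ, Fintype.card_fin, nsmul_eq_mul] at h2
  rw [mul_one_div] at h2
  linarith

/-- Jensen's inequality in the elementary form `t + 1 ≤ exp t`, together with the mean value zero of
the background. -/
lemma mean_le (hu : IsAdm B u₀) (hi : ∀ j, Integrable (u₀ j) (cellMeasure B))
    (h0 : ∀ j, ∫ x, u₀ j x ∂cellMeasure B = 0) (v : W12N B N) (j : Fin N) :
    mean B (v j) ≤ (∫ x, U u₀ v j x ∂cellMeasure B) / area B := by
  have hA := area_pos B
  rw [le_div_iff₀ hA]
  have i1 : Integrable (fun x => u₀ j x + fn (v j) x) (cellMeasure B) := (hi j).add (integrable_fn _)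
  have h1 : ∫ x, (u₀ j x + fn (v j) x) ∂cellMeasure B ≤ ∫ x, U u₀ v j x ∂cellMeasure B :=
    integral_mono i1 (integrable_U hu v j) fun x => by
      have : u₀ j x + fn (v j) x + 1 ≤ Real.exp (u₀ j x + fn (v j) x) := Real.add_one_le_exp _
      change _ ≤ Real.exp (u₀ j x + fn (v j) x)
      linarith
  rw [integral_add (hi j) (integrable_fn _), h0, integral_fn_eq_mean] at h1
  linarith

lemma sum_b_mul_intL (v : W12N B N) :
    ∑ j, b n j / area B * intL B (v j) = ∑ j, b n j * mean B (v j) :=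
  Finset.sum_congr rfl fun j _ => by rw [mean]; ring

lemma sum_M_mul_nonneg (hN : N = 3 ∨ N = 4 ∨ N = 5) (hu : IsAdm B u₀) (v : W12N B N) :
    1 / 4 * ∑ j, r N j ^ 2 * ∫ x, (U u₀ v j x - 1) ^ 2 ∂cellMeasure B ≤
      ∑ j, ∑ k, M N j k * ∫ x, (U u₀ v j x - 1) * (U u₀ v k x - 1) ∂cellMeasure B := by
  have i2 : ∀ j k, Integrable (fun x => M N j k * ((U u₀ v j x - 1) * (U u₀ v k x - 1)))
      (cellMeasure B) := fun j k => (integrable_U_sub_mul hu v j k).const_mul _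
  have i1 : ∀ j, Integrable (fun x => r N j ^ 2 * (U u₀ v j x - 1) ^ 2) (cellMeasure B) :=
    fun j => (memLp_U_sub_one hu v j).integrable_sq.const_mul _
  simp only [← integral_const_mul]
  rw [← integral_finsetSum _ fun j _ => i1 j, ← integral_const_mul]
  simp only [fun j => (integral_finsetSum Finset.univ fun k (_ : k ∈ Finset.univ) => i2 j k).symm]
  rw [← integral_finsetSum _ fun j _ => integrable_finsetSum _ fun k _ => i2 j k]
  refine integral_mono ((integrable_finsetSum _ fun j _ => i1 j).const_mul _)
    (integrable_finsetSum _ fun j _ => integrable_finsetSum _ fun k _ => i2 j k) fun x => ?_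
  have h := K_coercive hN fun j => r N j * (U u₀ v j x - 1)
  simp only [mul_pow] at h
  refine h.trans (le_of_eq (Finset.sum_congr rfl fun j _ => Finset.sum_congr rfl fun k _ => ?_))
  rw [M_apply]
  ring

lemma action_ge (hN : N = 3 ∨ N = 4 ∨ N = 5) (hu : IsAdm B u₀) {α : ℝ}
    (hα : ∀ (B : Module.Basis (Fin 2) ℝ Plane) (v : W12N B N),
      α * ∑ j, dirL B (v j) (v j) ≤ quadL B N v v) {lam : ℝ} (hlam : 0 ≤ lam) (v : W12N B N) :
    α / 2 * ∑ j, dirL B (v j) (v j) +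
      lam / 8 * ∑ j, r N j ^ 2 * ∫ x, (U u₀ v j x - 1) ^ 2 ∂cellMeasure B +
      ∑ j, b n j * mean B (v j) ≤ action n u₀ lam v := by
  rw [action_eq hu, potential, sum_b_mul_intL]
  have h1 := hα B v
  have h2 := mul_le_mul_of_nonneg_left (sum_M_mul_nonneg hN hu v) (by positivity : 0 ≤ lam / 2)
  linarith

end

end ChernSimonsHiggs
end

open MeasureTheory
open scoped ContDiff
noncomputable section
namespace ChernSimonsHiggs
variable {B : Module.Basis (Fin 2) ℝ Plane} {N : ℕ}

/-! ### Boundedness of Palais-Smale sequences -/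

section
variable {u₀ : Fin N → Plane → ℝ} {n : Fin N → ℕ} {g : Fin N → ℕ → W12 B}

/-- The sum of the `yⱼ`. -/
def yS (u₀ : Fin N → Plane → ℝ) (v : W12N B N) (x : Plane) : ℝ := ∑ j, yy u₀ v j x

lemma yS_nonneg (hN : N = 3 ∨ N = 4 ∨ N = 5) (v : W12N B N) (x : Plane) : 0 ≤ yS u₀ v x :=
  Finset.sum_nonneg fun j _ => (yy_pos hN v j x).le

lemma memLp_yS (hu : IsAdm B u₀) (v : W12N B N) : MemLp (yS u₀ v) 2 (cellMeasure B) :=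
  memLp_finsetSum _ fun j _ => memLp_yy hu v j

lemma integrable_yS_cube (hN : N = 3 ∨ N = 4 ∨ N = 5) (hu : IsAdm B u₀) (v : W12N B N) {δ : ℝ}
    (hδ : 0 < δ) : Integrable (fun x => yS u₀ v x ^ 3 / (1 + δ * yS u₀ v x)) (cellMeasure B) := by
  have hm := (memLp_yS hu v).1.aemeasurable
  refine Integrable.mono' (((memLp_yS hu v).integrable_sq).const_mul (1 / δ))
    ((hm.pow_const 3).div (aemeasurable_const.add (hm.const_mul δ))).aestronglyMeasurable
    (Filter.Eventually.of_forall fun x => ?_)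
  have h0 := yS_nonneg (u₀ := u₀) hN v x
  rw [Real.norm_of_nonneg (by positivity), div_le_iff₀ (by positivity)]
  have : 1 / δ * yS u₀ v x ^ 2 * (1 + δ * yS u₀ v x) = 1 / δ * yS u₀ v x ^ 2 + yS u₀ v x ^ 3 := by
    field_simp
  rw [this]
  have : 0 ≤ 1 / δ * yS u₀ v x ^ 2 := by positivity
  linarith

lemma integrable_dens_mul_trunc (hN : N = 3 ∨ N = 4 ∨ N = 5) (hu : IsAdm B u₀) (v : W12N B N) {δ : ℝ}
    (hδ : 0 < δ) (j : Fin N) : Integrable (fun x => dens u₀ v j x * ((∑ i, K N j i * yy u₀ v i x) /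
      (1 + δ * ∑ k, yy u₀ v k x))) (cellMeasure B) := by
  have hm : AEMeasurable (fun x => ∑ i, K N j i * yy u₀ v i x) (cellMeasure B) :=
    (memLp_finsetSum _ fun i _ => (memLp_yy hu v i).const_mul (K N j i)).1.aemeasurable
  have hmS := (memLp_yS hu v).1.aemeasurable
  refine (integrable_dens hu v j).mul_bdd (c := 2 / δ)
    (hm.div (aemeasurable_const.add (hmS.const_mul δ))).aestronglyMeasurable
    (Filter.Eventually.of_forall fun x => ?_)
  have h0 : 0 ≤ ∑ k, yy u₀ v k x := yS_nonneg (u₀ := u₀) hN v x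
  have hd : 0 < 1 + δ * ∑ k, yy u₀ v k x := by positivity
  rw [norm_div, Real.norm_of_nonneg hd.le, div_le_iff₀ hd]
  have h1 : ‖∑ i, K N j i * yy u₀ v i x‖ ≤ 2 * ∑ i, yy u₀ v i x := by
    rw [Finset.mul_sum]
    refine (norm_sum_le _ _).trans (Finset.sum_le_sum fun i _ => ?_)
    rw [norm_mul, Real.norm_of_nonneg (yy_pos hN v i x).le]
    exact mul_le_mul_of_nonneg_right (abs_K_le j i) (yy_pos hN v i x).le
  refine h1.trans ?_
  have e : 2 / δ * (1 + δ * ∑ k, yy u₀ v k x) = 2 / δ + 2 * ∑ k, yy u₀ v k x := by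
    field_simp
  have : 0 < 2 / δ := by positivity
  linarith

lemma integral_yS_sq_le (hu : IsAdm B u₀) (v : W12N B N) :
    ∫ x, yS u₀ v x ^ 2 ∂cellMeasure B ≤ N * ∑ j, ∫ x, yy u₀ v j x ^ 2 ∂cellMeasure B := by
  rw [← integral_finsetSum _ fun j _ => integrable_yy_sq hu v j, ← integral_const_mul]
  refine integral_mono (memLp_yS hu v).integrable_sq
    ((integrable_finsetSum _ fun j _ => integrable_yy_sq hu v j).const_mul _) fun x => ?_
  have := sq_sum_le_card_mul_sum_sq (s := Finset.univ) (f := fun j => yy u₀ v j x)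
  simpa [yS] using this

/-- The identity `∑ dens (K y)ⱼ = ∑ yⱼ (K y)ⱼ² - yᵀ K y` splits the tested nonlinearity: the first
sum dominates the cube of `S = ∑ yⱼ`, the second costs at most `2 S²`. The second term of the bound
does not depend on `δ`. -/
lemma integral_yS_cube_le (hN : N = 3 ∨ N = 4 ∨ N = 5) (hu : IsAdm B u₀)
    (hg : ∀ i, IsApproxBackground (n i) (u₀ i) (g i)) {lam : ℝ} (hlam : 0 < lam) (v : W12N B N) {δ : ℝ}
    (hδ : 0 < δ) : 1 / (16 * N ^ 2) * ∫ x, yS u₀ v x ^ 3 / (1 + δ * yS u₀ v x) ∂cellMeasure B ≤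
      truncBound B N δ ‖actionDer hu n lam v‖ / lam +
        2 * (N * ∑ j, ∫ x, yy u₀ v j x ^ 2 ∂cellMeasure B) := by
  have h1 := sum_integral_dens_mul_le hN hu hg lam v hδ
  have h2 : ∑ j, ∫ x, dens u₀ v j x * ((∑ i, K N j i * yy u₀ v i x) /
      (1 + δ * ∑ k, yy u₀ v k x)) ∂cellMeasure B ≤ truncBound B N δ ‖actionDer hu n lam v‖ / lam := by
    rw [le_div_iff₀ hlam, mul_comm]
    exact h1
  have i1 := integrable_dens_mul_trunc hN hu v hδ
  have i2 := (memLp_yS hu v).integrable_sq.const_mul 2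
  have h3 : ∫ x, 1 / (16 * N ^ 2) * (yS u₀ v x ^ 3 / (1 + δ * yS u₀ v x)) ∂cellMeasure B ≤
      ∫ x, ((∑ j, dens u₀ v j x * ((∑ i, K N j i * yy u₀ v i x) /
      (1 + δ * ∑ k, yy u₀ v k x))) + 2 * yS u₀ v x ^ 2) ∂cellMeasure B := by
    refine integral_mono ((integrable_yS_cube hN hu v hδ).const_mul _)
      ((integrable_finsetSum _ fun j _ => i1 j).add i2) fun x => ?_
    have hy : ∀ j, 0 ≤ yy u₀ v j x := fun j => (yy_pos hN v j x).le
    have h0 := yS_nonneg (u₀ := u₀) hN v x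
    have hd : 0 < 1 + δ * yS u₀ v x := by positivity
    have a1 := cube_le_sum hN hy
    have a2 := sum_mul_K_le hy
    have e : ∑ j, dens u₀ v j x * ((∑ i, K N j i * yy u₀ v i x) / (1 + δ * ∑ k, yy u₀ v k x)) =
        ((∑ j, yy u₀ v j x * (∑ k, K N j k * yy u₀ v k x) ^ 2) -
          ∑ j, yy u₀ v j x * ∑ k, K N j k * yy u₀ v k x) / (1 + δ * yS u₀ v x) := by
      rw [← Finset.sum_sub_distrib, Finset.sum_div]
      refine Finset.sum_congr rfl fun j _ => ?_
      rw [dens, ← mul_div_assoc]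
      congr 1
      ring
    simp only [e]
    rw [← mul_div_assoc, div_add' _ _ _ hd.ne', div_le_div_iff_of_pos_right hd]
    change _ ≤ 2 * yS u₀ v x ^ 2 at a2
    change _ * yS u₀ v x ^ 3 ≤ _ at a1
    have : 0 ≤ 2 * yS u₀ v x ^ 2 * (δ * yS u₀ v x) := by positivity
    linarith
  rw [integral_const_mul, integral_add (integrable_finsetSum _ fun j _ => i1 j) i2,
    integral_finsetSum _ fun j _ => i1 j, integral_const_mul] at h3
  have := integral_yS_sq_le hu v
  linarith

/-- Where `v j` exceeds its mean `m < 0` by at most `-m / 2`, the function `yⱼ` is at most a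
multiple of `exp (m / 2)`. The complement is small by Chebyshev's inequality, with the variance
bounded by the energy. -/
lemma integral_min_yy_le (hN : N = 3 ∨ N = 4 ∨ N = 5) (hu : IsAdm B u₀) {C₀ : ℝ}
    (hC₀ : ∀ j, ∀ᵐ x ∂cellMeasure B, u₀ j x ≤ C₀) {C : ℝ} (hC : ∀ w : W12 B,
      ∫ x, (fn w x - mean B w) ^ 2 ∂cellMeasure B ≤ C * dirL B w w) (v : W12N B N) (j : Fin N)
    {R : ℝ} (hR : 0 < R) (hm : mean B (v j) < 0) :
    ∫ x, min (yy u₀ v j x) R ∂cellMeasure B ≤ area B * (r N j * Real.exp C₀ * Real.exp (mean B (v j) / 2))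
      + 4 * R / mean B (v j) ^ 2 * (C * dirL B (v j) (v j)) := by
  set m := mean B (v j) with hmdef
  have i2 : Integrable (fun x => 4 * R / m ^ 2 * (fn (v j) x - m) ^ 2) (cellMeasure B) :=
    (integrable_fn_sub_const_sq _ _).const_mul _
  have hr := r_pos hN j
  have h1 : ∫ x, min (yy u₀ v j x) R ∂cellMeasure B ≤ ∫ x, (r N j * Real.exp C₀ * Real.exp (m / 2) +
      4 * R / m ^ 2 * (fn (v j) x - m) ^ 2) ∂cellMeasure B := by
    refine integral_mono_ae ((integrable_yy hu v j).inf (integrable_const R))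
      ((integrable_const _).add i2) ?_
    filter_upwards [hC₀ j] with x hx
    have hm2 : 0 < m ^ 2 := by have := hm.ne; positivity
    rcases le_or_gt (fn (v j) x - m) (-m / 2) with h | h
    · refine (min_le_left _ _).trans ?_
      have : yy u₀ v j x ≤ r N j * Real.exp C₀ * Real.exp (m / 2) := by
        rw [yy, U_eq, mul_assoc]
        refine mul_le_mul_of_nonneg_left (mul_le_mul (Real.exp_le_exp.2 hx)
          (Real.exp_le_exp.2 (by linarith)) (Real.exp_pos _).le (Real.exp_pos _).le) hr.le
      have : 0 ≤ 4 * R / m ^ 2 * (fn (v j) x - m) ^ 2 := by positivity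
      linarith
    · refine (min_le_right _ _).trans ?_
      have h2 : R ≤ 4 * R / m ^ 2 * (fn (v j) x - m) ^ 2 := by
        rw [div_mul_eq_mul_div, le_div_iff₀ hm2]
        have : m ^ 2 ≤ 4 * (fn (v j) x - m) ^ 2 := by nlinarith
        nlinarith
      have : 0 ≤ r N j * Real.exp C₀ * Real.exp (m / 2) := by positivity
      linarith
  rw [integral_add (integrable_const _) i2, integral_cst, integral_const_mul] at h1
  refine h1.trans (add_le_add le_rfl ?_)
  exact mul_le_mul_of_nonneg_left (hC _) (by positivity)

/-- Where `S ≥ R` one has `S³ / (1 + S / R) ≥ R S² / 2`, and elsewhere `yⱼ ≤ R`. The cubic estimate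
with `δ = 1 / R` thus gives uniform integrability of `yⱼ²`. -/
lemma integral_yy_sq_le (hN : N = 3 ∨ N = 4 ∨ N = 5) (hu : IsAdm B u₀) (v : W12N B N) (j : Fin N)
    {R : ℝ} (hR : 0 < R) : ∫ x, yy u₀ v j x ^ 2 ∂cellMeasure B ≤
      2 / R * (∫ x, yS u₀ v x ^ 3 / (1 + 1 / R * yS u₀ v x) ∂cellMeasure B) +
        R * ∫ x, min (yy u₀ v j x) R ∂cellMeasure B := by
  have i1 : Integrable (fun x => 2 / R * (yS u₀ v x ^ 3 / (1 + 1 / R * yS u₀ v x))) (cellMeasure B) :=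
    (integrable_yS_cube hN hu v (by positivity)).const_mul _
  have i2 : Integrable (fun x => R * min (yy u₀ v j x) R) (cellMeasure B) :=
    ((integrable_yy hu v j).inf (integrable_const R)).const_mul R
  rw [← integral_const_mul, ← integral_const_mul, ← integral_add i1 i2]
  refine integral_mono (integrable_yy_sq hu v j) (i1.add i2) fun x => ?_
  have hy := yy_pos (u₀ := u₀) hN v j x
  have hS := yS_nonneg (u₀ := u₀) hN v x
  have hyS : yy u₀ v j x ≤ yS u₀ v x :=
    Finset.single_le_sum (f := fun j => yy u₀ v j x) (fun k _ => (yy_pos hN v k x).le)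
      (Finset.mem_univ j)
  have h1 : 0 ≤ yS u₀ v x ^ 3 / (1 + 1 / R * yS u₀ v x) := by positivity
  have h2 : 0 ≤ R * min (yy u₀ v j x) R := by positivity
  simp only
  rcases le_or_gt R (yS u₀ v x) with h | h
  · have h3 : yS u₀ v x ^ 2 ≤ 2 / R * (yS u₀ v x ^ 3 / (1 + 1 / R * yS u₀ v x)) := by
      rw [← mul_div_assoc, le_div_iff₀ (by positivity)]
      have e : 2 / R * yS u₀ v x ^ 3 - yS u₀ v x ^ 2 * (1 + 1 / R * yS u₀ v x) =
          yS u₀ v x ^ 2 * ((yS u₀ v x - R) / R) := by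
        field_simp
        ring
      have : 0 ≤ yS u₀ v x ^ 2 * ((yS u₀ v x - R) / R) := by
        have : 0 ≤ yS u₀ v x - R := by linarith
        positivity
      linarith
    have : yy u₀ v j x ^ 2 ≤ yS u₀ v x ^ 2 := pow_le_pow_left₀ hy.le hyS 2
    linarith
  · have h4 : min (yy u₀ v j x) R = yy u₀ v j x := min_eq_left (hyS.trans h.le)
    rw [h4]
    have : 0 ≤ 2 / R * (yS u₀ v x ^ 3 / (1 + 1 / R * yS u₀ v x)) := by positivity
    nlinarith

/-- If `yⱼ` tends to zero in `L²` while the other components stay bounded, then so does `∫ dens`;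
this is incompatible with the integrated equation. -/
lemma abs_integral_dens_le (hN : N = 3 ∨ N = 4 ∨ N = 5) (hu : IsAdm B u₀) (v : W12N B N) (j : Fin N) :
    |∫ x, dens u₀ v j x ∂cellMeasure B| ≤ √(∫ x, yy u₀ v j x ^ 2 ∂cellMeasure B) *
      (2 * √(∫ x, yS u₀ v x ^ 2 ∂cellMeasure B) + √(area B)) := by
  have h1 := integral_abs_mul_abs_le (memLp_yy hu v j) (memLp_yS hu v)
  have h2 := integral_abs_mul_abs_le (memLp_yy hu v j) (memLp_const (μ := cellMeasure B) (1 : ℝ))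
  have i1 : Integrable (fun x => |yy u₀ v j x| * |yS u₀ v x|) (cellMeasure B) :=
    (memLp_yy hu v j).abs.integrable_mul (memLp_yS hu v).abs
  have i2 : Integrable (fun x => |yy u₀ v j x| * |(1 : ℝ)|) (cellMeasure B) :=
    (integrable_yy hu v j).abs.mul_const _
  have h3 : |∫ x, dens u₀ v j x ∂cellMeasure B| ≤
      ∫ x, (2 * (|yy u₀ v j x| * |yS u₀ v x|) + |yy u₀ v j x| * |(1 : ℝ)|) ∂cellMeasure B := by
    refine (abs_integral_le_integral_abs).trans ?_
    refine integral_mono (integrable_dens hu v j).abs ((i1.const_mul 2).add i2) fun x => ?_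
    simp only
    rw [dens, abs_mul, abs_one, mul_one]
    have h4 : |∑ i, K N j i * yy u₀ v i x| ≤ 2 * |yS u₀ v x| := by
      rw [abs_of_nonneg (yS_nonneg hN v x), yS, Finset.mul_sum]
      refine (Finset.abs_sum_le_sum_abs _ _).trans (Finset.sum_le_sum fun i _ => ?_)
      rw [abs_mul, abs_of_pos (yy_pos hN v i x)]
      exact mul_le_mul_of_nonneg_right (abs_K_le j i) (yy_pos hN v i x).le
    calc |yy u₀ v j x| * |(∑ k, K N j k * yy u₀ v k x) - 1| ≤ |yy u₀ v j x| * (2 * |yS u₀ v x| + 1) := by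
          refine mul_le_mul_of_nonneg_left ?_ (abs_nonneg _)
          refine (abs_sub _ _).trans (add_le_add h4 (by simp))
      _ = _ := by ring
  rw [integral_add (i1.const_mul 2) i2, integral_const_mul] at h3
  simp only [one_pow, integral_cst, mul_one] at h2
  simp only [abs_one, mul_one] at h2 h3
  nlinarith

end

end ChernSimonsHiggs
end

/-! ### The Palais-Smale condition -/

open MeasureTheory
open scoped ContDiff
noncomputable section
namespace ChernSimonsHiggs
variable {B : Module.Basis (Fin 2) ℝ Plane} {N : ℕ}

section
variable {u₀ : Fin N → Plane → ℝ} {n : Fin N → ℕ} {g : Fin N → ℕ → W12 B}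

lemma integral_U_le (hu : IsAdm B u₀) (v : W12N B N) (j : Fin N) :
    r N j * ∫ x, U u₀ v j x ∂cellMeasure B ≤ ∫ x, yy u₀ v j x ^ 2 ∂cellMeasure B + area B := by
  rw [← integral_const_mul, ← mul_one (area B), ← integral_cst,
    ← integral_add (integrable_yy_sq hu v j) (integrable_const _)]
  refine integral_mono ((integrable_U hu v j).const_mul _)
    ((integrable_yy_sq hu v j).add (integrable_const _)) fun x => ?_
  change yy u₀ v j x ≤ yy u₀ v j x ^ 2 + 1
  nlinarith [sq_nonneg (yy u₀ v j x - 1 / 2)]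

lemma exists_mean_le (hN : N = 3 ∨ N = 4 ∨ N = 5) (hu : IsAdm B u₀)
    (hi : ∀ j, Integrable (u₀ j) (cellMeasure B)) (h0 : ∀ j, ∫ x, u₀ j x ∂cellMeasure B = 0) (Y : ℝ) :
    ∃ C, 0 ≤ C ∧ ∀ v : W12N B N, ∑ j, ∫ x, yy u₀ v j x ^ 2 ∂cellMeasure B ≤ Y →
      ∀ j, mean B (v j) ≤ C := by
  have hA := area_pos B
  have hq : ∀ j, 0 ≤ (|Y| + area B) / (r N j * area B) := fun j => by
    have := r_pos hN j
    positivity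
  refine ⟨∑ j, (|Y| + area B) / (r N j * area B), Finset.sum_nonneg fun j _ => hq j, fun v hv j => ?_⟩
  have hr := r_pos hN j
  refine (mean_le hu hi h0 v j).trans (le_trans ?_
    (Finset.single_le_sum (f := fun j => (|Y| + area B) / (r N j * area B)) (fun j _ => hq j)
      (Finset.mem_univ j)))
  rw [div_le_div_iff₀ hA (by positivity)]
  have h1 := integral_U_le (u₀ := u₀) hu v j
  have h2 : ∫ x, yy u₀ v j x ^ 2 ∂cellMeasure B ≤ Y :=
    (Finset.single_le_sum (f := fun j => ∫ x, yy u₀ v j x ^ 2 ∂cellMeasure B)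
      (fun j _ => integral_nonneg fun x => sq_nonneg _) (Finset.mem_univ j)).trans hv
  have h3 := le_abs_self Y
  nlinarith

/-- The shape of the error terms in `exists_bound_of_palaisSmale` for a fixed truncation level: each
has a factor that vanishes as the norm `ε` of the derivative tends to zero or as the lowest mean `m`
tends to `-∞`. -/
lemma tendsto_remainder {l : Filter ℕ} {ε m : ℕ → ℝ} (hε : Filter.Tendsto ε l (nhds 0))
    (hm : Filter.Tendsto m l Filter.atBot) (a₁ a₂ a₃ a₄ a₅ : ℝ) :
    Filter.Tendsto (fun k => a₁ * ε k + a₂ * ε k ^ 2 + a₃ * Real.exp (m k / 2) +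
      (a₄ * (m k)⁻¹ ^ 2 + a₅ * -(m k)⁻¹)) l (nhds 0) := by
  have h1 : Filter.Tendsto (fun k => (m k)⁻¹) l (nhds 0) := tendsto_inv_atBot_zero.comp hm
  have h2 : Filter.Tendsto (fun k => Real.exp (m k / 2)) l (nhds 0) :=
    Real.tendsto_exp_atBot.comp (hm.atBot_div_const (by norm_num))
  have := (((hε.const_mul a₁).add ((hε.pow 2).const_mul a₂)).add (h2.const_mul a₃)).add
    (((h1.pow 2).const_mul a₄).add (h1.neg.const_mul a₅))
  simpa using this

set_option maxHeartbeats 1000000 in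
/-- Palais-Smale sequences are bounded. -/
lemma exists_bound_of_palaisSmale (hN : N = 3 ∨ N = 4 ∨ N = 5) (hn : ∃ i, 0 < n i) (hu : IsAdm B u₀)
    (hg : ∀ i, IsApproxBackground (n i) (u₀ i) (g i)) (h0 : ∀ j, ∫ x, u₀ j x ∂cellMeasure B = 0)
    {lam : ℝ} (hlam : 0 < lam) (v : ℕ → W12N B N) (c : ℝ)
    (hI : Filter.Tendsto (fun k => action n u₀ lam (v k)) Filter.atTop (nhds c))
    (hI' : Filter.Tendsto (fun k => ‖actionDer hu n lam (v k)‖) Filter.atTop (nhds 0)) :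
    ∃ R, ∀ᶠ k in (Filter.hyperfilter ℕ : Filter ℕ), ‖v k‖ ≤ R := by
  by_contra hcon
  set l : Ultrafilter ℕ := Filter.hyperfilter ℕ with hl
  -- For an ultrafilter, failure of every eventual bound means that the norms eventually exceed each
  -- `R`, so no subsequences are needed.
  replace hcon : ∀ R, ∀ᶠ k in (l : Filter ℕ), ¬ ‖v k‖ ≤ R := fun R =>
    Ultrafilter.eventually_not.2 fun h => hcon ⟨R, h⟩
  have hle : (l : Filter ℕ) ≤ Filter.atTop := Nat.hyperfilter_le_atTop
  replace hI' := hI'.mono_left hle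
  replace hI := hI.mono_left hle
  set ε : ℕ → ℝ := fun k => ‖actionDer hu n lam (v k)‖ with hεdef
  have : Nonempty (Fin N) := ⟨⟨0, pos_of_hN hN⟩⟩
  have hN0 : (0 : ℝ) < N := Nat.cast_pos.2 (pos_of_hN hN)
  have hA := area_pos B
  obtain ⟨α, hα, hquad⟩ := exists_quadL_coercive hN
  obtain ⟨Cn, hCn, hnorm⟩ := exists_norm_sq_le_mean B N
  obtain ⟨CP, hCP, hpoin⟩ := exists_integral_sub_mean_sq_le B
  obtain ⟨C₀, -, hC₀⟩ := hu.2
  have ev1 : ∀ᶠ k in (l : Filter ℕ), action n u₀ lam (v k) ≤ |c| + 1 :=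
    (hI.eventually_lt_const (lt_add_of_le_of_pos (le_abs_self c) one_pos)).mono fun k hk => hk.le
  have ev2 : ∀ᶠ k in (l : Filter ℕ), ∀ j : Fin N, ε k * ‖unitV B j‖ ≤ 1 := by
    refine Filter.eventually_all.2 fun j => ?_
    have := hI'.mul_const ‖unitV B j‖
    rw [zero_mul] at this
    exact (this.eventually_lt_const one_pos).mono fun k hk => hk.le
  set Y : ℝ := 8 * (N / lam + 2 * N * area B) with hY
  have ev3 : ∀ᶠ k in (l : Filter ℕ), ∑ j, ∫ x, yy u₀ (v k) j x ^ 2 ∂cellMeasure B ≤ Y :=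
    ev2.mono fun k hk => sum_integral_yy_sq_le hN hu hlam hn hk
  obtain ⟨C3, hC3, hmean⟩ := exists_mean_le (B := B) (u₀ := u₀) hN hu (fun j => (hg j).integrable) h0 Y
  -- The component with the smallest mean may vary with `k`, but it is constant along the
  -- ultrafilter.
  obtain ⟨j, hj⟩ : ∃ j : Fin N, ∀ᶠ k in (l : Filter ℕ), ∀ i, mean B (v k j) ≤ mean B (v k i) :=
    (Ultrafilter.eventually_exists_iff).1 (Filter.Eventually.of_forall fun k =>
      Finite.exists_min fun i => mean B (v k i))
  set m : ℕ → ℝ := fun k => mean B (v k j) with hmdef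
  set S : ℝ := ∑ i, b n i with hS
  have hb : ∀ i, 0 < b n i := fun i => b_pos hN hn i
  have hS0 : 0 ≤ S := Finset.sum_nonneg fun i _ => (hb i).le
  have evD : ∀ᶠ k in (l : Filter ℕ), ∑ i, dirL B (v k i) (v k i) ≤ 2 / α * (|c| + 1 + S * -m k) := by
    filter_upwards [ev1, hj] with k h1 h2
    have h3 := action_ge (n := n) hN hu hquad hlam.le (v k)
    have h4 : S * m k ≤ ∑ i, b n i * mean B (v k i) := by
      rw [hS, Finset.sum_mul]
      exact Finset.sum_le_sum fun i _ => mul_le_mul_of_nonneg_left (h2 i) (hb i).le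
    have h5 : 0 ≤ lam / 8 * ∑ i, r N i ^ 2 * ∫ x, (U u₀ (v k) i x - 1) ^ 2 ∂cellMeasure B := by
      refine mul_nonneg (by positivity) (Finset.sum_nonneg fun i _ => mul_nonneg (sq_nonneg _)
        (integral_nonneg fun x => sq_nonneg _))
    rw [div_mul_eq_mul_div, le_div_iff₀ hα]
    linarith
  -- If the smallest mean stayed above some level, all means would be bounded (from above by
  -- `hmean`), and so would the energy by `evD`; then the norms would be bounded.
  have hmbot : Filter.Tendsto m (l : Filter ℕ) Filter.atBot := by
    refine Filter.tendsto_atBot.2 fun L => ?_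
    by_contra hno
    rw [← Ultrafilter.eventually_not] at hno
    obtain ⟨k, ⟨h1, h2, h3⟩, h4, h5⟩ := ((hcon (√(Cn * (2 / α * (|c| + 1 + S * |L|) +
      ∑ _i : Fin N, (C3 + |L|) ^ 2)))).and (ev3.and hno)).and (evD.and hj) |>.exists
    refine h1 (Real.le_sqrt_of_sq_le ?_)
    have h3' : L < m k := not_le.1 h3
    refine (hnorm (v k)).trans (mul_le_mul_of_nonneg_left ?_ hCn.le)
    rw [Finset.sum_add_distrib]
    have h6 := neg_abs_le L
    refine add_le_add (h4.trans ?_) (Finset.sum_le_sum fun i _ => ?_)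
    · gcongr
      linarith
    · have h7 := hmean (v k) h2 i
      have h8 := h5 i
      refine sq_le_sq' ?_ ?_
      · change m k ≤ _ at h8
        linarith
      · have := abs_nonneg L
        linarith
  -- The variance grows at most linearly in `|m k|` and is divided by `(m k)²`, so the truncated
  -- integral of `yⱼ` tends to zero. The cubic bound with `δ = 1 / R` leaves the error `(2 / R) (16
  -- N²) (2 N Y) = 64 N³ Y / R`, and `R` is arbitrary.
  have hy0 : Filter.Tendsto (fun k => ∫ x, yy u₀ (v k) j x ^ 2 ∂cellMeasure B) (l : Filter ℕ)
      (nhds 0) := by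
    have hkey : ∀ R : ℝ, 0 < R → ∃ f : ℕ → ℝ, Filter.Tendsto f (l : Filter ℕ) (nhds 0) ∧
        ∀ᶠ k in (l : Filter ℕ), ∫ x, yy u₀ (v k) j x ^ 2 ∂cellMeasure B ≤
          f k + 64 * N ^ 3 * Y / R := by
      intro R hR
      refine ⟨_, tendsto_remainder hI' hmbot
        (2 / R * (16 * N ^ 2) * (2 * N ^ 2 * (√(area B) / (1 / R)) / lam))
        (2 / R * (16 * N ^ 2) * (N ^ 3 / (1 / R) / lam)) (R * (area B * (r N j * Real.exp C₀)))
        (R * (4 * R * (CP * (2 / α * (|c| + 1))))) (R * (4 * R * (CP * (2 / α * S)))), ?_⟩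
      filter_upwards [ev3, evD, hmbot.eventually_lt_atBot 0] with k h1 h2 h3
      have h4 := integral_yy_sq_le (u₀ := u₀) hN hu (v k) j hR
      have h5 := integral_yS_cube_le (n := n) hN hu hg hlam (v k) (one_div_pos.2 hR)
      have h6 := integral_min_yy_le hN hu hC₀ hpoin (v k) j hR h3
      have h7 : dirL B (v k j) (v k j) ≤ 2 / α * (|c| + 1 + S * -m k) :=
        (Finset.single_le_sum (f := fun i => dirL B (v k i) (v k i))
          (fun i _ => dirL_self_nonneg _) (Finset.mem_univ j)).trans h2
      change _ ≤ truncBound B N (1 / R) (ε k) / lam + _ at h5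
      change _ ≤ area B * (r N j * Real.exp C₀ * Real.exp (m k / 2)) + 4 * R / m k ^ 2 * _ at h6
      have h5' : ∫ x, yS u₀ (v k) x ^ 3 / (1 + 1 / R * yS u₀ (v k) x) ∂cellMeasure B ≤
          (16 * N ^ 2) * (truncBound B N (1 / R) (ε k) / lam + 2 * (N * Y)) := by
        have h8 := mul_le_mul_of_nonneg_left h5 (by positivity : (0 : ℝ) ≤ 16 * N ^ 2)
        rw [← mul_assoc, mul_one_div_cancel (by positivity), one_mul] at h8
        refine h8.trans ?_
        gcongr
      have h6' : ∫ x, min (yy u₀ (v k) j x) R ∂cellMeasure B ≤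
          area B * (r N j * Real.exp C₀ * Real.exp (m k / 2)) +
            4 * R / m k ^ 2 * (CP * (2 / α * (|c| + 1 + S * -m k))) := by
        refine h6.trans ?_
        gcongr
      have hm0 : m k ≠ 0 := h3.ne
      calc _ ≤ 2 / R * ((16 * N ^ 2) * (truncBound B N (1 / R) (ε k) / lam + 2 * (N * Y))) +
            R * (area B * (r N j * Real.exp C₀ * Real.exp (m k / 2)) +
              4 * R / m k ^ 2 * (CP * (2 / α * (|c| + 1 + S * -m k)))) := by
            refine h4.trans (add_le_add ?_ ?_)
            · exact mul_le_mul_of_nonneg_left h5' (by positivity)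
            · exact mul_le_mul_of_nonneg_left h6' hR.le
        _ = _ := by
            rw [truncBound]
            field_simp
            ring
    rw [tendsto_order]
    refine ⟨fun a ha => Filter.Eventually.of_forall fun k =>
      ha.trans_le (integral_nonneg fun x => sq_nonneg _), fun a ha => ?_⟩
    have hY0 : 0 ≤ Y := by positivity
    obtain ⟨f, hf, hf'⟩ := hkey (2 * (64 * N ^ 3 * Y + 1) / a) (by positivity)
    filter_upwards [hf', hf.eventually_lt_const (half_pos ha)] with k h1 h2
    refine h1.trans_lt ?_
    have : 64 * N ^ 3 * Y / (2 * (64 * N ^ 3 * Y + 1) / a) ≤ a / 2 := by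
      rw [div_div_eq_mul_div, div_le_div_iff₀ (by positivity) (by norm_num)]
      nlinarith [mul_nonneg (by positivity : (0 : ℝ) ≤ 64 * N ^ 3 * Y) ha.le]
    linarith
  have hlim : Filter.Tendsto (fun k => lam * (√(∫ x, yy u₀ (v k) j x ^ 2 ∂cellMeasure B) *
      (2 * √(N * Y) + √(area B))) + ε k * ‖unitV B j‖) (l : Filter ℕ) (nhds 0) := by
    have := ((hy0.sqrt.mul_const (2 * √(N * Y) + √(area B))).const_mul lam).add
      (hI'.mul_const ‖unitV B j‖)
    simpa using this
  -- The integrated equation bounds the positive constant `b n j` by a sequence that tends to zero.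
  refine absurd (ge_of_tendsto hlim (b := b n j) ?_) (not_le.2 (hb j))
  filter_upwards [ev3] with k h1
  have h2 := abs_mul_integral_dens_add_le (n := n) hu lam (v k) j
  have h3 := abs_integral_dens_le (u₀ := u₀) hN hu (v k) j
  have h4 : √(∫ x, yS u₀ (v k) x ^ 2 ∂cellMeasure B) ≤ √(N * Y) :=
    Real.sqrt_le_sqrt ((integral_yS_sq_le hu (v k)).trans (by gcongr))
  have h5 : |∫ x, dens u₀ (v k) j x ∂cellMeasure B| ≤
      √(∫ x, yy u₀ (v k) j x ^ 2 ∂cellMeasure B) * (2 * √(N * Y) + √(area B)) :=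
    h3.trans (by gcongr)
  have h6 := (abs_le.1 h2).2
  have h7 := (abs_le.1 h5).1
  change _ ≤ ε k * _ at h6
  nlinarith

end

end ChernSimonsHiggs
end

open MeasureTheory
open scoped ContDiff
noncomputable section
namespace ChernSimonsHiggs
variable {B : Module.Basis (Fin 2) ℝ Plane} {N : ℕ}

/-! ### Coercivity on the relaxed constraint set -/

/-- The Trudinger inequality for `s (w - mean)`, whose norm is controlled by the energy through
Poincaré's inequality. The quadratic dependence on `s` in the exponent is what allows an arbitrarily
small coefficient of the energy in `exists_neg_mean_le`. -/
lemma exists_integral_exp_sub_mean_le (B : Module.Basis (Fin 2) ℝ Plane) : ∃ C, 0 < C ∧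
    ∀ (w : W12 B) (s : ℝ), 0 ≤ s → Integrable (fun x => Real.exp (s * (fn w x - mean B w))) (cellMeasure B) ∧
      ∫ x, Real.exp (s * (fn w x - mean B w)) ∂cellMeasure B ≤ C * Real.exp (C * (s ^ 2 * dirL B w w)) := by
  obtain ⟨C, hC, h⟩ := exists_trudinger B
  obtain ⟨CP, hCP, hP⟩ := exists_integral_sub_mean_sq_le B
  refine ⟨C * (CP + 1) + C, by positivity, fun w s hs => ?_⟩
  obtain ⟨z, hz⟩ : ∃ z, z = s • (w - cst B (mean B w)) := ⟨_, rfl⟩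
  have hzf : fn z =ᵐ[cellMeasure B] fun x => s * (fn w x - mean B w) := by
    filter_upwards [fn_smul s (w - cst B (mean B w)), fn_sub w (cst B (mean B w)),
      fn_cst (B := B) (mean B w)] with x h1 h2 h3
    rw [hz, h1, h2, h3]
  obtain ⟨h1, h2⟩ := h z
  have hdir : dirL B z z = s ^ 2 * dirL B w w := by
    rw [hz]
    simp only [map_smul, smul_apply, smul_eq_mul, map_sub, sub_apply, dirL_cst,
      dirL_comm w (cst B _)]
    ring
  have hsq : ∫ x, fn z x ^ 2 ∂cellMeasure B = s ^ 2 * ∫ x, (fn w x - mean B w) ^ 2 ∂cellMeasure B := by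
    rw [← integral_const_mul]
    refine integral_congr_ae ?_
    filter_upwards [hzf] with x hx
    rw [hx]
    ring
  have hnorm : ‖z‖ ^ 2 ≤ (CP + 1) * (s ^ 2 * dirL B w w) := by
    rw [norm_sq_eq, ← dirL_self, hdir, hsq]
    nlinarith [mul_le_mul_of_nonneg_left (hP w) (sq_nonneg s)]
  have hle : ∀ᵐ x ∂cellMeasure B, Real.exp (s * (fn w x - mean B w)) ≤ Real.exp |fn z x| := by
    filter_upwards [hzf] with x hx
    rw [hx]
    exact Real.exp_le_exp.2 (le_abs_self _)
  have hint : Integrable (fun x => Real.exp (s * (fn w x - mean B w))) (cellMeasure B) := by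
    refine Integrable.mono' h1 (Real.continuous_exp.comp_aestronglyMeasurable
      (((memLp_fn w).1.sub aestronglyMeasurable_const).const_mul s)) ?_
    filter_upwards [hle] with x hx
    rwa [Real.norm_of_nonneg (Real.exp_pos _).le]
  refine ⟨hint, (integral_mono_ae hint h1 hle).trans (h2.trans ?_)⟩
  have hd : 0 ≤ s ^ 2 * dirL B w w := mul_nonneg (sq_nonneg s) (dirL_self_nonneg w)
  have hCC : 0 ≤ C * (CP + 1) := by positivity
  have h3 : C * ‖z‖ ^ 2 ≤ (C * (CP + 1) + C) * (s ^ 2 * dirL B w w) := by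
    refine (mul_le_mul_of_nonneg_left hnorm hC.le).trans ?_
    rw [← mul_assoc]
    exact mul_le_mul_of_nonneg_right (by linarith) hd
  exact mul_le_mul (by linarith) (Real.exp_le_exp.2 h3) (Real.exp_pos _).le (by linarith)

/-- A pointwise inequality of Paley-Zygmund type: either `exp p` is below the threshold `exp q`, or
`exp (s (p - q)) ≥ 1`, and then `t ≤ η t² + 1 / (4 η)` with `t = exp p`. -/
lemma exp_le_add_add (p q : ℝ) {η s : ℝ} (hη : 0 < η) (hs : 0 ≤ s) :
    Real.exp p ≤ Real.exp q + η * Real.exp p ^ 2 + 1 / (4 * η) * Real.exp (s * (p - q)) := by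
  have h1 := Real.exp_pos q
  have h2 : 0 ≤ η * Real.exp p ^ 2 := by positivity
  have h3 : 0 ≤ 1 / (4 * η) * Real.exp (s * (p - q)) := by positivity
  rcases le_or_gt p q with h | h
  · have := Real.exp_le_exp.2 h
    linarith
  · have h4 : 1 ≤ Real.exp (s * (p - q)) := Real.one_le_exp (mul_nonneg hs (by linarith))
    have h5 : 1 / (4 * η) ≤ 1 / (4 * η) * Real.exp (s * (p - q)) :=
      le_mul_of_one_le_right (by positivity) h4
    have h6 : 0 ≤ (2 * η * Real.exp p - 1) ^ 2 / (4 * η) := by positivity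
    have e6 : (2 * η * Real.exp p - 1) ^ 2 / (4 * η) =
        η * Real.exp p ^ 2 - Real.exp p + 1 / (4 * η) := by
      field_simp
      ring
    linarith

section
variable {u₀ : Fin N → Plane → ℝ} {n : Fin N → ℕ}

/-- The relaxation of the constraints to inequalities. -/
def looseSet (n : Fin N → ℕ) (u₀ : Fin N → Plane → ℝ) (lam : ℝ) : Set (W12N B N) :=
  {v | ∀ j, 8 * b n j / lam * (∫ x, U u₀ v j x ^ 2 ∂cellMeasure B) ≤
      (∫ x, U u₀ v j x ∂cellMeasure B) ^ 2 ∧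
    Q u₀ v j ≤ 4 * r N j * ∫ x, U u₀ v j x ^ 2 ∂cellMeasure B}

lemma integral_U_pos (hu : IsAdm B u₀) (v : W12N B N) (j : Fin N) :
    0 < ∫ x, U u₀ v j x ∂cellMeasure B := by
  have : cellMeasure B ≠ 0 := fun h => by
    have h1 := cellMeasure_univ B
    rw [h] at h1
    simp at h1
    exact (area_pos B).ne h1
  rw [integral_pos_iff_support_of_nonneg (fun x => (U_pos v j x).le) (integrable_U hu v j)]
  have e : Function.support (U u₀ v j) = Set.univ := Set.eq_univ_of_forall fun x => (U_pos v j x).ne'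
  rw [e]
  exact pos_iff_ne_zero.2 (Measure.measure_univ_ne_zero.2 this)

lemma integral_U_sq_eq (v : W12N B N) (j : Fin N) : ∫ x, U u₀ v j x ^ 2 ∂cellMeasure B =
    ∫ x, U u₀ v j x * U u₀ v j x ∂cellMeasure B := by simp only [sq]

lemma Q_eq (hu : IsAdm B u₀) (v : W12N B N) (j : Fin N) : r N j * Q u₀ v j =
    2 * r N j ^ 2 * (∫ x, U u₀ v j x ^ 2 ∂cellMeasure B) - ∫ x, dens u₀ v j x ∂cellMeasure B := by
  have i1 : Integrable (fun x => 2 * r N j ^ 2 * U u₀ v j x ^ 2) (cellMeasure B) :=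
    (memLp_U hu v j).integrable_sq.const_mul _
  rw [Q, ← integral_const_mul, ← integral_const_mul, ← integral_sub i1 (integrable_dens hu v j)]
  refine integral_congr_ae (Filter.Eventually.of_forall fun x => ?_)
  simp only [dens, yy]
  rw [← Finset.add_sum_erase Finset.univ _ (Finset.mem_univ j), K_diag]
  ring

lemma integral_U_le_Q (hN : N = 3 ∨ N = 4 ∨ N = 5) (hu : IsAdm B u₀) (v : W12N B N) (j : Fin N) :
    ∫ x, U u₀ v j x ∂cellMeasure B ≤ Q u₀ v j := by
  have hi : Integrable (fun x => U u₀ v j x *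
      (1 - ∑ k ∈ Finset.univ.erase j, K N j k * (r N k * U u₀ v k x))) (cellMeasure B) := by
    refine (memLp_U hu v j).integrable_mul ((memLp_const 1).sub
      (memLp_finsetSum _ fun k _ => ((memLp_U hu v k).const_mul (r N k)).const_mul (K N j k)))
  refine integral_mono (integrable_U hu v j) hi fun x => ?_
  refine le_mul_of_one_le_right (U_pos v j x).le ?_
  have : ∑ k ∈ Finset.univ.erase j, K N j k * (r N k * U u₀ v k x) ≤ 0 :=
    Finset.sum_nonpos fun k hk => mul_nonpos_of_nonpos_of_nonneg
      (K_nonpos (Finset.ne_of_mem_erase hk).symm) (mul_pos (r_pos hN k) (U_pos v k x)).le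
  linarith

/-- With `X = ∫ Uⱼ` and `Y = ∫ Uⱼ²`, the chain `X ≤ Qⱼ ≤ 4 rⱼ Y` and the constraint `8 bⱼ Y / λ ≤
X²` give `2 bⱼ X ≤ rⱼ λ X²`. -/
lemma le_integral_U_of_mem_looseSet (hN : N = 3 ∨ N = 4 ∨ N = 5) (hn : ∃ i, 0 < n i) (hu : IsAdm B u₀)
    {lam : ℝ} (hlam : 0 < lam) {v : W12N B N} (hv : v ∈ looseSet n u₀ lam) (j : Fin N) :
    2 * b n j / (r N j * lam) ≤ ∫ x, U u₀ v j x ∂cellMeasure B := by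
  obtain ⟨h1, h2⟩ := hv j
  have h3 := integral_U_le_Q hN hu v j
  have h4 := integral_U_pos hu v j
  have hb := b_pos hN hn j
  have hr := r_pos hN j
  set X := ∫ x, U u₀ v j x ∂cellMeasure B
  set Y := ∫ x, U u₀ v j x ^ 2 ∂cellMeasure B
  rw [div_mul_eq_mul_div, div_le_iff₀ hlam] at h1
  rw [div_le_iff₀ (by positivity)]
  have h5 : X ≤ 4 * r N j * Y := h3.trans h2
  have h6 : 2 * b n j * X ≤ (X * (r N j * lam)) * X := by
    nlinarith [mul_le_mul_of_nonneg_left h5 hb.le, mul_le_mul_of_nonneg_left h1 hr.le]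
  exact le_of_mul_le_mul_right h6 h4

lemma integrable_exp_mul (hu : IsAdm B u₀) (v : W12N B N) (j : Fin N) {s : ℝ} (hs : 0 ≤ s) (q : ℝ) :
    Integrable (fun x => Real.exp (s * (u₀ j x + fn (v j) x - q))) (cellMeasure B) := by
  obtain ⟨C, hC, h⟩ := exists_integral_exp_sub_mean_le B
  obtain ⟨hm, C₀, hC₀, hb⟩ := hu
  refine Integrable.mono' ((h (v j) s hs).1.const_mul (Real.exp (s * (C₀ + mean B (v j) - q))))
    (Real.continuous_exp.comp_aestronglyMeasurable
      ((((hm j).add (memLp_fn (v j)).1).sub aestronglyMeasurable_const).const_mul s)) ?_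
  filter_upwards [hb j] with x hx
  rw [Real.norm_of_nonneg (Real.exp_pos _).le, ← Real.exp_add]
  refine Real.exp_le_exp.2 ?_
  rw [← mul_add]
  exact mul_le_mul_of_nonneg_left (by linarith) hs

/-- The threshold is half of the average of `Uⱼ`, and `η = X / (4 Y)`. After integration the first
two terms account for `X / 2` and `X / 4`; the last one must supply the remaining quarter of `X`. -/
lemma sq_div_le_integral_exp (hu : IsAdm B u₀) (v : W12N B N) (j : Fin N) {s : ℝ} (hs : 0 ≤ s) :
    (∫ x, U u₀ v j x ∂cellMeasure B) ^ 2 / (4 * ∫ x, U u₀ v j x ^ 2 ∂cellMeasure B) ≤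
      ∫ x, Real.exp (s * (u₀ j x + fn (v j) x -
        Real.log ((∫ x, U u₀ v j x ∂cellMeasure B) / (2 * area B)))) ∂cellMeasure B := by
  have hX := integral_U_pos hu v j
  have hA := area_pos B
  have hY : 0 < ∫ x, U u₀ v j x ^ 2 ∂cellMeasure B := by
    have h := integral_abs_mul_abs_le (memLp_U hu v j) (memLp_const (μ := cellMeasure B) (1 : ℝ))
    simp only [abs_one, mul_one, abs_of_pos (U_pos v j _)] at h
    by_contra hno
    rw [Real.sqrt_eq_zero_of_nonpos (not_lt.1 hno), zero_mul] at h
    linarith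
  set X := ∫ x, U u₀ v j x ∂cellMeasure B
  set Y := ∫ x, U u₀ v j x ^ 2 ∂cellMeasure B
  set q := Real.log (X / (2 * area B))
  set E := ∫ x, Real.exp (s * (u₀ j x + fn (v j) x - q)) ∂cellMeasure B
  have hq : Real.exp q = X / (2 * area B) := Real.exp_log (by positivity)
  have i1 : Integrable (fun x => X / (4 * Y) * U u₀ v j x ^ 2) (cellMeasure B) :=
    (memLp_U hu v j).integrable_sq.const_mul _
  have i2 : Integrable (fun x => 1 / (4 * (X / (4 * Y))) *
      Real.exp (s * (u₀ j x + fn (v j) x - q))) (cellMeasure B) :=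
    (integrable_exp_mul hu v j hs q).const_mul _
  have i3 : Integrable (fun x => X / (2 * area B) + X / (4 * Y) * U u₀ v j x ^ 2) (cellMeasure B) :=
    (integrable_const _).add i1
  have h1 : X ≤ ∫ x, (X / (2 * area B) + X / (4 * Y) * U u₀ v j x ^ 2 + 1 / (4 * (X / (4 * Y))) *
      Real.exp (s * (u₀ j x + fn (v j) x - q))) ∂cellMeasure B := by
    refine integral_mono (integrable_U hu v j) (i3.add i2) fun x => ?_
    have := exp_le_add_add (u₀ j x + fn (v j) x) q (η := X / (4 * Y)) (by positivity) hs
    rwa [hq] at this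
  rw [integral_add i3 i2, integral_add (integrable_const _) i1, integral_const_mul, integral_const_mul,
    integral_cst] at h1
  have e1 : area B * (X / (2 * area B)) = X / 2 := by field_simp
  have e2 : X / (4 * Y) * Y = X / 4 := by field_simp
  have e3 : 1 / (4 * (X / (4 * Y))) * E = Y / X * E := by field_simp
  change X ≤ area B * (X / (2 * area B)) + X / (4 * Y) * Y + 1 / (4 * (X / (4 * Y))) * E at h1
  rw [e1, e2, e3] at h1
  have h2 : X / 4 ≤ Y / X * E := by linarith
  rw [div_mul_eq_mul_div, le_div_iff₀ hX] at h2
  rw [div_le_iff₀ (by positivity)]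
  nlinarith

set_option maxHeartbeats 800000 in
-- The constraints give `X² / (4 Y) ≥ 2 bⱼ / λ`, so `Uⱼ` is not too concentrated, whereas a very
-- negative mean with moderate energy would force the exponential integral of
-- `sq_div_le_integral_exp` to be small. Taking logarithms and dividing by `s`, the energy has the
-- coefficient `C s² / s`, which is `κ` for `s = κ / C`. The terms with `log λ` come from `2 bⱼ / λ`
-- and from the lower bound for `∫ Uⱼ`.
lemma exists_neg_mean_le (hN : N = 3 ∨ N = 4 ∨ N = 5) (hn : ∃ i, 0 < n i) (hu : IsAdm B u₀) {κ : ℝ}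
    (hκ : 0 < κ) : ∃ C, 0 ≤ C ∧ ∀ lam : ℝ, 1 ≤ lam → ∀ v : W12N B N, v ∈ looseSet n u₀ lam → ∀ j,
      -mean B (v j) ≤ C + C * Real.log lam + κ * dirL B (v j) (v j) := by
  obtain ⟨C, hC, h⟩ := exists_integral_exp_sub_mean_le B
  obtain ⟨C₀, hC₀, hb₀⟩ := hu.2
  have hA := area_pos B
  set s := κ / C with hs
  have hs0 : 0 < s := by positivity
  set c : Fin N → ℝ := fun j => C₀ + |Real.log (b n j / (r N j * area B))| +
    s⁻¹ * (|Real.log (2 * b n j)| + |Real.log C|) with hc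
  have hc0 : ∀ j, 0 ≤ c j := fun j => by positivity
  have hcs : 0 ≤ ∑ j, c j := Finset.sum_nonneg fun j _ => hc0 j
  refine ⟨∑ j, c j + (1 + s⁻¹), by positivity, fun lam hlam v hv j => ?_⟩
  have hl0 : 0 < lam := by linarith
  have hlog : 0 ≤ Real.log lam := Real.log_nonneg hlam
  have hb := b_pos hN hn j
  have hr := r_pos hN j
  have h1 := sq_div_le_integral_exp hu v j hs0.le
  have h2 := le_integral_U_of_mem_looseSet hN hn hu hl0 hv j
  have h3 := (hv j).1
  have hX := integral_U_pos hu v j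
  set X := ∫ x, U u₀ v j x ∂cellMeasure B
  set q := Real.log (X / (2 * area B)) with hq
  set m := mean B (v j) with hm
  set D := dirL B (v j) (v j) with hD
  have hY : 0 < ∫ x, U u₀ v j x ^ 2 ∂cellMeasure B := by
    have h0 := ((integral_U_le_Q hN hu v j).trans (hv j).2)
    have : 0 < 4 * r N j * ∫ x, U u₀ v j x ^ 2 ∂cellMeasure B := hX.trans_le h0
    exact pos_of_mul_pos_right this (by positivity)
  have h4 : 2 * b n j / lam ≤ Real.exp (s * (C₀ + m - q)) * (C * Real.exp (C * (s ^ 2 * D))) := by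
    have h5 : 2 * b n j / lam ≤ X ^ 2 / (4 * ∫ x, U u₀ v j x ^ 2 ∂cellMeasure B) := by
      rw [le_div_iff₀ (by positivity)]
      refine le_trans (le_of_eq ?_) h3
      ring
    refine h5.trans (h1.trans ?_)
    refine le_trans ?_ (mul_le_mul_of_nonneg_left (h (v j) s hs0.le).2 (Real.exp_pos _).le)
    rw [← integral_const_mul]
    refine integral_mono_ae (integrable_exp_mul hu v j hs0.le q) ((h (v j) s hs0.le).1.const_mul _) ?_
    filter_upwards [hb₀ j] with x hx
    rw [← Real.exp_add]
    refine Real.exp_le_exp.2 ?_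
    rw [← mul_add]
    exact mul_le_mul_of_nonneg_left (by linarith) hs0.le
  have h5 := Real.log_le_log (by positivity) h4
  rw [Real.log_mul (Real.exp_pos _).ne' (by positivity), Real.log_mul hC.ne' (Real.exp_pos _).ne',
    Real.log_exp, Real.log_exp, Real.log_div (by positivity) hl0.ne'] at h5
  have h6 : Real.log (b n j / (r N j * area B)) - Real.log lam ≤ q := by
    rw [← Real.log_div (by positivity) hl0.ne', hq]
    refine Real.log_le_log (by positivity) ?_
    rw [le_div_iff₀ (by positivity)]
    refine le_trans (le_of_eq ?_) h2
    field_simp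
  have e1 : C * (s ^ 2 * D) = s * (κ * D) := by
    rw [hs]; field_simp
  rw [e1] at h5
  have h7 : s⁻¹ * (Real.log (2 * b n j) - Real.log lam) ≤ (C₀ + m - q) + s⁻¹ * Real.log C + κ * D := by
    have := mul_le_mul_of_nonneg_left h5 (inv_pos.2 hs0).le
    refine this.trans (le_of_eq ?_)
    field_simp
    ring
  have hs1 := inv_pos.2 hs0
  have h8 : -(s⁻¹ * |Real.log (2 * b n j)|) ≤ s⁻¹ * Real.log (2 * b n j) := by
    rw [← mul_neg]
    exact mul_le_mul_of_nonneg_left (neg_abs_le _) hs1.le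
  have h9 : s⁻¹ * Real.log C ≤ s⁻¹ * |Real.log C| := mul_le_mul_of_nonneg_left (le_abs_self _) hs1.le
  have h10 := neg_abs_le (Real.log (b n j / (r N j * area B)))
  have h11 : c j ≤ ∑ j, c j := Finset.single_le_sum (fun j _ => hc0 j) (Finset.mem_univ j)
  have h12 : 0 ≤ (∑ j, c j) * Real.log lam := mul_nonneg hcs hlog
  have h13 : c j = C₀ + |Real.log (b n j / (r N j * area B))| +
    s⁻¹ * (|Real.log (2 * b n j)| + |Real.log C|) := rfl
  nlinarith

end

end ChernSimonsHiggs
end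

/-! ### The relaxed constraint set: weak closedness and interior -/

open MeasureTheory
open scoped ContDiff
noncomputable section
namespace ChernSimonsHiggs
variable {B : Module.Basis (Fin 2) ℝ Plane} {N : ℕ}

section
variable {u₀ : Fin N → Plane → ℝ} {n : Fin N → ℕ}

lemma exists_pos_forall_lt {ι : Type*} [Finite ι] {t : ι → ℝ} (ht : ∀ j, 0 < t j) :
    ∃ θ, 0 < θ ∧ ∀ j, θ < t j := by
  have h1 : ∀ᶠ θ in nhdsWithin (0 : ℝ) (Set.Ioi 0), ∀ j, θ ∈ Set.Ioo 0 (t j) :=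
    Filter.eventually_all.2 fun j => Ioo_mem_nhdsGT (ht j)
  have h2 : ∀ᶠ θ in nhdsWithin (0 : ℝ) (Set.Ioi 0), θ ∈ Set.Ioi (0 : ℝ) := self_mem_nhdsWithin
  obtain ⟨θ, h3, h4⟩ := (h1.and h2).exists
  exact ⟨θ, h4, fun j => (h3 j).2⟩

lemma sum_erase_mul_U (v : W12N B N) (j : Fin N) (x : Plane) :
    U u₀ v j x * (1 - ∑ k ∈ Finset.univ.erase j, K N j k * (r N k * U u₀ v k x)) =
      U u₀ v j x - ∑ k ∈ Finset.univ.erase j, K N j k * r N k * (U u₀ v j x * U u₀ v k x) := by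
  rw [mul_sub, mul_one, Finset.mul_sum]
  congr 1
  exact Finset.sum_congr rfl fun k _ => by ring

lemma exists_isNice_Q (hu : IsAdm B u₀) (j : Fin N) :
    ∃ Q', IsNice (fun v : W12N B N => Q u₀ v j) Q' := by
  refine ⟨_, ((isNice_integral_U hu j).add (IsNice.const_mul (IsNice.sum (Finset.univ.erase j)
    fun k _ => (isNice_integral_U_mul_U hu j k).const_mul (K N j k * r N k)) (-1))).congr fun v => ?_⟩
  have i1 : ∀ k, Integrable (fun x => K N j k * r N k * (U u₀ v j x * U u₀ v k x)) (cellMeasure B) :=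
    fun k => (integrable_U_mul_U hu v j k).const_mul _
  simp only [Q, sum_erase_mul_U]
  rw [integral_sub (integrable_U hu v j) (integrable_finsetSum _ fun k _ => i1 k),
    integral_finsetSum _ fun k _ => i1 k]
  simp only [integral_const_mul]
  ring

lemma isNice_integral_U_sq (hu : IsAdm B u₀) (j : Fin N) :
    IsNice (fun v : W12N B N => ∫ x, U u₀ v j x ^ 2 ∂cellMeasure B) (intUUDer hu j j) :=
  (isNice_integral_U_mul_U hu j j).congr fun v => integral_U_sq_eq v j

/-- The constraints are non-strict inequalities between weakly continuous functionals. -/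
lemma WeakTendsto.mem_looseSet (hu : IsAdm B u₀) {lam : ℝ} {v : ℕ → W12N B N} {l : Filter ℕ} [l.NeBot]
    {z : W12N B N} (h : WeakTendsto v l z) (hv : ∀ k, v k ∈ looseSet n u₀ lam) :
    z ∈ looseSet n u₀ lam := by
  intro j
  obtain ⟨Q', hQ⟩ := exists_isNice_Q hu j
  have h1 := (isNice_integral_U hu j).tendsto h
  have h2 := (isNice_integral_U_sq hu j).tendsto h
  have h3 := hQ.tendsto h
  exact ⟨le_of_tendsto_of_tendsto' (h2.const_mul _) (h1.pow 2) fun k => (hv k j).1,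
    le_of_tendsto_of_tendsto' h3 (h2.const_mul _) fun k => (hv k j).2⟩

lemma IsNice.continuous {H : Type*} [NormedAddCommGroup H] [InnerProductSpace ℝ H] {G : H → ℝ}
    {G' : H → H →L[ℝ] ℝ} (h : IsNice G G') : Continuous G :=
  continuous_iff_continuousAt.2 fun v => (h.hasFDerivAt v).continuousAt

lemma looseSet_mem_nhds (hu : IsAdm B u₀) {lam : ℝ} {v : W12N B N}
    (hv : ∀ j, 8 * b n j / lam * (∫ x, U u₀ v j x ^ 2 ∂cellMeasure B) <
      (∫ x, U u₀ v j x ∂cellMeasure B) ^ 2 ∧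
      Q u₀ v j < 4 * r N j * ∫ x, U u₀ v j x ^ 2 ∂cellMeasure B) :
    looseSet n u₀ lam ∈ nhds v := by
  have : ∀ᶠ w in nhds v, ∀ j, 8 * b n j / lam * (∫ x, U u₀ w j x ^ 2 ∂cellMeasure B) <
      (∫ x, U u₀ w j x ∂cellMeasure B) ^ 2 ∧
      Q u₀ w j < 4 * r N j * ∫ x, U u₀ w j x ^ 2 ∂cellMeasure B := by
    refine Filter.eventually_all.2 fun j => ?_
    obtain ⟨Q', hQ⟩ := exists_isNice_Q hu j
    have c1 := (isNice_integral_U hu j).continuous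
    have c2 := (isNice_integral_U_sq hu j).continuous
    have c3 := hQ.continuous
    exact ((c2.const_mul _).continuousAt.eventually_lt (c1.pow 2).continuousAt (hv j).1).and
      (c3.continuousAt.eventually_lt (c2.const_mul _).continuousAt (hv j).2)
  filter_upwards [this] with w hw j
  exact ⟨(hw j).1.le, (hw j).2.le⟩

/-- The squared distance of `Uⱼ` from `1`. -/
def dev (u₀ : Fin N → Plane → ℝ) (v : W12N B N) (j : Fin N) : ℝ :=
  ∫ x, (U u₀ v j x - 1) ^ 2 ∂cellMeasure B

lemma dev_nonneg (v : W12N B N) (j : Fin N) : 0 ≤ dev u₀ v j := integral_nonneg fun _ => sq_nonneg _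

lemma dev_le_sum (v : W12N B N) (j : Fin N) : dev u₀ v j ≤ ∑ k, dev u₀ v k :=
  Finset.single_le_sum (fun k _ => dev_nonneg v k) (Finset.mem_univ j)

lemma integrable_U_sub_one_sq (hu : IsAdm B u₀) (v : W12N B N) (j : Fin N) :
    Integrable (fun x => (U u₀ v j x - 1) ^ 2) (cellMeasure B) :=
  (memLp_U_sub_one hu v j).integrable_sq

lemma integral_U_sq_le (hu : IsAdm B u₀) (v : W12N B N) (j : Fin N) :
    ∫ x, U u₀ v j x ^ 2 ∂cellMeasure B ≤ 2 * area B + 2 * dev u₀ v j := by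
  have e : 2 * area B + 2 * dev u₀ v j = ∫ x, (2 + 2 * (U u₀ v j x - 1) ^ 2) ∂cellMeasure B := by
    rw [integral_add (integrable_const _) ((integrable_U_sub_one_sq hu v j).const_mul 2), integral_cst,
      integral_const_mul, mul_comm, dev]
  rw [e]
  refine integral_mono (memLp_U hu v j).integrable_sq
    ((integrable_const _).add ((integrable_U_sub_one_sq hu v j).const_mul 2)) fun x => ?_
  nlinarith [sq_nonneg (U u₀ v j x - 2)]

lemma le_integral_U (hu : IsAdm B u₀) (v : W12N B N) (j : Fin N) :
    3 / 4 * area B - dev u₀ v j ≤ ∫ x, U u₀ v j x ∂cellMeasure B := by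
  have e : 3 / 4 * area B - dev u₀ v j = ∫ x, (3 / 4 - (U u₀ v j x - 1) ^ 2) ∂cellMeasure B := by
    rw [integral_sub (integrable_const _) (integrable_U_sub_one_sq hu v j), integral_cst, mul_comm, dev]
  rw [e]
  refine integral_mono ((integrable_const _).sub (integrable_U_sub_one_sq hu v j))
    (integrable_U hu v j) fun x => ?_
  nlinarith [sq_nonneg (U u₀ v j x - 1 / 2)]

lemma integral_U_le_dev (hu : IsAdm B u₀) (v : W12N B N) (j : Fin N) :
    ∫ x, U u₀ v j x ∂cellMeasure B ≤ 2 * area B + dev u₀ v j := by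
  have e : 2 * area B + dev u₀ v j = ∫ x, (2 + (U u₀ v j x - 1) ^ 2) ∂cellMeasure B := by
    rw [integral_add (integrable_const _) (integrable_U_sub_one_sq hu v j), integral_cst, mul_comm, dev]
  rw [e]
  refine integral_mono (integrable_U hu v j)
    ((integrable_const _).add (integrable_U_sub_one_sq hu v j)) fun x => ?_
  nlinarith [sq_nonneg (U u₀ v j x - 3 / 2)]

/-- The right-hand side is `2 rⱼ² ∫ Uⱼ² + ∫ dens` by `Q_eq`. Because `∑ₖ Kⱼₖ rₖ = 1`, the density is
`rⱼ Uⱼ L` with `L` linear in `U - 1`, and completing the square leaves `rⱼ² Uⱼ² - L² / 4`, which is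
positive near `U = 1`. -/
lemma le_sub_Q (hN : N = 3 ∨ N = 4 ∨ N = 5) (hu : IsAdm B u₀) (v : W12N B N) (j : Fin N) :
    r N j ^ 2 * area B / 2 - (r N j ^ 2 + (∑ k, (K N j k * r N k) ^ 2) / 4) * ∑ k, dev u₀ v k ≤
      r N j * (4 * r N j * (∫ x, U u₀ v j x ^ 2 ∂cellMeasure B) - Q u₀ v j) := by
  set c := ∑ k, (K N j k * r N k) ^ 2 with hc
  have e1 : r N j * (4 * r N j * (∫ x, U u₀ v j x ^ 2 ∂cellMeasure B) - Q u₀ v j) =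
      2 * r N j ^ 2 * (∫ x, U u₀ v j x ^ 2 ∂cellMeasure B) + ∫ x, dens u₀ v j x ∂cellMeasure B := by
    rw [mul_sub, Q_eq hu]
    ring
  have i1 : Integrable (fun x => 2 * r N j ^ 2 * U u₀ v j x ^ 2) (cellMeasure B) :=
    (memLp_U hu v j).integrable_sq.const_mul _
  have i2 : Integrable (fun x => (r N j ^ 2 + c / 4) * ∑ k, (U u₀ v k x - 1) ^ 2) (cellMeasure B) :=
    (integrable_finsetSum _ fun k _ => integrable_U_sub_one_sq hu v k).const_mul _
  have e2 : r N j ^ 2 * area B / 2 - (r N j ^ 2 + c / 4) * ∑ k, dev u₀ v k =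
      ∫ x, (r N j ^ 2 / 2 - (r N j ^ 2 + c / 4) * ∑ k, (U u₀ v k x - 1) ^ 2) ∂cellMeasure B := by
    rw [integral_sub (integrable_const _) i2, integral_cst, integral_const_mul,
      integral_finsetSum _ fun k _ => integrable_U_sub_one_sq hu v k]
    simp only [dev]
    ring
  rw [e1, e2, ← integral_const_mul, ← integral_add i1 (integrable_dens hu v j)]
  refine integral_mono ((integrable_const _).sub i2) (i1.add (integrable_dens hu v j)) fun x => ?_
  set L := ∑ k, K N j k * r N k * (U u₀ v k x - 1) with hL
  have e3 : dens u₀ v j x = r N j * U u₀ v j x * L := by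
    rw [dens, yy, hL]
    congr 1
    have : ∑ k, K N j k * r N k * (U u₀ v k x - 1) =
        ∑ k, K N j k * yy u₀ v k x - ∑ k, K N j k * r N k := by
      rw [← Finset.sum_sub_distrib]
      exact Finset.sum_congr rfl fun k _ => by rw [yy]; ring
    rw [this, sum_K_mul_r hN]
  have h1 : L ^ 2 ≤ c * ∑ k, (U u₀ v k x - 1) ^ 2 :=
    Finset.sum_mul_sq_le_sq_mul_sq _ _ _
  have h2 : (U u₀ v j x - 1) ^ 2 ≤ ∑ k, (U u₀ v k x - 1) ^ 2 :=
    Finset.single_le_sum (f := fun k => (U u₀ v k x - 1) ^ 2) (fun k _ => sq_nonneg _)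
      (Finset.mem_univ j)
  have h3 := mul_le_mul_of_nonneg_left h2 (sq_nonneg (r N j))
  simp only
  rw [e3]
  nlinarith [sq_nonneg (r N j * U u₀ v j x + L / 2), sq_nonneg (r N j * (U u₀ v j x - 1 / 2)),
    sq_nonneg (r N j * (2 * U u₀ v j x - 1))]

/-- Near `U = 1` the constraints are strict, for large `λ`. -/
lemma exists_strict (hN : N = 3 ∨ N = 4 ∨ N = 5) (hu : IsAdm B u₀) :
    ∃ θ, 0 < θ ∧ ∃ L, ∀ lam : ℝ, L < lam → ∀ v : W12N B N, ∑ k, dev u₀ v k ≤ θ → ∀ j,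
      8 * b n j / lam * (∫ x, U u₀ v j x ^ 2 ∂cellMeasure B) <
        (∫ x, U u₀ v j x ∂cellMeasure B) ^ 2 ∧
      Q u₀ v j < 4 * r N j * ∫ x, U u₀ v j x ^ 2 ∂cellMeasure B := by
  have hA := area_pos B
  have hr := fun j => r_pos hN j
  -- The first bound makes the lower estimate of `le_sub_Q` positive; the second keeps `∫ Uⱼ` above
  -- `|Ω| / 2`, after which the other constraint is strict for large `λ`.
  have hpos : ∀ j : Fin N, 0 < min (r N j ^ 2 * area B / 2 / (r N j ^ 2 +
      (∑ k, (K N j k * r N k) ^ 2) / 4)) (area B / 4) := fun j => by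
    have h1 : 0 ≤ ∑ k, (K N j k * r N k) ^ 2 := Finset.sum_nonneg fun k _ => sq_nonneg _
    have h2 := hr j
    positivity
  obtain ⟨θ, hθ, hθj⟩ := exists_pos_forall_lt hpos
  have hL : ∀ᶠ lam in Filter.atTop, ∀ j : Fin N,
      8 * b n j / lam * (2 * area B + 2 * θ) < (area B / 2) ^ 2 := by
    refine Filter.eventually_all.2 fun j => ?_
    have h1 : Filter.Tendsto (fun lam : ℝ => 8 * b n j / lam * (2 * area B + 2 * θ)) Filter.atTop
        (nhds (0 * (2 * area B + 2 * θ))) :=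
      (Filter.Tendsto.const_div_atTop Filter.tendsto_id _).mul_const _
    rw [zero_mul] at h1
    exact h1.eventually_lt_const (by positivity)
  obtain ⟨L, hL⟩ := Filter.eventually_atTop.1 hL
  refine ⟨θ, hθ, max L 0, fun lam hlam v hv j => ?_⟩
  have hl0 : 0 < lam := (le_max_right _ _).trans_lt hlam
  have hdev := (dev_le_sum v j).trans hv
  have hq : (0 : ℝ) < r N j ^ 2 + (∑ k, (K N j k * r N k) ^ 2) / 4 := by
    have h1 : 0 ≤ ∑ k, (K N j k * r N k) ^ 2 := Finset.sum_nonneg fun k _ => sq_nonneg _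
    have h2 := hr j
    positivity
  constructor
  · have h1 := integral_U_sq_le hu v j
    have h2 := le_integral_U hu v j
    have h3 := hL lam ((le_max_left _ _).trans hlam.le) j
    have h4 : θ < area B / 4 := (hθj j).trans_le (min_le_right _ _)
    have h5 : area B / 2 ≤ ∫ x, U u₀ v j x ∂cellMeasure B := by linarith
    have h6 := pow_le_pow_left₀ (by positivity) h5 2
    rcases le_or_gt (8 * b n j / lam) 0 with h | h
    · have h7 : 0 ≤ ∫ x, U u₀ v j x ^ 2 ∂cellMeasure B := integral_nonneg fun x => sq_nonneg _
      have h8 : 0 < (area B / 2) ^ 2 := by positivity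
      nlinarith [mul_nonneg (neg_nonneg.2 h) h7]
    · have h8 : 8 * b n j / lam * (∫ x, U u₀ v j x ^ 2 ∂cellMeasure B) ≤
          8 * b n j / lam * (2 * area B + 2 * θ) := mul_le_mul_of_nonneg_left (by linarith) h.le
      linarith
  · have h1 := le_sub_Q hN hu v j
    have h2 : θ < r N j ^ 2 * area B / 2 / (r N j ^ 2 + (∑ k, (K N j k * r N k) ^ 2) / 4) :=
      (hθj j).trans_le (min_le_left _ _)
    rw [lt_div_iff₀ hq] at h2
    have h3 := mul_le_mul_of_nonneg_left hv hq.le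
    have h4 : 0 < r N j * (4 * r N j * (∫ x, U u₀ v j x ^ 2 ∂cellMeasure B) - Q u₀ v j) := by
      linarith
    have h5 := pos_of_mul_pos_right h4 (hr j).le
    linarith

end

end ChernSimonsHiggs
end

open MeasureTheory
open scoped ContDiff
noncomputable section
namespace ChernSimonsHiggs
variable {B : Module.Basis (Fin 2) ℝ Plane} {N : ℕ}

/-! ### The constrained minimiser -/

section
variable {u₀ : Fin N → Plane → ℝ} {n : Fin N → ℕ} {g : Fin N → ℕ → W12 B}

lemma exists_action_ge_looseSet (hN : N = 3 ∨ N = 4 ∨ N = 5) (hn : ∃ i, 0 < n i) (hu : IsAdm B u₀) :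
    ∃ α, 0 < α ∧ ∃ C, 0 ≤ C ∧ ∀ lam : ℝ, 1 ≤ lam → ∀ v : W12N B N, v ∈ looseSet n u₀ lam →
      α * ∑ j, dirL B (v j) (v j) + lam / 8 * ∑ j, r N j ^ 2 * dev u₀ v j ≤
        action n u₀ lam v + C + C * Real.log lam := by
  obtain ⟨α, hα, hquad⟩ := exists_quadL_coercive hN
  have hb : ∀ j, 0 < b n j := fun j => b_pos hN hn j
  -- The choice `bⱼ κ ≤ α / 4` lets the linear term of the action consume at most half of the
  -- available energy `α / 2`.
  obtain ⟨κ, hκ, hκb⟩ := exists_pos_forall_lt (t := fun j => α / 4 / b n j)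
    fun j => div_pos (by positivity) (hb j)
  obtain ⟨C, hC, h⟩ := exists_neg_mean_le hN hn hu hκ
  have hS : 0 ≤ ∑ j, b n j := Finset.sum_nonneg fun j _ => (hb j).le
  refine ⟨α / 4, by positivity, (∑ j, b n j) * C, by positivity, fun lam hlam v hv => ?_⟩
  have h1 := action_ge (n := n) hN hu hquad (zero_le_one.trans hlam) v
  have h2 : ∑ j, b n j * -mean B (v j) ≤ ∑ j, (b n j * (C + C * Real.log lam) +
      α / 4 * dirL B (v j) (v j)) := Finset.sum_le_sum fun j _ => by
    have h3 := mul_le_mul_of_nonneg_left (h lam hlam v hv j) (hb j).le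
    have h4 : b n j * κ ≤ α / 4 := by
      have := (lt_div_iff₀ (hb j)).1 (hκb j)
      linarith
    have h5 := mul_le_mul_of_nonneg_right h4 (dirL_self_nonneg (v j))
    linarith
  rw [Finset.sum_add_distrib, ← Finset.sum_mul, ← Finset.mul_sum] at h2
  simp only [mul_neg, Finset.sum_neg_distrib] at h2
  simp only [dev]
  linarith

set_option maxHeartbeats 600000 in
lemma exists_norm_le_of_mem_looseSet (hN : N = 3 ∨ N = 4 ∨ N = 5) (hn : ∃ i, 0 < n i) (hu : IsAdm B u₀)
    (hi : ∀ j, Integrable (u₀ j) (cellMeasure B)) (h0 : ∀ j, ∫ x, u₀ j x ∂cellMeasure B = 0)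
    {lam : ℝ} (hlam : 1 ≤ lam) (E : ℝ) : ∃ R, ∀ v : W12N B N, v ∈ looseSet n u₀ lam →
      action n u₀ lam v ≤ E → ‖v‖ ≤ R := by
  obtain ⟨α, hα, C, hC, h⟩ := exists_action_ge_looseSet hN hn hu
  obtain ⟨C', hC', h'⟩ := exists_neg_mean_le hN hn hu one_pos
  obtain ⟨Cn, hCn, hnorm⟩ := exists_norm_sq_le_mean B N
  have hA := area_pos B
  have hl0 : 0 < lam := by linarith
  have hlog : 0 ≤ Real.log lam := Real.log_nonneg hlam
  set F := |E| + C + C * Real.log lam with hF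
  have hF0 : 0 ≤ F := by positivity
  set G : Fin N → ℝ := fun j => 2 + 8 * F / (lam * r N j ^ 2) / area B +
    (C' + C' * Real.log lam + F / α) with hG
  refine ⟨√(Cn * (F / α + ∑ j, G j ^ 2)), fun v hv hE => Real.le_sqrt_of_sq_le ?_⟩
  have h1 := h lam hlam v hv
  have h1' : α * ∑ j, dirL B (v j) (v j) + lam / 8 * ∑ j, r N j ^ 2 * dev u₀ v j ≤ F := by
    have := le_abs_self E
    linarith
  have hd0 : 0 ≤ ∑ j, dirL B (v j) (v j) := Finset.sum_nonneg fun j _ => dirL_self_nonneg _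
  have hv0 : ∀ j, 0 ≤ r N j ^ 2 * dev u₀ v j := fun j => mul_nonneg (sq_nonneg _) (dev_nonneg v j)
  have hv1 : 0 ≤ ∑ j, r N j ^ 2 * dev u₀ v j := Finset.sum_nonneg fun j _ => hv0 j
  have hD : ∑ j, dirL B (v j) (v j) ≤ F / α := by
    rw [le_div_iff₀ hα]
    have : 0 ≤ lam / 8 * ∑ j, r N j ^ 2 * dev u₀ v j := by positivity
    linarith
  refine (hnorm v).trans (mul_le_mul_of_nonneg_left ?_ hCn.le)
  rw [Finset.sum_add_distrib]
  refine add_le_add hD (Finset.sum_le_sum fun j _ => ?_)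
  have hr := r_pos hN j
  have hdev : dev u₀ v j ≤ 8 * F / (lam * r N j ^ 2) := by
    rw [le_div_iff₀ (by positivity)]
    have h2 : r N j ^ 2 * dev u₀ v j ≤ ∑ j, r N j ^ 2 * dev u₀ v j :=
      Finset.single_le_sum (f := fun j => r N j ^ 2 * dev u₀ v j) (fun j _ => hv0 j) (Finset.mem_univ j)
    have h3 : lam / 8 * ∑ j, r N j ^ 2 * dev u₀ v j ≤ F := by
      have := mul_nonneg hα.le hd0
      linarith
    have h4 := mul_le_mul_of_nonneg_left h2 hl0.le
    linarith
  have hDj : dirL B (v j) (v j) ≤ F / α :=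
    (Finset.single_le_sum (f := fun j => dirL B (v j) (v j)) (fun j _ => dirL_self_nonneg _)
      (Finset.mem_univ j)).trans hD
  have hup : mean B (v j) ≤ 2 + 8 * F / (lam * r N j ^ 2) / area B := by
    refine (mean_le hu hi h0 v j).trans ?_
    rw [div_le_iff₀ hA, add_mul, div_mul_cancel₀ _ hA.ne']
    exact (integral_U_le_dev hu v j).trans (by linarith)
  have hlow := h' lam hlam v hv j
  have p1 : 0 ≤ C' + C' * Real.log lam + F / α := by positivity
  have p2 : 0 ≤ 2 + 8 * F / (lam * r N j ^ 2) / area B := by positivity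
  refine sq_le_sq' ?_ ?_ <;> simp only [hG] <;> linarith

lemma exists_isMinOn_looseSet (hN : N = 3 ∨ N = 4 ∨ N = 5) (hn : ∃ i, 0 < n i) (hu : IsAdm B u₀)
    (hi : ∀ j, Integrable (u₀ j) (cellMeasure B)) (h0 : ∀ j, ∫ x, u₀ j x ∂cellMeasure B = 0)
    {lam : ℝ} (hlam : 1 ≤ lam) (hne : (looseSet (B := B) n u₀ lam).Nonempty) :
    ∃ z ∈ looseSet (B := B) n u₀ lam, IsMinOn (action n u₀ lam) (looseSet n u₀ lam) z := by
  obtain ⟨α, hα, C, hC, h⟩ := exists_action_ge_looseSet hN hn hu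
  set T := looseSet (B := B) n u₀ lam with hT
  have hbdd : BddBelow (action (B := B) n u₀ lam '' T) := by
    refine ⟨-(C + C * Real.log lam), ?_⟩
    rintro _ ⟨v, hv, rfl⟩
    have h1 := h lam hlam v hv
    have h2 : 0 ≤ α * ∑ j, dirL B (v j) (v j) :=
      mul_nonneg hα.le (Finset.sum_nonneg fun j _ => dirL_self_nonneg _)
    have h3 : 0 ≤ lam / 8 * ∑ j, r N j ^ 2 * dev u₀ v j :=
      mul_nonneg (by linarith) (Finset.sum_nonneg fun j _ => mul_nonneg (sq_nonneg _) (dev_nonneg v j))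
    linarith
  obtain ⟨f, -, hf, hmem⟩ := exists_seq_tendsto_sInf (hne.image (action n u₀ lam)) hbdd
  choose v hv hfv using hmem
  have hle : (Filter.hyperfilter ℕ : Filter ℕ) ≤ Filter.atTop := Nat.hyperfilter_le_atTop
  have hlim : Filter.Tendsto (fun k => action n u₀ lam (v k)) (Filter.hyperfilter ℕ : Filter ℕ)
      (nhds (sInf (action n u₀ lam '' T))) := by
    simp only [hfv]
    exact hf.mono_left hle
  obtain ⟨R, hR⟩ := exists_norm_le_of_mem_looseSet hN hn hu hi h0 hlam
    (sInf (action (B := B) n u₀ lam '' T) + 1)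
  have hev : ∀ᶠ k in (Filter.hyperfilter ℕ : Filter ℕ), ‖v k‖ ≤ R :=
    (hlim.eventually_lt_const (lt_add_one _)).mono fun k hk => hR (v k) (hv k) hk.le
  obtain ⟨z, hz, -⟩ := exists_weakTendsto hev
  have hzT : z ∈ T := hz.mem_looseSet hu hv
  refine ⟨z, hzT, fun w hw => ?_⟩
  have h1 := ((isVariational_action hN hu n lam).lsc inferInstance hz hlim).1
  exact h1.trans (csInf_le hbdd ⟨w, hw, rfl⟩)

/-- The negative of the approximate background functions. -/
def negBg (g : Fin N → ℕ → W12 B) (t : ℕ) : W12N B N := WithLp.toLp 2 fun j => -g j t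

lemma U_negBg (t : ℕ) (j : Fin N) :
    ∀ᵐ x ∂cellMeasure B, U u₀ (negBg g t) j x = Real.exp (u₀ j x - fn (g j t) x) := by
  filter_upwards [fn_smul (-1) (g j t)] with x hx
  have e : negBg g t j = (-1 : ℝ) • g j t := by
    rw [neg_one_smul]
    rfl
  rw [U, val_eq, e, hx]
  congr 1
  ring

/-- The choice `v = -u⁰` would give `U = 1`, but `u⁰` need not lie in the Sobolev space. For its
approximations `U = exp (u⁰ - g)` lies between `0` and `1`, since they are above `u⁰`, and tends to
`1` almost everywhere. -/
lemma tendsto_dev_negBg (hg : ∀ i, IsApproxBackground (n i) (u₀ i) (g i)) (j : Fin N) :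
    Filter.Tendsto (fun t => dev u₀ (negBg g t) j) Filter.atTop (nhds 0) := by
  have e : ∀ t, dev u₀ (negBg g t) j =
      ∫ x, (Real.exp (u₀ j x - fn (g j t) x) - 1) ^ 2 ∂cellMeasure B := fun t => by
    refine integral_congr_ae ?_
    filter_upwards [U_negBg (u₀ := u₀) (g := g) t j] with x hx
    rw [hx]
  simp only [e]
  have h0 : (0 : ℝ) = ∫ _, (0 : ℝ) ∂cellMeasure B := by simp
  rw [h0]
  refine tendsto_integral_of_dominated_convergence (fun _ => 1) (fun t => ?_) (integrable_const _)
    (fun t => ?_) ?_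
  · exact (((Real.continuous_exp.comp_aestronglyMeasurable ((hg j).measurable.aestronglyMeasurable.sub
      (memLp_fn (g j t)).1)).sub aestronglyMeasurable_const).pow 2)
  · filter_upwards [(hg j).le t] with x hx
    have h1 : Real.exp (u₀ j x - fn (g j t) x) ≤ 1 := Real.exp_le_one_iff.2 (by linarith)
    have h2 := Real.exp_pos (u₀ j x - fn (g j t) x)
    rw [Real.norm_of_nonneg (sq_nonneg _)]
    nlinarith
  · filter_upwards [(hg j).tendsto] with x hx
    have h1 : Filter.Tendsto (fun t => (Real.exp (u₀ j x - fn (g j t) x) - 1) ^ 2) Filter.atTop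
        (nhds ((Real.exp (u₀ j x - u₀ j x) - 1) ^ 2)) :=
      ((((tendsto_const_nhds.sub hx).rexp).sub_const 1).pow 2)
    simpa using h1

lemma sum_M_mul_le (hu : IsAdm B u₀) (v : W12N B N) :
    ∑ j, ∑ k, M N j k * ∫ x, (U u₀ v j x - 1) * (U u₀ v k x - 1) ∂cellMeasure B ≤
      (∑ j, ∑ k, |M N j k|) * ∑ i, dev u₀ v i := by
  rw [Finset.sum_mul]
  refine Finset.sum_le_sum fun j _ => ?_
  rw [Finset.sum_mul]
  refine Finset.sum_le_sum fun k _ => ?_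
  refine (le_abs_self _).trans ?_
  rw [abs_mul]
  refine mul_le_mul_of_nonneg_left ?_ (abs_nonneg _)
  have h1 : |∫ x, (U u₀ v j x - 1) * (U u₀ v k x - 1) ∂cellMeasure B| ≤
      ∫ x, (1 / 2 * (U u₀ v j x - 1) ^ 2 + 1 / 2 * (U u₀ v k x - 1) ^ 2) ∂cellMeasure B := by
    refine abs_integral_le_integral_abs.trans (integral_mono (integrable_U_sub_mul hu v j k).abs
      (((integrable_U_sub_one_sq hu v j).const_mul _).add ((integrable_U_sub_one_sq hu v k).const_mul _))
      fun x => ?_)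
    simp only
    rw [abs_le]
    constructor <;> nlinarith [sq_nonneg (U u₀ v j x - 1 + (U u₀ v k x - 1)),
      sq_nonneg (U u₀ v j x - 1 - (U u₀ v k x - 1))]
  rw [integral_add ((integrable_U_sub_one_sq hu v j).const_mul _)
    ((integrable_U_sub_one_sq hu v k).const_mul _), integral_const_mul, integral_const_mul] at h1
  have h2 := dev_le_sum (u₀ := u₀) v j
  have h3 := dev_le_sum (u₀ := u₀) v k
  simp only [dev] at h2 h3 ⊢
  linarith

/-- For large `λ` there is a minimiser on the relaxed constraint set, in its interior. -/
lemma exists_isMinOn_mem_nhds (hN : N = 3 ∨ N = 4 ∨ N = 5) (hn : ∃ i, 0 < n i) (hu : IsAdm B u₀)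
    (hg : ∀ i, IsApproxBackground (n i) (u₀ i) (g i)) (h0 : ∀ j, ∫ x, u₀ j x ∂cellMeasure B = 0) :
    ∃ L, 0 < L ∧ ∀ lam : ℝ, L < lam → ∃ v : W12N B N, looseSet n u₀ lam ∈ nhds v ∧
      IsMinOn (action n u₀ lam) (looseSet n u₀ lam) v := by
  obtain ⟨α, hα, C, hC, hlow⟩ := exists_action_ge_looseSet hN hn hu
  obtain ⟨θ, hθ, L₁, hstrict⟩ := exists_strict (n := n) hN hu
  have hr : ∀ j, 0 < r N j := fun j => r_pos hN j
  obtain ⟨ρ, hρ, hρr⟩ := exists_pos_forall_lt (t := fun j => r N j ^ 2) fun j => pow_pos (hr j) 2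
  set CM := ∑ j, ∑ k, |M N j k| with hCM
  have hCM0 : 0 ≤ CM := Finset.sum_nonneg fun j _ => Finset.sum_nonneg fun k _ => abs_nonneg _
  have hsum : Filter.Tendsto (fun t => ∑ j, dev u₀ (negBg g t) j) Filter.atTop (nhds 0) := by
    have := tendsto_finsetSum Finset.univ fun j (_ : j ∈ Finset.univ) => tendsto_dev_negBg hg j
    simpa using this
  have hev1 := hsum.eventually_lt_const hθ
  have hev2 := (hsum.const_mul CM).eventually_lt_const (u := ρ * θ / 16) (by rw [mul_zero]; positivity)
  -- The competitor is fixed before `λ`. Its potential term is at most `λ ρ θ / 32` and its other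
  -- terms do not depend on `λ`, whereas a deviation above `θ` would cost the minimiser more than `λ
  -- ρ θ / 8`; the losses in the lower bound are only of order `log λ`.
  obtain ⟨t, ht1, ht2⟩ := (hev1.and hev2).exists
  set e := negBg g t with he
  set P := 1 / 2 * quadL B N e e + ∑ j, b n j / area B * intL B (e j) with hP
  have hlog : ∀ᶠ lam : ℝ in Filter.atTop, P + C + C * Real.log lam ≤ ρ * θ / 32 * lam := by
    have h1 : Filter.Tendsto (fun lam : ℝ => (P + C) / lam + C * (Real.log lam / lam)) Filter.atTop
        (nhds (0 + C * 0)) :=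
      (Filter.Tendsto.const_div_atTop Filter.tendsto_id _).add
        (Real.isLittleO_log_id_atTop.tendsto_div_nhds_zero.const_mul C)
    rw [mul_zero, add_zero] at h1
    filter_upwards [h1.eventually_lt_const (by positivity : (0 : ℝ) < ρ * θ / 32),
      Filter.eventually_gt_atTop 0] with lam h2 h3
    have h4 := mul_le_mul_of_nonneg_right h2.le h3.le
    refine le_trans (le_of_eq ?_) h4
    field_simp
  obtain ⟨L₂, hL₂⟩ := Filter.eventually_atTop.1 hlog
  refine ⟨max (max L₁ L₂) 1, by positivity, fun lam hlam => ?_⟩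
  have hl1 : L₁ < lam := ((le_max_left _ _).trans (le_max_left _ _)).trans_lt hlam
  have hl2 : L₂ ≤ lam := ((le_max_right _ _).trans (le_max_left _ _)).trans hlam.le
  have hl3 : 1 ≤ lam := (le_max_right _ _).trans hlam.le
  have heT : e ∈ looseSet n u₀ lam := fun j =>
    ⟨(hstrict lam hl1 e ht1.le j).1.le, (hstrict lam hl1 e ht1.le j).2.le⟩
  obtain ⟨v, hvT, hvmin⟩ := exists_isMinOn_looseSet hN hn hu (fun j => (hg j).integrable) h0 hl3 ⟨e, heT⟩
  refine ⟨v, looseSet_mem_nhds hu (hstrict lam hl1 v ?_), hvmin⟩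
  have h1 := hlow lam hl3 v hvT
  have h2 : action n u₀ lam v ≤ action n u₀ lam e := hvmin heT
  have h3 : action n u₀ lam e ≤ P + lam / 2 * (CM * ∑ j, dev u₀ e j) := by
    rw [action_eq hu, potential, hP]
    have := mul_le_mul_of_nonneg_left (sum_M_mul_le hu e) (by linarith : 0 ≤ lam / 2)
    linarith
  have h4 := hL₂ lam hl2
  have h5 : 0 ≤ α * ∑ j, dirL B (v j) (v j) :=
    mul_nonneg hα.le (Finset.sum_nonneg fun j _ => dirL_self_nonneg _)
  have h6 : ρ * ∑ j, dev u₀ v j ≤ ∑ j, r N j ^ 2 * dev u₀ v j := by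
    rw [Finset.mul_sum]
    exact Finset.sum_le_sum fun j _ => mul_le_mul_of_nonneg_right (hρr j).le (dev_nonneg v j)
  have h7 : lam / 8 * (ρ * ∑ j, dev u₀ v j) ≤ lam / 8 * (ρ * θ) := by
    have h8 := mul_le_mul_of_nonneg_left h6 (by linarith : 0 ≤ lam / 8)
    have h9 := mul_le_mul_of_nonneg_left ht2.le (by linarith : 0 ≤ lam / 2)
    have h10 : 0 ≤ ρ * θ * lam := by positivity
    linarith
  have hl0 : 0 < lam / 8 := by linarith
  exact le_of_mul_le_mul_left (le_of_mul_le_mul_left h7 hl0) hρ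

/-- The branch of the integrated equations with the plus sign. -/
lemma mem_plusConstraintSet (hN : N = 3 ∨ N = 4 ∨ N = 5) (hu : IsAdm B u₀) {lam : ℝ}
    (hlam : 0 < lam) {v : W12N B N} (hv : v ∈ looseSet n u₀ lam) (hc : actionDer hu n lam v = 0) :
    v ∈ plusConstraintSet n u₀ lam := by
  intro j
  refine ⟨(hv j).1, ?_⟩
  have h1 := (hv j).2
  have h2 := actionDer_unitV (n := n) hu lam v j
  rw [hc] at h2
  have h3 := Q_eq hu v j
  have hr := r_pos hN j
  set Y := ∫ x, U u₀ v j x ^ 2 ∂cellMeasure B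
  set D := ∫ x, dens u₀ v j x ∂cellMeasure B
  have h4 : D = -(b n j / lam) := by
    have h5 : lam * D + b n j = 0 := h2.symm
    field_simp
    linarith
  -- At a critical point `rⱼ Qⱼ = 2 rⱼ² Y + bⱼ / λ`, which makes the discriminant a perfect square.
  -- The relaxed constraint then says that its root is `4 rⱼ Y - Qⱼ`, the plus branch.
  have e : Q u₀ v j ^ 2 - 8 * b n j / lam * Y = (4 * r N j * Y - Q u₀ v j) ^ 2 := by
    have h6 : 8 * b n j / lam = 8 * (b n j / lam) := by ring
    rw [h4] at h3
    rw [h6]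
    linear_combination 8 * Y * h3
  rw [e, Real.sqrt_sq (by linarith)]
  ring

lemma plusConstraintSet_subset (lam : ℝ) :
    plusConstraintSet (B := B) n u₀ lam ⊆ looseSet n u₀ lam := fun v hv j => by
  refine ⟨(hv j).1, ?_⟩
  rw [(hv j).2]
  exact le_add_of_nonneg_right (Real.sqrt_nonneg _)

end

end ChernSimonsHiggs
end

open MeasureTheory
open scoped ContDiff
noncomputable section
namespace ChernSimonsHiggs
variable {B : Module.Basis (Fin 2) ℝ Plane} {N : ℕ}

/-! ### Critical points and solutions -/

section
variable {u₀ : Fin N → Plane → ℝ} {n : Fin N → ℕ}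

/-- The solution that corresponds to a critical point of the action. -/
def solOf (u₀ : Fin N → Plane → ℝ) (v : W12N B N) (i : Fin N) (x : Plane) : ℝ :=
  Real.log (r N i) + u₀ i x + fn (v i) (ZSpan.fract B x)

lemma solOf_ae (v : W12N B N) (i : Fin N) :
    solOf u₀ v i =ᵐ[cellMeasure B] fun x => Real.log (r N i) + u₀ i x + v.val i x := by
  filter_upwards [ae_restrict_mem (μ := (volume : Measure Plane)) (measurableSet_cell B)] with x hx
  rw [solOf, ZSpan.fract_eq_self.2 hx, val_eq]

lemma exp_solOf_ae (hN : N = 3 ∨ N = 4 ∨ N = 5) (v : W12N B N) :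
    ∀ᵐ x ∂cellMeasure B, ∀ i, Real.exp (solOf u₀ v i x) = yy u₀ v i x :=
  ae_all_iff.2 fun i => by
    filter_upwards [solOf_ae (u₀ := u₀) v i] with x hx
    rw [hx, val_eq, exp_log_r_add hN]

lemma nonlinearity_eq (y : Fin N → ℝ) (i : Fin N) :
    (∑ j, K N j i * y j) - ∑ j, ∑ k, K N k j * K N j i * (y j * y k) =
      -∑ j, K N j i * (y j * ((∑ k, K N j k * y k) - 1)) := by
  rw [← Finset.sum_sub_distrib, ← Finset.sum_neg_distrib]
  refine Finset.sum_congr rfl fun j _ => ?_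
  have : ∑ k, K N k j * K N j i * (y j * y k) = K N j i * y j * ∑ k, K N j k * y k := by
    rw [Finset.mul_sum]
    exact Finset.sum_congr rfl fun k _ => by rw [K_symm k j]; ring
  rw [this]
  ring

set_option maxHeartbeats 800000 in
-- Testing with `K` applied to a vector whose only non-zero entry is `φ` in position `i` undoes the
-- multiplication by `A` and isolates the `i`-th equation of the system.
lemma dirL_add_integral_eq_zero (hN : N = 3 ∨ N = 4 ∨ N = 5) (hu : IsAdm B u₀) {lam : ℝ} {v : W12N B N}
    (hc : actionDer hu n lam v = 0) (i : Fin N) {φ : Plane → ℝ} (hφ : IsTest B φ) :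
    dirL B (v i) (ofTest hφ) + lam * ∫ x, (∑ j, K N j i * dens u₀ v j x) * φ x ∂cellMeasure B +
      4 * Real.pi * n i / area B * ∫ x, φ x ∂cellMeasure B = 0 := by
  set η : Fin N → W12 B := Pi.single i (ofTest hφ) with hη
  have h1 := actionDer_mulK (n := n) hN hu lam v η
  have hηi : η i = ofTest hφ := by simp [hη]
  have hηk : ∀ k, k ≠ i → η k = 0 := fun k hk => by simp [hη, hk]
  have e1 : ∑ j, dirL B (v j) (η j) = dirL B (v i) (ofTest hφ) := by
    rw [Finset.sum_eq_single i (fun k _ hk => by rw [hηk k hk, map_zero]) (by simp), hηi]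
  have e2 : ∑ k, 4 * Real.pi * n k / area B * intL B (η k) =
      4 * Real.pi * n i / area B * ∫ x, φ x ∂cellMeasure B := by
    rw [Finset.sum_eq_single i (fun k _ hk => by rw [hηk k hk, map_zero, mul_zero]) (by simp), hηi,
      intL_apply, integral_congr_ae (fn_ofTest hφ)]
  have e3 : ∀ j, mulK η j = K N j i • ofTest hφ := fun j => by
    rw [mulK_apply, Finset.sum_eq_single i (fun k _ hk => by rw [hηk k hk, smul_zero]) (by simp), hηi]
  have i1 : ∀ j, Integrable (fun x => K N j i * dens u₀ v j x * φ x) (cellMeasure B) := fun j =>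
    integrable_mul_of_continuous ((integrable_dens hu v j).const_mul _) hφ.1.continuous
  have e4 : ∑ j, ∫ x, dens u₀ v j x * fn (mulK η j) x ∂cellMeasure B =
      ∫ x, (∑ j, K N j i * dens u₀ v j x) * φ x ∂cellMeasure B := by
    simp only [Finset.sum_mul]
    rw [integral_finsetSum _ fun j _ => i1 j]
    refine Finset.sum_congr rfl fun j _ => integral_congr_ae ?_
    filter_upwards [fn_smul (K N j i) (ofTest hφ), fn_ofTest hφ] with x h2 h3
    rw [e3, h2, h3]
    ring
  rw [hc, e1, e2, e4] at h1
  exact h1.symm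

/-- Critical points of the action give solutions of the system. -/
lemma isSolution_solOf (hN : N = 3 ∨ N = 4 ∨ N = 5) (hu : IsAdm B u₀) {p : (i : Fin N) → Fin (n i) → Plane}
    (hb : ∀ i, IsBackground B (p i) (u₀ i)) {lam : ℝ} {v : W12N B N}
    (hc : actionDer hu n lam v = 0) : IsSolution B n p lam (solOf u₀ v) where
  periodic i k x := by
    simp only [solOf]
    have h := isDoublyPeriodic_comp_fract (B := B) (fn (v i)) k x
    simp only at h
    rw [(hb i).periodic k x, h]
  integrable i := (integrable_congr (solOf_ae v i)).2
    (((integrable_const _).add (hb i).integrable).add (integrable_fn (v i)))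
  integrable_exp i := by
    refine (integrable_yy hu v i).congr ?_
    filter_upwards [exp_solOf_ae (u₀ := u₀) hN v] with x hx
    rw [hx]
  integrable_exp_mul_exp i j := by
    refine ((memLp_yy hu v i).integrable_mul (memLp_yy hu v j)).congr ?_
    filter_upwards [exp_solOf_ae (u₀ := u₀) hN v] with x hx
    rw [hx, hx]
    rfl
  equation i φ hφ := by
    set w : W12 B := cst B (Real.log (r N i)) + v i with hw
    have hwf : fn w =ᵐ[cellMeasure B] fun x => Real.log (r N i) + fn (v i) x := by
      filter_upwards [fn_add (cst B (Real.log (r N i))) (v i), fn_cst (B := B) (Real.log (r N i))]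
        with x h1 h2
      rw [hw, h1, h2]
    have hl := hφ.continuous_laplacian
    have e1 : ∫ x, solOf u₀ v i x * Laplacian.laplacian φ x ∂cellMeasure B =
        ∫ x, u₀ i x * Laplacian.laplacian φ x ∂cellMeasure B +
          ∫ x, fn w x * Laplacian.laplacian φ x ∂cellMeasure B := by
      rw [← integral_add (integrable_mul_of_continuous (hb i).integrable hl)
        (integrable_mul_of_continuous (integrable_fn w) hl)]
      refine integral_congr_ae ?_
      filter_upwards [solOf_ae (u₀ := u₀) v i, hwf] with x h1 h2
      rw [h1, h2, val_eq]
      ring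
    have e2 : ∫ x, fn w x * Laplacian.laplacian φ x ∂cellMeasure B = -dirL B (v i) (ofTest hφ) := by
      have h1 : dirL B w (ofTest hφ) = dirL B (v i) (ofTest hφ) := by
        rw [hw, map_add, add_apply, dirL_cst, zero_add]
      rw [integral_mul_laplacian w hφ, ← h1, dirL_apply]
      congr 1
      refine integral_congr_ae ?_
      filter_upwards [gr_ofTest hφ] with x hx
      rw [hx]
    have e3 : ∫ x, ((∑ j, K N j i * Real.exp (solOf u₀ v j x)) - ∑ j, ∑ k, K N k j * K N j i *
        (Real.exp (solOf u₀ v j x) * Real.exp (solOf u₀ v k x))) * φ x ∂cellMeasure B =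
        -∫ x, (∑ j, K N j i * dens u₀ v j x) * φ x ∂cellMeasure B := by
      rw [← integral_neg]
      refine integral_congr_ae ?_
      filter_upwards [exp_solOf_ae (u₀ := u₀) hN v] with x hx
      simp only [hx]
      rw [nonlinearity_eq]
      simp only [dens, neg_mul]
    have h1 := dirL_add_integral_eq_zero hN hu hc i hφ
    rw [e1, e2, e3, (hb i).equation φ hφ]
    linarith

lemma eq_of_solOf_ae_eq {v w : W12N B N} (h : ∀ i, solOf u₀ v i =ᵐ[volume] solOf u₀ w i) : v = w := by
  refine PiLp.ext fun i => eq_of_fn_ae_eq ?_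
  filter_upwards [solOf_ae (u₀ := u₀) v i, solOf_ae (u₀ := u₀) w i, ae_restrict_of_ae (h i)]
    with x h1 h2 h3
  rw [h1, h2] at h3
  exact add_left_cancel h3

/-- Subtraction of a large constant. -/
def shiftV (v : W12N B N) (t : ℝ) : W12N B N := WithLp.toLp 2 fun j => v j - cst B t

lemma shiftV_apply (v : W12N B N) (t : ℝ) (j : Fin N) : shiftV v t j = v j - cst B t := rfl

lemma quadL_shiftV (v : W12N B N) (t : ℝ) : quadL B N (shiftV v t) (shiftV v t) = quadL B N v v := by
  rw [quadL_apply, quadL_apply]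
  refine Finset.sum_congr rfl fun j _ => Finset.sum_congr rfl fun k _ => ?_
  simp only [shiftV_apply, map_sub, sub_apply, dirL_cst, dirL_comm (v j) (cst B t), sub_zero]

lemma intL_shiftV (v : W12N B N) (t : ℝ) (j : Fin N) :
    intL B (shiftV v t j) = intL B (v j) - area B * t := by
  rw [shiftV_apply, map_sub, intL_apply (cst B t), integral_congr_ae (fn_cst t), integral_cst]

lemma dev_shiftV_le (hu : IsAdm B u₀) (v : W12N B N) {t : ℝ} (ht : 0 ≤ t) (j : Fin N) :
    dev u₀ (shiftV v t) j ≤ ∫ x, (U u₀ v j x ^ 2 + 1) ∂cellMeasure B := by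
  refine integral_mono_ae (integrable_U_sub_one_sq hu _ j)
    ((memLp_U hu v j).integrable_sq.add (integrable_const 1)) ?_
  filter_upwards [fn_sub (v j) (cst B t), fn_cst (B := B) t] with x h1 h2
  have h3 : U u₀ (shiftV v t) j x ≤ U u₀ v j x := by
    rw [U, U, val_eq, val_eq, shiftV_apply, h1, h2]
    exact Real.exp_le_exp.2 (by linarith)
  have h4 := U_pos (u₀ := u₀) (shiftV v t) j x
  nlinarith

/-- Subtracting a constant `t` from all components leaves the Dirichlet part unchanged, keeps the
potential bounded because `U` decreases, and lowers the linear term by `t ∑ bⱼ`, a positive multiple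
of `t`. -/
lemma exists_action_lt (hN : N = 3 ∨ N = 4 ∨ N = 5) (hn : ∃ i, 0 < n i) (hu : IsAdm B u₀) {lam : ℝ}
    (hlam : 0 ≤ lam) (v : W12N B N) (a : ℝ) : ∃ e : W12N B N, action n u₀ lam e < a := by
  have : Nonempty (Fin N) := ⟨⟨0, pos_of_hN hN⟩⟩
  have hA := area_pos B
  have hb : 0 < ∑ j, b n j := Finset.sum_pos (fun j _ => b_pos hN hn j) Finset.univ_nonempty
  set P := 1 / 2 * quadL B N v v + lam / 2 * ((∑ j, ∑ k, |M N j k|) *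
    ∑ j, ∫ x, (U u₀ v j x ^ 2 + 1) ∂cellMeasure B) + ∑ j, b n j / area B * intL B (v j) with hP
  set t := (|P - a| + 1) / ∑ j, b n j with ht
  have ht0 : 0 ≤ t := by positivity
  refine ⟨shiftV v t, ?_⟩
  have h1 : action n u₀ lam (shiftV v t) ≤ P - t * ∑ j, b n j := by
    rw [action_eq hu, potential, quadL_shiftV, hP]
    have h2 := sum_M_mul_le hu (shiftV v t)
    have h3 : (∑ j, ∑ k, |M N j k|) * ∑ i, dev u₀ (shiftV v t) i ≤ (∑ j, ∑ k, |M N j k|) *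
        ∑ j, ∫ x, (U u₀ v j x ^ 2 + 1) ∂cellMeasure B :=
      mul_le_mul_of_nonneg_left (Finset.sum_le_sum fun j _ => dev_shiftV_le hu v ht0 j)
        (Finset.sum_nonneg fun j _ => Finset.sum_nonneg fun k _ => abs_nonneg _)
    have h4 := mul_le_mul_of_nonneg_left (h2.trans h3) (by linarith : 0 ≤ lam / 2)
    have h5 : ∑ j, b n j / area B * intL B (shiftV v t j) =
        ∑ j, b n j / area B * intL B (v j) - t * ∑ j, b n j := by
      rw [Finset.mul_sum, ← Finset.sum_sub_distrib]
      refine Finset.sum_congr rfl fun j _ => ?_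
      rw [intL_shiftV]
      field_simp
    linarith
  rw [ht, div_mul_cancel₀ _ hb.ne'] at h1
  have := le_abs_self (P - a)
  linarith

lemma isAdm_of_isApproxBackground {g : Fin N → ℕ → W12 B}
    (hg : ∀ i, IsApproxBackground (n i) (u₀ i) (g i)) : IsAdm B u₀ := by
  refine ⟨fun j => (hg j).measurable.aestronglyMeasurable, ?_⟩
  choose C hC using fun j => (hg j).bdd_above
  refine ⟨∑ j, |C j|, Finset.sum_nonneg fun j _ => abs_nonneg _, fun j => ?_⟩
  filter_upwards [hC j 0, (hg j).le 0] with x h1 h2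
  exact (h2.trans h1).trans ((le_abs_self _).trans
    (Finset.single_le_sum (f := fun j => |C j|) (fun j _ => abs_nonneg _) (Finset.mem_univ j)))

end

end ChernSimonsHiggs
end

theorem theorem1p1 (B : Module.Basis (Fin 2) ℝ Plane) (N : ℕ) (hN : N = 3 ∨ N = 4 ∨ N = 5)
    (n : Fin N → ℕ) (hn : ∃ i, 0 < n i) (p : (i : Fin N) → Fin (n i) → Plane) :
    ∃ u₀ : Fin N → Plane → ℝ, (∀ i, IsBackground B (p i) (u₀ i)) ∧
      ∃ lam₁ : ℝ, 0 < lam₁ ∧ ∀ lam : ℝ, lam₁ < lam →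
        ∃ u u' : Fin N → Plane → ℝ,
          IsSolution B n p lam u ∧ IsSolution B n p lam u' ∧
          (∃ i, ¬ u i =ᵐ[volume] u' i) ∧
          ∃ v v' : W12N B N,
            (∀ i, u i =ᵐ[cellMeasure B] fun x => Real.log (r N i) + u₀ i x + v.val i x) ∧
            (∀ i, u' i =ᵐ[cellMeasure B] fun x => Real.log (r N i) + u₀ i x + v'.val i x) ∧
            HasFDerivAt (action n u₀ lam) (0 : W12N B N →L[ℝ] ℝ) v ∧
            IsLocalMin (action n u₀ lam) v ∧
            v ∈ plusConstraintSet n u₀ lam ∧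
            IsMinOn (action n u₀ lam) (plusConstraintSet n u₀ lam) v ∧
            IsMountainPassPoint (action n u₀ lam) v v' := by
  have hg : ∀ i, IsApproxBackground (n i) (bg B (p i)) (bgW B (p i)) :=
    fun i => isApproxBackground_bg (p i)
  have hb : ∀ i, IsBackground B (p i) (bg B (p i)) := fun i => isBackground_bg (p i)
  refine ⟨fun i => bg B (p i), hb, ?_⟩
  have hu : IsAdm B fun i => bg B (p i) := isAdm_of_isApproxBackground hg
  obtain ⟨L, hL, h⟩ := exists_isMinOn_mem_nhds hN hn hu hg fun i => (hb i).mean_zero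
  refine ⟨L, hL, fun lam hlam => ?_⟩
  have hl0 : 0 < lam := hL.trans hlam
  obtain ⟨v, hv, hmin⟩ := h lam hlam
  have hI := isVariational_action hN hu n lam
  have hloc : IsLocalMin (action n (fun i => bg B (p i)) lam) v := hmin.isLocalMin hv
  have hcrit : actionDer hu n lam v = 0 := hloc.hasFDerivAt_eq_zero (hI.hasFDerivAt v)
  obtain ⟨e, he⟩ := exists_action_lt hN hn hu hl0.le v (action n (fun i => bg B (p i)) lam v)
  obtain ⟨v', hne, hcrit', hglb⟩ := exists_mountainPass hI hloc he
    (exists_bound_of_palaisSmale hN hn hu hg (fun i => (hb i).mean_zero) hl0)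
  refine ⟨solOf (fun i => bg B (p i)) v, solOf (fun i => bg B (p i)) v',
    isSolution_solOf hN hu hb hcrit, isSolution_solOf hN hu hb hcrit', ?_, v, v',
    solOf_ae v, solOf_ae v', hcrit ▸ hI.hasFDerivAt v, hloc,
    mem_plusConstraintSet hN hu hl0 (mem_of_mem_nhds hv) hcrit,
    hmin.on_subset (plusConstraintSet_subset lam), hcrit' ▸ hI.hasFDerivAt v', e, he, hglb⟩
  by_contra hno
  push Not at hno
  exact hne (eq_of_solOf_ae_eq hno).symm
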